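/- Let $k$ be a commutative ring containing $\mathbb{Q}$. A filtered dg module is a $\mathbb{Z}$-graded $k$-module with a filtration $A=F_0A\supset F_1A\supset\cdots$ in each degree and a filtered square-zero differential of degree $-1$; it is complete if $A\cong\lim_l A/F_lA$ in each degree. Let $C$ be a filtered dg cooperad, possibly with non-trivial $C(0)$: a filtered dg $\mathbb{S}$-module with an equivariant, coassociative infinitesimal decomposition map $\Delta_{(1)}:C\to C\circ_{(1)}C$ and a counit $C\to I$; no coaugmentation is used. Let $A$ be a complete dg module, with filtered endomorphism operad $\mathrm{end}_A$, and let $$\mathfrak a=\hom_{\mathbb S}(C,\mathrm{end}_A)=\prod_{n\ge0}\hom_{\mathbb S_n}(C(n),\mathrm{end}_A(n))$$ be the convolution algebra, with its differential $\partial$, its pre-Lie product $f\star g=\gamma_{(1)}\circ(f\circ_{(1)}g)\circ\Delta_{(1)}$, its left unit $1$ (the counit of $C$ followed by $\mathrm{id}_A$), the bracket $[f,g]=f\star g-(-1)^{|f||g|}g\star f$, and arity-wise convergence of series. Let $\mathrm{MC}$ be the set of $\alpha\in\mathfrak a_{-1}$ with $\partial\alpha+\alpha\star\alpha=0$. Let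 $\Omega C$ be the cobar construction: the free operad $\mathcal T(s^{-1}C)$ with the derivation $d(s^{-1}c)=-s^{-1}(d_Cc)-\sum(-1)^{|c'|}s^{-1}c'\circ s^{-1}c''$, where $\Delta_{(1)}(c)=\sum c'\circ c''$. A (complete) $\Omega C$-algebra structure on $A$ is a morphism of filtered dg operads $\rho:\Omega C\to\mathrm{end}_A$; put $\alpha_\rho(c)=\rho(s^{-1}c)$. The deformation gauge group is $\widetilde\Gamma=\{\lambda\in\mathfrak a_0:\lambda_0\in F_1,\ \lambda_1\in F_1\}$ with the Baker-Campbell-Hausdorff product. Here and below, $f_n$ is the component of arity $n$ of $f$, and $F_l$ stands for the filtration of $\hom(C(n),\mathrm{end}_A(n))$. Let $F_1\widetilde\Gamma=\widetilde\Gamma$ and $F_l\widetilde\Gamma=F_l\mathfrak a_0$ for $l\ge2$. It acts on $\mathrm{MC}$ by $$\lambda\cdot\alpha=e^{\mathrm{ad}_\lambda}(\alpha)-\frac{e^{\mathrm{ad}_\lambda}-1}{\mathrm{ad}_\lambda}(\partial\lambda),$$ and the Deligne groupoid is the action groupoid of $\widetilde\Gamma$ on $\mathrm{MC}$. The pre-Lie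 exponential is $e^\lambda=1+\lambda+\frac{1}{2!}\lambda\star\lambda+\frac1{3!}(\lambda\star\lambda)\star\lambda+\cdots$ and the circle product is $a\circledcirc(1+b)=\sum_n\frac1{n!}\{a;b,\dots,b\}$, where $\{a;b_1,\dots,b_n\}$ are the symmetric braces of the pre-Lie algebra. Let $\delta\in\mathfrak a_{-1}$ be the counit of $C$ followed by the differential $d_A$. An $\infty$-morphism $\rho\rightsquigarrow\sigma$ between two $\Omega C$-algebra structures on $A$ is an $f\in\mathfrak a_0$ with $f_0\in F_1$ and $$f\star(\delta+\alpha_\rho)+f\circ d_C=(\delta+\alpha_\sigma)\circledcirc f ;$$ it is an $\infty$-isotopy if moreover $f_1\in1+F_1$. **Theorem.** All the above series converge; $\widetilde\Gamma$ is a group, and it acts on $\mathrm{MC}$. The set $\{f\in\mathfrak a_0: f_0\in F_1\}$ is a monoid for $\circledcirc$ with unit $1$, and $\infty$-morphisms compose under $\circledcirc$. The set of $\infty$-isotopies of $\Omega C$-algebra structures on $A$ is $\{f\in\mathfrak a_0: f_0\in F_1,\ f_1\in1+F_1\}=1+\widetilde\Gamma$; it is a subgroup of the group of invertible $\infty$-morphisms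 of $\Omega C$-algebra structures on $A$, and the pre-Lie exponential is an isomorphism from the group $\widetilde\Gamma$ onto it, which maps $F_l\widetilde\Gamma$ onto $1+F_l\widetilde\Gamma$ for all $l\ge 1$. The $\Omega C$-algebra structures on $A$ and their $\infty$-isotopies form a groupoid under $\circledcirc$. The Deligne groupoid is isomorphic to this groupoid, by the bijection $\alpha_\rho\leftrightarrow\rho$ on objects and by $\lambda\mapsto e^\lambda$ on morphisms. -/

import Mathlib

open scoped TensorProduct

universe u v w

noncomputable section

/-! ### Filtered differential graded modules -/

/-- The sign `(-1)^i` in a ring. -/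
def zsign (k : Type u) [CommRing k] (i : ℤ) : k := ((i.negOnePow : ℤ) : k)

theorem zsign_add (k : Type u) [CommRing k] (i j : ℤ) :
    zsign k (i + j) = zsign k i * zsign k j := by
  simp only [zsign, Int.negOnePow_add, Units.val_mul, Int.cast_mul]

theorem zsign_zero (k : Type u) [CommRing k] : zsign k 0 = 1 := by
  simp [zsign]

theorem zsign_mul_self (k : Type u) [CommRing k] (i : ℤ) : zsign k i * zsign k i = 1 := by
  rw [← zsign_add, zsign, Int.negOnePow_even _ (Even.add_self i)]
  simp

theorem zsign_sub (k : Type u) [CommRing k] (i j : ℤ) :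
    zsign k (i - j) = zsign k i * zsign k j := by
  have := zsign_add k (i - j) j
  rw [sub_add_cancel] at this
  rw [this, mul_assoc, zsign_mul_self, mul_one]

/-- A filtered differential graded module over `k`, in homological degree convention.  The
collection `{A_i}` of graded pieces is recorded as an internal grading `deg` of its direct sum; each
`fil l` is a homogeneous submodule, so that `fil l ∩ deg i` is the `l`-th filtration step of `A_i`;
the differential has degree `-1`, squares to zero and preserves the filtration. -/
structure FilteredDGModule (k : Type u) [CommRing k] where
  carrier : Type v
  [addCommGroup : AddCommGroup carrier]
  [module : Module k carrier]
  deg : ℤ → Submodule k carrier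
  [decomposition : DirectSum.Decomposition deg]
  fil : ℕ → Submodule k carrier
  fil_zero : fil 0 = ⊤
  fil_antitone : Antitone fil
  fil_homogeneous : ∀ (l : ℕ) (x : carrier), x ∈ fil l →
    ∀ i : ℤ, (DirectSum.decompose deg x i : carrier) ∈ fil l
  d : carrier →ₗ[k] carrier
  d_deg : ∀ (i : ℤ) (x : carrier), x ∈ deg i → d x ∈ deg (i - 1)
  d_fil : ∀ (l : ℕ) (x : carrier), x ∈ fil l → d x ∈ fil l
  d_d : ∀ x : carrier, d (d x) = 0

namespace FilteredDGModule

attribute [instance] addCommGroup module decomposition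

instance (k : Type*) [CommRing k] : CoeSort (FilteredDGModule k) (Type _) := ⟨carrier⟩

variable {k : Type*} [CommRing k]

/-- The linear map which multiplies the homogeneous component of degree `i` by `w i`. -/
def weight (M : FilteredDGModule k) (w : ℤ → k) : M →ₗ[k] M :=
  (DirectSum.toModule k ℤ M fun i => w i • (M.deg i).subtype) ∘ₗ
    (DirectSum.decomposeLinearEquiv M.deg).toLinearMap

/-- The Koszul sign operator `x ↦ (-1)^(j * |x|) x`. -/
def sgn (M : FilteredDGModule k) (j : ℤ) : M →ₗ[k] M :=
  M.weight fun i => zsign k (j * i)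

/-- The projection onto the part of even degree. -/
def even (M : FilteredDGModule k) : M →ₗ[k] M := M.weight fun i => if Even i then 1 else 0

/-- The projection onto the part of odd degree. -/
def odd (M : FilteredDGModule k) : M →ₗ[k] M := M.weight fun i => if Even i then 0 else 1

/-- The symmetry `x ⊗ y ↦ (-1)^(|x| |y|) y ⊗ x` of the tensor product of graded modules. -/
def braiding (M N : FilteredDGModule k) : M ⊗[k] N →ₗ[k] N ⊗[k] M :=
  (TensorProduct.comm k M N).toLinearMap ∘ₗ
    (LinearMap.id - (2 : k) • TensorProduct.map M.odd N.odd)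

/-- The degree `i` part of the tensor product. -/
def tensorDeg (M N : FilteredDGModule k) (i : ℤ) : Submodule k (M ⊗[k] N) :=
  ⨆ a : ℤ, Submodule.map₂ (TensorProduct.mk k M N) (M.deg a) (N.deg (i - a))

/-- The `l`-th step of the filtration of the tensor product. -/
def tensorFil (M N : FilteredDGModule k) (l : ℕ) : Submodule k (M ⊗[k] N) :=
  ⨆ (a : ℕ) (b : ℕ) (_ : a + b = l), Submodule.map₂ (TensorProduct.mk k M N) (M.fil a) (N.fil b)

/-- A complete dg module: every `A_i → lim_l A_i / F_l A_i` is bijective. -/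
def IsComplete (M : FilteredDGModule k) : Prop :=
  ∀ (i : ℤ) (x : ℕ → M), (∀ l, x l ∈ M.deg i) → (∀ l, x (l + 1) - x l ∈ M.fil l) →
    ∃! y : M, y ∈ M.deg i ∧ ∀ l, y - x l ∈ M.fil l

theorem weight_of_mem {k : Type u} [CommRing k] (M : FilteredDGModule.{u, v} k) (w : ℤ → k) {i : ℤ} {x : M}
    (hx : x ∈ M.deg i) : M.weight w x = w i • x := by
  simp only [weight, LinearMap.comp_apply, LinearEquiv.coe_coe,
    DirectSum.decomposeLinearEquiv_apply, DirectSum.decompose_of_mem _ hx]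
  erw [DirectSum.toModule_lof]
  rfl

theorem sgn_mem_deg {k : Type u} [CommRing k] (M : FilteredDGModule.{u, v} k) (j : ℤ) {i : ℤ}
    {x : M} (hx : x ∈ M.deg i) : M.sgn j x ∈ M.deg i := by
  rw [sgn, M.weight_of_mem _ hx]
  exact Submodule.smul_mem _ _ hx

end FilteredDGModule

/-! ### Two-vertex trees -/

namespace TwoTree

variable {p q r l : ℕ}

/-- Add to `h` an extra first leaf on the first summand, sent to the first label. -/
def graftLeft (h : Fin q ⊕ Fin p ≃ Fin l) : Fin (q + 1) ⊕ Fin p ≃ Fin (l + 1) where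
  toFun := Sum.elim (Fin.cases 0 fun j => (h (Sum.inl j)).succ) fun i => (h (Sum.inr i)).succ
  invFun := Fin.cases (Sum.inl 0) fun x => Sum.map Fin.succ id (h.symm x)
  left_inv := by
    rintro (j | i)
    · refine Fin.cases ?_ (fun j => ?_) j <;> simp
    · simp
  right_inv := by
    intro x
    refine Fin.cases ?_ (fun x => ?_) x
    · simp
    · rcases hx : h.symm x with j | i
      · simp [hx, ← (Equiv.symm_apply_eq h).1 hx]
      · simp [hx, ← (Equiv.symm_apply_eq h).1 hx]

/-- Add to `h` an extra first leaf on the second summand, sent to the first label. -/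
def graftRight (h : Fin q ⊕ Fin p ≃ Fin l) : Fin q ⊕ Fin (p + 1) ≃ Fin (l + 1) :=
  (Equiv.sumComm _ _).trans (graftLeft ((Equiv.sumComm _ _).trans h))

/-- The tree with root having `p + 1` inputs and an upper vertex with one input, presented so that
every leaf keeps its place. -/
def unitRight (p : ℕ) : Fin 1 ⊕ Fin p ≃ Fin (p + 1) :=
  graftLeft (q := 0) (Equiv.emptySum (Fin 0) (Fin p))

/-- Exchange of the first two summands. -/
def exchange (q r p : ℕ) : Fin q ⊕ (Fin r ⊕ Fin p) ≃ Fin r ⊕ (Fin q ⊕ Fin p) :=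
  (Equiv.sumAssoc _ _ _).symm.trans
    (((Equiv.sumComm _ _).sumCongr (Equiv.refl _)).trans (Equiv.sumAssoc _ _ _))

/-- The permutation fixing the first element and acting as `τ` on the others. -/
def permSucc (τ : Equiv.Perm (Fin p)) : Equiv.Perm (Fin (p + 1)) :=
  (finSuccEquiv p).trans ((Equiv.optionCongr τ).trans (finSuccEquiv p).symm)

end TwoTree

/-! ### Filtered dg cooperads -/

/-- A filtered dg cooperad, given by its infinitesimal decomposition map and its counit.

`C(n)` is a filtered dg module with an action of the symmetric group; `act n σ c` is `c` with the
leaf labelled `i` relabelled `σ i`.  A bijection `e : Fin q ⊕ Fin p ≃ Fin n` describes the tree with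
two vertices and `n` leaves: the root vertex has `p + 1` inputs, the first of which carries the
upper vertex and the others the leaves `e (inr 0), …, e (inr (p - 1))`; the upper vertex has `q`
inputs, which carry the leaves `e (inl 0), …, e (inl (q - 1))`.  The map `Δ e` is the component of
the infinitesimal decomposition map at this tree. -/
structure FilteredDGCooperad (k : Type u) [CommRing k] where
  obj : ℕ → FilteredDGModule.{u, v} k
  act : ∀ n, Equiv.Perm (Fin n) →* Module.End k (obj n)
  act_deg : ∀ n σ i (c : obj n), c ∈ (obj n).deg i → act n σ c ∈ (obj n).deg i
  act_fil : ∀ n σ l (c : obj n), c ∈ (obj n).fil l → act n σ c ∈ (obj n).fil l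
  act_d : ∀ n σ (c : obj n), act n σ ((obj n).d c) = (obj n).d (act n σ c)
  Δ : ∀ {p q n : ℕ}, (Fin q ⊕ Fin p ≃ Fin n) → (obj n →ₗ[k] obj (p + 1) ⊗[k] obj q)
  Δ_deg : ∀ {p q n : ℕ} (e : Fin q ⊕ Fin p ≃ Fin n) i (c : obj n), c ∈ (obj n).deg i →
    Δ e c ∈ (obj (p + 1)).tensorDeg (obj q) i
  Δ_fil : ∀ {p q n : ℕ} (e : Fin q ⊕ Fin p ≃ Fin n) l (c : obj n), c ∈ (obj n).fil l →
    Δ e c ∈ (obj (p + 1)).tensorFil (obj q) l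
  Δ_d : ∀ {p q n : ℕ} (e : Fin q ⊕ Fin p ≃ Fin n) (c : obj n),
    Δ e ((obj n).d c) = TensorProduct.map (obj (p + 1)).d LinearMap.id (Δ e c) +
      TensorProduct.map ((obj (p + 1)).sgn 1) (obj q).d (Δ e c)
  /-- Equivariance: relabelling the leaves. -/
  Δ_relabel : ∀ {p q n : ℕ} (e : Fin q ⊕ Fin p ≃ Fin n) (σ : Equiv.Perm (Fin n)) (c : obj n),
    Δ (e.trans σ) (act n σ c) = Δ e c
  /-- Compatibility of the components at two presentations of the same tree. -/
  Δ_act : ∀ {p q n : ℕ} (e : Fin q ⊕ Fin p ≃ Fin n) (ρ : Equiv.Perm (Fin q))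
    (τ : Equiv.Perm (Fin p)) (c : obj n),
    TensorProduct.map (act (p + 1) (TwoTree.permSucc τ)) (act q ρ)
      (Δ ((Equiv.sumCongr ρ τ).trans e) c) = Δ e c
  /-- Coassociativity on trees with three vertices on a line. -/
  Δ_sequential : ∀ {p q r l m n : ℕ} (e : Fin r ⊕ (Fin q ⊕ Fin p) ≃ Fin n)
    (g : Fin r ⊕ Fin q ≃ Fin m) (h : Fin q ⊕ Fin p ≃ Fin l) (c : obj n),
    TensorProduct.assoc k (obj (p + 1)) (obj (q + 1)) (obj r)
      ((Δ (TwoTree.graftLeft h)).rTensor (obj r)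
        (Δ (((Equiv.refl (Fin r)).sumCongr h.symm).trans e) c)) =
    (Δ g).lTensor (obj (p + 1))
      (Δ ((g.symm.sumCongr (Equiv.refl (Fin p))).trans ((Equiv.sumAssoc _ _ _).trans e)) c)
  /-- Coassociativity on trees with two upper vertices grafted on the root. -/
  Δ_parallel : ∀ {p q r l m n : ℕ} (e : Fin r ⊕ (Fin q ⊕ Fin p) ≃ Fin n)
    (h : Fin q ⊕ Fin p ≃ Fin l) (g : Fin r ⊕ Fin p ≃ Fin m) (c : obj n),
    TensorProduct.assoc k (obj (p + 1 + 1)) (obj q) (obj r)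
      ((Δ (TwoTree.graftRight h)).rTensor (obj r)
        (Δ (((Equiv.refl (Fin r)).sumCongr h.symm).trans e) c)) =
    TensorProduct.map (act (p + 1 + 1) (Equiv.swap 0 1)) ((obj r).braiding (obj q))
      (TensorProduct.assoc k (obj (p + 1 + 1)) (obj r) (obj q)
        ((Δ (TwoTree.graftRight g)).rTensor (obj q)
          (Δ (((Equiv.refl (Fin q)).sumCongr g.symm).trans
            ((TwoTree.exchange q r p).trans e)) c)))
  counit : obj 1 →ₗ[k] k
  counit_deg : ∀ i (c : obj 1), i ≠ 0 → c ∈ (obj 1).deg i → counit c = 0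
  /-- The counit is filtered, the ground ring having the trivial filtration. -/
  counit_fil : ∀ c : obj 1, c ∈ (obj 1).fil 1 → counit c = 0
  counit_d : ∀ c : obj 1, counit ((obj 1).d c) = 0
  counit_left : ∀ {n : ℕ} (c : obj n),
    TensorProduct.lid k (obj n)
      (counit.rTensor (obj n) (Δ (p := 0) (Equiv.sumEmpty (Fin n) (Fin 0)) c)) = c
  counit_right : ∀ {p : ℕ} (c : obj (p + 1)),
    TensorProduct.rid k (obj (p + 1))
      (counit.lTensor (obj (p + 1)) (Δ (TwoTree.unitRight p) c)) = c

namespace FilteredDGCooperad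

variable {k : Type u} [CommRing k]

/-- Sum over all two-vertex trees with `n` leaves of `Φ` applied to the components of the
infinitesimal decomposition map: every tree with upper vertex of arity `q` and root of arity
`p + 1` has exactly `q! p!` presentations `e`. -/
def treeSum [Algebra ℚ k] (C : FilteredDGCooperad.{u, v} k) {V : Type*} [AddCommGroup V]
    [Module k V] (n : ℕ)
    (Φ : ∀ {p q : ℕ}, (Fin q ⊕ Fin p ≃ Fin n) → (C.obj (p + 1) ⊗[k] C.obj q →ₗ[k] V)) :
    C.obj n →ₗ[k] V :=
  ∑ qp ∈ Finset.HasAntidiagonal.antidiagonal n,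
    algebraMap ℚ k ((qp.1.factorial * qp.2.factorial : ℚ)⁻¹) •
      ∑ e : Fin qp.1 ⊕ Fin qp.2 ≃ Fin n, Φ e ∘ₗ C.Δ e

/-! ### The cobar construction -/

/-- Operadic monomials in the generators `s⁻¹ c`, where `c` is a homogeneous element of `C`. -/
inductive Mon (C : FilteredDGCooperad.{u, v} k) : ℕ → Type v
  | gen {n : ℕ} (j : ℤ) (c : (C.obj n).deg j) : Mon C n
  | one : Mon C 1
  | comp {p q n : ℕ} (e : Fin q ⊕ Fin p ≃ Fin n) (t : Mon C (p + 1)) (u : Mon C q) : Mon C n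
  | act {n : ℕ} (σ : Equiv.Perm (Fin n)) (t : Mon C n) : Mon C n

variable (C : FilteredDGCooperad.{u, v} k)

namespace Mon

variable {C}

/-- The degree of a monomial; the generator `s⁻¹ c` has degree `|c| - 1`. -/
def degree : ∀ {n : ℕ}, Mon C n → ℤ
  | _, gen j _ => j - 1
  | _, one => 0
  | _, comp _ t u => degree t + degree u
  | _, act _ t => degree t

/-- The monomial lies in the `l`-th filtration step of the filtered free operad. -/
def InFil : ∀ {n : ℕ}, Mon C n → ℕ → Prop
  | n, gen _ c, l => (c : C.obj n) ∈ (C.obj n).fil l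
  | _, one, l => l = 0
  | _, comp _ t u, l => ∃ a b : ℕ, a + b = l ∧ InFil t a ∧ InFil u b
  | _, act _ t, l => InFil t l

end Mon

/-- Linear combinations of monomials. -/
abbrev Lin (n : ℕ) : Type (max u v) := C.Mon n →₀ k

variable {C}

/-- A monomial as a linear combination. -/
def mono {n : ℕ} (t : C.Mon n) : C.Lin n := Finsupp.single t 1

/-- Bilinear extension of the composition of monomials. -/
def linComp {p q n : ℕ} (e : Fin q ⊕ Fin p ≃ Fin n) : C.Lin (p + 1) →ₗ[k] C.Lin q →ₗ[k] C.Lin n :=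
  Finsupp.lift _ k _ fun t => Finsupp.lift _ k _ fun u => mono (.comp e t u)

/-- Linear extension of the relabelling of monomials. -/
def linAct {n : ℕ} (σ : Equiv.Perm (Fin n)) : C.Lin n →ₗ[k] C.Lin n :=
  Finsupp.lift _ k _ fun t => mono (.act σ t)

/-- The defining relations of the free operad on the `S`-module `s⁻¹ C`: the generators are linear
and equivariant, and the axioms of a graded operad hold. -/
inductive BaseRel : ∀ {n : ℕ}, C.Lin n → Prop
  | gen_add {n : ℕ} (j : ℤ) (c c' : (C.obj n).deg j) :
      BaseRel (mono (.gen j (c + c')) - mono (.gen j c) - mono (.gen j c'))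
  | gen_smul {n : ℕ} (j : ℤ) (a : k) (c : (C.obj n).deg j) :
      BaseRel (mono (.gen j (a • c)) - a • mono (.gen j c))
  | gen_act {n : ℕ} (σ : Equiv.Perm (Fin n)) (j : ℤ) (c : (C.obj n).deg j) :
      BaseRel (mono (.gen j ⟨C.act n σ c, C.act_deg n σ j c c.2⟩) - mono (.act σ (.gen j c)))
  | act_one {n : ℕ} (t : C.Mon n) : BaseRel (mono (.act 1 t) - mono t)
  | act_mul {n : ℕ} (σ τ : Equiv.Perm (Fin n)) (t : C.Mon n) :
      BaseRel (mono (.act (σ * τ) t) - mono (.act σ (.act τ t)))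
  | comp_relabel {p q n : ℕ} (e : Fin q ⊕ Fin p ≃ Fin n) (σ : Equiv.Perm (Fin n))
      (t : C.Mon (p + 1)) (u : C.Mon q) :
      BaseRel (mono (.comp (e.trans σ) t u) - mono (.act σ (.comp e t u)))
  | comp_act {p q n : ℕ} (e : Fin q ⊕ Fin p ≃ Fin n) (ρ : Equiv.Perm (Fin q))
      (τ : Equiv.Perm (Fin p)) (t : C.Mon (p + 1)) (u : C.Mon q) :
      BaseRel (mono (.comp ((Equiv.sumCongr ρ τ).trans e) t u) -
        mono (.comp e (.act (TwoTree.permSucc τ) t) (.act ρ u)))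
  | one_comp {n : ℕ} (t : C.Mon n) :
      BaseRel (mono (.comp (p := 0) (Equiv.sumEmpty (Fin n) (Fin 0)) .one t) - mono t)
  | comp_one {p : ℕ} (t : C.Mon (p + 1)) :
      BaseRel (mono (.comp (TwoTree.unitRight p) t .one) - mono t)
  | sequential {p q r l m n : ℕ} (e : Fin r ⊕ (Fin q ⊕ Fin p) ≃ Fin n)
      (g : Fin r ⊕ Fin q ≃ Fin m) (h : Fin q ⊕ Fin p ≃ Fin l)
      (t : C.Mon (p + 1)) (u : C.Mon (q + 1)) (v : C.Mon r) :
      BaseRel (mono (.comp (((Equiv.refl (Fin r)).sumCongr h.symm).trans e)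
          (.comp (TwoTree.graftLeft h) t u) v) -
        mono (.comp ((g.symm.sumCongr (Equiv.refl (Fin p))).trans
          ((Equiv.sumAssoc _ _ _).trans e)) t (.comp g u v)))
  | parallel {p q r l m n : ℕ} (e : Fin r ⊕ (Fin q ⊕ Fin p) ≃ Fin n)
      (h : Fin q ⊕ Fin p ≃ Fin l) (g : Fin r ⊕ Fin p ≃ Fin m)
      (t : C.Mon (p + 1 + 1)) (u : C.Mon q) (v : C.Mon r) :
      BaseRel (mono (.comp (((Equiv.refl (Fin r)).sumCongr h.symm).trans e)
          (.comp (TwoTree.graftRight h) t u) v) -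
        zsign k (u.degree * v.degree) •
        mono (.comp (((Equiv.refl (Fin q)).sumCongr g.symm).trans
            ((TwoTree.exchange q r p).trans e))
          (.comp (TwoTree.graftRight g) (.act (Equiv.swap 0 1) t) v) u))

/-- The operadic ideal generated by the defining relations. -/
inductive IsRel : ∀ {n : ℕ}, C.Lin n → Prop
  | base {n : ℕ} {x : C.Lin n} : BaseRel x → IsRel x
  | zero {n : ℕ} : IsRel (0 : C.Lin n)
  | add {n : ℕ} {x y : C.Lin n} : IsRel x → IsRel y → IsRel (x + y)
  | smul {n : ℕ} (a : k) {x : C.Lin n} : IsRel x → IsRel (a • x)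
  | comp_left {p q n : ℕ} (e : Fin q ⊕ Fin p ≃ Fin n) {x : C.Lin (p + 1)} (y : C.Lin q) :
      IsRel x → IsRel (linComp e x y)
  | comp_right {p q n : ℕ} (e : Fin q ⊕ Fin p ≃ Fin n) (x : C.Lin (p + 1)) {y : C.Lin q} :
      IsRel y → IsRel (linComp e x y)
  | act {n : ℕ} (σ : Equiv.Perm (Fin n)) {x : C.Lin n} : IsRel x → IsRel (linAct σ x)

variable (C)

/-- The arity `n` part of the operadic ideal of relations. -/
def relIdeal (n : ℕ) : Submodule k (C.Lin n) where
  carrier := {x | IsRel x}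
  zero_mem' := .zero
  add_mem' := .add
  smul_mem' := fun a _ => .smul a

/-- The arity `n` part of the free operad `T(s⁻¹ C)`, the underlying operad of the cobar
construction `Ω C`. -/
abbrev Cobar (n : ℕ) : Type (max u v) := C.Lin n ⧸ C.relIdeal n

namespace Cobar

variable {C}

/-- The class of a monomial. -/
def cls {n : ℕ} (t : C.Mon n) : C.Cobar n := (C.relIdeal n).mkQ (mono t)

/-- The partial composition of the cobar construction. -/
def comp {p q n : ℕ} (e : Fin q ⊕ Fin p ≃ Fin n) :
    C.Cobar (p + 1) →ₗ[k] C.Cobar q →ₗ[k] C.Cobar n :=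
  ((C.relIdeal q).liftQ
    ((C.relIdeal (p + 1)).liftQ ((linComp e).compr₂ (C.relIdeal n).mkQ) (fun _ hx =>
      LinearMap.ext fun y => (Submodule.Quotient.mk_eq_zero _).2 (IsRel.comp_left e y hx))).flip
    (fun _ hy => LinearMap.ext fun x => Submodule.Quotient.induction_on _ x fun x =>
      (Submodule.Quotient.mk_eq_zero _).2 (IsRel.comp_right e x hy))).flip

/-- The action of the symmetric group. -/
def act {n : ℕ} (σ : Equiv.Perm (Fin n)) : C.Cobar n →ₗ[k] C.Cobar n :=
  (C.relIdeal n).mapQ (C.relIdeal n) (linAct σ) fun _ hx => IsRel.act σ hx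

/-- The operadic unit. -/
def one : C.Cobar 1 := cls .one

variable (C) in
/-- The degree `i` part of the cobar construction. -/
def deg (n : ℕ) (i : ℤ) : Submodule k (C.Cobar n) :=
  Submodule.span k {x | ∃ t : C.Mon n, t.degree = i ∧ x = cls t}

variable (C) in
/-- The `l`-th filtration step of the cobar construction. -/
def fil (n : ℕ) (l : ℕ) : Submodule k (C.Cobar n) :=
  Submodule.span k {x | ∃ t : C.Mon n, t.InFil l ∧ x = cls t}

/-- The universal map `c ↦ s⁻¹ c`. -/
def gen (n : ℕ) : C.obj n →ₗ[k] C.Cobar n :=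
  (DirectSum.toModule k ℤ (C.Cobar n) fun j =>
    { toFun := fun c => cls (.gen j c)
      map_add' := fun c c' => by
        rw [← sub_eq_zero, ← sub_sub]
        exact (Submodule.Quotient.mk_eq_zero _).2 (.base (.gen_add j c c'))
      map_smul' := fun a c => by
        rw [← sub_eq_zero]
        exact (Submodule.Quotient.mk_eq_zero _).2 (.base (.gen_smul j a c)) }) ∘ₗ
    (DirectSum.decomposeLinearEquiv (C.obj n).deg).toLinearMap

theorem cls_eq {n : ℕ} {t u : C.Mon n} (h : BaseRel (mono t - mono u)) : cls t = cls u := by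
  rw [← sub_eq_zero]
  exact (Submodule.Quotient.mk_eq_zero _).2 (.base h)

theorem cls_eq_smul {n : ℕ} {t u : C.Mon n} {a : k} (h : BaseRel (mono t - a • mono u)) :
    cls t = a • cls u := by
  rw [← sub_eq_zero]
  exact (Submodule.Quotient.mk_eq_zero _).2 (.base h)

@[simp] theorem comp_cls {p q n : ℕ} (e : Fin q ⊕ Fin p ≃ Fin n) (t : C.Mon (p + 1))
    (u : C.Mon q) : comp e (cls t) (cls u) = cls (.comp e t u) := by
  change (C.relIdeal n).mkQ (linComp e (mono t) (mono u)) = _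
  simp [linComp, mono, cls]

@[simp] theorem act_cls {n : ℕ} (σ : Equiv.Perm (Fin n)) (t : C.Mon n) :
    act σ (cls t) = cls (.act σ t) := by
  change (C.relIdeal n).mkQ (linAct σ (mono t)) = _
  simp [linAct, mono, cls]

theorem hom_ext {n : ℕ} {V : Type*} [AddCommGroup V] [Module k V] {f g : C.Cobar n →ₗ[k] V}
    (h : ∀ t, f (cls t) = g (cls t)) : f = g := by
  apply Submodule.linearMap_qext
  apply Finsupp.lhom_ext'
  intro t
  ext
  exact h t

theorem gen_of_mem {n : ℕ} {j : ℤ} (c : (C.obj n).deg j) :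
    gen n (c : C.obj n) = cls (.gen j c) := by
  simp only [gen, LinearMap.comp_apply, LinearEquiv.coe_coe,
    DirectSum.decomposeLinearEquiv_apply, DirectSum.decompose_coe]
  erw [DirectSum.toModule_lof]
  rfl

theorem act_gen {n : ℕ} (σ : Equiv.Perm (Fin n)) (c : C.obj n) :
    act σ (gen n c) = gen n (C.act n σ c) := by
  induction c using DirectSum.Decomposition.inductionOn (C.obj n).deg with
  | zero => simp
  | @homogeneous j c =>
    rw [gen_of_mem, act_cls]
    refine (cls_eq (.gen_act σ j c)).symm.trans ?_
    exact (gen_of_mem (⟨C.act n σ c, C.act_deg n σ j c c.2⟩ : (C.obj n).deg j)).symm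
  | add x y hx hy => simp [hx, hy]

theorem act_one_apply {n : ℕ} (x : C.Cobar n) : act 1 x = x := by
  have : act (C := C) (n := n) 1 = LinearMap.id := hom_ext fun t => by
    simpa using cls_eq (.act_one t)
  rw [this]; rfl

theorem act_mul_apply {n : ℕ} (σ τ : Equiv.Perm (Fin n)) (x : C.Cobar n) :
    act (σ * τ) x = act σ (act τ x) := by
  have : act (C := C) (σ * τ) = act σ ∘ₗ act τ := hom_ext fun t => by
    simpa using cls_eq (.act_mul σ τ t)
  rw [this]; rfl

theorem comp_relabel {p q n : ℕ} (e : Fin q ⊕ Fin p ≃ Fin n) (σ : Equiv.Perm (Fin n))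
    (x : C.Cobar (p + 1)) (y : C.Cobar q) :
    comp (e.trans σ) x y = act σ (comp e x y) := by
  have : comp (C := C) (e.trans σ) = (comp e).compr₂ (act σ) := hom_ext fun t => hom_ext fun u => by
    simpa using cls_eq (.comp_relabel e σ t u)
  rw [this]; rfl

theorem comp_act {p q n : ℕ} (e : Fin q ⊕ Fin p ≃ Fin n) (ρ : Equiv.Perm (Fin q))
    (τ : Equiv.Perm (Fin p)) (x : C.Cobar (p + 1)) (y : C.Cobar q) :
    comp ((Equiv.sumCongr ρ τ).trans e) x y = comp e (act (TwoTree.permSucc τ) x) (act ρ y) := by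
  have : comp (C := C) ((Equiv.sumCongr ρ τ).trans e) =
      (comp e).compl₁₂ (act (TwoTree.permSucc τ)) (act ρ) := hom_ext fun t => hom_ext fun u => by
    simpa using cls_eq (.comp_act e ρ τ t u)
  rw [this]; rfl

theorem one_comp {n : ℕ} (x : C.Cobar n) :
    comp (p := 0) (Equiv.sumEmpty (Fin n) (Fin 0)) one x = x := by
  have : comp (C := C) (p := 0) (Equiv.sumEmpty (Fin n) (Fin 0)) one = LinearMap.id :=
    hom_ext fun t => by
      have := cls_eq (.one_comp t)
      rw [← comp_cls] at this
      exact this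
  rw [this]; rfl

theorem comp_one {p : ℕ} (x : C.Cobar (p + 1)) : comp (TwoTree.unitRight p) x one = x := by
  have : (comp (C := C) (TwoTree.unitRight p)).flip one = LinearMap.id :=
    hom_ext fun t => by
      have := cls_eq (.comp_one t)
      rw [← comp_cls] at this
      exact this
  exact LinearMap.congr_fun this x

theorem sequential {p q r l m n : ℕ} (e : Fin r ⊕ (Fin q ⊕ Fin p) ≃ Fin n)
    (g : Fin r ⊕ Fin q ≃ Fin m) (h : Fin q ⊕ Fin p ≃ Fin l)
    (x : C.Cobar (p + 1)) (y : C.Cobar (q + 1)) (z : C.Cobar r) :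
    comp (((Equiv.refl (Fin r)).sumCongr h.symm).trans e) (comp (TwoTree.graftLeft h) x y) z =
      comp ((g.symm.sumCongr (Equiv.refl (Fin p))).trans ((Equiv.sumAssoc _ _ _).trans e)) x
        (comp g y z) := by
  have : (comp (TwoTree.graftLeft h)).compr₂
        (comp (C := C) (((Equiv.refl (Fin r)).sumCongr h.symm).trans e)) =
      LinearMap.compl₂ (LinearMap.llcomp k _ _ _ ∘ₗ comp (C := C)
        ((g.symm.sumCongr (Equiv.refl (Fin p))).trans ((Equiv.sumAssoc _ _ _).trans e)))
          (comp g) := by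
    refine hom_ext fun t => hom_ext fun u => hom_ext fun v => ?_
    simpa using cls_eq (.sequential e g h t u v)
  exact LinearMap.congr_fun (LinearMap.congr_fun (LinearMap.congr_fun this x) y) z

theorem parallel {p q r l m n : ℕ} (e : Fin r ⊕ (Fin q ⊕ Fin p) ≃ Fin n)
    (h : Fin q ⊕ Fin p ≃ Fin l) (g : Fin r ⊕ Fin p ≃ Fin m)
    (x : C.Cobar (p + 1 + 1)) {i j : ℤ} {y : C.Cobar q} {z : C.Cobar r}
    (hy : y ∈ deg C q i) (hz : z ∈ deg C r j) :
    comp (((Equiv.refl (Fin r)).sumCongr h.symm).trans e) (comp (TwoTree.graftRight h) x y) z =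
      zsign k (i * j) •
        comp (((Equiv.refl (Fin q)).sumCongr g.symm).trans ((TwoTree.exchange q r p).trans e))
          (comp (TwoTree.graftRight g) (act (Equiv.swap 0 1) x) z) y := by
  induction hy using Submodule.span_induction with
  | zero => simp
  | add y y' _ _ h1 h2 => simp [h1, h2]
  | smul a y _ h1 => simp only [map_smul, LinearMap.smul_apply, h1]; rw [smul_comm]
  | mem y hy =>
    obtain ⟨u, rfl, rfl⟩ := hy
    induction hz using Submodule.span_induction with
    | zero => simp
    | add y y' _ _ h1 h2 => simp [h1, h2]
    | smul a y _ h1 => simp only [map_smul, LinearMap.smul_apply, h1]; rw [smul_comm]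
    | mem z hz =>
      obtain ⟨v, rfl, rfl⟩ := hz
      have : (((comp (TwoTree.graftRight h)).compr₂
          (comp (C := C) (((Equiv.refl (Fin r)).sumCongr h.symm).trans e))).flip (cls u)).flip
            (cls v) =
          zsign k (u.degree * v.degree) •
            ((comp (((Equiv.refl (Fin q)).sumCongr g.symm).trans
              ((TwoTree.exchange q r p).trans e))).flip (cls u) ∘ₗ
            (comp (TwoTree.graftRight g)).flip (cls v) ∘ₗ act (Equiv.swap 0 1)) := by
        refine hom_ext fun t => ?_
        simpa using cls_eq_smul (.parallel e h g t u v)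
      exact LinearMap.congr_fun this x

theorem comp_mem_deg {p q n : ℕ} (e : Fin q ⊕ Fin p ≃ Fin n) {i j : ℤ} {x : C.Cobar (p + 1)}
    {y : C.Cobar q} (hx : x ∈ deg C (p + 1) i) (hy : y ∈ deg C q j) :
    comp e x y ∈ deg C n (i + j) := by
  induction hx using Submodule.span_induction with
  | zero => simp
  | add x x' _ _ h1 h2 => simpa using add_mem h1 h2
  | smul a x _ h1 => simpa using Submodule.smul_mem _ a h1
  | mem x hx =>
    obtain ⟨t, rfl, rfl⟩ := hx
    induction hy using Submodule.span_induction with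
    | zero => simp
    | add x x' _ _ h1 h2 => simpa using add_mem h1 h2
    | smul a x _ h1 => simpa using Submodule.smul_mem _ a h1
    | mem y hy =>
      obtain ⟨u, rfl, rfl⟩ := hy
      rw [comp_cls]
      exact Submodule.subset_span ⟨_, rfl, rfl⟩

theorem act_mem_deg {n : ℕ} (σ : Equiv.Perm (Fin n)) {i : ℤ} {x : C.Cobar n}
    (hx : x ∈ deg C n i) : act σ x ∈ deg C n i := by
  induction hx using Submodule.span_induction with
  | zero => simp
  | add x x' _ _ h1 h2 => simpa using add_mem h1 h2
  | smul a x _ h1 => simpa using Submodule.smul_mem _ a h1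
  | mem x hx =>
    obtain ⟨t, rfl, rfl⟩ := hx
    rw [act_cls]
    exact Submodule.subset_span ⟨.act σ t, rfl, rfl⟩

theorem gen_mem_deg {n : ℕ} {j : ℤ} {c : C.obj n} (hc : c ∈ (C.obj n).deg j) :
    gen n c ∈ deg C n (j - 1) := by
  rw [gen_of_mem ⟨c, hc⟩]
  exact Submodule.subset_span ⟨_, rfl, rfl⟩

/-- The Koszul sign of an odd operator passing a linear combination of monomials. -/
def linSgn (n : ℕ) : C.Lin n →ₗ[k] C.Lin n :=
  Finsupp.lift _ k _ fun t => zsign k t.degree • mono t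

theorem linSgn_mono {n : ℕ} (t : C.Mon n) :
    linSgn n (mono t) = zsign k t.degree • mono t := by
  rw [linSgn, mono, Finsupp.lift_apply, Finsupp.sum_single_index] <;> simp [mono]

theorem linComp_mono {p q n : ℕ} (e : Fin q ⊕ Fin p ≃ Fin n) (t : C.Mon (p + 1)) (u : C.Mon q) :
    linComp e (mono t) (mono u) = mono (.comp e t u) := by
  simp [linComp, mono]

theorem linAct_mono {n : ℕ} (σ : Equiv.Perm (Fin n)) (t : C.Mon n) :
    linAct σ (mono t) = mono (.act σ t) := by
  simp [linAct, mono]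

theorem lin_ext {n : ℕ} {V : Type*} [AddCommGroup V] [Module k V] {f g : C.Lin n →ₗ[k] V}
    (h : ∀ t, f (mono t) = g (mono t)) : f = g := by
  apply Finsupp.lhom_ext'
  intro t
  ext
  exact h t

theorem linSgn_linComp {p q n : ℕ} (e : Fin q ⊕ Fin p ≃ Fin n) (x : C.Lin (p + 1))
    (y : C.Lin q) : linSgn n (linComp e x y) = linComp e (linSgn _ x) (linSgn _ y) := by
  have : (linComp e).compr₂ (linSgn (C := C) n) =
      (linComp e).compl₁₂ (linSgn _) (linSgn _) := lin_ext fun t => lin_ext fun u => by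
    simp only [LinearMap.compr₂_apply, LinearMap.compl₁₂_apply, linComp_mono, linSgn_mono,
      Mon.degree, zsign_add, mul_smul, map_smul, LinearMap.smul_apply]
    rw [smul_comm]
  exact LinearMap.congr_fun (LinearMap.congr_fun this x) y

theorem linSgn_linAct {n : ℕ} (σ : Equiv.Perm (Fin n)) (x : C.Lin n) :
    linSgn n (linAct σ x) = linAct σ (linSgn _ x) := by
  have : linSgn (C := C) n ∘ₗ linAct σ = linAct σ ∘ₗ linSgn n := lin_ext fun t => by
    simp [linAct_mono, linSgn_mono, Mon.degree]
  exact LinearMap.congr_fun this x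

theorem isRel_linSgn_base {n : ℕ} {x : C.Lin n} (h : BaseRel x) : IsRel (linSgn n x) := by
  have key : ∃ a : k, linSgn n x = a • x := by
    cases h with
    | gen_add j c c' => exact ⟨zsign k (j - 1), by
        simp only [map_sub, linSgn_mono, Mon.degree, smul_sub]⟩
    | gen_smul j a c => exact ⟨zsign k (j - 1), by
        simp only [map_sub, map_smul, linSgn_mono, Mon.degree, smul_sub]; rw [smul_comm a]⟩
    | gen_act σ j c => exact ⟨zsign k (j - 1), by
        simp only [map_sub, linSgn_mono, Mon.degree, smul_sub]⟩
    | act_one t => exact ⟨zsign k t.degree, by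
        simp only [map_sub, linSgn_mono, Mon.degree, smul_sub]⟩
    | act_mul σ τ t => exact ⟨zsign k t.degree, by
        simp only [map_sub, linSgn_mono, Mon.degree, smul_sub]⟩
    | comp_relabel e σ t u => exact ⟨zsign k (t.degree + u.degree), by
        simp only [map_sub, linSgn_mono, Mon.degree, smul_sub]⟩
    | comp_act e ρ τ t u => exact ⟨zsign k (t.degree + u.degree), by
        simp only [map_sub, linSgn_mono, Mon.degree, smul_sub]⟩
    | one_comp t => exact ⟨zsign k t.degree, by
        simp only [map_sub, linSgn_mono, Mon.degree, smul_sub, zero_add]⟩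
    | comp_one t => exact ⟨zsign k t.degree, by
        simp only [map_sub, linSgn_mono, Mon.degree, smul_sub, add_zero]⟩
    | sequential e g h t u v => exact ⟨zsign k (t.degree + u.degree + v.degree), by
        simp only [map_sub, linSgn_mono, Mon.degree, smul_sub, add_assoc]⟩
    | parallel e h g t u v => exact ⟨zsign k (t.degree + u.degree + v.degree), by
        simp only [map_sub, map_smul, linSgn_mono, Mon.degree, smul_sub]
        rw [smul_comm, add_right_comm]⟩
  obtain ⟨a, ha⟩ := key
  rw [ha]
  exact .smul a (.base h)

theorem isRel_linSgn {n : ℕ} {x : C.Lin n} (h : IsRel x) : IsRel (linSgn n x) := by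
  induction h with
  | base h => exact isRel_linSgn_base h
  | zero => rw [map_zero]; exact .zero
  | add _ _ h1 h2 => rw [map_add]; exact .add h1 h2
  | smul a _ h1 => rw [map_smul]; exact .smul a h1
  | comp_left e y _ h1 => rw [linSgn_linComp]; exact .comp_left e _ h1
  | comp_right e x _ h1 => rw [linSgn_linComp]; exact .comp_right e _ h1
  | act σ _ h1 => rw [linSgn_linAct]; exact .act σ h1

variable [Algebra ℚ k]

/-- The differential on generators:
`d (s⁻¹ c) = - s⁻¹ (d c) - ∑ (-1)^|c'| s⁻¹ c' ∘ s⁻¹ c''`, the sum being over the components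
`c' ⊗ c''` of the infinitesimal decomposition of `c`. -/
def dGen (n : ℕ) : C.obj n →ₗ[k] C.Cobar n :=
  - gen n ∘ₗ (C.obj n).d -
    C.treeSum n fun {p q} e => TensorProduct.lift (comp e) ∘ₗ
      TensorProduct.map (gen (p + 1) ∘ₗ (C.obj (p + 1)).sgn 1) (gen q)

/-- The differential on monomials: the derivation extending `dGen`. -/
def dMon : ∀ {n : ℕ}, C.Mon n → C.Cobar n
  | n, .gen _ c => dGen n c
  | _, .one => 0
  | _, .comp e t u => comp e (dMon t) (cls u) +
      zsign k t.degree • comp e (cls t) (dMon u)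
  | _, .act σ t => act σ (dMon t)

/-- The linear extension of the differential to linear combinations of monomials. -/
def dLin (n : ℕ) : C.Lin n →ₗ[k] C.Cobar n := Finsupp.lift _ k _ dMon


theorem dLin_mono {n : ℕ} (t : C.Mon n) : dLin n (mono t) = dMon t := by
  simp [dLin, mono]

theorem dLin_linComp {p q n : ℕ} (e : Fin q ⊕ Fin p ≃ Fin n) (x : C.Lin (p + 1)) (y : C.Lin q) :
    dLin n (linComp e x y) = comp e (dLin _ x) ((C.relIdeal q).mkQ y) +
      comp e ((C.relIdeal (p + 1)).mkQ (linSgn _ x)) (dLin _ y) := by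
  have : (linComp e).compr₂ (dLin (C := C) n) =
      (comp e).compl₁₂ (dLin _) (C.relIdeal q).mkQ +
      (comp e).compl₁₂ ((C.relIdeal (p + 1)).mkQ ∘ₗ linSgn _) (dLin _) := by
    refine lin_ext fun t => lin_ext fun u => ?_
    simp only [LinearMap.compr₂_apply, LinearMap.add_apply, LinearMap.compl₁₂_apply,
      LinearMap.comp_apply, linComp_mono, dLin_mono, linSgn_mono, map_smul, LinearMap.smul_apply,
      dMon]
    rfl
  exact LinearMap.congr_fun (LinearMap.congr_fun this x) y

theorem dLin_linAct {n : ℕ} (σ : Equiv.Perm (Fin n)) (x : C.Lin n) :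
    dLin n (linAct σ x) = act σ (dLin n x) := by
  have : dLin (C := C) n ∘ₗ linAct σ = act σ ∘ₗ dLin n := lin_ext fun t => by
    simp [linAct_mono, dLin_mono, dMon]
  exact LinearMap.congr_fun this x

theorem treeSum_act {V : Type*} [AddCommGroup V] [Module k V] {n : ℕ}
    (Φ : ∀ {p q : ℕ}, (Fin q ⊕ Fin p ≃ Fin n) → (C.obj (p + 1) ⊗[k] C.obj q →ₗ[k] V))
    (σ : Equiv.Perm (Fin n)) (A : V →ₗ[k] V)
    (hΦ : ∀ {p q : ℕ} (e : Fin q ⊕ Fin p ≃ Fin n), Φ (e.trans σ) = A ∘ₗ Φ e) (c : C.obj n) :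
    C.treeSum n Φ (C.act n σ c) = A (C.treeSum n Φ c) := by
  simp only [treeSum, LinearMap.sum_apply, LinearMap.smul_apply, map_sum, map_smul,
    LinearMap.comp_apply]
  refine Finset.sum_congr rfl fun qp _ => ?_
  congr 1
  rw [← (Equiv.equivCongr (Equiv.refl (Fin qp.1 ⊕ Fin qp.2)) σ).sum_comp]
  refine Finset.sum_congr rfl fun e _ => ?_
  have : (Equiv.equivCongr (Equiv.refl (Fin qp.1 ⊕ Fin qp.2)) σ) e = e.trans σ := by
    ext; simp
  rw [this, C.Δ_relabel, hΦ]
  rfl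

theorem dGen_act {n : ℕ} (σ : Equiv.Perm (Fin n)) (c : C.obj n) :
    dGen n (C.act n σ c) = act σ (dGen n c) := by
  simp only [dGen, LinearMap.sub_apply, LinearMap.neg_apply, LinearMap.comp_apply, map_sub, map_neg]
  rw [treeSum_act _ σ (act σ), ← C.act_d, act_gen]
  intro p q e
  ext x y
  simp [comp_relabel]

theorem dGen_mem_deg {n : ℕ} {j : ℤ} {c : C.obj n} (hc : c ∈ (C.obj n).deg j) :
    dGen n c ∈ deg C n (j - 1 - 1) := by
  refine sub_mem (neg_mem (gen_mem_deg ((C.obj n).d_deg j c hc))) ?_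
  simp only [treeSum, LinearMap.sum_apply, LinearMap.smul_apply]
  refine sum_mem fun qp _ => Submodule.smul_mem _ _ (sum_mem fun e _ => ?_)
  have h := C.Δ_deg e j c hc
  rw [LinearMap.comp_apply]
  revert h
  generalize C.Δ e c = z
  intro hz
  suffices h : (C.obj (qp.2 + 1)).tensorDeg (C.obj qp.1) j ≤ (deg C n (j - 1 - 1)).comap
      (TensorProduct.lift (comp e) ∘ₗ
      TensorProduct.map (gen (qp.2 + 1) ∘ₗ (C.obj (qp.2 + 1)).sgn 1) (gen qp.1)) from h hz
  refine iSup_le fun a => Submodule.map₂_le.2 fun x hx y hy => ?_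
  have := comp_mem_deg e (gen_mem_deg (FilteredDGModule.sgn_mem_deg _ 1 hx)) (gen_mem_deg hy)
  rw [show a - 1 + (j - a - 1) = j - 1 - 1 by ring] at this
  simpa using this

theorem dMon_mem_deg : ∀ {n : ℕ} (t : C.Mon n), dMon t ∈ deg C n (t.degree - 1)
  | n, .gen j c => dGen_mem_deg c.2
  | _, .one => zero_mem _
  | _, .comp e t u => by
    refine add_mem ?_ (Submodule.smul_mem _ _ ?_)
    · have := comp_mem_deg e (dMon_mem_deg t) (Submodule.subset_span ⟨u, rfl, rfl⟩)
      rwa [show t.degree - 1 + u.degree = (Mon.comp e t u).degree - 1 by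
        simp only [Mon.degree]; ring] at this
    · have := comp_mem_deg e (Submodule.subset_span ⟨t, rfl, rfl⟩) (dMon_mem_deg u)
      rwa [show t.degree + (u.degree - 1) = (Mon.comp e t u).degree - 1 by
        simp only [Mon.degree]; ring] at this
  | _, .act σ t => act_mem_deg σ (dMon_mem_deg t)

theorem dLin_base {n : ℕ} {x : C.Lin n} (h : BaseRel x) : dLin n x = 0 := by
  cases h with
  | gen_add j c c' => simp [dLin_mono, dMon]
  | gen_smul j a c => simp [dLin_mono, dMon]
  | gen_act σ j c => simp [dLin_mono, dMon, dGen_act]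
  | act_one t => simp [dLin_mono, dMon, act_one_apply]
  | act_mul σ τ t => simp [dLin_mono, dMon, act_mul_apply]
  | comp_relabel e σ t u => simp [dLin_mono, dMon, comp_relabel]
  | comp_act e ρ τ t u =>
    simp [dLin_mono, dMon, comp_act, Mon.degree]
  | one_comp t =>
    have := one_comp (dMon t)
    rw [one] at this
    simpa [dLin_mono, dMon, Mon.degree, sub_eq_zero, zsign_zero] using this
  | comp_one t =>
    have := comp_one (dMon t)
    rw [one] at this
    simpa [dLin_mono, dMon, Mon.degree, sub_eq_zero, zsign_zero] using this
  | sequential e g h t u v =>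
    simp only [map_sub, dLin_mono, dMon, ← comp_cls, sub_eq_zero, Mon.degree, map_add,
      LinearMap.add_apply, map_smul, LinearMap.smul_apply, sequential e g h, zsign_add, mul_smul, smul_add, add_assoc]
  | parallel e h g t u v =>
    have hu : cls u ∈ deg C _ u.degree := Submodule.subset_span ⟨u, rfl, rfl⟩
    have hv : cls v ∈ deg C _ v.degree := Submodule.subset_span ⟨v, rfl, rfl⟩
    simp only [map_sub, dLin_mono, dMon, ← comp_cls, ← act_cls, sub_eq_zero, Mon.degree, map_add,
      LinearMap.add_apply, map_smul, LinearMap.smul_apply, parallel e h g _ hu hv,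
      parallel e h g _ (dMon_mem_deg u) hv, parallel e h g _ hu (dMon_mem_deg v),
      smul_add, smul_smul, zsign_add, sub_mul, mul_sub, one_mul, mul_one, zsign_sub]
    have hs' := zsign_mul_self k u.degree
    rw [show zsign k t.degree * zsign k u.degree *
        (zsign k (u.degree * v.degree) * zsign k u.degree) =
          zsign k (u.degree * v.degree) * zsign k t.degree by
        linear_combination (zsign k t.degree * zsign k (u.degree * v.degree)) * hs',
      show zsign k t.degree * (zsign k (u.degree * v.degree) * zsign k v.degree) =
        zsign k (u.degree * v.degree) * (zsign k t.degree * zsign k v.degree) by ring]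
    abel

theorem dLin_rel {n : ℕ} {x : C.Lin n} (h : IsRel x) : dLin n x = 0 := by
  induction h with
  | base h => exact dLin_base h
  | zero => simp
  | add _ _ h1 h2 => simp [h1, h2]
  | smul a _ h1 => simp [h1]
  | comp_left e y h h1 =>
    have h2 : (C.relIdeal _).mkQ (linSgn _ _) = 0 :=
      (Submodule.Quotient.mk_eq_zero (C.relIdeal _)).2 (isRel_linSgn h)
    rw [dLin_linComp, h1, h2]
    simp
  | comp_right e x h h1 =>
    have h2 : (C.relIdeal _).mkQ _ = 0 := (Submodule.Quotient.mk_eq_zero (C.relIdeal _)).2 h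
    rw [dLin_linComp, h1, h2]
    simp
  | act σ _ h1 => rw [dLin_linAct, h1, map_zero]

/-- The differential of the cobar construction: the derivation of the free operad `T(s⁻¹ C)`
extending `dGen`. -/
def d (n : ℕ) : C.Cobar n →ₗ[k] C.Cobar n :=
  (C.relIdeal n).liftQ (dLin n) fun _ h => dLin_rel h

end Cobar

end FilteredDGCooperad

/-! ### The endomorphism operad -/

namespace EndOp

variable {k : Type u} [CommRing k] (A : FilteredDGModule.{u, w} k)

/-- All multilinear maps `A^n → A`; the component `end_A(n)` consists of the filtered ones. -/
abbrev Mult (n : ℕ) : Type w := MultilinearMap k (fun _ : Fin n => A) A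

/-- Homogeneous maps of degree `i`. -/
def deg (n : ℕ) (i : ℤ) : Submodule k (Mult A n) where
  carrier := {f | ∀ (a : Fin n → A) (j : Fin n → ℤ), (∀ s, a s ∈ A.deg (j s)) →
    f a ∈ A.deg (∑ s, j s + i)}
  zero_mem' := fun _ _ _ => zero_mem _
  add_mem' := fun hf hg a j h => add_mem (hf a j h) (hg a j h)
  smul_mem' := fun c _ hf a j h => Submodule.smul_mem _ c (hf a j h)

/-- The filtration: `f` lies in the `l`-th step when
`f (F_{i_1} A, …, F_{i_n} A) ⊆ F_{i_1 + ⋯ + i_n + l} A`. -/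
def fil (n : ℕ) (l : ℕ) : Submodule k (Mult A n) where
  carrier := {f | ∀ (a : Fin n → A) (i : Fin n → ℕ), (∀ s, a s ∈ A.fil (i s)) →
    f a ∈ A.fil (∑ s, i s + l)}
  zero_mem' := fun _ _ _ => zero_mem _
  add_mem' := fun hf hg a j h => add_mem (hf a j h) (hg a j h)
  smul_mem' := fun c _ hf a j h => Submodule.smul_mem _ c (hf a j h)

/-- The Koszul sign of the rearrangement `a_0 ⊗ ⋯ ⊗ a_{n-1} ↦ a_{σ 0} ⊗ ⋯ ⊗ a_{σ (m-1)}`, where the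
elements of odd degree are those with index in `S`. -/
def koszulSign {m n : ℕ} (σ : Fin m ≃ Fin n) (S : Finset (Fin n)) : ℤ :=
  ∏ i : Fin m, ∏ j : Fin m, if i < j ∧ σ j < σ i ∧ σ i ∈ S ∧ σ j ∈ S then -1 else 1

variable {A}

/-- Rearrangement of the arguments: on homogeneous elements,
`(rearrange σ f) (a_0, …, a_{n-1}) = ± f (a_{σ 0}, …, a_{σ (m-1)})` with the Koszul sign.  The sum
runs over the parity patterns of the arguments. -/
def rearrange {m n : ℕ} (σ : Fin m ≃ Fin n) (f : Mult A m) : Mult A n :=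
  ∑ S : Finset (Fin n), koszulSign σ S •
    (f.domDomCongr σ).compLinearMap fun i => if i ∈ S then A.odd else A.even

/-- The partial composition along a two-vertex tree: on homogeneous elements
`(comp e f g) a = ± f (g (a_{e (inl 0)}, …, a_{e (inl (q-1))}), a_{e (inr 0)}, …, a_{e (inr (p-1))})`
with the Koszul sign of the rearrangement of the arguments. -/
def comp {p q n : ℕ} (e : Fin q ⊕ Fin p ≃ Fin n) (f : Mult A (p + 1)) (g : Mult A q) : Mult A n :=
  rearrange (finSumFinEquiv.symm.trans e)
    ((MultilinearMap.uncurrySum (f.curryLeft.compMultilinearMap g)).domDomCongr finSumFinEquiv)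

/-- The operadic unit. -/
def one : Mult A 1 := MultilinearMap.ofSubsingleton k A A (0 : Fin 1) LinearMap.id

/-- The action of the symmetric group. -/
def act {n : ℕ} (σ : Equiv.Perm (Fin n)) (f : Mult A n) : Mult A n := rearrange σ f

/-- The differential `∂ f = d ∘ f - (-1)^|f| ∑_i f ∘ (id, …, id, d, id, …, id)`, with the Koszul
signs; the operator `sgn 1` is `a ↦ (-1)^|a| a`. -/
def d {n : ℕ} (f : Mult A n) : Mult A n :=
  A.d.compMultilinearMap f - ∑ i : Fin n,
    (A.sgn 1).compMultilinearMap (f.compLinearMap fun j =>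
      if j < i then LinearMap.id else if j = i then A.sgn 1 ∘ₗ A.d else A.sgn 1)

theorem rearrange_add {m n : ℕ} (σ : Fin m ≃ Fin n) (f g : Mult A m) :
    rearrange σ (f + g) = rearrange σ f + rearrange σ g := by
  simp only [rearrange, ← Finset.sum_add_distrib, ← smul_add]
  rfl

theorem rearrange_smul {m n : ℕ} (σ : Fin m ≃ Fin n) (c : k) (f : Mult A m) :
    rearrange σ (c • f) = c • rearrange σ f := by
  simp only [rearrange, Finset.smul_sum, smul_comm c]
  rfl

/-- The differential as a linear map. -/
def dLinear {n : ℕ} : Mult A n →ₗ[k] Mult A n where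
  toFun := d
  map_add' f g := by
    ext a
    simp [d, Finset.sum_add_distrib]
    abel
  map_smul' c f := by
    ext a
    simp [d, Finset.smul_sum, smul_sub]

/-- The partial composition as a linear map on the tensor product. -/
def compTensor {p q n : ℕ} (e : Fin q ⊕ Fin p ≃ Fin n) :
    Mult A (p + 1) ⊗[k] Mult A q →ₗ[k] Mult A n :=
  TensorProduct.lift (LinearMap.mk₂ k (comp e)
    (fun f f' g => by
      rw [comp, comp, comp, ← rearrange_add]
      rfl)
    (fun c f g => by
      rw [comp, comp, ← rearrange_smul]
      rfl)
    (fun f g g' => by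
      rw [comp, comp, comp, ← rearrange_add]
      congr 1
      ext a
      simp)
    (fun c f g => by
      rw [comp, comp, ← rearrange_smul]
      congr 1
      ext a
      simp))

end EndOp

/-! ### The convolution pre-Lie algebra -/

namespace Conv

variable {k : Type u} [CommRing k]

/-- Families of linear maps `C(n) → Hom(A^n, A)`. -/
abbrev Family (C : FilteredDGCooperad.{u, v} k) (A : FilteredDGModule.{u, w} k) : Type (max v w) :=
  ∀ n : ℕ, C.obj n →ₗ[k] EndOp.Mult A n

variable {C : FilteredDGCooperad.{u, v} k} {A : FilteredDGModule.{u, w} k}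

/-- The arity `n` component `f` lies in the `l`-th step of the filtration of
`hom(C(n), end_A(n))`. -/
def InFil (l : ℕ) {n : ℕ} (f : C.obj n →ₗ[k] EndOp.Mult A n) : Prop :=
  ∀ (i : ℕ) (c : C.obj n), c ∈ (C.obj n).fil i → f c ∈ EndOp.fil A n (i + l)

/-- The elements of degree `j` of `hom_S(C, end_A) = ∏_n hom_{S_n}(C(n), end_A(n))`. -/
structure IsHom (j : ℤ) (f : Family C A) : Prop where
  equivariant : ∀ n (σ : Equiv.Perm (Fin n)) (c : C.obj n),
    f n (C.act n σ c) = EndOp.act σ (f n c)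
  degree : ∀ n i (c : C.obj n), c ∈ (C.obj n).deg i → f n c ∈ EndOp.deg A n (i + j)
  filtered : ∀ n, InFil 0 (f n)

/-- The differential `∂ f = ∂_A ∘ f - (-1)^j f ∘ d_C` of an element of degree `j`. -/
def diff (j : ℤ) (f : Family C A) : Family C A := fun n =>
  EndOp.dLinear ∘ₗ f n - zsign k j • (f n ∘ₗ (C.obj n).d)

/-- The left unit: the counit of `C` followed by the unit of the endomorphism operad. -/
def unit : Family C A
  | 0 => 0
  | 1 => C.counit.smulRight EndOp.one
  | _ + 2 => 0

/-- The element `δ`: the counit of `C` followed by the differential of `A`. -/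
def delta : Family C A
  | 0 => 0
  | 1 => C.counit.smulRight (MultilinearMap.ofSubsingleton k A A (0 : Fin 1) A.d)
  | _ + 2 => 0

/-- Convergence of the series `∑ x_i` to `L` in the complete module `hom_S(C, end_A)`, arity by
arity. -/
def Converges (x : ℕ → Family C A) (L : Family C A) : Prop :=
  ∀ n l : ℕ, ∃ N : ℕ, ∀ m ≥ N, InFil l (L n - ∑ i ∈ Finset.range m, x i n)

open Classical in
/-- The sum of a convergent series. -/
def seriesSum (x : ℕ → Family C A) : Family C A :=
  if h : ∃ L, Converges x L then h.choose else 0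

variable [Algebra ℚ k]

/-- The pre-Lie product `f ⋆ g`, where `g` has degree `j`: the composite of the infinitesimal
decomposition map of `C`, of `f ⊗ g` (with `(f ⊗ g) (x ⊗ y) = (-1)^(j |x|) f x ⊗ g y`) and of the
infinitesimal composition map of the endomorphism operad. -/
def star (j : ℤ) (f g : Family C A) : Family C A := fun n =>
  C.treeSum n fun {p q} e => EndOp.compTensor e ∘ₗ
    TensorProduct.map (f (p + 1) ∘ₗ (C.obj (p + 1)).sgn j) (g q)

/-- The bracket `[f, g] = f ⋆ g - g ⋆ f` of `f` of degree `0` and `g` of degree `j`. -/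
def bracket (j : ℤ) (f g : Family C A) : Family C A := star j f g - star 0 g f

/-- The rational number `r` times `f`. -/
def ratSmul (r : ℚ) (f : Family C A) : Family C A := algebraMap ℚ k r • f

/-- Right iterated powers for the pre-Lie product of an element of degree `0`. -/
def power (f : Family C A) : ℕ → Family C A
  | 0 => unit
  | 1 => f
  | n + 2 => star 0 (power f (n + 1)) f

/-- The terms of the pre-Lie exponential. -/
def expTerm (f : Family C A) (n : ℕ) : Family C A := ratSmul (n.factorial : ℚ)⁻¹ (power f n)

/-- The pre-Lie exponential `e^f = 1 + f + f^{⋆2} / 2! + ⋯`. -/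
def exp (f : Family C A) : Family C A := seriesSum (expTerm f)

/-- The symmetric braces `{a; b_1, …, b_n}`, the `b_i` being of degree `0`. -/
def brace : (n : ℕ) → Family C A → (Fin n → Family C A) → Family C A
  | 0, a, _ => a
  | n + 1, a, b =>
    star 0 (brace n a fun i => b i.castSucc) (b (Fin.last n)) -
      ∑ i : Fin n, brace n a
        (Function.update (fun i => b i.castSucc) i (star 0 (b i.castSucc) (b (Fin.last n))))

/-- The terms of the circle product. -/
def circTerm (a f : Family C A) (n : ℕ) : Family C A :=
  ratSmul (n.factorial : ℚ)⁻¹ (brace n a fun _ => f - unit)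

/-- The circle product `a ⊚ (1 + b) = ∑ {a; b, …, b} / n!`. -/
def circ (a f : Family C A) : Family C A := seriesSum (circTerm a f)

/-- The right-nested bracket `[a_1, [a_2, [⋯, a_n]]]` of a word of elements of degree `0`. -/
def nested : List (Family C A) → Family C A
  | [] => 0
  | [a] => a
  | a :: b :: t => bracket 0 a (nested (b :: t))

/-- The component of weight `N` of the Baker-Campbell-Hausdorff series, in Dynkin's form
`∑_n (-1)^(n-1) / n ∑ [x^{r_1} y^{s_1} ⋯ x^{r_n} y^{s_n}] / (N ∏ r_i! s_i!)`, the second sum being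
over `r_i + s_i > 0` with `∑ (r_i + s_i) = N`. -/
def bchTerm (x y : Family C A) (N : ℕ) : Family C A :=
  ∑ n ∈ Finset.Icc 1 N, ∑ rs : Fin n → Fin (N + 1) × Fin (N + 1),
    if (∀ i, 0 < (rs i).1.val + (rs i).2.val) ∧ ∑ i, ((rs i).1.val + (rs i).2.val) = N then
      ratSmul ((-1) ^ (n + 1) / n /
          (N * ∏ i, ((rs i).1.val.factorial * (rs i).2.val.factorial : ℚ)))
        (nested (List.ofFn fun i =>
          List.replicate (rs i).1.val x ++ List.replicate (rs i).2.val y).flatten)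
    else 0

/-- The Baker-Campbell-Hausdorff product. -/
def bch (x y : Family C A) : Family C A := seriesSum (bchTerm x y)

/-- The terms of `e^{ad_f} (δ + α) - δ`, without the factors `1 / n!`, where `α` has degree `-1`
and the formal element `δ` satisfies `[f, δ] = - ∂ f`. -/
def gaugeIter (f α : Family C A) : ℕ → Family C A
  | 0 => α
  | 1 => bracket (-1) f α - diff 0 f
  | n + 2 => bracket (-1) f (gaugeIter f α (n + 1))

/-- The terms of the gauge action. -/
def gaugeTerm (f α : Family C A) (n : ℕ) : Family C A :=
  ratSmul (n.factorial : ℚ)⁻¹ (gaugeIter f α n)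

/-- The gauge action `f . α = e^{ad_f} α - ((e^{ad_f} - 1) / ad_f) (∂ f)`. -/
def gauge (f α : Family C A) : Family C A := seriesSum (gaugeTerm f α)

variable (C A)

/-- The underlying set of the deformation gauge group: elements of degree `0` whose components of
arity `0` and `1` lie in the first step of the filtration. -/
abbrev GaugeSet : Type (max v w) :=
  {f : Family C A // IsHom 0 f ∧ InFil 1 (f 0) ∧ InFil 1 (f 1)}

/-- The elements of degree `0` whose component of arity `0` lies in the first step of the
filtration. -/
abbrev MorSet : Type (max v w) := {f : Family C A // IsHom 0 f ∧ InFil 1 (f 0)}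

/-- The Maurer--Cartan elements of the convolution algebra. -/
abbrev MC : Type (max v w) :=
  {α : Family C A // IsHom (-1) α ∧ diff (-1) α + star (-1) α α = 0}

variable {C A}

/-- `f` is an `∞`-morphism from `α` to `β`. -/
structure IsInftyMor (f α β : Family C A) : Prop where
  isHom : IsHom 0 f
  zero_mem : InFil 1 (f 0)
  eq : star (-1) f (delta + α) + (fun n => f n ∘ₗ (C.obj n).d) = circ (delta + β) f

/-- `f` is an `∞`-isotopy from `α` to `β`. -/
structure IsInftyIsotopy (f α β : Family C A) : Prop extends IsInftyMor f α β where
  one_mem : InFil 1 (f 1 - unit 1)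

variable (C A)

/-- A complete `Ω C`-algebra structure on `A`: a morphism of filtered dg operads from the cobar
construction of `C` to the endomorphism operad of `A`. -/
structure CobarAlg where
  map : ∀ n, C.Cobar n →ₗ[k] EndOp.Mult A n
  map_deg : ∀ n i (x : C.Cobar n),
    x ∈ FilteredDGCooperad.Cobar.deg C n i → map n x ∈ EndOp.deg A n i
  map_fil : ∀ n l (x : C.Cobar n),
    x ∈ FilteredDGCooperad.Cobar.fil C n l → map n x ∈ EndOp.fil A n l
  map_act : ∀ n (σ : Equiv.Perm (Fin n)) (x : C.Cobar n),
    map n (FilteredDGCooperad.Cobar.act σ x) = EndOp.act σ (map n x)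
  map_one : map 1 FilteredDGCooperad.Cobar.one = EndOp.one
  map_comp : ∀ {p q n : ℕ} (e : Fin q ⊕ Fin p ≃ Fin n) (x : C.Cobar (p + 1)) (y : C.Cobar q),
    map n (FilteredDGCooperad.Cobar.comp e x y) = EndOp.comp e (map (p + 1) x) (map q y)
  map_d : ∀ n (x : C.Cobar n), map n (FilteredDGCooperad.Cobar.d n x) = EndOp.d (map n x)

variable {C A}

/-- The twisting element `c ↦ ρ (s⁻¹ c)` of an `Ω C`-algebra structure. -/
def CobarAlg.twist (ρ : CobarAlg C A) : Family C A := fun n =>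
  ρ.map n ∘ₗ FilteredDGCooperad.Cobar.gen n

end Conv

/-! ### Groupoids of labelled arrows -/

/-- The sets `hom x y` are the morphisms of a groupoid, whose composition and units are given by a
binary operation and by an element of the set of labels. -/
structure IsLabelledGroupoid {O X : Type*} (hom : O → O → Set X) (mul : X → X → X) (one : X) :
    Prop where
  one_mem : ∀ x, one ∈ hom x x
  mul_mem : ∀ {x y z f g}, f ∈ hom x y → g ∈ hom y z → mul g f ∈ hom x z
  one_mul : ∀ {x y f}, f ∈ hom x y → mul one f = f
  mul_one : ∀ {x y f}, f ∈ hom x y → mul f one = f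
  assoc : ∀ {x y z t f g h}, f ∈ hom x y → g ∈ hom y z → h ∈ hom z t →
    mul (mul h g) f = mul h (mul g f)
  exists_inv : ∀ {x y f}, f ∈ hom x y → ∃ g ∈ hom y x, mul g f = one ∧ mul f g = one

/-- The groupoid of labelled arrows. -/
abbrev IsLabelledGroupoid.groupoid {O X : Type*} {hom : O → O → Set X} {mul : X → X → X} {one : X}
    (h : IsLabelledGroupoid hom mul one) : CategoryTheory.Groupoid O where
  Hom x y := hom x y
  id x := ⟨one, h.one_mem x⟩
  comp f g := ⟨mul g.1 f.1, h.mul_mem f.2 g.2⟩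
  id_comp f := Subtype.ext (h.mul_one f.2)
  comp_id f := Subtype.ext (h.one_mul f.2)
  assoc f g i := Subtype.ext (h.assoc f.2 g.2 i.2).symm
  inv f := ⟨(h.exists_inv f.2).choose, (h.exists_inv f.2).choose_spec.1⟩
  inv_comp f := Subtype.ext (h.exists_inv f.2).choose_spec.2.2
  comp_inv f := Subtype.ext (h.exists_inv f.2).choose_spec.2.1

end

noncomputable section

/-! ### Koszul signs -/

/-- The Koszul sign of the passage from the ordering `x` to the ordering `y` of a finite family of
homogeneous elements of degrees `d`. -/
def orderSign (k : Type*) [CommRing k] {ι α β : Type*} [Fintype ι] [LinearOrder α] [LinearOrder β]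
    (x : ι → α) (y : ι → β) (d : ι → ℤ) : k :=
  ∏ i, ∏ j, if x i < x j ∧ y j < y i then zsign k (d i * d j) else 1

/-- The Koszul sign of the passage of an odd operator to the position `i`. -/
def beforeSign (k : Type*) [CommRing k] {ι α : Type*} [Fintype ι] [LinearOrder α]
    (x : ι → α) (i : ι) (d : ι → ℤ) : k :=
  ∏ j, if x j < x i then zsign k (d j) else 1

section Signs

theorem zsign_sum (k : Type*) [CommRing k] {ι : Type*} (s : Finset ι) (d : ι → ℤ) : zsign k (∑ i ∈ s, d i) = ∏ i ∈ s, zsign k (d i) := by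
  classical
  induction s using Finset.induction_on with
  | empty => simp [zsign_zero]
  | insert a s h ih => rw [Finset.sum_insert h, Finset.prod_insert h, zsign_add, ih]

variable (k : Type*) [CommRing k] {ι κ α β γ : Type*}

theorem zsign_even {i : ℤ} (h : Even i) : zsign k i = 1 := by
  rw [zsign, Int.negOnePow_even _ h]; simp

theorem zsign_odd {i : ℤ} (h : Odd i) : zsign k i = -1 := by
  rw [zsign, Int.negOnePow_odd _ h]; simp

theorem zsign_congr {i j : ℤ} (h : Even (i - j)) : zsign k i = zsign k j := by
  rw [← sub_add_cancel i j, zsign_add, zsign_even k h, one_mul]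

variable [Fintype ι] [Fintype κ] [LinearOrder α] [LinearOrder β] [LinearOrder γ]

theorem orderSign_mul {x : ι → α} {y : ι → β} {z : ι → γ} (hx : x.Injective) (hy : y.Injective)
    (hz : z.Injective) (d : ι → ℤ) :
    orderSign k x y d * orderSign k y z d = orderSign k x z d := by
  let F : ι → ι → k := fun i j => zsign k (d i * d j)
  let G : ι → ι → k := fun i j => if x i < x j ∧ y j < y i ∧ z i < z j then F i j else 1
  have hF : ∀ i j, F j i = F i j := fun i j => by simp only [F, mul_comm]
  have hFF : ∀ i j, F i j * F i j = 1 := fun i j => zsign_mul_self k _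
  have key : ∀ i j, (if x i < x j ∧ y j < y i then F i j else 1) *
      (if y i < y j ∧ z j < z i then F i j else 1) =
      (if x i < x j ∧ z j < z i then F i j else 1) * (G i j * G j i) := by
    intro i j
    simp only [G, hF i j]
    rcases eq_or_ne i j with rfl | h
    · simp
    · rcases lt_or_gt_of_ne (hx.ne h) with h1 | h1 <;> rcases lt_or_gt_of_ne (hy.ne h) with h2 | h2 <;>
      rcases lt_or_gt_of_ne (hz.ne h) with h3 | h3 <;>
      simp [h1, h2, h3, h1.not_gt, h2.not_gt, h3.not_gt]
  have hG : (∏ i, ∏ j, G i j) * ∏ i, ∏ j, G j i = 1 := by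
    rw [Finset.prod_comm (f := fun i j => G j i), ← Finset.prod_mul_distrib]
    refine Finset.prod_eq_one fun i _ => ?_
    rw [← Finset.prod_mul_distrib]
    refine Finset.prod_eq_one fun j _ => ?_
    simp only [G]
    split_ifs
    · exact hFF i j
    · simp
  have := congrArg (fun f : ι → ι → k => ∏ i, ∏ j, f i j) (funext fun i => funext (key i))
  simp only [Finset.prod_mul_distrib] at this
  rw [hG, mul_one] at this
  exact this

theorem orderSign_eq_one {x : ι → α} {y : ι → β} (h : ∀ i j, x i < x j → y i < y j) (d : ι → ℤ) :
    orderSign k x y d = 1 :=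
  Finset.prod_eq_one fun i _ => Finset.prod_eq_one fun j _ => if_neg fun hh =>
    (h i j hh.1).not_gt hh.2

theorem orderSign_congr {α' β' : Type*} [LinearOrder α'] [LinearOrder β'] {x : ι → α} {y : ι → β}
    {x' : ι → α'} {y' : ι → β'} (hx : ∀ i j, x i < x j ↔ x' i < x' j)
    (hy : ∀ i j, y i < y j ↔ y' i < y' j) (d : ι → ℤ) :
    orderSign k x y d = orderSign k x' y' d := by
  simp only [orderSign, hx, hy]

theorem orderSign_reindex (e : ι ≃ κ) (x : κ → α) (y : κ → β) (d : κ → ℤ) :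
    orderSign k (fun i => x (e i)) (fun i => y (e i)) (fun i => d (e i)) = orderSign k x y d := by
  simp only [orderSign]
  rw [← e.prod_comp]
  exact Finset.prod_congr rfl fun i _ => e.prod_comp (fun j =>
    if x (e i) < x j ∧ y j < y (e i) then zsign k (d (e i) * d j) else 1)

theorem orderSign_sum {x : ι ⊕ κ → α} {y : ι ⊕ κ → β}
    (hx : ∀ i j, x (.inl i) < x (.inr j)) (hy : ∀ i j, y (.inl i) < y (.inr j)) (d : ι ⊕ κ → ℤ) :
    orderSign k x y d = orderSign k (fun i => x (.inl i)) (fun i => y (.inl i)) (fun i => d (.inl i)) *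
      orderSign k (fun i => x (.inr i)) (fun i => y (.inr i)) (fun i => d (.inr i)) := by
  simp only [orderSign, Fintype.prod_sum_type, hy, hx, (hx _ _).not_gt, (hy _ _).not_gt,
    false_and, and_false, if_false, Finset.prod_const_one, mul_one, one_mul]

theorem orderSign_sum_swap {x : ι ⊕ κ → α} {y : ι ⊕ κ → β}
    (hx : ∀ i j, x (.inl i) < x (.inr j)) (hy : ∀ i j, y (.inr j) < y (.inl i))
    (h1 : ∀ i i', x (.inl i) < x (.inl i') → y (.inl i) < y (.inl i'))
    (h2 : ∀ i i', x (.inr i) < x (.inr i') → y (.inr i) < y (.inr i')) (d : ι ⊕ κ → ℤ) :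
    orderSign k x y d = zsign k ((∑ i, d (.inl i)) * ∑ i, d (.inr i)) := by
  have e1 : ∀ i i', ¬ (x (.inl i) < x (.inl i') ∧ y (.inl i') < y (.inl i)) := fun i i' h =>
    (h1 _ _ h.1).not_gt h.2
  have e2 : ∀ i i', ¬ (x (.inr i) < x (.inr i') ∧ y (.inr i') < y (.inr i)) := fun i i' h =>
    (h2 _ _ h.1).not_gt h.2
  simp only [orderSign, Fintype.prod_sum_type, hy, hx, (hx _ _).not_gt, (hy _ _).not_gt, e1, e2,
    if_false, Finset.prod_const_one, mul_one, one_mul, and_self, if_true]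
  rw [Finset.sum_mul_sum, zsign_sum]
  exact Finset.prod_congr rfl fun i _ => (zsign_sum k _ _).symm

theorem orderSign_update [DecidableEq ι] {x : ι → α} {y : ι → β} (hx : x.Injective)
    (hy : y.Injective) (d : ι → ℤ) (i : ι) :
    orderSign k x y (Function.update d i (d i - 1)) * beforeSign k y i d =
      orderSign k x y d * beforeSign k x i d := by
  set d' := Function.update d i (d i - 1) with hd'
  have h1 : orderSign k x y d' = orderSign k x y d *
      ((∏ j, if x i < x j ∧ y j < y i then zsign k (d j) else 1) *
       (∏ j, if x j < x i ∧ y i < y j then zsign k (d j) else 1)) := by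
    have key : ∀ a b, (if x a < x b ∧ y b < y a then zsign k (d' a * d' b) else 1) =
        (if x a < x b ∧ y b < y a then zsign k (d a * d b) else 1) *
        ((if a = i then (if x i < x b ∧ y b < y i then zsign k (d b) else 1) else 1) *
        (if b = i then (if x a < x i ∧ y i < y a then zsign k (d a) else 1) else 1)) := by
      intro a b
      by_cases hab : x a < x b ∧ y b < y a
      · have hne : a ≠ b := by rintro rfl; exact lt_irrefl _ hab.1
        rcases eq_or_ne a i with rfl | ha
        · rw [hd', Function.update_self, Function.update_of_ne hne.symm]
          simp only [hab, hne.symm, and_self, if_true, if_false, mul_one]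
          rw [sub_one_mul, zsign_sub]
        · rcases eq_or_ne b i with rfl | hb
          · rw [hd', Function.update_self, Function.update_of_ne hne]
            simp only [hab, hne, and_self, if_true, if_false, one_mul]
            rw [mul_sub_one, zsign_sub]
          · rw [hd', Function.update_of_ne ha, Function.update_of_ne hb]
            simp [ha, hb]
      · rw [if_neg hab, if_neg hab, one_mul]
        have e1 : (if a = i then (if x i < x b ∧ y b < y i then zsign k (d b) else 1) else 1) =
            (1 : k) := by
          split_ifs with h1 h2
          · rw [h1] at hab; exact absurd h2 hab
          · rfl
          · rfl
        have e2 : (if b = i then (if x a < x i ∧ y i < y a then zsign k (d a) else 1) else 1) =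
            (1 : k) := by
          split_ifs with h1 h2
          · rw [h1] at hab; exact absurd h2 hab
          · rfl
          · rfl
        rw [e1, e2, one_mul]
    rw [orderSign, Finset.prod_congr rfl fun a _ => Finset.prod_congr rfl fun b _ => key a b]
    simp only [Finset.prod_mul_distrib, orderSign]
    congr 2
    · rw [Finset.prod_eq_single i]
      · simp
      · intro b _ hb; simp [hb]
      · simp
    · exact Finset.prod_congr rfl fun a _ => by simp
  rw [h1, mul_assoc]
  congr 1
  rw [beforeSign, beforeSign, ← Finset.prod_mul_distrib, ← Finset.prod_mul_distrib]
  refine Finset.prod_congr rfl fun j _ => ?_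
  have hz := zsign_mul_self k (d j)
  rcases eq_or_ne i j with rfl | h
  · simp
  · rcases lt_or_gt_of_ne (hx.ne h) with h1 | h1 <;> rcases lt_or_gt_of_ne (hy.ne h) with h2 | h2 <;>
      simp [h1, h2, h1.not_gt, h2.not_gt, hz]

theorem beforeSign_reindex (e : ι ≃ κ) (x : κ → α) (i : ι) (d : κ → ℤ) :
    beforeSign k (fun j => x (e j)) i (fun j => d (e j)) = beforeSign k x (e i) d := by
  simp only [beforeSign]
  exact e.prod_comp (fun j => if x j < x (e i) then zsign k (d j) else 1)

end Signs

namespace FilteredDGModule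

variable {k : Type u} [CommRing k] (A : FilteredDGModule.{u, w} k)

theorem even_of_even {i : ℤ} (h : Even i) {x : A} (hx : x ∈ A.deg i) : A.even x = x := by
  rw [even, A.weight_of_mem _ hx, if_pos h, one_smul]

theorem even_of_odd {i : ℤ} (h : ¬ Even i) {x : A} (hx : x ∈ A.deg i) : A.even x = 0 := by
  rw [even, A.weight_of_mem _ hx, if_neg h, zero_smul]

theorem odd_of_even {i : ℤ} (h : Even i) {x : A} (hx : x ∈ A.deg i) : A.odd x = 0 := by
  rw [odd, A.weight_of_mem _ hx, if_pos h, zero_smul]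

theorem odd_of_odd {i : ℤ} (h : ¬ Even i) {x : A} (hx : x ∈ A.deg i) : A.odd x = x := by
  rw [odd, A.weight_of_mem _ hx, if_neg h, one_smul]

theorem sgn_of_mem (j : ℤ) {i : ℤ} {x : A} (hx : x ∈ A.deg i) :
    A.sgn j x = zsign k (j * i) • x := by
  rw [sgn, A.weight_of_mem _ hx]

open Classical in
/-- The degrees of the nonzero homogeneous components. -/
def degrees (x : A) : Finset ℤ := (DirectSum.decompose A.deg x).support

theorem sum_decompose (x : A) :
    ∑ i ∈ A.degrees x, (DirectSum.decompose A.deg x i : A) = x := by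
  classical
  exact DirectSum.sum_support_decompose A.deg x

theorem linearMap_ext {V : Type*} [AddCommGroup V] [Module k V] {f g : A →ₗ[k] V}
    (h : ∀ i, ∀ x ∈ A.deg i, f x = g x) : f = g := by
  ext x
  rw [← A.sum_decompose x, map_sum, map_sum]
  exact Finset.sum_congr rfl fun i _ => h i _ (SetLike.coe_mem _)

theorem weight_mem_of_homogeneous (S : Submodule k A)
    (hS : ∀ x ∈ S, ∀ i, (DirectSum.decompose A.deg x i : A) ∈ S) (f : ℤ → k) {x : A}
    (hx : x ∈ S) : A.weight f x ∈ S := by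
  rw [← A.sum_decompose x, map_sum]
  refine sum_mem fun i _ => ?_
  rw [A.weight_of_mem f (SetLike.coe_mem (DirectSum.decompose A.deg x i))]
  exact S.smul_mem _ (hS x hx i)

theorem weight_mem_fil (f : ℤ → k) {l : ℕ} {x : A} (hx : x ∈ A.fil l) : A.weight f x ∈ A.fil l :=
  A.weight_mem_of_homogeneous _ (fun x hx => A.fil_homogeneous l x hx) f hx

theorem sgn_sgn (i j : ℤ) (x : A) : A.sgn i (A.sgn j x) = A.sgn (i + j) x := by
  have : A.sgn i ∘ₗ A.sgn j = A.sgn (i + j) := A.linearMap_ext fun l x hx => by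
    rw [LinearMap.comp_apply, A.sgn_of_mem j hx, map_smul, A.sgn_of_mem i hx, A.sgn_of_mem _ hx,
      smul_smul, add_mul, zsign_add, mul_comm]
  exact LinearMap.congr_fun this x

theorem sgn_congr {i j : ℤ} (h : Even (i - j)) : A.sgn i = A.sgn j :=
  A.linearMap_ext fun l x hx => by
    rw [A.sgn_of_mem i hx, A.sgn_of_mem j hx]
    congr 1
    refine zsign_congr k ?_
    rw [← sub_mul]
    exact h.mul_right l

theorem fil_mono {l m : ℕ} (h : l ≤ m) {x : A} (hx : x ∈ A.fil m) : x ∈ A.fil l :=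
  A.fil_antitone h hx

theorem mem_fil_zero (x : A) : x ∈ A.fil 0 := by rw [A.fil_zero]; trivial

end FilteredDGModule

namespace EndOp

variable {k : Type u} [CommRing k] {A : FilteredDGModule.{u, w} k}

theorem mult_ext {n : ℕ} {V : Type*} [AddCommGroup V] [Module k V]
    {f g : MultilinearMap k (fun _ : Fin n => A) V}
    (h : ∀ (a : Fin n → A) (j : Fin n → ℤ), (∀ s, a s ∈ A.deg (j s)) → f a = g a) : f = g := by
  ext a
  have ha : a = fun s => ∑ i ∈ A.degrees (a s),
      (DirectSum.decompose A.deg (a s) i : A) := funext fun s => (A.sum_decompose _).symm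
  rw [ha, MultilinearMap.map_sum_finset, MultilinearMap.map_sum_finset]
  exact Finset.sum_congr rfl fun r _ => h _ r fun s => SetLike.coe_mem _

theorem rearrange_apply {m n : ℕ} (σ : Fin m ≃ Fin n) (f : Mult A m) {a : Fin n → A}
    {j : Fin n → ℤ} (h : ∀ s, a s ∈ A.deg (j s)) :
    rearrange σ f a = orderSign k id σ (fun i => j (σ i)) • f (fun i => a (σ i)) := by
  classical
  have hterm : ∀ S : Finset (Fin n), ((f.domDomCongr σ).compLinearMap
      fun i => if i ∈ S then A.odd else A.even) a =
      f (fun i => (if σ i ∈ S then A.odd else A.even) (a (σ i))) := fun S => rfl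
  rw [rearrange, sum_apply]
  simp only [smul_apply, hterm]
  rw [Finset.sum_eq_single (Finset.univ.filter fun i => ¬ Even (j i))]
  · have e1 : (fun i => (if σ i ∈ Finset.univ.filter (fun i => ¬ Even (j i)) then A.odd else A.even)
        (a (σ i))) = fun i => a (σ i) := by
      funext i
      by_cases hi : Even (j (σ i))
      · rw [if_neg (by simpa using hi), A.even_of_even hi (h _)]
      · rw [if_pos (by simpa using hi), A.odd_of_odd hi (h _)]
    rw [e1, ← Int.cast_smul_eq_zsmul k]
    congr 1
    rw [koszulSign, orderSign]
    push_cast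
    refine Finset.prod_congr rfl fun x _ => Finset.prod_congr rfl fun y _ => ?_
    simp only [Finset.mem_filter, Finset.mem_univ, true_and, id]
    by_cases h1 : x < y ∧ σ y < σ x
    · rw [if_pos h1]
      by_cases h2 : ¬ Even (j (σ x)) ∧ ¬ Even (j (σ y))
      · rw [if_pos ⟨h1.1, h1.2, h2⟩, zsign_odd k
          ((Int.not_even_iff_odd.1 h2.1).mul (Int.not_even_iff_odd.1 h2.2))]
      · rw [if_neg fun h => h2 h.2.2, zsign_even k (by rw [Int.even_mul]; tauto)]
    · rw [if_neg h1, if_neg fun h => h1 ⟨h.1, h.2.1⟩]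
  · intro S _ hS
    obtain ⟨i, hi⟩ : ∃ i, ¬ (i ∈ S ↔ ¬ Even (j i)) := by
      by_contra! hc
      apply hS
      ext i
      have := hc i
      simp only [Finset.mem_filter, Finset.mem_univ, true_and]
      tauto
    rw [MultilinearMap.map_coord_zero f (σ.symm i), smul_zero]
    simp only [Equiv.apply_symm_apply]
    by_cases hi' : Even (j i)
    · rw [if_pos (by tauto), A.odd_of_even hi' (h _)]
    · rw [if_neg (by tauto), A.even_of_odd hi' (h _)]
  · simp

theorem rearrange_rearrange {l m n : ℕ} (σ : Fin m ≃ Fin n) (τ : Fin l ≃ Fin m) (f : Mult A l) :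
    rearrange σ (rearrange τ f) = rearrange (τ.trans σ) f := by
  refine mult_ext fun a j h => ?_
  rw [rearrange_apply σ _ h, rearrange_apply τ _ (fun s => h (σ s)), rearrange_apply _ _ h,
    smul_smul, ← orderSign_reindex k τ id σ]
  congr 1
  rw [mul_comm]
  exact orderSign_mul k Function.injective_id τ.injective (τ.trans σ).injective _

theorem rearrange_refl {n : ℕ} (f : Mult A n) : rearrange (Equiv.refl _) f = f := by
  refine mult_ext fun a j h => ?_
  rw [rearrange_apply _ _ h, orderSign_eq_one k (x := id) (y := Equiv.refl _) (fun _ _ h => h), one_smul]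
  rfl

/-- The partial composition at the first input, with the arguments in their standard order. -/
def compFirst {p q : ℕ} (f : Mult A (p + 1)) (g : Mult A q) : Mult A (q + p) :=
  (MultilinearMap.uncurrySum (f.curryLeft.compMultilinearMap g)).domDomCongr finSumFinEquiv

theorem compFirst_apply {p q : ℕ} (f : Mult A (p + 1)) (g : Mult A q) (a : Fin (q + p) → A) :
    compFirst f g a = f (Fin.cons (g fun i => a (Fin.castAdd p i)) fun i => a (Fin.natAdd q i)) := by
  simp [compFirst, MultilinearMap.uncurrySum]

theorem comp_eq {p q n : ℕ} (e : Fin q ⊕ Fin p ≃ Fin n) (f : Mult A (p + 1)) (g : Mult A q) :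
    comp e f g = rearrange (finSumFinEquiv.symm.trans e) (compFirst f g) := rfl

theorem comp_apply {p q n : ℕ} (e : Fin q ⊕ Fin p ≃ Fin n) (f : Mult A (p + 1)) (g : Mult A q)
    {a : Fin n → A} {j : Fin n → ℤ} (h : ∀ s, a s ∈ A.deg (j s)) :
    comp e f g a = orderSign k finSumFinEquiv e (fun i => j (e i)) •
      f (Fin.cons (g fun i => a (e (.inl i))) fun i => a (e (.inr i))) := by
  rw [comp_eq, rearrange_apply _ _ h, compFirst_apply, ← orderSign_reindex k finSumFinEquiv]
  simp

end EndOp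

namespace TwoTree

variable {p q l : ℕ}

@[simp] theorem graftLeft_inl_zero (h : Fin q ⊕ Fin p ≃ Fin l) : graftLeft h (.inl 0) = 0 := rfl

@[simp] theorem graftLeft_inl_succ (h : Fin q ⊕ Fin p ≃ Fin l) (i : Fin q) :
    graftLeft h (.inl i.succ) = (h (.inl i)).succ := rfl

@[simp] theorem graftLeft_inr (h : Fin q ⊕ Fin p ≃ Fin l) (i : Fin p) :
    graftLeft h (.inr i) = (h (.inr i)).succ := rfl

@[simp] theorem graftRight_inr_zero (h : Fin q ⊕ Fin p ≃ Fin l) : graftRight h (.inr 0) = 0 := rfl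

@[simp] theorem graftRight_inr_succ (h : Fin q ⊕ Fin p ≃ Fin l) (i : Fin p) :
    graftRight h (.inr i.succ) = (h (.inr i)).succ := rfl

@[simp] theorem graftRight_inl (h : Fin q ⊕ Fin p ≃ Fin l) (i : Fin q) :
    graftRight h (.inl i) = (h (.inl i)).succ := rfl

@[simp] theorem permSucc_zero (τ : Equiv.Perm (Fin p)) : permSucc τ 0 = 0 := by
  simp [permSucc]

@[simp] theorem permSucc_succ (τ : Equiv.Perm (Fin p)) (i : Fin p) :
    permSucc τ i.succ = (τ i).succ := by
  simp [permSucc]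

end TwoTree

namespace EndOp

theorem finSum_inl_lt_inr {p q : ℕ} (i : Fin q) (j : Fin p) :
    finSumFinEquiv (.inl i : Fin q ⊕ Fin p) < finSumFinEquiv (.inr j : Fin q ⊕ Fin p) := by
  rw [Fin.lt_def]; simp; omega

theorem finSum_not_inr_lt_inl {p q : ℕ} (i : Fin q) (j : Fin p) :
    ¬ finSumFinEquiv (.inr j : Fin q ⊕ Fin p) < finSumFinEquiv (.inl i : Fin q ⊕ Fin p) :=
  (finSum_inl_lt_inr i j).not_gt

theorem finSum_inl_lt_inl {p q : ℕ} (i j : Fin q) :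
    finSumFinEquiv (.inl i : Fin q ⊕ Fin p) < finSumFinEquiv (.inl j : Fin q ⊕ Fin p) ↔ i < j := by
  rw [Fin.lt_def, Fin.lt_def]; simp

theorem finSum_inr_lt_inr {p q : ℕ} (i j : Fin p) :
    finSumFinEquiv (.inr i : Fin q ⊕ Fin p) < finSumFinEquiv (.inr j : Fin q ⊕ Fin p) ↔ i < j := by
  rw [Fin.lt_def, Fin.lt_def]; simp

section

variable (k : Type*) [CommRing k] {p q l : ℕ}

theorem orderSign_permSucc (τ : Equiv.Perm (Fin p)) (d : Fin (p + 1) → ℤ) :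
    orderSign k id (TwoTree.permSucc τ) d = orderSign k id τ (fun i => d i.succ) := by
  simp [orderSign, Fin.prod_univ_succ]

theorem orderSign_graftLeft (h : Fin q ⊕ Fin p ≃ Fin l) (d : Fin (q + 1) ⊕ Fin p → ℤ) :
    orderSign k finSumFinEquiv (TwoTree.graftLeft h) d =
      orderSign k finSumFinEquiv h (Sum.elim (fun i => d (.inl i.succ)) fun i => d (.inr i)) := by
  simp [orderSign, Fin.prod_univ_succ, Fintype.prod_sum_type, -finSumFinEquiv_apply_left,
    -finSumFinEquiv_apply_right, finSum_inl_lt_inr, finSum_not_inr_lt_inl, finSum_inl_lt_inl,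
    finSum_inr_lt_inr]

theorem orderSign_graftRight (h : Fin q ⊕ Fin p ≃ Fin l) (d : Fin q ⊕ Fin (p + 1) → ℤ) :
    orderSign k finSumFinEquiv (TwoTree.graftRight h) d =
      zsign k ((∑ i, d (.inl i)) * d (.inr 0)) *
      orderSign k finSumFinEquiv h (Sum.elim (fun i => d (.inl i)) fun i => d (.inr i.succ)) := by
  simp [orderSign, Fin.prod_univ_succ, Fintype.prod_sum_type, -finSumFinEquiv_apply_left,
    -finSumFinEquiv_apply_right, finSum_inl_lt_inr, finSum_not_inr_lt_inl, finSum_inl_lt_inl,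
    finSum_inr_lt_inr, Finset.prod_mul_distrib, Finset.sum_mul, zsign_sum]
  ring

end

variable {k : Type u} [CommRing k] {A : FilteredDGModule.{u, w} k} {p q r l m n : ℕ}

theorem act_one_apply (f : Mult A n) : act 1 f = f := rearrange_refl f

theorem act_mul_apply (σ τ : Equiv.Perm (Fin n)) (f : Mult A n) :
    act (σ * τ) f = act σ (act τ f) := (rearrange_rearrange σ τ f).symm

theorem comp_relabel (e : Fin q ⊕ Fin p ≃ Fin n) (σ : Equiv.Perm (Fin n)) (f : Mult A (p + 1))
    (g : Mult A q) : comp (e.trans σ) f g = act σ (comp e f g) := by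
  rw [act, comp_eq, comp_eq, rearrange_rearrange]
  rfl

/-- The action of a permutation as a linear map. -/
def actLinear (σ : Equiv.Perm (Fin n)) : Mult A n →ₗ[k] Mult A n where
  toFun := act σ
  map_add' := rearrange_add σ
  map_smul' := rearrange_smul σ

@[simp] theorem actLinear_apply (σ : Equiv.Perm (Fin n)) (f : Mult A n) :
    actLinear σ f = act σ f := rfl

@[simp] theorem compTensor_tmul (e : Fin q ⊕ Fin p ≃ Fin n) (f : Mult A (p + 1)) (g : Mult A q) :
    compTensor e (f ⊗ₜ[k] g) = comp e f g := rfl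

/-- A multilinear map as a linear function of its first argument. -/
def headLinear (f : Mult A (n + 1)) (a : Fin n → A) : A →ₗ[k] A where
  toFun v := f (Fin.cons v a)
  map_add' := f.cons_add a
  map_smul' := f.cons_smul a

@[simp] theorem headLinear_apply (f : Mult A (n + 1)) (a : Fin n → A) (v : A) :
    headLinear f a v = f (Fin.cons v a) := rfl

theorem apply_cons_smul (f : Mult A (n + 1)) (a : Fin n → A) (c : k) (v : A) :
    f (Fin.cons (c • v) a) = c • f (Fin.cons v a) := f.cons_smul a c v

theorem forall_cons_mem {a : Fin n → A} {j : Fin n → ℤ} (h : ∀ s, a s ∈ A.deg (j s)) {i : ℤ} {v : A}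
    (hv : v ∈ A.deg i) (s : Fin (n + 1)) :
    (Fin.cons v a : Fin (n + 1) → A) s ∈ A.deg ((Fin.cons i j : Fin (n + 1) → ℤ) s) := by
  refine Fin.cases ?_ (fun s => ?_) s
  · exact hv
  · exact h s

theorem act_permSucc_cons (τ : Equiv.Perm (Fin p)) (f : Mult A (p + 1)) (v : A) {a : Fin p → A}
    {j : Fin p → ℤ} (h : ∀ s, a s ∈ A.deg (j s)) :
    act (TwoTree.permSucc τ) f (Fin.cons v a) =
      orderSign k id τ (fun i => j (τ i)) • f (Fin.cons v fun i => a (τ i)) := by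
  have key : headLinear (act (TwoTree.permSucc τ) f) a =
      orderSign k id τ (fun i => j (τ i)) • headLinear f fun i => a (τ i) :=
    A.linearMap_ext fun i v hv => by
      rw [headLinear_apply, act, rearrange_apply _ _ (forall_cons_mem h hv), orderSign_permSucc]
      simp only [TwoTree.permSucc_succ, Fin.cons_succ, LinearMap.smul_apply, headLinear_apply]
      congr 2
      funext s
      refine Fin.cases ?_ (fun s => ?_) s <;> simp
  exact LinearMap.congr_fun key v

theorem comp_graftLeft_cons (h : Fin q ⊕ Fin p ≃ Fin l) (x : Mult A (p + 1)) (y : Mult A (q + 1))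
    (v : A) {a : Fin l → A} {j : Fin l → ℤ} (ha : ∀ s, a s ∈ A.deg (j s)) :
    comp (TwoTree.graftLeft h) x y (Fin.cons v a) =
      orderSign k finSumFinEquiv h (fun i => j (h i)) •
        x (Fin.cons (y (Fin.cons v fun i => a (h (.inl i)))) fun i => a (h (.inr i))) := by
  have key : headLinear (comp (TwoTree.graftLeft h) x y) a =
      orderSign k finSumFinEquiv h (fun i => j (h i)) •
        (headLinear x fun i => a (h (.inr i))) ∘ₗ (headLinear y fun i => a (h (.inl i))) :=
    A.linearMap_ext fun i v hv => by
      rw [headLinear_apply, comp_apply _ _ _ (forall_cons_mem ha hv), orderSign_graftLeft]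
      simp only [LinearMap.smul_apply, headLinear_apply, TwoTree.graftLeft_inl_succ, Fin.cons_succ,
        TwoTree.graftLeft_inr, LinearMap.comp_apply]
      congr 1
      · congr 1
        funext s
        rcases s with s | s <;> rfl
      · congr 2
        congr 1
        funext s
        refine Fin.cases ?_ (fun s => ?_) s <;> simp
  exact LinearMap.congr_fun key v

theorem comp_graftRight_cons (h : Fin q ⊕ Fin p ≃ Fin l) (x : Mult A (p + 1 + 1)) (y : Mult A q)
    {v : A} {i : ℤ} (hv : v ∈ A.deg i) {a : Fin l → A} {j : Fin l → ℤ}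
    (ha : ∀ s, a s ∈ A.deg (j s)) :
    comp (TwoTree.graftRight h) x y (Fin.cons v a) =
      (zsign k ((∑ s, j (h (.inl s))) * i) * orderSign k finSumFinEquiv h (fun i => j (h i))) •
        x (Fin.cons (y fun i => a (h (.inl i))) (Fin.cons v fun i => a (h (.inr i)))) := by
  rw [comp_apply _ _ _ (forall_cons_mem ha hv), orderSign_graftRight]
  simp only [TwoTree.graftRight_inr_zero, TwoTree.graftRight_inr_succ, TwoTree.graftRight_inl,
    Fin.cons_succ, Fin.cons_zero]
  congr 1
  · congr 2
    funext s
    rcases s with s | s <;> rfl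
  · congr 2
    funext s
    refine Fin.cases ?_ (fun s => ?_) s <;> simp

theorem comp_act (e : Fin q ⊕ Fin p ≃ Fin n) (ρ : Equiv.Perm (Fin q)) (τ : Equiv.Perm (Fin p))
    (x : Mult A (p + 1)) (y : Mult A q) :
    comp ((Equiv.sumCongr ρ τ).trans e) x y = comp e (act (TwoTree.permSucc τ) x) (act ρ y) := by
  refine mult_ext fun a j h => ?_
  rw [comp_apply _ _ _ h, comp_apply _ _ _ h, act_permSucc_cons τ x _ (fun s => h (e (.inr s))), act,
    rearrange_apply ρ _ (fun s => h (e (.inl s))), apply_cons_smul,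
    smul_smul, smul_smul]
  simp only [Equiv.trans_apply, Equiv.sumCongr_apply, Sum.map_inl, Sum.map_inr]
  congr 1
  have h1 := orderSign_sum k (x := (finSumFinEquiv : Fin q ⊕ Fin p ≃ _))
    (y := fun i => finSumFinEquiv (Sum.map ρ τ i)) (fun i j => finSum_inl_lt_inr i j)
    (fun i j => finSum_inl_lt_inr _ _) (fun i => j (e (Sum.map ρ τ i)))
  have h2 := orderSign_mul k (x := (finSumFinEquiv : Fin q ⊕ Fin p ≃ _))
    (y := fun i => finSumFinEquiv (Sum.map ρ τ i)) (z := fun i => e (Sum.map ρ τ i))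
    finSumFinEquiv.injective (finSumFinEquiv.injective.comp (Sum.map_injective.2
      ⟨ρ.injective, τ.injective⟩)) (e.injective.comp (Sum.map_injective.2
      ⟨ρ.injective, τ.injective⟩)) (fun i => j (e (Sum.map ρ τ i)))
  have h3 := orderSign_reindex k (Equiv.sumCongr ρ τ) finSumFinEquiv e (fun i => j (e i))
  simp only [Equiv.sumCongr_apply] at h3
  rw [← h3]
  refine h2.symm.trans ?_
  rw [h1, mul_comm]
  simp only [Sum.map_inl, Sum.map_inr]
  rw [mul_assoc]
  congr 1
  rw [mul_comm]
  congr 1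
  · exact orderSign_congr k (fun _ _ => finSum_inr_lt_inr _ _) (fun _ _ => finSum_inr_lt_inr _ _) _

theorem one_apply (a : Fin 1 → A) : (one : Mult A 1) a = a 0 := rfl

theorem one_comp (x : Mult A n) : comp (p := 0) (Equiv.sumEmpty (Fin n) (Fin 0)) one x = x := by
  refine mult_ext fun a j h => ?_
  rw [comp_apply _ _ _ h, one_apply, orderSign_eq_one, one_smul]
  · rfl
  · rintro (i | i) (j | j) hij
    · exact (finSum_inl_lt_inl _ _).1 hij
    · exact j.elim0
    · exact i.elim0
    · exact i.elim0

theorem comp_one (x : Mult A (p + 1)) : comp (TwoTree.unitRight p) x one = x := by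
  refine mult_ext fun a j h => ?_
  rw [← Fin.cons_self_tail a, TwoTree.unitRight, comp_graftLeft_cons _ _ _ _
    (show ∀ s, Fin.tail a s ∈ A.deg (j s.succ) from fun s => h s.succ),
    one_apply, orderSign_eq_one, one_smul]
  · rfl
  · rintro (i | i) (j | j) hij
    · exact i.elim0
    · exact i.elim0
    · exact j.elim0
    · exact (finSum_inr_lt_inr _ _).1 hij

end EndOp

namespace EndOp

/-- The standard ordering of the leaves of a three-vertex tree. -/
def threeOrder (r q p : ℕ) : Fin r ⊕ (Fin q ⊕ Fin p) → ℕ :=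
  Sum.elim (fun i => i) (Sum.elim (fun i => r + i) fun i => r + q + i)

theorem threeOrder_injective (r q p : ℕ) : (threeOrder r q p).Injective := by
  rintro (i | i | i) (j | j | j) h <;> simp [threeOrder] at h <;>
    first | omega | (congr; ext; omega)

theorem finSum_val_inl {p q : ℕ} (i : Fin q) :
    ((finSumFinEquiv (.inl i : Fin q ⊕ Fin p) : Fin (q + p)) : ℕ) = i := by simp

theorem finSum_val_inr {p q : ℕ} (i : Fin p) :
    ((finSumFinEquiv (.inr i : Fin q ⊕ Fin p) : Fin (q + p)) : ℕ) = q + i := by simp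

section

variable (k : Type*) [CommRing k] {p q r l m n : ℕ}

theorem orderSign_left (e : Fin r ⊕ (Fin q ⊕ Fin p) ≃ Fin n) (h : Fin q ⊕ Fin p ≃ Fin l)
    (d : Fin n → ℤ) :
    orderSign k finSumFinEquiv (((Equiv.refl (Fin r)).sumCongr h.symm).trans e)
        (fun i => d (((Equiv.refl (Fin r)).sumCongr h.symm).trans e i)) *
      orderSign k finSumFinEquiv h (fun i => d (e (.inr i))) =
    orderSign k (threeOrder r q p) e (fun i => d (e i)) := by
  have h1 := orderSign_reindex k ((Equiv.refl (Fin r)).sumCongr h) finSumFinEquiv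
    (((Equiv.refl (Fin r)).sumCongr h.symm).trans e)
    (fun i => d (((Equiv.refl (Fin r)).sumCongr h.symm).trans e i))
  have hs : ∀ i, (((Equiv.refl (Fin r)).sumCongr h.symm).trans e)
      (((Equiv.refl (Fin r)).sumCongr h) i) = e i := by
    rintro (i | i) <;> simp
  simp only [hs] at h1
  have h2 := orderSign_sum k (x := threeOrder r q p)
    (y := fun i => finSumFinEquiv (((Equiv.refl (Fin r)).sumCongr h) i))
    (by rintro i (j | j) <;> simp only [threeOrder, Sum.elim_inl, Sum.elim_inr] <;> omega)
    (fun i j => finSum_inl_lt_inr _ _) (fun i => d (e i))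
  rw [← h1, ← orderSign_mul k (threeOrder_injective r q p)
    (finSumFinEquiv.injective.comp ((Equiv.refl (Fin r)).sumCongr h).injective) e.injective
    (fun i => d (e i)), mul_comm]
  congr 1
  refine Eq.trans ?_ h2.symm
  rw [orderSign_eq_one k (x := fun i => threeOrder r q p (.inl i))
    (y := fun i => finSumFinEquiv (((Equiv.refl (Fin r)).sumCongr h) (.inl i)))
    (fun i j hij => (finSum_inl_lt_inl _ _).2 (by simpa [threeOrder] using hij)), one_mul]
  refine orderSign_congr k ?_ (fun i j => (finSum_inr_lt_inr _ _).symm) _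
  rintro (i | i) (j | j) <;> rw [Fin.lt_def] <;> simp [threeOrder] <;> omega

theorem orderSign_right (e : Fin r ⊕ (Fin q ⊕ Fin p) ≃ Fin n) (g : Fin r ⊕ Fin q ≃ Fin m)
    (d : Fin n → ℤ) :
    orderSign k finSumFinEquiv ((g.symm.sumCongr (Equiv.refl (Fin p))).trans
        ((Equiv.sumAssoc _ _ _).trans e))
        (fun i => d ((g.symm.sumCongr (Equiv.refl (Fin p))).trans
          ((Equiv.sumAssoc _ _ _).trans e) i)) *
      orderSign k finSumFinEquiv g (fun i => d (e (Equiv.sumAssoc _ _ _ (.inl i)))) =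
    orderSign k (threeOrder r q p) e (fun i => d (e i)) := by
  have h1 := orderSign_reindex k (g.sumCongr (Equiv.refl (Fin p))) finSumFinEquiv
    ((g.symm.sumCongr (Equiv.refl (Fin p))).trans ((Equiv.sumAssoc _ _ _).trans e))
    (fun i => d ((g.symm.sumCongr (Equiv.refl (Fin p))).trans ((Equiv.sumAssoc _ _ _).trans e) i))
  have hs : ∀ i, ((g.symm.sumCongr (Equiv.refl (Fin p))).trans ((Equiv.sumAssoc _ _ _).trans e))
      ((g.sumCongr (Equiv.refl (Fin p))) i) = e (Equiv.sumAssoc _ _ _ i) := by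
    rintro (i | i) <;> simp
  simp only [hs] at h1
  have h2 := orderSign_sum k (x := fun i => threeOrder r q p (Equiv.sumAssoc _ _ _ i))
    (y := fun i => finSumFinEquiv ((g.sumCongr (Equiv.refl (Fin p))) i))
    (by rintro (i | i) j <;> simp [threeOrder] <;> omega)
    (fun i j => finSum_inl_lt_inr _ _) (fun i => d (e (Equiv.sumAssoc _ _ _ i)))
  have h3 := orderSign_reindex k (Equiv.sumAssoc _ _ _) (threeOrder r q p) e (fun i => d (e i))
  rw [← h1, ← h3, ← orderSign_mul k (x := fun i => threeOrder r q p (Equiv.sumAssoc _ _ _ i))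
    (y := fun i => finSumFinEquiv ((g.sumCongr (Equiv.refl (Fin p))) i))
    (z := fun i => e (Equiv.sumAssoc _ _ _ i)) ((threeOrder_injective r q p).comp
      (Equiv.sumAssoc _ _ _).injective)
    (finSumFinEquiv.injective.comp (g.sumCongr (Equiv.refl (Fin p))).injective)
    (e.injective.comp (Equiv.sumAssoc _ _ _).injective)
    (fun i => d (e (Equiv.sumAssoc _ _ _ i))), mul_comm]
  congr 1
  refine Eq.trans ?_ h2.symm
  rw [orderSign_eq_one k (x := fun i => threeOrder r q p (Equiv.sumAssoc _ _ _ (.inr i)))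
    (y := fun i => finSumFinEquiv ((g.sumCongr (Equiv.refl (Fin p))) (.inr i)))
    (fun i j hij => (finSum_inr_lt_inr _ _).2 ?_), mul_one]
  · refine orderSign_congr k ?_ (fun i j => (finSum_inl_lt_inl _ _).symm) _
    rintro (i | i) (j | j) <;> rw [Fin.lt_def] <;> simp [threeOrder]
  · simpa [threeOrder] using hij

theorem orderSign_exchange (e : Fin r ⊕ (Fin q ⊕ Fin p) ≃ Fin n) (d : Fin n → ℤ) :
    orderSign k (threeOrder r q p) e (fun i => d (e i)) =
      zsign k ((∑ i, d (e (.inl i))) * ∑ i, d (e (.inr (.inl i)))) *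
      orderSign k (threeOrder q r p) ((TwoTree.exchange q r p).trans e)
        (fun i => d ((TwoTree.exchange q r p).trans e i)) := by
  have h1 := orderSign_reindex k (TwoTree.exchange r q p) (threeOrder q r p)
    ((TwoTree.exchange q r p).trans e) (fun i => d ((TwoTree.exchange q r p).trans e i))
  have hs : ∀ i, ((TwoTree.exchange q r p).trans e) (TwoTree.exchange r q p i) = e i := by
    rintro (i | i | i) <;> rfl
  simp only [hs] at h1
  rw [← h1, ← orderSign_mul k (threeOrder_injective r q p)
    ((threeOrder_injective q r p).comp (TwoTree.exchange r q p).injective) e.injective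
    (fun i => d (e i))]
  congr 1
  have h3 := orderSign_reindex k (Equiv.sumAssoc (Fin r) (Fin q) (Fin p)) (threeOrder r q p)
    (fun i => threeOrder q r p (TwoTree.exchange r q p i)) (fun i => d (e i))
  refine h3.symm.trans ?_
  rw [orderSign_sum k, orderSign_sum_swap k, orderSign_eq_one k, mul_one]
  · rfl
  · intro i j hij; simpa [threeOrder, TwoTree.exchange] using hij
  · intro i j; simp [threeOrder]; omega
  · intro i j; simp [threeOrder, TwoTree.exchange]; omega
  · intro i j hij; simpa [threeOrder, TwoTree.exchange] using hij
  · intro i j hij; simpa [threeOrder, TwoTree.exchange] using hij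
  · rintro (i | i) j <;> simp [threeOrder] <;> omega
  · rintro (i | i) j <;> simp [threeOrder, TwoTree.exchange] <;> omega

end

variable {k : Type u} [CommRing k] {A : FilteredDGModule.{u, w} k} {p q r l m n : ℕ}

theorem sequential (e : Fin r ⊕ (Fin q ⊕ Fin p) ≃ Fin n) (g : Fin r ⊕ Fin q ≃ Fin m)
    (h : Fin q ⊕ Fin p ≃ Fin l) (x : Mult A (p + 1)) (y : Mult A (q + 1)) (z : Mult A r) :
    comp (((Equiv.refl (Fin r)).sumCongr h.symm).trans e) (comp (TwoTree.graftLeft h) x y) z =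
      comp ((g.symm.sumCongr (Equiv.refl (Fin p))).trans ((Equiv.sumAssoc _ _ _).trans e)) x
        (comp g y z) := by
  refine mult_ext fun a j ha => ?_
  rw [comp_apply _ _ _ ha, comp_apply _ _ _ ha, comp_graftLeft_cons _ _ _ _ (fun s => ha _),
    comp_apply g y z (fun s => ha _), apply_cons_smul, smul_smul, smul_smul]
  congr 1
  · refine Eq.trans ?_ ((orderSign_left k e h j).trans (orderSign_right k e g j).symm |>.trans ?_)
    · simp
    · simp
  · simp

theorem apply_cons_cons_swap (x : Mult A (p + 1 + 1)) {v v' : A} {i i' : ℤ} (hv : v ∈ A.deg i)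
    (hv' : v' ∈ A.deg i') {a : Fin p → A} {j : Fin p → ℤ} (ha : ∀ s, a s ∈ A.deg (j s)) :
    act (Equiv.swap 0 1) x (Fin.cons v (Fin.cons v' a)) =
      zsign k (i * i') • x (Fin.cons v' (Fin.cons v a)) := by
  rw [act, rearrange_apply _ _ (forall_cons_mem (forall_cons_mem ha hv') hv)]
  have h0 : ∀ s : Fin p, Equiv.swap (0 : Fin (p + 1 + 1)) 1 s.succ.succ = s.succ.succ := fun s =>
    Equiv.swap_apply_of_ne_of_ne (Fin.succ_ne_zero _) (fun h =>
      Fin.succ_ne_zero s (Fin.succ_injective _ h))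
  have h1 : (Fin.succ 0 : Fin (p + 1 + 1)) = 1 := rfl
  congr 1
  · have h2 : ∀ s s' : Fin p, ¬ (s < s' ∧ s' < s) := fun s s' h => h.1.not_gt h.2
    simp [orderSign, Fin.prod_univ_succ, h0, h1, mul_comm i, h2]
  · congr 1
    funext s
    refine Fin.cases ?_ (fun s => Fin.cases ?_ (fun s => ?_) s) s
    · simp
    · simp
    · simp [h0]

theorem parallel (e : Fin r ⊕ (Fin q ⊕ Fin p) ≃ Fin n) (h : Fin q ⊕ Fin p ≃ Fin l)
    (g : Fin r ⊕ Fin p ≃ Fin m) (x : Mult A (p + 1 + 1)) {i i' : ℤ} {y : Mult A q} {z : Mult A r}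
    (hy : y ∈ deg A q i) (hz : z ∈ deg A r i') :
    comp (((Equiv.refl (Fin r)).sumCongr h.symm).trans e) (comp (TwoTree.graftRight h) x y) z =
      zsign k (i * i') •
        comp (((Equiv.refl (Fin q)).sumCongr g.symm).trans ((TwoTree.exchange q r p).trans e))
          (comp (TwoTree.graftRight g) (act (Equiv.swap 0 1) x) z) y := by
  refine mult_ext fun a j ha => ?_
  have hz' := hz (fun s => a (e (.inl s))) _ (fun s => ha _)
  have hy' := hy (fun s => a (e (.inr (.inl s)))) _ (fun s => ha _)
  rw [smul_apply, comp_apply _ _ _ ha, comp_apply _ _ _ ha]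
  have h1 := comp_graftRight_cons h x y hz' (a := fun s => a (e (.inr (h.symm s)))) (fun s => ha _)
  have h2 := comp_graftRight_cons g (act (Equiv.swap 0 1) x) z hy'
    (a := fun s => a (e (TwoTree.exchange q r p (.inr (g.symm s))))) (fun s => ha _)
  have h3 := apply_cons_cons_swap x hz' hy' (a := fun s => a (e (.inr (.inr s)))) (fun s => ha _)
  simp only [Equiv.symm_apply_apply] at h1 h2
  have e1 := orderSign_left k e h j
  have e2 := orderSign_left k ((TwoTree.exchange q r p).trans e) g j
  have e3 := orderSign_exchange k e j
  refine (congrArg _ h1).trans ?_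
  refine Eq.trans ?_ (congrArg _ (congrArg _ h2.symm))
  rw [show (fun s => a (e (TwoTree.exchange q r p (.inr (.inr s))))) =
    fun s => a (e (.inr (.inr s))) from rfl]
  refine Eq.trans ?_ (congrArg _ (congrArg _ (congrArg _ h3.symm)))
  rw [smul_smul, smul_smul, smul_smul, smul_smul]
  congr 1
  rw [mul_left_comm]
  refine (congrArg _ (e1.trans (e3.trans (congrArg _ e2.symm)))).trans ?_
  generalize hR : ∑ s, j (e (.inl s)) = R
  generalize hQ : ∑ s, j (e (.inr (.inl s))) = Q
  have hR' : ∑ s, j (e (TwoTree.exchange q r p (.inr (.inl s)))) = R := hR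
  rw [hR']
  have hz : zsign k (Q * (R + i')) * zsign k (R * Q) =
      zsign k (i * i') * zsign k (R * (Q + i)) * zsign k ((R + i') * (Q + i)) := by
    rw [← zsign_add, ← zsign_add, ← zsign_add]
    refine zsign_congr k ⟨-(i * i') - R * i, by ring⟩
  have hf : ∀ O G : k, zsign k (Q * (R + i')) * (zsign k (R * Q) * (O * G)) =
      zsign k (i * i') * O * (zsign k (R * (Q + i)) * G) * zsign k ((R + i') * (Q + i)) :=
    fun O G => by linear_combination (O * G) * hz
  exact hf _ _

end EndOp

namespace EndOp

variable {k : Type u} [CommRing k] {A : FilteredDGModule.{u, w} k} {p q r l m n : ℕ}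

theorem rearrange_mem_deg (σ : Fin m ≃ Fin n) {i : ℤ} {f : Mult A m} (hf : f ∈ deg A m i) :
    rearrange σ f ∈ deg A n i := by
  intro a j h
  rw [rearrange_apply σ f h]
  refine Submodule.smul_mem _ _ ?_
  have := hf (fun s => a (σ s)) (fun s => j (σ s)) (fun s => h _)
  rwa [σ.sum_comp] at this

theorem compFirst_mem_deg {i j : ℤ} {f : Mult A (p + 1)} {g : Mult A q}
    (hf : f ∈ deg A (p + 1) i) (hg : g ∈ deg A q j) : compFirst f g ∈ deg A (q + p) (i + j) := by
  intro a d h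
  rw [compFirst_apply]
  have := hf _ _ (forall_cons_mem (fun s => h (Fin.natAdd q s))
    (hg (fun s => a (Fin.castAdd p s)) _ fun s => h _))
  rw [Fin.sum_cons] at this
  rw [Fin.sum_univ_add]
  convert this using 2
  ring

theorem comp_mem_deg (e : Fin q ⊕ Fin p ≃ Fin n) {i j : ℤ} {f : Mult A (p + 1)} {g : Mult A q}
    (hf : f ∈ deg A (p + 1) i) (hg : g ∈ deg A q j) : comp e f g ∈ deg A n (i + j) :=
  rearrange_mem_deg _ (compFirst_mem_deg hf hg)

theorem act_mem_deg (σ : Equiv.Perm (Fin n)) {i : ℤ} {f : Mult A n} (hf : f ∈ deg A n i) :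
    act σ f ∈ deg A n i := rearrange_mem_deg σ hf

theorem rearrange_mem (σ : Fin m ≃ Fin n) {f : Mult A m} {P : Fin n → Submodule k A}
    (hP : ∀ s, ∀ x ∈ P s, ∀ i, (DirectSum.decompose A.deg x i : A) ∈ P s) {Q : Submodule k A}
    (hf : ∀ a : Fin m → A, (∀ s, a s ∈ P (σ s)) → f a ∈ Q) {a : Fin n → A} (ha : ∀ s, a s ∈ P s) :
    rearrange σ f a ∈ Q := by
  rw [rearrange, sum_apply]
  refine sum_mem fun S _ => ?_
  rw [smul_apply]
  refine zsmul_mem (hf (fun s => (if σ s ∈ S then A.odd else A.even) (a (σ s))) fun s => ?_) _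
  split_ifs
  · exact A.weight_mem_of_homogeneous _ (hP _) _ (ha _)
  · exact A.weight_mem_of_homogeneous _ (hP _) _ (ha _)

theorem comp_mem (e : Fin q ⊕ Fin p ≃ Fin n) {f : Mult A (p + 1)} {g : Mult A q}
    {P : Fin n → Submodule k A}
    (hP : ∀ s, ∀ x ∈ P s, ∀ i, (DirectSum.decompose A.deg x i : A) ∈ P s) {Q : Submodule k A}
    (h : ∀ (a : Fin q → A) (b : Fin p → A), (∀ s, a s ∈ P (e (.inl s))) →
      (∀ s, b s ∈ P (e (.inr s))) → f (Fin.cons (g a) b) ∈ Q) {a : Fin n → A}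
    (ha : ∀ s, a s ∈ P s) : comp e f g a ∈ Q := by
  refine rearrange_mem _ hP (fun a ha => ?_) ha
  change compFirst f g a ∈ Q
  rw [compFirst_apply]
  refine h _ _ (fun s => ?_) (fun s => ?_)
  · simpa using ha (Fin.castAdd p s)
  · simpa using ha (Fin.natAdd q s)

theorem rearrange_mem_fil (σ : Fin m ≃ Fin n) {i : ℕ} {f : Mult A m} (hf : f ∈ fil A m i) :
    rearrange σ f ∈ fil A n i := fun a j h =>
  rearrange_mem σ (P := fun s => A.fil (j s)) (fun s x hx => A.fil_homogeneous _ x hx) (fun b hb => by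
    have := hf b (fun s => j (σ s)) hb
    rwa [σ.sum_comp] at this) h

theorem forall_cons_mem_fil {a : Fin n → A} {j : Fin n → ℕ} (h : ∀ s, a s ∈ A.fil (j s)) {i : ℕ}
    {v : A} (hv : v ∈ A.fil i) (s : Fin (n + 1)) :
    (Fin.cons v a : Fin (n + 1) → A) s ∈ A.fil ((Fin.cons i j : Fin (n + 1) → ℕ) s) := by
  refine Fin.cases ?_ (fun s => ?_) s
  · exact hv
  · exact h s

theorem comp_mem_fil (e : Fin q ⊕ Fin p ≃ Fin n) {i j : ℕ} {f : Mult A (p + 1)} {g : Mult A q}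
    (hf : f ∈ fil A (p + 1) i) (hg : g ∈ fil A q j) : comp e f g ∈ fil A n (i + j) := fun a d h =>
  comp_mem e (P := fun s => A.fil (d s)) (fun s x hx => A.fil_homogeneous _ x hx) (fun b c hb hc => by
    have := hf _ _ (forall_cons_mem_fil hc (hg b _ hb))
    rw [Fin.sum_cons] at this
    rw [← e.sum_comp, Fintype.sum_sum_type]
    convert this using 2
    ring) h

theorem act_mem_fil (σ : Equiv.Perm (Fin n)) {i : ℕ} {f : Mult A n} (hf : f ∈ fil A n i) :
    act σ f ∈ fil A n i := rearrange_mem_fil σ hf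

theorem fil_mono {i j : ℕ} (h : i ≤ j) {f : Mult A n} (hf : f ∈ fil A n j) : f ∈ fil A n i :=
  fun a d ha => A.fil_mono (by omega) (hf a d ha)

theorem one_mem_deg : (one : Mult A 1) ∈ deg A 1 0 := fun a j h => by
  simpa [one_apply] using h 0

theorem one_mem_fil : (one : Mult A 1) ∈ fil A 1 0 := fun a j h => by
  simpa [one_apply] using h 0

/-! ### The differential -/

theorem forall_update_mem {a : Fin n → A} {j : Fin n → ℤ} (h : ∀ s, a s ∈ A.deg (j s)) (i : Fin n)
    (s : Fin n) : Function.update a i (A.d (a i)) s ∈ A.deg (Function.update j i (j i - 1) s) := by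
  rcases eq_or_ne s i with rfl | hs
  · simpa using A.d_deg _ _ (h s)
  · simpa [hs] using h s

theorem d_apply {i : ℤ} {f : Mult A n} (hf : f ∈ deg A n i) {a : Fin n → A} {j : Fin n → ℤ}
    (h : ∀ s, a s ∈ A.deg (j s)) :
    d f a = A.d (f a) -
      zsign k i • ∑ s, beforeSign k id s j • f (Function.update a s (A.d (a s))) := by
  rw [d, sub_apply, sum_apply, Finset.smul_sum]
  congr 1
  refine Finset.sum_congr rfl fun s _ => ?_
  set a' := Function.update a s (A.d (a s)) with ha'
  set j' := Function.update j s (j s - 1) with hj'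
  have hmem := forall_update_mem h s
  have e1 : (fun t => (if t < s then LinearMap.id else if t = s then A.sgn 1 ∘ₗ A.d else A.sgn 1)
      (a t)) = fun t => (if t < s then 1 else zsign k (j' t)) • a' t := by
    funext t
    rcases lt_trichotomy t s with ht | rfl | ht
    · simp [ht, ha', ht.ne]
    · simp only [lt_irrefl, if_false, if_true, LinearMap.comp_apply]
      rw [A.sgn_of_mem 1 (A.d_deg _ _ (h t))]
      simp [ha', hj']
    · simp only [ht.not_gt, ht.ne', if_false]
      rw [A.sgn_of_mem 1 (h t)]
      simp [ha', hj', ht.ne']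
  change A.sgn 1 (f fun t => (if t < s then LinearMap.id else
    if t = s then A.sgn 1 ∘ₗ A.d else A.sgn 1) (a t)) = _
  rw [e1, f.map_smul_univ, map_smul, A.sgn_of_mem 1 (hf a' j' hmem), smul_smul, smul_smul]
  congr 1
  have h1 : beforeSign k id s j * ∏ t, (if t < s then 1 else zsign k (j' t)) =
      zsign k (∑ t, j' t) := by
    rw [beforeSign, ← Finset.prod_mul_distrib, zsign_sum]
    refine Finset.prod_congr rfl fun t _ => ?_
    by_cases ht : t < s
    · simp [ht, hj', ht.ne]
    · simp [ht]
  have h2 : beforeSign k id s j * beforeSign k id s j = 1 := by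
    rw [beforeSign, ← Finset.prod_mul_distrib]
    refine Finset.prod_eq_one fun t _ => ?_
    split_ifs
    · exact zsign_mul_self k _
    · simp
  have h3 := zsign_mul_self k (∑ t, j' t)
  rw [one_mul, zsign_add]
  generalize (∏ t, if t < s then 1 else zsign k (j' t)) = P at *
  generalize beforeSign k id s j = B at *
  generalize zsign k (∑ t, j' t) = Z at *
  linear_combination (-P * Z * zsign k i) * h2 + (B * Z * zsign k i) * h1 + B * zsign k i * h3

theorem d_rearrange (σ : Fin m ≃ Fin n) {i : ℤ} {f : Mult A m} (hf : f ∈ deg A m i) :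
    d (rearrange σ f) = rearrange σ (d f) := by
  refine mult_ext fun a j h => ?_
  rw [d_apply (rearrange_mem_deg σ hf) h, rearrange_apply σ f h, rearrange_apply σ _ h,
    d_apply hf (fun s => h (σ s)), map_smul, smul_sub, smul_comm _ (zsign k i)]
  congr 2
  rw [Finset.smul_sum]
  refine (Equiv.sum_comp σ _).symm.trans (Finset.sum_congr rfl fun s _ => ?_)
  rw [rearrange_apply σ f (forall_update_mem h (σ s)), smul_smul, smul_smul]
  rw [Function.update_comp_eq_of_injective' a σ.injective, Function.update_comp_eq_of_injective' j σ.injective]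
  congr 1
  rw [← orderSign_update k Function.injective_id σ.injective (fun t => j (σ t)) s, mul_comm]
  congr 1
  exact (beforeSign_reindex k σ id s j).symm

theorem beforeSign_succ (d : Fin (n + 1) → ℤ) (s : Fin n) :
    beforeSign k id s.succ d = zsign k (d 0) * beforeSign k id s (fun t => d t.succ) := by
  simp [beforeSign, Fin.prod_univ_succ]

theorem beforeSign_zero (d : Fin (n + 1) → ℤ) : beforeSign k id 0 d = 1 := by
  simp [beforeSign]

theorem beforeSign_castAdd (d : Fin (q + p) → ℤ) (s : Fin q) :
    beforeSign k id (Fin.castAdd p s) d = beforeSign k id s (fun t => d (Fin.castAdd p t)) := by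
  have : ∀ x : Fin p, ¬ Fin.natAdd q x < Fin.castAdd p s := fun x => by
    rw [Fin.lt_def]; simp; omega
  have h2 : ∀ x : Fin q, Fin.castAdd p x < Fin.castAdd p s ↔ x < s := fun x => Iff.rfl
  simp [beforeSign, Fin.prod_univ_add, this, h2]

theorem beforeSign_natAdd (d : Fin (q + p) → ℤ) (s : Fin p) :
    beforeSign k id (Fin.natAdd q s) d = zsign k (∑ t, d (Fin.castAdd p t)) *
      beforeSign k id s (fun t => d (Fin.natAdd q t)) := by
  have : ∀ x : Fin q, Fin.castAdd p x < Fin.natAdd q s := fun x => by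
    rw [Fin.lt_def]; simp; omega
  simp [beforeSign, Fin.prod_univ_add, this, zsign_sum]

theorem d_compFirst {i j : ℤ} {f : Mult A (p + 1)} {g : Mult A q} (hf : f ∈ deg A (p + 1) i)
    (hg : g ∈ deg A q j) :
    d (compFirst f g) = compFirst (d f) g + zsign k i • compFirst f (d g) := by
  refine mult_ext fun a t h => ?_
  have hL : ∀ s, a (Fin.castAdd p s) ∈ A.deg (t (Fin.castAdd p s)) := fun s => h _
  have hR : ∀ s, a (Fin.natAdd q s) ∈ A.deg (t (Fin.natAdd q s)) := fun s => h _
  have hc := forall_cons_mem hR (hg _ _ hL)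
  rw [add_apply, smul_apply, d_apply (compFirst_mem_deg hf hg) h, compFirst_apply, compFirst_apply,
    compFirst_apply, d_apply hf hc, d_apply hg hL, ← headLinear_apply f, ← headLinear_apply f, map_sub,
    map_smul, map_sum, Fin.sum_univ_add, Fin.sum_univ_succ]
  simp only [headLinear_apply, map_smul, beforeSign_zero, beforeSign_succ, Fin.cons_zero,
    Fin.cons_succ, Fin.update_cons_zero, ← Fin.cons_update, one_smul, beforeSign_castAdd,
    beforeSign_natAdd, compFirst_apply]
  have hu1 : ∀ (s : Fin q) x, (fun u => Function.update a (Fin.castAdd p s) x (Fin.castAdd p u)) =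
      Function.update (fun u => a (Fin.castAdd p u)) s x := fun s x => by
    funext u
    rcases eq_or_ne u s with rfl | hu
    · simp
    · have : Fin.castAdd p u ≠ Fin.castAdd p s := fun h => hu (Fin.castAdd_injective q p h)
      simp [hu, this]
  have hu2 : ∀ (s : Fin p) x, (fun u => Function.update a (Fin.natAdd q s) x (Fin.natAdd q u)) =
      Function.update (fun u => a (Fin.natAdd q u)) s x := fun s x => by
    funext u
    rcases eq_or_ne u s with rfl | hu
    · simp
    · have : Fin.natAdd q u ≠ Fin.natAdd q s := fun h => hu (Fin.natAdd_injective p q h)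
      simp [hu, this]
  have hu3 : ∀ (s : Fin q) x, (fun u => Function.update a (Fin.castAdd p s) x (Fin.natAdd q u)) =
      fun u => a (Fin.natAdd q u) := fun s x => by
    funext u
    have : Fin.natAdd q u ≠ Fin.castAdd p s := fun h => by
      have := congrArg Fin.val h; simp at this; omega
    simp [this]
  have hu4 : ∀ (s : Fin p) x, (fun u => Function.update a (Fin.natAdd q s) x (Fin.castAdd p u)) =
      fun u => a (Fin.castAdd p u) := fun s x => by
    funext u
    have : Fin.castAdd p u ≠ Fin.natAdd q s := fun h => by
      have := congrArg Fin.val h; simp at this; omega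
    simp [this]
  simp only [hu1, hu2, hu3, hu4, smul_sub, smul_add, Finset.smul_sum, smul_smul, zsign_add]
  simp only [mul_assoc, mul_left_comm]
  abel

theorem d_comp (e : Fin q ⊕ Fin p ≃ Fin n) {i j : ℤ} {f : Mult A (p + 1)} {g : Mult A q}
    (hf : f ∈ deg A (p + 1) i) (hg : g ∈ deg A q j) :
    d (comp e f g) = comp e (d f) g + zsign k i • comp e f (d g) := by
  rw [comp_eq, d_rearrange _ (compFirst_mem_deg hf hg), d_compFirst hf hg, rearrange_add,
    rearrange_smul]
  rfl

theorem d_act (σ : Equiv.Perm (Fin n)) {i : ℤ} {f : Mult A n} (hf : f ∈ deg A n i) :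
    d (act σ f) = act σ (d f) := d_rearrange σ hf

theorem d_one : d (one : Mult A 1) = 0 := by
  refine mult_ext fun a j h => ?_
  rw [d_apply one_mem_deg h]
  simp [one_apply, beforeSign_zero, zsign_zero]

end EndOp

/-- The inverse of `n!` in a `ℚ`-algebra. -/
def invFact (k : Type u) [CommRing k] [Algebra ℚ k] (n : ℕ) : k :=
  algebraMap ℚ k ((n.factorial : ℚ)⁻¹)

section Trees

variable {k : Type u} [CommRing k] [Algebra ℚ k] {V : Type*} [AddCommGroup V] [Module k V]
  {p q r l m n : ℕ}

theorem invFact_mul (a b : ℕ) :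
    invFact k a * invFact k b = algebraMap ℚ k ((a.factorial * b.factorial : ℚ)⁻¹) := by
  rw [invFact, invFact, ← map_mul, mul_inv]

theorem invFact_mul_factorial (n : ℕ) : invFact k n * (n.factorial : k) = 1 := by
  rw [invFact, ← map_natCast (algebraMap ℚ k), ← map_mul, inv_mul_cancel₀, map_one]
  exact_mod_cast n.factorial_ne_zero

theorem succ_mul_invFact (n : ℕ) : ((n + 1 : ℕ) : k) * invFact k (n + 1) = invFact k n := by
  rw [invFact, invFact, ← map_natCast (algebraMap ℚ k), ← map_mul, Nat.factorial_succ]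
  congr 1
  have : ((n + 1 : ℕ) : ℚ) ≠ 0 := by positivity
  push_cast at *
  field_simp

theorem eq_of_sumEquiv (e : Fin q ⊕ Fin p ≃ Fin n) : q + p = n := by
  simpa using Fintype.card_congr e

theorem sum_antidiagonal_equiv {N : ℕ} (hN : n < N)
    (F : ∀ q p : ℕ, (Fin q ⊕ Fin p ≃ Fin n) → V) :
    ∑ qp ∈ Finset.HasAntidiagonal.antidiagonal n, ∑ e, F qp.1 qp.2 e =
      ∑ q ∈ Finset.range N, ∑ p ∈ Finset.range N, ∑ e, F q p e := by
  rw [← Finset.sum_product']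
  refine Finset.sum_subset (fun x hx => ?_) fun x _ hx => Finset.sum_eq_zero fun e _ => ?_
  · have := Finset.HasAntidiagonal.mem_antidiagonal.1 hx
    simp only [Finset.mem_product, Finset.mem_range]
    omega
  · exact absurd (Finset.HasAntidiagonal.mem_antidiagonal.2 (eq_of_sumEquiv e)) hx

theorem sum_invFact_smul_equiv {N : ℕ} (hN : q + p < N) (x : V) :
    ∑ l ∈ Finset.range N, ∑ _h : Fin q ⊕ Fin p ≃ Fin l, invFact k l • x = x := by
  rw [Finset.sum_eq_single (q + p)]
  · rw [Finset.sum_const, Finset.card_univ, Fintype.card_equiv finSumFinEquiv, Fintype.card_sum,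
      Fintype.card_fin, Fintype.card_fin, ← Nat.cast_smul_eq_nsmul k, smul_smul, mul_comm,
      invFact_mul_factorial, one_smul]
  · intro l _ hl
    exact Finset.sum_eq_zero fun e _ => absurd (eq_of_sumEquiv e).symm hl
  · intro h
    exact absurd (Finset.mem_range.2 hN) h

theorem exists_graftLeft (e : Fin (q + 1) ⊕ Fin p ≃ Fin (l + 1)) (he : e (.inl 0) = 0) :
    ∃ h : Fin q ⊕ Fin p ≃ Fin l, TwoTree.graftLeft h = e := by
  have hne : ∀ x : Fin q ⊕ Fin p, e (Sum.map Fin.succ id x) ≠ 0 := fun x hx => by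
    have := e.injective (hx.trans he.symm)
    rcases x with x | x <;> simp at this
  have hc : q + p = l := by have := eq_of_sumEquiv e; omega
  let f : Fin q ⊕ Fin p → Fin l := fun x => (e (Sum.map Fin.succ id x)).pred (hne x)
  have hf : f.Injective := fun x y hxy => by
    have := e.injective (Fin.pred_inj.1 hxy)
    rcases x with x | x <;> rcases y with y | y <;> simp at this <;> simp [this]
  have hb : f.Bijective := (Fintype.bijective_iff_injective_and_card f).2 ⟨hf, by simpa using hc⟩
  refine ⟨Equiv.ofBijective f hb, ?_⟩
  ext x
  rcases x with x | x
  · refine Fin.cases ?_ (fun x => ?_) x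
    · simp [he]
    · simp [f]
  · simp [f]

theorem graftLeft_injective : Function.Injective
    (TwoTree.graftLeft : (Fin q ⊕ Fin p ≃ Fin l) → _) := fun h h' hh => by
  ext x
  rcases x with x | x
  · have := congrArg (fun e => (e (.inl x.succ)).val) hh
    simpa using this
  · have := congrArg (fun e => (e (.inr x)).val) hh
    simpa using this

theorem sum_equiv_isLeft (X : (Fin (q + 1) ⊕ Fin p ≃ Fin (l + 1)) → V)
    (hX : ∀ (ρ : Equiv.Perm (Fin (q + 1))) e,
      X ((Equiv.sumCongr ρ (Equiv.refl _)).trans e) = X e) :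
    ∑ e with (e.symm 0).isLeft, X e =
      (q + 1 : ℕ) • ∑ h : Fin q ⊕ Fin p ≃ Fin l, X (TwoTree.graftLeft h) := by
  have : (q + 1 : ℕ) • ∑ h : Fin q ⊕ Fin p ≃ Fin l, X (TwoTree.graftLeft h) =
      ∑ sh : Fin (q + 1) × (Fin q ⊕ Fin p ≃ Fin l),
        X ((Equiv.sumCongr (Equiv.swap 0 sh.1) (Equiv.refl _)).trans (TwoTree.graftLeft sh.2)) := by
    rw [Fintype.sum_prod_type]
    simp only [hX, Finset.sum_const, Finset.card_univ, Fintype.card_fin]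
  rw [this]
  symm
  refine Finset.sum_bij (fun sh _ =>
    (Equiv.sumCongr (Equiv.swap 0 sh.1) (Equiv.refl _)).trans (TwoTree.graftLeft sh.2)) ?_ ?_ ?_ ?_
  · rintro ⟨s, h⟩ _
    have : ((Equiv.sumCongr (Equiv.swap 0 s) (Equiv.refl (Fin p))).trans
        (TwoTree.graftLeft h)).symm 0 = .inl s := by
      rw [Equiv.symm_apply_eq]; simp
    simp only [Finset.mem_filter, Finset.mem_univ, true_and, this, Sum.isLeft_inl]
  · rintro ⟨s, h⟩ _ ⟨s', h'⟩ _ hh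
    have h1 : s = s' := by
      have h2 : ((Equiv.sumCongr (Equiv.swap 0 s) (Equiv.refl (Fin p))).trans
        (TwoTree.graftLeft h)) (.inl s) = 0 := by simp
      simp only at hh
      rw [hh, ← Equiv.eq_symm_apply] at h2
      have h3 : ((Equiv.sumCongr (Equiv.swap 0 s') (Equiv.refl (Fin p))).trans
        (TwoTree.graftLeft h')).symm 0 = .inl s' := by
        rw [Equiv.symm_apply_eq]; simp
      simpa using h2.trans h3
    subst h1
    have h4 : TwoTree.graftLeft h = TwoTree.graftLeft h' := by
      ext x
      have := congrArg (fun e => (e ((Equiv.sumCongr (Equiv.swap 0 s) (Equiv.refl (Fin p))).symm x)).val) hh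
      simpa using this
    rw [graftLeft_injective h4]
  · intro e he
    simp only [Finset.mem_filter, Finset.mem_univ, true_and] at he
    obtain ⟨s, hs⟩ := Sum.isLeft_iff.1 he
    obtain ⟨h, hh⟩ := exists_graftLeft ((Equiv.sumCongr (Equiv.swap 0 s) (Equiv.refl (Fin p))).trans e)
      (by simp [← hs])
    refine ⟨(s, h), Finset.mem_univ _, ?_⟩
    simp only [hh]
    ext x
    rcases x with x | x <;> simp
  · intro _ _
    rfl

theorem sum_equiv_isRight (X : (Fin q ⊕ Fin (p + 1) ≃ Fin (l + 1)) → V)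
    (hX : ∀ (τ : Equiv.Perm (Fin (p + 1))) e,
      X ((Equiv.sumCongr (Equiv.refl _) τ).trans e) = X e) :
    ∑ e with ¬ (e.symm 0).isLeft, X e =
      (p + 1 : ℕ) • ∑ h : Fin q ⊕ Fin p ≃ Fin l, X (TwoTree.graftRight h) := by
  have h1 := sum_equiv_isLeft (fun e => X ((Equiv.sumComm _ _).trans e)) fun τ e => by
    refine (congrArg X ?_).trans (hX τ _)
    ext x
    rcases x with x | x <;> simp
  have e1 : ∑ h : Fin q ⊕ Fin p ≃ Fin l, X (TwoTree.graftRight h) =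
      ∑ h : Fin p ⊕ Fin q ≃ Fin l, X ((Equiv.sumComm _ _).trans (TwoTree.graftLeft h)) :=
    Fintype.sum_equiv ((Equiv.sumComm _ _).equivCongr (Equiv.refl _)) _ _ fun h => by
      rfl
  rw [e1, ← h1]
  refine Finset.sum_bij (fun e _ => (Equiv.sumComm _ _).trans e) ?_ ?_ ?_ ?_
  · intro e he
    simp only [Finset.mem_filter, Finset.mem_univ, true_and] at he ⊢
    simpa using he
  · intro e _ e' _ h
    ext x
    have := congrArg (fun f => (f ((Equiv.sumComm _ _) x)).val) h
    simpa using this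
  · intro e he
    refine ⟨(Equiv.sumComm _ _).trans e, ?_, ?_⟩
    · simp only [Finset.mem_filter, Finset.mem_univ, true_and] at he ⊢
      simpa using he
    · ext x
      simp
  · intro e _
    congr 1
    ext x
    simp

/-- A sum over trees with leaves `0, …, l` splits according to the vertex which carries the first
leaf. -/
theorem sum_tree_split (X : ∀ {q p : ℕ}, (Fin q ⊕ Fin p ≃ Fin (l + 1)) → V)
    (hX : ∀ {q p : ℕ} (ρ : Equiv.Perm (Fin q)) (τ : Equiv.Perm (Fin p)) e,
      X ((Equiv.sumCongr ρ τ).trans e) = X e) :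
    ∑ qp ∈ Finset.HasAntidiagonal.antidiagonal (l + 1), ∑ e : Fin qp.1 ⊕ Fin qp.2 ≃ Fin (l + 1),
      (invFact k qp.1 * invFact k qp.2) • X e =
    ∑ qp ∈ Finset.HasAntidiagonal.antidiagonal l, ∑ h : Fin qp.1 ⊕ Fin qp.2 ≃ Fin l,
      (invFact k qp.1 * invFact k qp.2) • (X (TwoTree.graftLeft h) + X (TwoTree.graftRight h)) := by
  have key : ∀ qp : ℕ × ℕ, ∑ e : Fin qp.1 ⊕ Fin qp.2 ≃ Fin (l + 1),
      (invFact k qp.1 * invFact k qp.2) • X e =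
      (invFact k qp.1 * invFact k qp.2) • ∑ e : Fin qp.1 ⊕ Fin qp.2 ≃ Fin (l + 1) with
        (e.symm 0).isLeft, X e +
      (invFact k qp.1 * invFact k qp.2) • ∑ e : Fin qp.1 ⊕ Fin qp.2 ≃ Fin (l + 1) with
        ¬ (e.symm 0).isLeft, X e := fun qp => by
    rw [← Finset.smul_sum, ← smul_add, Finset.sum_filter_add_sum_filter_not]
  simp only [key]
  simp only [smul_add, Finset.sum_add_distrib]
  congr 1
  · rw [Finset.Nat.sum_antidiagonal_succ]
    rw [Finset.sum_eq_zero (s := Finset.filter _ _), smul_zero, zero_add]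
    · refine Finset.sum_congr rfl fun qp _ => ?_
      rw [sum_equiv_isLeft _ fun ρ e => hX ρ _ e, ← Nat.cast_smul_eq_nsmul k, smul_smul,
        ← Finset.smul_sum, ← succ_mul_invFact qp.1]
      congr 1
      ring
    · intro e he
      simp only [Finset.mem_filter, Finset.mem_univ, true_and] at he
      obtain ⟨s, hs⟩ := Sum.isLeft_iff.1 he
      exact s.elim0
  · rw [Finset.Nat.sum_antidiagonal_succ']
    rw [Finset.sum_eq_zero (s := Finset.filter _ _), smul_zero, zero_add]
    · refine Finset.sum_congr rfl fun qp _ => ?_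
      rw [sum_equiv_isRight _ fun ρ e => hX _ ρ e, ← Nat.cast_smul_eq_nsmul k, smul_smul,
        ← Finset.smul_sum, ← succ_mul_invFact qp.2]
      congr 1
      ring
    · intro e he
      simp only [Finset.mem_filter, Finset.mem_univ, true_and] at he
      rcases hs : e.symm 0 with s | s
      · simp [hs] at he
      · exact s.elim0

theorem sum_left_tree {N : ℕ} (hN : n < N)
    (P : ∀ {r l q p : ℕ}, (Fin r ⊕ Fin l ≃ Fin n) → (Fin q ⊕ Fin p ≃ Fin l) → V)
    (T : ∀ {r q p : ℕ}, (Fin r ⊕ (Fin q ⊕ Fin p) ≃ Fin n) → V)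
    (hP : ∀ {r q p l : ℕ} (e : Fin r ⊕ (Fin q ⊕ Fin p) ≃ Fin n) (h : Fin q ⊕ Fin p ≃ Fin l),
      P (((Equiv.refl (Fin r)).sumCongr h.symm).trans e) h = T e) :
    ∑ rl ∈ Finset.HasAntidiagonal.antidiagonal n, ∑ e : Fin rl.1 ⊕ Fin rl.2 ≃ Fin n,
      (invFact k rl.1 * invFact k rl.2) • ∑ qp ∈ Finset.HasAntidiagonal.antidiagonal rl.2,
        ∑ h : Fin qp.1 ⊕ Fin qp.2 ≃ Fin rl.2, (invFact k qp.1 * invFact k qp.2) • P e h =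
    ∑ r ∈ Finset.range N, ∑ q ∈ Finset.range N, ∑ p ∈ Finset.range N,
      ∑ e : Fin r ⊕ (Fin q ⊕ Fin p) ≃ Fin n,
        (invFact k r * invFact k q * invFact k p) • T e := by
  rw [sum_antidiagonal_equiv hN (fun r l e => (invFact k r * invFact k l) •
    ∑ qp ∈ Finset.HasAntidiagonal.antidiagonal l,
        ∑ h : Fin qp.1 ⊕ Fin qp.2 ≃ Fin l, (invFact k qp.1 * invFact k qp.2) • P e h)]
  refine Finset.sum_congr rfl fun r _ => ?_
  have h1 : ∀ l ∈ Finset.range N, ∑ e : Fin r ⊕ Fin l ≃ Fin n, (invFact k r * invFact k l) •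
      ∑ qp ∈ Finset.HasAntidiagonal.antidiagonal l, ∑ h : Fin qp.1 ⊕ Fin qp.2 ≃ Fin l,
        (invFact k qp.1 * invFact k qp.2) • P e h =
      ∑ q ∈ Finset.range N, ∑ p ∈ Finset.range N, ∑ _h : Fin q ⊕ Fin p ≃ Fin l,
        invFact k l • ∑ e : Fin r ⊕ (Fin q ⊕ Fin p) ≃ Fin n,
        (invFact k r * invFact k q * invFact k p) • T e := fun l hl => by
    have h2 : ∀ e : Fin r ⊕ Fin l ≃ Fin n, (invFact k r * invFact k l) •
      ∑ qp ∈ Finset.HasAntidiagonal.antidiagonal l, ∑ h : Fin qp.1 ⊕ Fin qp.2 ≃ Fin l,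
        (invFact k qp.1 * invFact k qp.2) • P e h =
      ∑ q ∈ Finset.range N, ∑ p ∈ Finset.range N, ∑ h : Fin q ⊕ Fin p ≃ Fin l,
        (invFact k r * invFact k l) • (invFact k q * invFact k p) • P e h := fun e => by
      rw [sum_antidiagonal_equiv (Finset.mem_range.1 hl) (fun q p h =>
        (invFact k q * invFact k p) • P e h)]
      simp only [Finset.smul_sum]
    rw [Finset.sum_congr rfl fun e _ => h2 e, Finset.sum_comm]
    refine Finset.sum_congr rfl fun q _ => ?_
    rw [Finset.sum_comm]
    refine Finset.sum_congr rfl fun p _ => ?_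
    rw [Finset.sum_comm]
    refine Finset.sum_congr rfl fun h _ => ?_
    rw [Finset.smul_sum]
    let E := ((Equiv.refl (Fin r)).sumCongr h.symm).equivCongr (Equiv.refl (Fin n))
    refine Eq.trans (Finset.sum_congr rfl fun e _ => ?_) (E.sum_comp _)
    have h3 := hP (E e) h
    have h4 : ((Equiv.refl (Fin r)).sumCongr h.symm).trans (E e) = e := by
      ext x
      rcases x with x | x <;> simp [E]
    rw [h4] at h3
    rw [h3, smul_smul, smul_smul]
    congr 1
    ring
  rw [Finset.sum_congr rfl h1, Finset.sum_comm]
  refine Finset.sum_congr rfl fun q _ => ?_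
  rw [Finset.sum_comm]
  refine Finset.sum_congr rfl fun p _ => ?_
  by_cases hqp : q + p < N
  · exact sum_invFact_smul_equiv hqp _
  · have : IsEmpty (Fin r ⊕ (Fin q ⊕ Fin p) ≃ Fin n) := ⟨fun e => by
      have := Fintype.card_congr e
      simp at this
      omega⟩
    simp

theorem sum_right_tree {N : ℕ} (hN : n < N)
    (Q : ∀ {m p r q : ℕ}, (Fin m ⊕ Fin p ≃ Fin n) → (Fin r ⊕ Fin q ≃ Fin m) → V)
    (T : ∀ {r q p : ℕ}, (Fin r ⊕ (Fin q ⊕ Fin p) ≃ Fin n) → V)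
    (hQ : ∀ {r q p m : ℕ} (e : Fin r ⊕ (Fin q ⊕ Fin p) ≃ Fin n) (g : Fin r ⊕ Fin q ≃ Fin m),
      Q ((g.symm.sumCongr (Equiv.refl (Fin p))).trans ((Equiv.sumAssoc _ _ _).trans e)) g = T e) :
    ∑ mp ∈ Finset.HasAntidiagonal.antidiagonal n, ∑ e : Fin mp.1 ⊕ Fin mp.2 ≃ Fin n,
      (invFact k mp.1 * invFact k mp.2) • ∑ rq ∈ Finset.HasAntidiagonal.antidiagonal mp.1,
        ∑ g : Fin rq.1 ⊕ Fin rq.2 ≃ Fin mp.1, (invFact k rq.1 * invFact k rq.2) • Q e g =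
    ∑ r ∈ Finset.range N, ∑ q ∈ Finset.range N, ∑ p ∈ Finset.range N,
      ∑ e : Fin r ⊕ (Fin q ⊕ Fin p) ≃ Fin n,
        (invFact k r * invFact k q * invFact k p) • T e := by
  rw [sum_antidiagonal_equiv hN (fun m p e => (invFact k m * invFact k p) •
    ∑ rq ∈ Finset.HasAntidiagonal.antidiagonal m,
        ∑ g : Fin rq.1 ⊕ Fin rq.2 ≃ Fin m, (invFact k rq.1 * invFact k rq.2) • Q e g)]
  have h1 : ∀ m ∈ Finset.range N, ∀ p, ∑ e : Fin m ⊕ Fin p ≃ Fin n,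
      (invFact k m * invFact k p) •
      ∑ rq ∈ Finset.HasAntidiagonal.antidiagonal m, ∑ g : Fin rq.1 ⊕ Fin rq.2 ≃ Fin m,
        (invFact k rq.1 * invFact k rq.2) • Q e g =
      ∑ r ∈ Finset.range N, ∑ q ∈ Finset.range N, ∑ _g : Fin r ⊕ Fin q ≃ Fin m,
        invFact k m • ∑ e : Fin r ⊕ (Fin q ⊕ Fin p) ≃ Fin n,
        (invFact k r * invFact k q * invFact k p) • T e := fun m hm p => by
    have h2 : ∀ e : Fin m ⊕ Fin p ≃ Fin n, (invFact k m * invFact k p) •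
      ∑ rq ∈ Finset.HasAntidiagonal.antidiagonal m, ∑ g : Fin rq.1 ⊕ Fin rq.2 ≃ Fin m,
        (invFact k rq.1 * invFact k rq.2) • Q e g =
      ∑ r ∈ Finset.range N, ∑ q ∈ Finset.range N, ∑ g : Fin r ⊕ Fin q ≃ Fin m,
        (invFact k m * invFact k p) • (invFact k r * invFact k q) • Q e g := fun e => by
      rw [sum_antidiagonal_equiv (Finset.mem_range.1 hm) (fun r q g =>
        (invFact k r * invFact k q) • Q e g)]
      simp only [Finset.smul_sum]
    rw [Finset.sum_congr rfl fun e _ => h2 e, Finset.sum_comm]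
    refine Finset.sum_congr rfl fun r _ => ?_
    rw [Finset.sum_comm]
    refine Finset.sum_congr rfl fun q _ => ?_
    rw [Finset.sum_comm]
    refine Finset.sum_congr rfl fun g _ => ?_
    rw [Finset.smul_sum]
    let E := ((g.symm.sumCongr (Equiv.refl (Fin p))).trans
      (Equiv.sumAssoc (Fin r) (Fin q) (Fin p))).equivCongr (Equiv.refl (Fin n))
    refine Eq.trans (Finset.sum_congr rfl fun e _ => ?_) (E.sum_comp _)
    have h3 := hQ (E e) g
    have h4 : (g.symm.sumCongr (Equiv.refl (Fin p))).trans
        ((Equiv.sumAssoc _ _ _).trans (E e)) = e := by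
      ext x
      rcases x with x | x <;> simp [E]
    rw [h4] at h3
    rw [h3, smul_smul, smul_smul]
    congr 1
    ring
  rw [Finset.sum_congr rfl fun m hm => Finset.sum_congr rfl fun p _ => h1 m hm p]
  calc _ = ∑ r ∈ Finset.range N, ∑ q ∈ Finset.range N, ∑ p ∈ Finset.range N,
      ∑ m ∈ Finset.range N, ∑ _g : Fin r ⊕ Fin q ≃ Fin m,
        invFact k m • ∑ e : Fin r ⊕ (Fin q ⊕ Fin p) ≃ Fin n,
        (invFact k r * invFact k q * invFact k p) • T e := by
        rw [Finset.sum_comm]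
        rw [Finset.sum_congr rfl fun p _ => Finset.sum_comm, Finset.sum_comm]
        refine Finset.sum_congr rfl fun r _ => ?_
        rw [Finset.sum_congr rfl fun p _ => Finset.sum_comm, Finset.sum_comm]
    _ = _ := by
        refine Finset.sum_congr rfl fun r _ => Finset.sum_congr rfl fun q _ =>
          Finset.sum_congr rfl fun p _ => ?_
        by_cases hqp : r + q < N
        · exact sum_invFact_smul_equiv hqp _
        · have : IsEmpty (Fin r ⊕ (Fin q ⊕ Fin p) ≃ Fin n) := ⟨fun e => by
            have := Fintype.card_congr e
            simp at this
            omega⟩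
          simp

theorem sum_exchange_tree (N : ℕ) (T T' : ∀ {r q p : ℕ}, (Fin r ⊕ (Fin q ⊕ Fin p) ≃ Fin n) → V)
    (hT : ∀ {r q p : ℕ} (e : Fin r ⊕ (Fin q ⊕ Fin p) ≃ Fin n),
      T e = T' ((TwoTree.exchange q r p).trans e)) :
    ∑ r ∈ Finset.range N, ∑ q ∈ Finset.range N, ∑ p ∈ Finset.range N,
      ∑ e : Fin r ⊕ (Fin q ⊕ Fin p) ≃ Fin n,
        (invFact k r * invFact k q * invFact k p) • T e =
    ∑ r ∈ Finset.range N, ∑ q ∈ Finset.range N, ∑ p ∈ Finset.range N,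
      ∑ e : Fin r ⊕ (Fin q ⊕ Fin p) ≃ Fin n,
        (invFact k r * invFact k q * invFact k p) • T' e := by
  rw [Finset.sum_comm]
  refine Finset.sum_congr rfl fun q _ => Finset.sum_congr rfl fun r _ =>
    Finset.sum_congr rfl fun p _ => ?_
  refine Fintype.sum_equiv ((TwoTree.exchange q r p).symm.equivCongr (Equiv.refl _)) _ _
    fun e => ?_
  rw [hT, mul_comm (invFact k r)]
  rfl

end Trees

namespace Conv

variable {k : Type u} [CommRing k] {C : FilteredDGCooperad.{u, v} k} {A : FilteredDGModule.{u, w} k}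

/-- The families of equivariant filtered maps `C(n) → end_A(n)`, of any degree. -/
structure IsSym (f : Family C A) : Prop where
  equivariant : ∀ n (σ : Equiv.Perm (Fin n)) (c : C.obj n),
    f n (C.act n σ c) = EndOp.act σ (f n c)
  filtered : ∀ n, InFil 0 (f n)

theorem IsHom.isSym {j : ℤ} {f : Family C A} (h : IsHom j f) : IsSym f := ⟨h.equivariant, h.filtered⟩

theorem InFil.add {l n : ℕ} {f g : C.obj n →ₗ[k] EndOp.Mult A n} (hf : InFil l f)
    (hg : InFil l g) : InFil l (f + g) := fun i c hc => add_mem (hf i c hc) (hg i c hc)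

theorem InFil.sub {l n : ℕ} {f g : C.obj n →ₗ[k] EndOp.Mult A n} (hf : InFil l f)
    (hg : InFil l g) : InFil l (f - g) := fun i c hc => sub_mem (hf i c hc) (hg i c hc)

theorem InFil.smul {l n : ℕ} (a : k) {f : C.obj n →ₗ[k] EndOp.Mult A n} (hf : InFil l f) :
    InFil l (a • f) := fun i c hc => Submodule.smul_mem _ a (hf i c hc)

theorem InFil.zero {l n : ℕ} : InFil l (0 : C.obj n →ₗ[k] EndOp.Mult A n) :=
  fun _ _ _ => zero_mem _

theorem act_add {n : ℕ} (σ : Equiv.Perm (Fin n)) (x y : EndOp.Mult A n) :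
    EndOp.act σ (x + y) = EndOp.act σ x + EndOp.act σ y := EndOp.rearrange_add _ _ _

theorem act_smul {n : ℕ} (σ : Equiv.Perm (Fin n)) (a : k) (x : EndOp.Mult A n) :
    EndOp.act σ (a • x) = a • EndOp.act σ x := EndOp.rearrange_smul _ _ _

variable (C A) in
/-- The module of equivariant filtered families. -/
def sym : Submodule k (Family C A) where
  carrier := {f | IsSym f}
  zero_mem' := ⟨fun n σ _ => ((EndOp.actLinear σ).map_zero).symm, fun _ => InFil.zero⟩
  add_mem' hf hg := ⟨fun n σ c => by
    rw [Pi.add_apply, LinearMap.add_apply, hf.1, hg.1, ← act_add]; rfl,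
    fun n => (hf.2 n).add (hg.2 n)⟩
  smul_mem' a _ hf := ⟨fun n σ c => by
    rw [Pi.smul_apply, LinearMap.smul_apply, hf.1, ← act_smul]; rfl, fun n => (hf.2 n).smul a⟩

variable (C A) in
/-- The module of elements of degree `j` of the convolution algebra. -/
def hom (j : ℤ) : Submodule k (Family C A) where
  carrier := {f | IsHom j f}
  zero_mem' := ⟨(sym C A).zero_mem.1, fun _ _ _ _ => zero_mem _, (sym C A).zero_mem.2⟩
  add_mem' hf hg := ⟨((sym C A).add_mem hf.isSym hg.isSym).1,
    fun n i c hc => add_mem (hf.2 n i c hc) (hg.2 n i c hc), fun n => (hf.3 n).add (hg.3 n)⟩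
  smul_mem' a _ hf := ⟨((sym C A).smul_mem a hf.isSym).1,
    fun n i c hc => Submodule.smul_mem _ a (hf.2 n i c hc), fun n => (hf.3 n).smul a⟩

theorem family_smul_apply (a : k) (f : Family C A) (n : ℕ) (c : C.obj n) :
    (a • f) n c = a • f n c := rfl

theorem family_add_apply (f g : Family C A) (n : ℕ) (c : C.obj n) :
    (f + g) n c = f n c + g n c := rfl

/-! ### The pre-Lie product as a sum over trees -/

/-- The contribution of the tree `e` to the pre-Lie product, before decomposition. -/
def starMap (j : ℤ) (f g : Family C A) {p q n : ℕ} (e : Fin q ⊕ Fin p ≃ Fin n) :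
    C.obj (p + 1) ⊗[k] C.obj q →ₗ[k] EndOp.Mult A n :=
  EndOp.compTensor e ∘ₗ TensorProduct.map (f (p + 1) ∘ₗ (C.obj (p + 1)).sgn j) (g q)

theorem starMap_tmul (j : ℤ) (f g : Family C A) {p q n : ℕ} (e : Fin q ⊕ Fin p ≃ Fin n)
    (x : C.obj (p + 1)) (y : C.obj q) : starMap j f g e (x ⊗ₜ y) =
      EndOp.comp e (f (p + 1) ((C.obj (p + 1)).sgn j x)) (g q y) := by
  simp [starMap]

theorem act_sgn {n : ℕ} (σ : Equiv.Perm (Fin n)) (j : ℤ) (c : C.obj n) :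
    C.act n σ ((C.obj n).sgn j c) = (C.obj n).sgn j (C.act n σ c) := by
  have : C.act n σ ∘ₗ (C.obj n).sgn j = (C.obj n).sgn j ∘ₗ C.act n σ :=
    FilteredDGModule.linearMap_ext _ fun i x hx => by
      simp only [LinearMap.comp_apply]
      rw [FilteredDGModule.sgn_of_mem _ _ hx,
        FilteredDGModule.sgn_of_mem _ _ (C.act_deg n σ i x hx), map_smul]
  exact LinearMap.congr_fun this c

theorem starMap_Δ_sumCongr (j : ℤ) {f g : Family C A} (hf : IsSym f) (hg : IsSym g) {p q n : ℕ}
    (ρ : Equiv.Perm (Fin q)) (τ : Equiv.Perm (Fin p)) (e : Fin q ⊕ Fin p ≃ Fin n) :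
    starMap j f g ((Equiv.sumCongr ρ τ).trans e) ∘ₗ C.Δ ((Equiv.sumCongr ρ τ).trans e) =
      starMap j f g e ∘ₗ C.Δ e := by
  ext1 c
  simp only [LinearMap.comp_apply]
  rw [← C.Δ_act e ρ τ c]
  have : starMap j f g ((Equiv.sumCongr ρ τ).trans e) = starMap j f g e ∘ₗ
      TensorProduct.map (C.act (p + 1) (TwoTree.permSucc τ)) (C.act q ρ) :=
    TensorProduct.ext' fun x y => by
      rw [LinearMap.comp_apply, TensorProduct.map_tmul, starMap_tmul, starMap_tmul, ← act_sgn,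
        hf.1, hg.1, EndOp.comp_act]
  rw [this]
  rfl

theorem Δ_sgn (j : ℤ) {p q n : ℕ} (e : Fin q ⊕ Fin p ≃ Fin n) (c : C.obj n) :
    C.Δ e ((C.obj n).sgn j c) =
      TensorProduct.map ((C.obj (p + 1)).sgn j) ((C.obj q).sgn j) (C.Δ e c) := by
  have : C.Δ e ∘ₗ (C.obj n).sgn j =
      TensorProduct.map ((C.obj (p + 1)).sgn j) ((C.obj q).sgn j) ∘ₗ C.Δ e :=
    FilteredDGModule.linearMap_ext _ fun i x hx => by
      simp only [LinearMap.comp_apply]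
      rw [FilteredDGModule.sgn_of_mem _ _ hx, map_smul]
      have h := C.Δ_deg e i x hx
      suffices hle : (C.obj (p + 1)).tensorDeg (C.obj q) i ≤
        LinearMap.ker (zsign k (j * i) • LinearMap.id -
          TensorProduct.map ((C.obj (p + 1)).sgn j) ((C.obj q).sgn j)) from
        sub_eq_zero.1 (hle h)
      refine iSup_le fun a => Submodule.map₂_le.2 fun y hy z hz => ?_
      rw [LinearMap.mem_ker, LinearMap.sub_apply, TensorProduct.mk_apply, TensorProduct.map_tmul,
        FilteredDGModule.sgn_of_mem _ _ hy, FilteredDGModule.sgn_of_mem _ _ hz,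
        TensorProduct.smul_tmul_smul, ← zsign_add, sub_eq_zero, ← mul_add, add_sub_cancel]
      rfl
  exact LinearMap.congr_fun this c

variable [Algebra ℚ k]

theorem treeSum_eq {V : Type*} [AddCommGroup V] [Module k V] (n : ℕ)
    (Φ : ∀ {p q : ℕ}, (Fin q ⊕ Fin p ≃ Fin n) → (C.obj (p + 1) ⊗[k] C.obj q →ₗ[k] V)) :
    C.treeSum n Φ = ∑ qp ∈ Finset.HasAntidiagonal.antidiagonal n,
      ∑ e : Fin qp.1 ⊕ Fin qp.2 ≃ Fin n,
        (invFact k qp.1 * invFact k qp.2) • (Φ e ∘ₗ C.Δ e) := by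
  simp only [FilteredDGCooperad.treeSum, invFact_mul, Finset.smul_sum]

theorem star_eq (j : ℤ) (f g : Family C A) (n : ℕ) :
    star j f g n = ∑ qp ∈ Finset.HasAntidiagonal.antidiagonal n,
      ∑ e : Fin qp.1 ⊕ Fin qp.2 ≃ Fin n,
        (invFact k qp.1 * invFact k qp.2) • (starMap j f g e ∘ₗ C.Δ e) := treeSum_eq n _

theorem star_apply (j : ℤ) (f g : Family C A) (n : ℕ) (c : C.obj n) :
    star j f g n c = ∑ qp ∈ Finset.HasAntidiagonal.antidiagonal n,
      ∑ e : Fin qp.1 ⊕ Fin qp.2 ≃ Fin n,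
        (invFact k qp.1 * invFact k qp.2) • starMap j f g e (C.Δ e c) := by
  rw [star_eq]
  simp only [LinearMap.sum_apply, LinearMap.smul_apply, LinearMap.comp_apply]

/-- The pre-Lie product with an element of degree `j`, as a bilinear map. -/
def starₗ (j : ℤ) : Family C A →ₗ[k] Family C A →ₗ[k] Family C A :=
  LinearMap.mk₂ k (star j)
    (fun f f' g => by
      funext n; ext1 c
      simp only [star_apply, family_add_apply, ← Finset.sum_add_distrib, ← smul_add]
      refine Finset.sum_congr rfl fun _ _ => Finset.sum_congr rfl fun e _ => ?_
      congr 1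
      rw [← LinearMap.add_apply]
      congr 1
      exact TensorProduct.ext' fun x y => by
        simp only [starMap_tmul, LinearMap.add_apply, Pi.add_apply, ← EndOp.compTensor_tmul,
          TensorProduct.add_tmul, map_add])
    (fun a f g => by
      funext n; ext1 c
      simp only [star_apply, family_smul_apply, Finset.smul_sum]
      refine Finset.sum_congr rfl fun _ _ => Finset.sum_congr rfl fun e _ => ?_
      rw [smul_comm]
      congr 1
      rw [← LinearMap.smul_apply]
      congr 1
      exact TensorProduct.ext' fun x y => by
        simp only [starMap_tmul, LinearMap.smul_apply, Pi.smul_apply, ← EndOp.compTensor_tmul,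
          ← TensorProduct.smul_tmul', map_smul])
    (fun f g g' => by
      funext n; ext1 c
      simp only [star_apply, family_add_apply, ← Finset.sum_add_distrib, ← smul_add]
      refine Finset.sum_congr rfl fun _ _ => Finset.sum_congr rfl fun e _ => ?_
      congr 1
      rw [← LinearMap.add_apply]
      congr 1
      exact TensorProduct.ext' fun x y => by
        simp only [starMap_tmul, LinearMap.add_apply, Pi.add_apply, ← EndOp.compTensor_tmul,
          TensorProduct.tmul_add, map_add])
    (fun a f g => by
      funext n; ext1 c
      simp only [star_apply, family_smul_apply, Finset.smul_sum]
      refine Finset.sum_congr rfl fun _ _ => Finset.sum_congr rfl fun e _ => ?_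
      rw [smul_comm]
      congr 1
      rw [← LinearMap.smul_apply]
      congr 1
      exact TensorProduct.ext' fun x y => by
        simp only [starMap_tmul, LinearMap.smul_apply, Pi.smul_apply, ← EndOp.compTensor_tmul,
          TensorProduct.tmul_smul, map_smul])

theorem starₗ_apply (j : ℤ) (f g : Family C A) : starₗ j f g = star j f g := rfl

theorem star_congr {i j : ℤ} (h : Even (i - j)) (f g : Family C A) : star i f g = star j f g := by
  funext n; ext1 c
  have : ∀ m, (C.obj m).sgn i = (C.obj m).sgn j := fun m => FilteredDGModule.sgn_congr _ h
  simp only [star_apply, starMap, this]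

theorem star_mem (j : ℤ) (f g : Family C A) {n i : ℕ} {Q : Submodule k (EndOp.Mult A n)}
    (h : ∀ {p q : ℕ} (e : Fin q ⊕ Fin p ≃ Fin n) (a b : ℕ), a + b = i →
      ∀ x ∈ (C.obj (p + 1)).fil a, ∀ y ∈ (C.obj q).fil b, EndOp.comp e (f _ x) (g _ y) ∈ Q)
    {c : C.obj n} (hc : c ∈ (C.obj n).fil i) : star j f g n c ∈ Q := by
  rw [star_apply]
  refine sum_mem fun qp _ => sum_mem fun e _ => Submodule.smul_mem _ _ ?_
  suffices hle : (C.obj (qp.2 + 1)).tensorFil (C.obj qp.1) i ≤ Q.comap (starMap j f g e) from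
    hle (C.Δ_fil e i c hc)
  refine iSup_le fun a => iSup_le fun b => iSup_le fun hab => Submodule.map₂_le.2 fun x hx y hy => ?_
  rw [Submodule.mem_comap, TensorProduct.mk_apply, starMap_tmul]
  exact h e a b hab _ (FilteredDGModule.weight_mem_fil _ _ hx) _ hy

theorem star_inFil (j : ℤ) {f g : Family C A} {n l : ℕ}
    (h : ∀ q p, q + p = n → ∃ a b, l ≤ a + b ∧ InFil a (f (p + 1)) ∧ InFil b (g q)) :
    InFil l (star j f g n) := fun i c hc => by
  refine star_mem j f g (fun {p q} e a b hab x hx y hy => ?_) hc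
  obtain ⟨a', b', hl, h1, h2⟩ := h q p (eq_of_sumEquiv e)
  exact EndOp.fil_mono (by omega) (EndOp.comp_mem_fil e (h1 a x hx) (h2 b y hy))

theorem star_isSym (j : ℤ) {f g : Family C A} (hf : IsSym f) (hg : IsSym g) :
    IsSym (star j f g) where
  equivariant n σ c := by
    refine FilteredDGCooperad.Cobar.treeSum_act _ σ (EndOp.actLinear σ) (fun {p q} e => ?_) c
    refine TensorProduct.ext' fun x y => ?_
    simp [EndOp.comp_relabel]
  filtered n := star_inFil j fun q p _ => ⟨0, 0, le_rfl, hf.2 _, hg.2 _⟩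

theorem star_isHom {i j : ℤ} {f g : Family C A} (hf : IsHom i f) (hg : IsHom j g) :
    IsHom (i + j) (star j f g) where
  equivariant := (star_isSym j hf.isSym hg.isSym).1
  filtered := (star_isSym j hf.isSym hg.isSym).2
  degree n d c hc := by
    rw [star_apply]
    refine sum_mem fun qp _ => sum_mem fun e _ => Submodule.smul_mem _ _ ?_
    suffices hle : (C.obj (qp.2 + 1)).tensorDeg (C.obj qp.1) d ≤
      (EndOp.deg A n (d + (i + j))).comap (starMap j f g e) from hle (C.Δ_deg e d c hc)
    refine iSup_le fun a => Submodule.map₂_le.2 fun x hx y hy => ?_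
    rw [Submodule.mem_comap, TensorProduct.mk_apply, starMap_tmul]
    have := EndOp.comp_mem_deg e (hf.2 _ _ _ (FilteredDGModule.sgn_mem_deg _ j hx)) (hg.2 _ _ _ hy)
    convert this using 2
    ring

end Conv

namespace Conv

variable {k : Type u} [CommRing k] {C : FilteredDGCooperad.{u, v} k} {A : FilteredDGModule.{u, w} k}
  {p q r l m n : ℕ}

theorem braiding_tmul {M N : FilteredDGModule.{u, v} k} {a b : ℤ} {x : M} (hx : x ∈ M.deg a) {y : N}
    (hy : y ∈ N.deg b) : M.braiding N (x ⊗ₜ y) = zsign k (a * b) • y ⊗ₜ[k] x := by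
  simp only [FilteredDGModule.braiding, LinearMap.comp_apply, LinearMap.sub_apply,
    LinearMap.smul_apply, TensorProduct.map_tmul, LinearMap.id_apply, LinearEquiv.coe_coe, map_sub,
    map_smul, TensorProduct.comm_tmul]
  by_cases ha : Even a
  · rw [FilteredDGModule.odd_of_even _ ha hx, zsign_even k (ha.mul_right b)]
    simp
  · by_cases hb : Even b
    · rw [FilteredDGModule.odd_of_even _ hb hy, zsign_even k (hb.mul_left a)]
      simp
    · rw [FilteredDGModule.odd_of_odd _ ha hx, FilteredDGModule.odd_of_odd _ hb hy, zsign_odd k, two_smul]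
      · simp
      · simp only [Int.not_even_iff_odd] at *
        exact ha.mul hb

theorem compTensor_sequential (e : Fin r ⊕ (Fin q ⊕ Fin p) ≃ Fin n) (g : Fin r ⊕ Fin q ≃ Fin m)
    (h : Fin q ⊕ Fin p ≃ Fin l) (φ : C.obj (p + 1) →ₗ[k] EndOp.Mult A (p + 1))
    (ψ : C.obj (q + 1) →ₗ[k] EndOp.Mult A (q + 1)) (χ : C.obj r →ₗ[k] EndOp.Mult A r)
    (c : C.obj n) :
    EndOp.compTensor (((Equiv.refl (Fin r)).sumCongr h.symm).trans e)
      (TensorProduct.map ((EndOp.compTensor (TwoTree.graftLeft h) ∘ₗ TensorProduct.map φ ψ) ∘ₗ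
        C.Δ (TwoTree.graftLeft h)) χ (C.Δ (((Equiv.refl (Fin r)).sumCongr h.symm).trans e) c)) =
    EndOp.compTensor ((g.symm.sumCongr (Equiv.refl (Fin p))).trans ((Equiv.sumAssoc _ _ _).trans e))
      (TensorProduct.map φ ((EndOp.compTensor g ∘ₗ TensorProduct.map ψ χ) ∘ₗ C.Δ g)
        (C.Δ ((g.symm.sumCongr (Equiv.refl (Fin p))).trans
          ((Equiv.sumAssoc _ _ _).trans e)) c)) := by
  have hs := C.Δ_sequential e g h c
  have e1 : TensorProduct.map ((EndOp.compTensor (TwoTree.graftLeft h) ∘ₗ TensorProduct.map φ ψ) ∘ₗ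
        C.Δ (TwoTree.graftLeft h)) χ =
      TensorProduct.map (EndOp.compTensor (TwoTree.graftLeft h) ∘ₗ TensorProduct.map φ ψ) χ ∘ₗ
        (TensorProduct.assoc k _ _ _).symm.toLinearMap ∘ₗ
        ((TensorProduct.assoc k _ _ _).toLinearMap ∘ₗ
          (C.Δ (TwoTree.graftLeft h)).rTensor (C.obj r)) :=
    TensorProduct.ext' fun x y => by simp
  have e2 : TensorProduct.map φ ((EndOp.compTensor g ∘ₗ TensorProduct.map ψ χ) ∘ₗ C.Δ g) =
      TensorProduct.map φ (EndOp.compTensor g ∘ₗ TensorProduct.map ψ χ) ∘ₗ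
        (C.Δ g).lTensor (C.obj (p + 1)) :=
    TensorProduct.ext' fun x y => by simp
  rw [e1, e2]
  simp only [LinearMap.comp_apply, LinearEquiv.coe_coe]
  rw [hs]
  generalize (C.Δ g).lTensor (C.obj (p + 1)) _ = z
  have : EndOp.compTensor (A := A) (((Equiv.refl (Fin r)).sumCongr h.symm).trans e) ∘ₗ
      TensorProduct.map (EndOp.compTensor (TwoTree.graftLeft h) ∘ₗ TensorProduct.map φ ψ) χ ∘ₗ
        (TensorProduct.assoc k _ _ _).symm.toLinearMap =
      EndOp.compTensor ((g.symm.sumCongr (Equiv.refl (Fin p))).trans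
        ((Equiv.sumAssoc _ _ _).trans e)) ∘ₗ
      TensorProduct.map φ (EndOp.compTensor g ∘ₗ TensorProduct.map ψ χ) := by
    refine TensorProduct.ext' fun x yz => ?_
    refine TensorProduct.induction_on yz ?_ (fun y z => ?_) fun a b ha hb => ?_
    · simp
    · simp [EndOp.sequential e g h]
    · rw [TensorProduct.tmul_add, map_add, map_add, ha, hb]
  exact LinearMap.congr_fun this z

theorem compTensor_parallel (e : Fin r ⊕ (Fin q ⊕ Fin p) ≃ Fin n) (h : Fin q ⊕ Fin p ≃ Fin l)
    (g : Fin r ⊕ Fin p ≃ Fin m) (φ : C.obj (p + 1 + 1) →ₗ[k] EndOp.Mult A (p + 1 + 1))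
    (hφ : ∀ σ c, φ (C.act _ σ c) = EndOp.act σ (φ c)) {i j : ℤ}
    {ψ : C.obj q →ₗ[k] EndOp.Mult A q}
    (hψ : ∀ a, ∀ c ∈ (C.obj q).deg a, ψ c ∈ EndOp.deg A q (a + i))
    {χ : C.obj r →ₗ[k] EndOp.Mult A r}
    (hχ : ∀ a, ∀ c ∈ (C.obj r).deg a, χ c ∈ EndOp.deg A r (a + j)) (c : C.obj n) :
    EndOp.compTensor (((Equiv.refl (Fin r)).sumCongr h.symm).trans e)
      (TensorProduct.map ((EndOp.compTensor (TwoTree.graftRight h) ∘ₗ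
        TensorProduct.map φ (ψ ∘ₗ (C.obj q).sgn j)) ∘ₗ
        C.Δ (TwoTree.graftRight h)) χ (C.Δ (((Equiv.refl (Fin r)).sumCongr h.symm).trans e) c)) =
    zsign k (i * j) •
    EndOp.compTensor (((Equiv.refl (Fin q)).sumCongr g.symm).trans ((TwoTree.exchange q r p).trans e))
      (TensorProduct.map ((EndOp.compTensor (TwoTree.graftRight g) ∘ₗ
        TensorProduct.map φ (χ ∘ₗ (C.obj r).sgn i)) ∘ₗ
        C.Δ (TwoTree.graftRight g)) ψ (C.Δ (((Equiv.refl (Fin q)).sumCongr g.symm).trans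
          ((TwoTree.exchange q r p).trans e)) c)) := by
  have hs := C.Δ_parallel e h g c
  have e1 : ∀ {q r p l : ℕ} (h : Fin q ⊕ Fin p ≃ Fin l)
      (φ : C.obj (p + 1 + 1) →ₗ[k] EndOp.Mult A (p + 1 + 1))
      (ψ : C.obj q →ₗ[k] EndOp.Mult A q) (χ : C.obj r →ₗ[k] EndOp.Mult A r),
      TensorProduct.map ((EndOp.compTensor (TwoTree.graftRight h) ∘ₗ
        TensorProduct.map φ ψ) ∘ₗ C.Δ (TwoTree.graftRight h)) χ =
      TensorProduct.map (EndOp.compTensor (TwoTree.graftRight h) ∘ₗ TensorProduct.map φ ψ) χ ∘ₗ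
        (TensorProduct.assoc k _ _ _).symm.toLinearMap ∘ₗ
        ((TensorProduct.assoc k _ _ _).toLinearMap ∘ₗ
          (C.Δ (TwoTree.graftRight h)).rTensor (C.obj r)) := fun h φ ψ χ =>
    TensorProduct.ext' fun x y => by simp
  rw [e1, e1]
  simp only [LinearMap.comp_apply, LinearEquiv.coe_coe]
  rw [hs]
  generalize TensorProduct.assoc k (C.obj (p + 1 + 1)) (C.obj r) (C.obj q) _ = z
  have : EndOp.compTensor (A := A) (((Equiv.refl (Fin r)).sumCongr h.symm).trans e) ∘ₗ
      TensorProduct.map (EndOp.compTensor (TwoTree.graftRight h) ∘ₗ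
        TensorProduct.map φ (ψ ∘ₗ (C.obj q).sgn j)) χ ∘ₗ
        (TensorProduct.assoc k _ _ _).symm.toLinearMap ∘ₗ
        TensorProduct.map (C.act (p + 1 + 1) (Equiv.swap 0 1)) ((C.obj r).braiding (C.obj q)) =
      zsign k (i * j) • EndOp.compTensor (((Equiv.refl (Fin q)).sumCongr g.symm).trans
        ((TwoTree.exchange q r p).trans e)) ∘ₗ
      TensorProduct.map (EndOp.compTensor (TwoTree.graftRight g) ∘ₗ
        TensorProduct.map φ (χ ∘ₗ (C.obj r).sgn i)) ψ ∘ₗ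
        (TensorProduct.assoc k _ _ _).symm.toLinearMap := by
    refine TensorProduct.ext' fun x yz => ?_
    refine TensorProduct.induction_on yz ?_ (fun z y => ?_) fun a b ha hb => ?_
    · simp
    · rw [← (C.obj r).sum_decompose z, ← (C.obj q).sum_decompose y, TensorProduct.sum_tmul]
      simp only [TensorProduct.tmul_sum, map_sum]
      refine Finset.sum_congr rfl fun b _ => Finset.sum_congr rfl fun a _ => ?_
      have hz := SetLike.coe_mem (DirectSum.decompose (C.obj r).deg z b)
      have hy := SetLike.coe_mem (DirectSum.decompose (C.obj q).deg y a)
      generalize (DirectSum.decompose (C.obj r).deg z b : C.obj r) = z at hz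
      generalize (DirectSum.decompose (C.obj q).deg y a : C.obj q) = y at hy
      simp only [LinearMap.comp_apply, LinearMap.smul_apply, TensorProduct.map_tmul,
        LinearEquiv.coe_coe, TensorProduct.assoc_symm_tmul, EndOp.compTensor_tmul,
        braiding_tmul hz hy, TensorProduct.tmul_smul, map_smul]
      rw [FilteredDGModule.sgn_of_mem _ _ hz, FilteredDGModule.sgn_of_mem _ _ hy, map_smul, map_smul,
        ← EndOp.compTensor_tmul, ← EndOp.compTensor_tmul, ← EndOp.compTensor_tmul,
        ← EndOp.compTensor_tmul, TensorProduct.tmul_smul, TensorProduct.tmul_smul, map_smul, map_smul,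
        ← TensorProduct.smul_tmul', ← TensorProduct.smul_tmul', map_smul, map_smul, smul_smul,
        smul_smul]
      simp only [EndOp.compTensor_tmul]
      rw [EndOp.parallel e h g _ (hψ a y hy) (hχ b z hz), hφ, ← EndOp.act_mul_apply,
        Equiv.swap_mul_self, EndOp.act_one_apply, smul_smul]
      congr 1
      rw [← zsign_add, ← zsign_add, ← zsign_add]
      refine zsign_congr k ⟨b * a + a * j, ?_⟩
      ring
    · rw [TensorProduct.tmul_add, map_add, map_add, ha, hb]
  exact LinearMap.congr_fun this z

theorem starMap_comp_Δ_comp_sgn (i j : ℤ) (f g : Family C A) (e : Fin q ⊕ Fin p ≃ Fin n) :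
    (starMap i f g e ∘ₗ C.Δ e) ∘ₗ (C.obj n).sgn j =
      (EndOp.compTensor e ∘ₗ TensorProduct.map (f (p + 1) ∘ₗ (C.obj (p + 1)).sgn (i + j))
        (g q ∘ₗ (C.obj q).sgn j)) ∘ₗ C.Δ e := by
  ext1 c
  simp only [LinearMap.comp_apply, Δ_sgn, starMap]
  congr 1
  rw [← LinearMap.comp_apply, ← TensorProduct.map_comp]
  congr 2
  ext1 x
  simp [FilteredDGModule.sgn_sgn]

variable [Algebra ℚ k]

/-- The terms of `(f ⋆ g) ⋆ h` in which the product `f ⋆ g` is grafted along the first leaf of `g`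
cancel `f ⋆ (g ⋆ h)`. -/
theorem star_star (i j : ℤ) {f g h : Family C A} (hf : IsSym f) (hg : IsSym g) (n N : ℕ)
    (hN : n < N) (c : C.obj n) :
    star j (star i f g) h n c = star (i + j) f (star j g h) n c +
      ∑ rl ∈ Finset.HasAntidiagonal.antidiagonal n, ∑ e : Fin rl.1 ⊕ Fin rl.2 ≃ Fin n,
      (invFact k rl.1 * invFact k rl.2) • ∑ qp ∈ Finset.HasAntidiagonal.antidiagonal rl.2,
        ∑ t : Fin qp.1 ⊕ Fin qp.2 ≃ Fin rl.2, (invFact k qp.1 * invFact k qp.2) •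
        EndOp.compTensor e (TensorProduct.map ((starMap i f g (TwoTree.graftRight t) ∘ₗ
          C.Δ (TwoTree.graftRight t)) ∘ₗ (C.obj (rl.2 + 1)).sgn j) (h rl.1) (C.Δ e c)) := by
  have h1 : ∀ l, star i f g (l + 1) = ∑ qp ∈ Finset.HasAntidiagonal.antidiagonal l,
      ∑ t : Fin qp.1 ⊕ Fin qp.2 ≃ Fin l, (invFact k qp.1 * invFact k qp.2) •
        (starMap i f g (TwoTree.graftLeft t) ∘ₗ C.Δ (TwoTree.graftLeft t) +
          starMap i f g (TwoTree.graftRight t) ∘ₗ C.Δ (TwoTree.graftRight t)) := fun l => by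
    rw [star_eq]
    exact sum_tree_split (fun {q p} e => starMap i f g e ∘ₗ C.Δ e)
      fun ρ τ e => starMap_Δ_sumCongr i hf hg ρ τ e
  have h2 : ∀ (r l : ℕ) (e : Fin r ⊕ Fin l ≃ Fin n), starMap j (star i f g) h e (C.Δ e c) =
      ∑ qp ∈ Finset.HasAntidiagonal.antidiagonal l,
      ∑ t : Fin qp.1 ⊕ Fin qp.2 ≃ Fin l, (invFact k qp.1 * invFact k qp.2) •
        EndOp.compTensor e (TensorProduct.map ((starMap i f g (TwoTree.graftLeft t) ∘ₗ
          C.Δ (TwoTree.graftLeft t)) ∘ₗ (C.obj (l + 1)).sgn j) (h r) (C.Δ e c)) +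
      ∑ qp ∈ Finset.HasAntidiagonal.antidiagonal l,
      ∑ t : Fin qp.1 ⊕ Fin qp.2 ≃ Fin l, (invFact k qp.1 * invFact k qp.2) •
        EndOp.compTensor e (TensorProduct.map ((starMap i f g (TwoTree.graftRight t) ∘ₗ
          C.Δ (TwoTree.graftRight t)) ∘ₗ (C.obj (l + 1)).sgn j) (h r) (C.Δ e c)) := fun r l e => by
    rw [starMap, h1, LinearMap.comp_apply, ← Finset.sum_add_distrib]
    generalize C.Δ e c = z
    simp only [← Finset.sum_add_distrib, ← smul_add]
    simp only [← LinearMap.comp_apply, ← LinearMap.smul_apply, ← LinearMap.add_apply,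
      ← LinearMap.sum_apply]
    congr 1
    refine TensorProduct.ext' fun x y => ?_
    simp only [LinearMap.comp_apply, LinearMap.smul_apply, LinearMap.add_apply,
      LinearMap.sum_apply, TensorProduct.map_tmul, TensorProduct.sum_tmul, map_sum,
      ← TensorProduct.smul_tmul', map_smul, TensorProduct.add_tmul, map_add]
  rw [star_apply]
  simp only [h2, smul_add, Finset.sum_add_distrib]
  congr 1
  rw [sum_left_tree hN (fun {r l q p} e t => EndOp.compTensor e (TensorProduct.map
      ((starMap i f g (TwoTree.graftLeft t) ∘ₗ C.Δ (TwoTree.graftLeft t)) ∘ₗ (C.obj (l + 1)).sgn j)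
      (h r) (C.Δ e c)))
    (fun {r q p} e => EndOp.compTensor
      ((finSumFinEquiv.symm.sumCongr (Equiv.refl (Fin p))).trans ((Equiv.sumAssoc _ _ _).trans e))
      (TensorProduct.map (f (p + 1) ∘ₗ (C.obj (p + 1)).sgn (i + j))
        ((EndOp.compTensor finSumFinEquiv ∘ₗ TensorProduct.map (g (q + 1) ∘ₗ (C.obj (q + 1)).sgn j)
          (h r)) ∘ₗ C.Δ finSumFinEquiv)
        (C.Δ ((finSumFinEquiv.symm.sumCongr (Equiv.refl (Fin p))).trans
          ((Equiv.sumAssoc _ _ _).trans e)) c)))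
    fun e t => by
      rw [starMap_comp_Δ_comp_sgn]
      exact compTensor_sequential e finSumFinEquiv t _ _ _ c]
  rw [star_apply]
  have h3 : ∀ (m p : ℕ) (e : Fin m ⊕ Fin p ≃ Fin n), starMap (i + j) f (star j g h) e (C.Δ e c) =
      ∑ rq ∈ Finset.HasAntidiagonal.antidiagonal m,
      ∑ t : Fin rq.1 ⊕ Fin rq.2 ≃ Fin m, (invFact k rq.1 * invFact k rq.2) •
        EndOp.compTensor e (TensorProduct.map (f (p + 1) ∘ₗ (C.obj (p + 1)).sgn (i + j))
          (starMap j g h t ∘ₗ C.Δ t) (C.Δ e c)) := fun m p e => by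
    rw [starMap, star_eq, LinearMap.comp_apply]
    generalize C.Δ e c = z
    simp only [← LinearMap.comp_apply, ← LinearMap.smul_apply, ← LinearMap.sum_apply]
    congr 1
    refine TensorProduct.ext' fun x y => ?_
    simp only [LinearMap.comp_apply, LinearMap.smul_apply,
      LinearMap.sum_apply, TensorProduct.map_tmul, TensorProduct.tmul_sum, map_sum,
      TensorProduct.tmul_smul, map_smul]
  simp only [h3]
  symm
  refine sum_right_tree hN (fun {m p r q} e t => EndOp.compTensor e (TensorProduct.map
    (f (p + 1) ∘ₗ (C.obj (p + 1)).sgn (i + j)) (starMap j g h t ∘ₗ C.Δ t) (C.Δ e c))) _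
    fun e t => ?_
  exact (compTensor_sequential e t finSumFinEquiv _ _ _ c).symm.trans
    (compTensor_sequential e finSumFinEquiv finSumFinEquiv _ _ _ c)

/-- The graded pre-Lie identity. -/
theorem star_preLie {i j : ℤ} {f g h : Family C A} (hf : IsSym f) (hg : IsHom i g)
    (hh : IsHom j h) :
    star j (star i f g) h - star (i + j) f (star j g h) =
      zsign k (i * j) • (star i (star j f h) g - star (i + j) f (star i h g)) := by
  funext n
  ext1 c
  have h1 := star_star i j (h := h) hf hg.isSym n (n + 1) (Nat.lt_succ_self n) c
  have h2 := star_star j i (h := g) hf hh.isSym n (n + 1) (Nat.lt_succ_self n) c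
  change star j (star i f g) h n c - star (i + j) f (star j g h) n c =
    zsign k (i * j) • (star i (star j f h) g n c - star (i + j) f (star i h g) n c)
  rw [h1, add_sub_cancel_left, h2, add_comm j i, add_sub_cancel_left]
  rw [sum_left_tree (Nat.lt_succ_self n) (fun {r l q p} e t => EndOp.compTensor e (TensorProduct.map
      ((starMap i f g (TwoTree.graftRight t) ∘ₗ C.Δ (TwoTree.graftRight t)) ∘ₗ (C.obj (l + 1)).sgn j)
      (h r) (C.Δ e c)))
    (fun {r q p} e => EndOp.compTensor (((Equiv.refl (Fin r)).sumCongr finSumFinEquiv.symm).trans e)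
      (TensorProduct.map ((starMap i f g (TwoTree.graftRight finSumFinEquiv) ∘ₗ
        C.Δ (TwoTree.graftRight finSumFinEquiv)) ∘ₗ (C.obj (q + p + 1)).sgn j)
      (h r) (C.Δ (((Equiv.refl (Fin r)).sumCongr finSumFinEquiv.symm).trans e) c)))
    fun {r q p l} e t => by
      rw [starMap_comp_Δ_comp_sgn, starMap_comp_Δ_comp_sgn]
      exact (compTensor_parallel e t finSumFinEquiv _ (fun σ c => by
        rw [LinearMap.comp_apply, ← act_sgn, hf.1]; rfl) (hg.2 q) (hh.2 r) c).trans
        (compTensor_parallel e finSumFinEquiv finSumFinEquiv _ (fun σ c => by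
        rw [LinearMap.comp_apply, ← act_sgn, hf.1]; rfl) (hg.2 q) (hh.2 r) c).symm]
  rw [sum_left_tree (Nat.lt_succ_self n) (fun {r l q p} e t => EndOp.compTensor e (TensorProduct.map
      ((starMap j f h (TwoTree.graftRight t) ∘ₗ C.Δ (TwoTree.graftRight t)) ∘ₗ (C.obj (l + 1)).sgn i)
      (g r) (C.Δ e c)))
    (fun {r q p} e => EndOp.compTensor (((Equiv.refl (Fin r)).sumCongr finSumFinEquiv.symm).trans e)
      (TensorProduct.map ((starMap j f h (TwoTree.graftRight finSumFinEquiv) ∘ₗ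
        C.Δ (TwoTree.graftRight finSumFinEquiv)) ∘ₗ (C.obj (q + p + 1)).sgn i)
      (g r) (C.Δ (((Equiv.refl (Fin r)).sumCongr finSumFinEquiv.symm).trans e) c)))
    fun {r q p l} e t => by
      rw [starMap_comp_Δ_comp_sgn, starMap_comp_Δ_comp_sgn]
      exact (compTensor_parallel e t finSumFinEquiv _ (fun σ c => by
        rw [LinearMap.comp_apply, ← act_sgn, hf.1]; rfl) (hh.2 q) (hg.2 r) c).trans
        (compTensor_parallel e finSumFinEquiv finSumFinEquiv _ (fun σ c => by
        rw [LinearMap.comp_apply, ← act_sgn, hf.1]; rfl) (hh.2 q) (hg.2 r) c).symm]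
  rw [Finset.smul_sum]
  simp only [Finset.smul_sum]
  simp only [smul_comm (zsign k (i * j))]
  refine sum_exchange_tree (n + 1) _ _ fun {r q p} e => ?_
  rw [starMap_comp_Δ_comp_sgn, starMap_comp_Δ_comp_sgn]
  have := compTensor_parallel e finSumFinEquiv finSumFinEquiv (f (p + 1 + 1) ∘ₗ
    (C.obj (p + 1 + 1)).sgn (i + j)) (fun σ c => by
        rw [LinearMap.comp_apply, ← act_sgn, hf.1]; rfl) (hg.2 q) (hh.2 r) c
  rw [add_comm j i]
  exact this

end Conv

namespace EndOp

variable {k : Type u} [CommRing k] {A B : FilteredDGModule.{u, w} k} {p q n m : ℕ}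

/-- The composite of a multilinear map with a linear map on the left, and with another one on
all its arguments. -/
def conj (α : A →ₗ[k] B) (β : B →ₗ[k] A) (n : ℕ) : Mult A n →ₗ[k] Mult B n where
  toFun f := α.compMultilinearMap (f.compLinearMap fun _ => β)
  map_add' f g := by ext a; simp
  map_smul' c f := by ext a; simp

theorem conj_apply (α : A →ₗ[k] B) (β : B →ₗ[k] A) (f : Mult A n) (a : Fin n → B) :
    conj α β n f a = α (f fun s => β (a s)) := rfl

theorem conj_rearrange (α : A →ₗ[k] B) (β : B →ₗ[k] A) (hβ : ∀ i, ∀ x ∈ B.deg i, β x ∈ A.deg i)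
    (σ : Fin m ≃ Fin n) (f : Mult A m) :
    conj α β n (rearrange σ f) = rearrange σ (conj α β m f) := by
  refine mult_ext fun a d h => ?_
  rw [conj_apply, rearrange_apply σ f (fun s => hβ _ _ (h s)), rearrange_apply σ _ h, map_smul]
  rfl

theorem conj_comp (α : A →ₗ[k] B) (β : B →ₗ[k] A) (hβ : ∀ i, ∀ x ∈ B.deg i, β x ∈ A.deg i)
    (e : Fin q ⊕ Fin p ≃ Fin n) {f : Mult A (p + 1)} {g : Mult A q} {f' : Mult B (p + 1)}
    {g' : Mult B q}
    (h : ∀ a b, α (f (Fin.cons (g fun s => β (a s)) fun s => β (b s))) =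
      f' (Fin.cons (g' a) b)) :
    conj α β n (comp e f g) = comp e f' g' := by
  rw [comp_eq, comp_eq, conj_rearrange α β hβ]
  congr 1
  ext a
  rw [conj_apply, compFirst_apply, compFirst_apply]
  exact h _ _

/-- A linear map as a multilinear map in one variable. -/
def unary (L : A →ₗ[k] A) : Mult A 1 := MultilinearMap.ofSubsingleton k A A (0 : Fin 1) L

theorem unary_apply (L : A →ₗ[k] A) (a : Fin 1 → A) : unary L a = L (a 0) := rfl

theorem unary_comp (L : A →ₗ[k] A) (f : Mult A n) :
    comp (p := 0) (Equiv.sumEmpty (Fin n) (Fin 0)) (unary L) f = L.compMultilinearMap f := by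
  have := conj_comp L LinearMap.id (fun _ _ h => h) (Equiv.sumEmpty (Fin n) (Fin 0))
    (f := one) (g := f) (f' := unary L) (g' := f) fun a b => by
      rw [one_apply, unary_apply]
      rfl
  rw [← this, one_comp]
  rfl

theorem comp_unary_apply (f : Mult A (p + 1)) (L : A →ₗ[k] A) (a : Fin (p + 1) → A) :
    comp (TwoTree.unitRight p) f (unary L) a = f (Function.update a 0 (L (a 0))) := by
  have h := conj_comp LinearMap.id LinearMap.id (fun _ _ h => h) (TwoTree.unitRight p)
    (f := f) (g := unary L) (f' := f.compLinearMap (Function.update (fun _ => LinearMap.id) 0 L))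
    (g' := one) fun a b => by
      rw [MultilinearMap.compLinearMap_apply, LinearMap.id_apply]
      congr 1
      funext s
      refine Fin.cases ?_ (fun s => ?_) s
      · simp [unary_apply, one_apply]
      · simp
  rw [comp_one] at h
  have h2 := congrArg (fun x => x a) h
  rw [conj_apply] at h2
  refine h2.trans ?_
  rw [MultilinearMap.compLinearMap_apply]
  congr 1
  funext s
  refine Fin.cases ?_ (fun s => ?_) s
  · simp
  · simp

end EndOp

namespace Conv

variable {k : Type u} [CommRing k] {C : FilteredDGCooperad.{u, v} k} {A B : FilteredDGModule.{u, w} k}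

/-- Conjugation of a family by linear maps. -/
def conj (α : A →ₗ[k] B) (β : B →ₗ[k] A) : Family C A →ₗ[k] Family C B where
  toFun f n := EndOp.conj α β n ∘ₗ f n
  map_add' f g := by funext n; ext1 c; simp
  map_smul' a f := by funext n; ext1 c; simp

theorem conj_apply (α : A →ₗ[k] B) (β : B →ₗ[k] A) (f : Family C A) (n : ℕ) (c : C.obj n) :
    conj α β f n c = EndOp.conj α β n (f n c) := rfl

/-- The counit of `C` followed by a linear endomorphism of `A`. -/
def scalar (L : A →ₗ[k] A) : Family C A
  | 0 => 0
  | 1 => C.counit.smulRight (EndOp.unary L)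
  | _ + 2 => 0

theorem unit_eq_scalar : (unit : Family C A) = scalar LinearMap.id := by
  funext n
  match n with
  | 0 => rfl
  | 1 => rfl
  | _ + 2 => rfl

theorem delta_eq_scalar : (delta : Family C A) = scalar A.d := by
  funext n
  match n with
  | 0 => rfl
  | 1 => rfl
  | _ + 2 => rfl

theorem counit_sgn (j : ℤ) (c : C.obj 1) : C.counit ((C.obj 1).sgn j c) = C.counit c := by
  have : C.counit ∘ₗ (C.obj 1).sgn j = C.counit := FilteredDGModule.linearMap_ext _ fun i x hx => by
    rw [LinearMap.comp_apply, FilteredDGModule.sgn_of_mem _ _ hx, map_smul]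
    by_cases hi : i = 0
    · simp [hi, zsign_zero]
    · simp [C.counit_deg i x hi hx]
  exact LinearMap.congr_fun this c

theorem scalar_isHom {L : A →ₗ[k] A} {j : ℤ} (hd : ∀ i, ∀ x ∈ A.deg i, L x ∈ A.deg (i + j))
    (hf : ∀ l, ∀ x ∈ A.fil l, L x ∈ A.fil l) : IsHom j (scalar L : Family C A) where
  equivariant n σ c := match n with
    | 0 => (map_zero (EndOp.actLinear σ)).symm
    | 1 => by
      rw [Subsingleton.elim σ 1, EndOp.act_one_apply]
      simp
    | _ + 2 => (map_zero (EndOp.actLinear σ)).symm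
  degree n i c hc := match n with
    | 0 => zero_mem _
    | 1 => by
      change C.counit c • EndOp.unary L ∈ _
      by_cases hi : i = 0
      · subst hi
        refine Submodule.smul_mem _ _ fun a d h => ?_
        simpa [EndOp.unary_apply] using hd _ _ (h 0)
      · rw [C.counit_deg i c hi hc, zero_smul]
        exact zero_mem _
    | _ + 2 => zero_mem _
  filtered n := match n with
    | 0 => fun _ _ _ => zero_mem _
    | 1 => fun i c hc => by
      change C.counit c • EndOp.unary L ∈ _
      rcases Nat.eq_zero_or_pos i with hi | hi
      · subst hi
        refine Submodule.smul_mem _ _ fun a d h => ?_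
        simpa [EndOp.unary_apply] using hf _ _ (h 0)
      · rw [C.counit_fil c (FilteredDGModule.fil_mono _ hi hc), zero_smul]
        exact zero_mem _
    | _ + 2 => fun _ _ _ => zero_mem _

theorem unit_isHom : IsHom 0 (unit : Family C A) := by
  rw [unit_eq_scalar]
  exact scalar_isHom (fun i x hx => by simpa using hx) fun _ _ h => h

theorem delta_isHom : IsHom (-1) (delta : Family C A) := by
  rw [delta_eq_scalar]
  exact scalar_isHom A.d_deg A.d_fil

/-- Precomposition with the differential of `C`. -/
def precompD : Family C A →ₗ[k] Family C A where
  toFun f n := f n ∘ₗ (C.obj n).d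
  map_add' _ _ := rfl
  map_smul' _ _ := rfl

theorem precompD_apply (f : Family C A) (n : ℕ) (c : C.obj n) :
    precompD f n c = f n ((C.obj n).d c) := rfl

theorem precompD_precompD (f : Family C A) : precompD (precompD f) = 0 := by
  funext n; ext1 c
  simp [precompD_apply, (C.obj n).d_d]

theorem precompD_isSym {f : Family C A} (hf : IsSym f) : IsSym (precompD f) where
  equivariant n σ c := by rw [precompD_apply, ← C.act_d, hf.1]; rfl
  filtered n i c hc := hf.2 n i _ ((C.obj n).d_fil i c hc)

theorem precompD_isHom {j : ℤ} {f : Family C A} (hf : IsHom j f) : IsHom (j - 1) (precompD f) where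
  equivariant := (precompD_isSym hf.isSym).1
  degree n i c hc := by
    have := hf.2 n _ _ ((C.obj n).d_deg i c hc)
    rw [precompD_apply]
    convert this using 2
    ring
  filtered := (precompD_isSym hf.isSym).2

theorem precompD_scalar (L : A →ₗ[k] A) : precompD (scalar L : Family C A) = 0 := by
  funext n; ext1 c
  match n with
  | 0 => rfl
  | 1 =>
    change C.counit ((C.obj 1).d c) • EndOp.unary L = 0
    rw [C.counit_d, zero_smul]
  | _ + 2 => rfl

theorem precompD_delta : precompD (delta : Family C A) = 0 := by
  rw [delta_eq_scalar, precompD_scalar]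

theorem precompD_unit : precompD (unit : Family C A) = 0 := by
  rw [unit_eq_scalar, precompD_scalar]

variable [Algebra ℚ k]

theorem star_conj (α : A →ₗ[k] B) (β : B →ₗ[k] A) (hβ : ∀ i, ∀ x ∈ B.deg i, β x ∈ A.deg i) (j : ℤ)
    {f g : Family C A} {f' g' : Family C B}
    (h : ∀ (p q : ℕ) (x : C.obj (p + 1)) (y : C.obj q) a b,
      α (f _ x (Fin.cons (g _ y fun s => β (a s)) fun s => β (b s))) =
        f' _ x (Fin.cons (g' _ y a) b)) :
    conj α β (star j f g) = star j f' g' := by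
  funext n; ext1 c
  rw [conj_apply, star_apply, star_apply]
  simp only [map_sum, map_smul]
  refine Finset.sum_congr rfl fun qp _ => Finset.sum_congr rfl fun e _ => ?_
  congr 1
  rw [← LinearMap.comp_apply]
  congr 1
  refine TensorProduct.ext' fun x y => ?_
  rw [LinearMap.comp_apply, starMap_tmul, starMap_tmul]
  exact EndOp.conj_comp α β hβ e (h _ _ _ _)

theorem precompD_star (j : ℤ) (f g : Family C A) :
    precompD (star j f g) = zsign k j • star j (precompD f) g + star (j - 1) f (precompD g) := by
  rw [star_congr (show Even (j - 1 - (j + 1)) from ⟨-1, by ring⟩)]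
  funext n; ext1 c
  rw [precompD_apply, family_add_apply, family_smul_apply, star_apply, star_apply, star_apply,
    Finset.smul_sum]
  simp only [Finset.smul_sum, ← Finset.sum_add_distrib]
  refine Finset.sum_congr rfl fun qp _ => Finset.sum_congr rfl fun e _ => ?_
  rw [smul_comm (zsign k j), ← smul_add, C.Δ_d, map_add]
  generalize C.Δ e c = z
  congr 2
  · rw [← LinearMap.comp_apply, ← LinearMap.smul_apply]
    congr 1
    refine TensorProduct.ext' fun x y => ?_
    rw [LinearMap.comp_apply, TensorProduct.map_tmul, LinearMap.smul_apply, starMap_tmul,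
      starMap_tmul, ← EndOp.compTensor_tmul, ← EndOp.compTensor_tmul, ← map_smul,
      TensorProduct.smul_tmul', ← map_smul]
    refine congrArg (fun x => EndOp.compTensor e (x ⊗ₜ[k] g qp.1 y)) ?_
    rw [precompD_apply, ← map_smul]
    refine congrArg (f (qp.2 + 1)) ?_
    have : (C.obj (qp.2 + 1)).sgn j ∘ₗ (C.obj (qp.2 + 1)).d =
        zsign k j • (C.obj (qp.2 + 1)).d ∘ₗ (C.obj (qp.2 + 1)).sgn j :=
      FilteredDGModule.linearMap_ext _ fun i x hx => by
        rw [LinearMap.comp_apply, LinearMap.smul_apply, LinearMap.comp_apply,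
          FilteredDGModule.sgn_of_mem _ _ hx,
          FilteredDGModule.sgn_of_mem _ _ ((C.obj (qp.2 + 1)).d_deg i x hx), map_smul, smul_smul,
          ← zsign_add]
        congr 1
        exact zsign_congr k ⟨-j, by ring⟩
    rw [map_smul, map_smul]
    exact LinearMap.congr_fun this x
  · rw [← LinearMap.comp_apply]
    congr 1
    refine TensorProduct.ext' fun x y => ?_
    rw [LinearMap.comp_apply, TensorProduct.map_tmul, starMap_tmul, starMap_tmul,
      FilteredDGModule.sgn_sgn]
    rfl

theorem scalar_star {L : A →ₗ[k] A} (hL : IsSym (scalar L : Family C A)) (j : ℤ)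
    {f : Family C A} (hf : IsSym f) (n : ℕ) (c : C.obj n) :
    star j (scalar L) f n c = L.compMultilinearMap (f n c) := by
  have h0 : starMap j (scalar L) f (Equiv.sumEmpty (Fin n) (Fin 0)) (C.Δ (Equiv.sumEmpty (Fin n) (Fin 0)) c)
      = L.compMultilinearMap (f n c) := by
    conv_rhs => rw [← C.counit_left c]
    generalize C.Δ (Equiv.sumEmpty (Fin n) (Fin 0)) c = z
    induction z using TensorProduct.induction_on with
    | zero => simp
    | add x y hx hy =>
      rw [map_add, hx, hy, map_add, map_add, map_add]
      ext a
      simp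
    | tmul x y =>
      rw [starMap_tmul]
      simp only [LinearMap.rTensor_tmul, TensorProduct.lid_tmul, map_smul]
      change EndOp.comp _ (C.counit _ • EndOp.unary L) _ = _
      rw [counit_sgn, ← EndOp.compTensor_tmul, ← TensorProduct.smul_tmul', map_smul,
        EndOp.compTensor_tmul, EndOp.unary_comp]
      ext a
      simp
  rw [star_apply, Finset.sum_eq_single (n, 0)]
  · have : ∀ e : Fin n ⊕ Fin 0 ≃ Fin n, starMap j (scalar L) f e (C.Δ e c) =
        L.compMultilinearMap (f n c) := fun e => by
      rw [← h0]
      have := starMap_Δ_sumCongr j (f := scalar L) (g := f) hL hf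
        ((Equiv.sumEmpty (Fin n) (Fin 0)).symm.trans e) (Equiv.refl _) (Equiv.sumEmpty (Fin n) (Fin 0))
      have he : ((Equiv.sumCongr ((Equiv.sumEmpty (Fin n) (Fin 0)).symm.trans e)
        (Equiv.refl _)).trans (Equiv.sumEmpty (Fin n) (Fin 0))) = e := by
        ext x
        rcases x with x | x
        · simp
        · exact x.elim0
      rw [he] at this
      exact LinearMap.congr_fun this c
    simp only [this]
    rw [Finset.sum_const, Finset.card_univ, Fintype.card_equiv (Equiv.sumEmpty (Fin n) (Fin 0)).symm.symm,
      Fintype.card_sum, Fintype.card_fin, Fintype.card_fin, ← Nat.cast_smul_eq_nsmul k, smul_smul]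
    have h1 := invFact_mul_factorial (k := k) n
    have h2 := invFact_mul_factorial (k := k) 0
    simp only [Nat.factorial_zero, Nat.cast_one, mul_one] at h2
    rw [add_zero, h2, mul_one, mul_comm, h1, one_smul]
  · rintro ⟨q, p⟩ _ hne
    have hqp := ‹_ ∈ Finset.HasAntidiagonal.antidiagonal n›
    rw [Finset.HasAntidiagonal.mem_antidiagonal] at hqp
    simp only at hqp
    refine Finset.sum_eq_zero fun e _ => ?_
    match p with
    | 0 => exact absurd (by simpa using hqp) (by simpa using hne)
    | p + 1 =>
      have : starMap j (scalar L) f e = 0 := TensorProduct.ext' fun x y => by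
        rw [starMap_tmul, ← EndOp.compTensor_tmul]
        change EndOp.compTensor e (0 ⊗ₜ _) = _
        simp
      rw [this]
      simp
  · intro h
    exact absurd (Finset.HasAntidiagonal.mem_antidiagonal.2 (by simp)) h

end Conv

namespace EndOp

variable {k : Type u} [CommRing k] {A : FilteredDGModule.{u, w} k} {n p : ℕ}

theorem act_comp_unary_apply (σ : Equiv.Perm (Fin (p + 1))) (f : Mult A (p + 1))
    {a : Fin (p + 1) → A} {j : Fin (p + 1) → ℤ} (h : ∀ s, a s ∈ A.deg (j s)) :
    act σ (comp (TwoTree.unitRight p) (act σ⁻¹ f) (unary A.d)) a =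
      beforeSign k id (σ 0) j • f (Function.update a (σ 0) (A.d (a (σ 0)))) := by
  have hu : ∀ s, Function.update (fun t => a (σ t)) 0 (A.d (a (σ 0))) s ∈
      A.deg (Function.update (fun t => j (σ t)) 0 (j (σ 0) - 1) s) :=
    fun s => forall_update_mem (a := fun t => a (σ t)) (fun s => h (σ s)) 0 s
  have e1 : (fun s => Function.update (fun t => a (σ t)) 0 (A.d (a (σ 0))) (σ⁻¹ s)) =
      Function.update a (σ 0) (A.d (a (σ 0))) := by
    rw [← Function.update_comp_eq_of_injective' a σ.injective]
    simp
  have e2 : orderSign k id ⇑σ⁻¹ (fun s => Function.update (fun t => j (σ t)) 0 (j (σ 0) - 1) (σ⁻¹ s)) =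
      orderSign k σ id (Function.update (fun t => j (σ t)) 0 (j (σ 0) - 1)) := by
    rw [← orderSign_reindex k σ⁻¹ σ id]
    congr 1
    funext s
    simp
  rw [act, rearrange_apply σ _ h, comp_unary_apply, act, rearrange_apply σ⁻¹ _ hu, e1, smul_smul, e2]
  congr 1
  have h3 := orderSign_update k (x := σ) (y := id) σ.injective Function.injective_id
    (fun t => j (σ t)) 0
  rw [beforeSign_zero, mul_one] at h3
  rw [h3, ← mul_assoc, orderSign_mul k Function.injective_id σ.injective Function.injective_id,
    orderSign_eq_one k (fun _ _ h => h), one_mul]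
  exact beforeSign_reindex k σ id 0 j

end EndOp

namespace Conv

variable {k : Type u} [CommRing k] [Algebra ℚ k] {C : FilteredDGCooperad.{u, v} k}
  {A : FilteredDGModule.{u, w} k}

theorem sum_perm_apply_zero {V : Type*} [AddCommGroup V] {p : ℕ} (F : Fin (p + 1) → V) :
    ∑ σ : Equiv.Perm (Fin (p + 1)), F (σ 0) = p.factorial • ∑ s, F s := by
  rw [← Equiv.Perm.decomposeFin.symm.sum_comp]
  simp only [Equiv.Perm.decomposeFin_symm_apply_zero, Fintype.sum_prod_type, Finset.sum_const,
    Finset.card_univ, Fintype.card_perm, Fintype.card_fin, Finset.smul_sum]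

theorem star_delta_apply (j : ℤ) {f : Family C A} (hf : IsSym f) {n : ℕ} {i : ℤ} {c : C.obj n}
    (hc : c ∈ (C.obj n).deg i) {a : Fin n → A} {d : Fin n → ℤ} (h : ∀ s, a s ∈ A.deg (d s)) :
    star j f delta n c a = zsign k (j * i) •
      ∑ s, beforeSign k id s d • f n c (Function.update a s (A.d (a s))) := by
  have hz : ∀ {p q : ℕ} (e : Fin q ⊕ Fin p ≃ Fin n), q ≠ 1 →
      starMap j f delta e (C.Δ e c) = 0 := fun {p q} e hq => by
    have : starMap j f delta e = 0 := TensorProduct.ext' fun x y => by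
      rw [starMap_tmul, ← EndOp.compTensor_tmul]
      match q with
      | 0 =>
        change EndOp.compTensor e (_ ⊗ₜ 0) = _
        simp
      | 1 => exact absurd rfl hq
      | q + 2 =>
        change EndOp.compTensor e (_ ⊗ₜ 0) = _
        simp
    rw [this]
    rfl
  match n with
  | 0 =>
    rw [star_apply, Finset.sum_eq_zero, Finset.univ_eq_empty, Finset.sum_empty, smul_zero]
    · rfl
    · intro qp hqp
      refine Finset.sum_eq_zero fun e _ => ?_
      rw [hz e, smul_zero]
      have := eq_of_sumEquiv e
      omega
  | p + 1 =>
    have hr : ∀ c' : C.obj (p + 1), starMap j f delta (TwoTree.unitRight p) (C.Δ (TwoTree.unitRight p) c') =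
        EndOp.comp (TwoTree.unitRight p) (f (p + 1) ((C.obj (p + 1)).sgn j c')) (EndOp.unary A.d) :=
      fun c' => by
      conv_rhs => rw [← C.counit_right c']
      generalize C.Δ (TwoTree.unitRight p) c' = z
      induction z using TensorProduct.induction_on with
      | zero =>
        simp only [map_zero]
        rw [← EndOp.compTensor_tmul, TensorProduct.zero_tmul, map_zero]
      | add x y hx hy =>
        rw [map_add, hx, hy]
        simp only [map_add]
        rw [← EndOp.compTensor_tmul, ← EndOp.compTensor_tmul, ← EndOp.compTensor_tmul,
          TensorProduct.add_tmul, map_add]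
      | tmul x y =>
        rw [starMap_tmul]
        simp only [LinearMap.lTensor_tmul, TensorProduct.rid_tmul, map_smul]
        change EndOp.comp _ _ (C.counit y • EndOp.unary A.d) = _
        rw [← EndOp.compTensor_tmul, ← EndOp.compTensor_tmul, TensorProduct.tmul_smul,
          TensorProduct.smul_tmul']
    rw [star_apply, Finset.sum_eq_single (1, p)]
    · let E := (TwoTree.unitRight p).symm.equivCongr (Equiv.refl (Fin (p + 1)))
      have hE : ∀ σ, E σ = (TwoTree.unitRight p).trans σ := fun σ => by
        ext x; simp [E]
      rw [← E.sum_comp]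
      have ht : ∀ σ : Equiv.Perm (Fin (p + 1)), starMap j f delta (E σ) (C.Δ (E σ) c) =
          EndOp.act σ (EndOp.comp (TwoTree.unitRight p)
            (EndOp.act σ⁻¹ (zsign k (j * i) • f (p + 1) c)) (EndOp.unary A.d)) := fun σ => by
        have h1 := C.Δ_relabel (TwoTree.unitRight p) σ (C.act _ σ⁻¹ c)
        rw [← Module.End.mul_apply, ← map_mul, mul_inv_cancel, map_one, Module.End.one_apply] at h1
        rw [hE, h1]
        have h2 : starMap j f delta ((TwoTree.unitRight p).trans σ) =
            EndOp.actLinear σ ∘ₗ starMap j f delta (TwoTree.unitRight p) :=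
          TensorProduct.ext' fun x y => by
            simp [starMap_tmul, EndOp.comp_relabel]
        rw [h2, LinearMap.comp_apply, hr, ← act_sgn, hf.1, FilteredDGModule.sgn_of_mem _ _ hc,
          map_smul]
        rfl
      simp only [ht]
      rw [← Finset.smul_sum, smul_apply, sum_apply]
      simp only [EndOp.act_comp_unary_apply _ _ h]
      rw [sum_perm_apply_zero (fun s => beforeSign k id s d •
        (zsign k (j * i) • f (p + 1) c) (Function.update a s (A.d (a s)))),
        ← Nat.cast_smul_eq_nsmul k, smul_smul]
      have h1 := invFact_mul_factorial (k := k) p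
      have h2 := invFact_mul_factorial (k := k) 1
      simp only [Nat.factorial_one, Nat.cast_one, mul_one] at h2
      rw [h2, one_mul, h1, one_smul, Finset.smul_sum]
      refine Finset.sum_congr rfl fun s _ => ?_
      rw [smul_apply, smul_comm]
    · rintro ⟨q, p'⟩ hqp hne
      rw [Finset.HasAntidiagonal.mem_antidiagonal] at hqp
      refine Finset.sum_eq_zero fun e _ => ?_
      rw [hz e, smul_zero]
      rintro rfl
      simp only at hqp
      exact hne (by rw [show p' = p by omega])
    · intro hh
      exact absurd (Finset.HasAntidiagonal.mem_antidiagonal.2 (by simp [add_comm])) hh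

theorem delta_star (j : ℤ) {f : Family C A} (hf : IsSym f) (n : ℕ) (c : C.obj n) :
    star j delta f n c = A.d.compMultilinearMap (f n c) := by
  rw [delta_eq_scalar]
  exact scalar_star (delta_eq_scalar (C := C) (A := A) ▸ delta_isHom.isSym) j hf n c

theorem unit_star (j : ℤ) {f : Family C A} (hf : IsSym f) : star j unit f = f := by
  funext n; ext1 c
  rw [unit_eq_scalar, scalar_star (unit_eq_scalar (C := C) (A := A) ▸ unit_isHom.isSym) j hf n c]
  rfl

theorem diff_eq {j : ℤ} {f : Family C A} (hf : IsHom j f) :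
    diff j f = star j delta f - zsign k j • star (-1) f delta - zsign k j • precompD f := by
  funext n
  refine FilteredDGModule.linearMap_ext _ fun i c hc => ?_
  refine EndOp.mult_ext fun a d h => ?_
  change EndOp.d (f n c) a - zsign k j • f n ((C.obj n).d c) a = star j delta f n c a -
    zsign k j • star (-1) f delta n c a - zsign k j • f n ((C.obj n).d c) a
  rw [EndOp.d_apply (hf.2 n i c hc) h, delta_star j hf.isSym, star_delta_apply (-1) hf.isSym hc h,
    smul_smul, ← zsign_add, zsign_congr k (show Even (i + j - (j + -1 * i)) from ⟨i, by ring⟩)]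
  rfl

theorem delta_star_delta : star (-1) (delta : Family C A) delta = 0 := by
  funext n; ext1 c
  rw [delta_star _ delta_isHom.isSym]
  ext a
  match n with
  | 0 => exact A.d.map_zero
  | 1 =>
    change A.d (C.counit c • A.d (a 0)) = 0
    rw [map_smul, A.d_d, smul_zero]
  | _ + 2 => exact A.d.map_zero

end Conv

namespace FilteredDGModule

variable {k : Type u} [CommRing k] (A B : FilteredDGModule.{u, w} k)

/-- The decomposition of a pair into pairs of homogeneous elements. -/
def decomposePair : A × B →ₗ[k] DirectSum ℤ fun i => (A.deg i).prod (B.deg i) :=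
  LinearMap.coprod
    (DirectSum.lmap (fun i => (LinearMap.inl k A B).restrict (p := A.deg i)
      (q := (A.deg i).prod (B.deg i)) fun _ hx => ⟨hx, zero_mem _⟩) ∘ₗ
      (DirectSum.decomposeLinearEquiv A.deg).toLinearMap)
    (DirectSum.lmap (fun i => (LinearMap.inr k A B).restrict (p := B.deg i)
      (q := (A.deg i).prod (B.deg i)) fun _ hx => ⟨zero_mem _, hx⟩) ∘ₗ
      (DirectSum.decomposeLinearEquiv B.deg).toLinearMap)

theorem decomposePair_apply (x : A × B) (i : ℤ) : (decomposePair A B x i : A × B) =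
    ((DirectSum.decompose A.deg x.1 i : A), (DirectSum.decompose B.deg x.2 i : B)) := by
  simp only [decomposePair, LinearMap.coprod_apply, LinearMap.comp_apply, LinearEquiv.coe_coe,
    DirectSum.decomposeLinearEquiv_apply, DirectSum.add_apply, DirectSum.lmap_apply,
    Submodule.coe_add]
  ext
  · exact add_zero _
  · exact zero_add _

instance decompositionPair : DirectSum.Decomposition fun i => (A.deg i).prod (B.deg i) where
  decompose' := decomposePair A B
  left_inv x := by
    have : DirectSum.coeLinearMap (fun i => (A.deg i).prod (B.deg i)) ∘ₗ decomposePair A B =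
        LinearMap.id := by
      refine LinearMap.prod_ext (A.linearMap_ext fun i x hx => ?_) (B.linearMap_ext fun i x hx => ?_)
      · simp only [LinearMap.comp_apply, decomposePair, LinearMap.coprod_apply, LinearEquiv.coe_coe,
          LinearMap.inl_apply, map_zero, add_zero, DirectSum.decomposeLinearEquiv_apply,
          DirectSum.decompose_of_mem _ hx, LinearMap.id_apply]
        erw [DirectSum.lmap_lof, DirectSum.coeLinearMap_lof]
        rfl
      · simp only [LinearMap.comp_apply, decomposePair, LinearMap.coprod_apply, LinearEquiv.coe_coe,
          LinearMap.inr_apply, map_zero, zero_add, DirectSum.decomposeLinearEquiv_apply,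
          DirectSum.decompose_of_mem _ hx, LinearMap.id_apply]
        erw [DirectSum.lmap_lof, DirectSum.coeLinearMap_lof]
        rfl
    exact LinearMap.congr_fun this x
  right_inv y := by
    have : decomposePair A B ∘ₗ DirectSum.coeLinearMap (fun i => (A.deg i).prod (B.deg i)) =
        LinearMap.id := by
      refine DirectSum.linearMap_ext _ fun i => LinearMap.ext fun x => ?_
      refine DFinsupp.ext fun j => Subtype.ext ?_
      rw [LinearMap.comp_apply, LinearMap.comp_apply, DirectSum.coeLinearMap_lof,
        LinearMap.comp_apply, LinearMap.id_apply, DirectSum.lof_eq_of]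
      refine (decomposePair_apply A B _ j).trans ?_
      rcases eq_or_ne i j with rfl | hij
      · rw [DirectSum.decompose_of_mem_same _ x.2.1, DirectSum.decompose_of_mem_same _ x.2.2,
          DirectSum.of_eq_same]
      · rw [DirectSum.decompose_of_mem_ne _ x.2.1 hij, DirectSum.decompose_of_mem_ne _ x.2.2 hij,
          DirectSum.of_eq_of_ne _ _ _ hij.symm]
        rfl
    exact LinearMap.congr_fun this y

/-- The product of two filtered graded modules, with zero differential. -/
def prod : FilteredDGModule.{u, w} k where
  carrier := A × B
  deg i := (A.deg i).prod (B.deg i)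
  fil l := (A.fil l).prod (B.fil l)
  fil_zero := by rw [A.fil_zero, B.fil_zero, Submodule.prod_top]
  fil_antitone l m h := Submodule.prod_mono (A.fil_antitone h) (B.fil_antitone h)
  fil_homogeneous l x hx i := by
    change (decomposePair A B x i : A × B) ∈ _
    rw [decomposePair_apply]
    exact ⟨A.fil_homogeneous l _ hx.1 i, B.fil_homogeneous l _ hx.2 i⟩
  d := 0
  d_deg _ _ _ := zero_mem _
  d_fil _ _ _ := zero_mem _
  d_d _ := rfl

theorem decompose_prod (x : A.prod B) (i : ℤ) :
    (DirectSum.decompose (A.prod B).deg x i : A.prod B) =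
      ((DirectSum.decompose A.deg x.1 i : A), (DirectSum.decompose B.deg x.2 i : B)) :=
  decomposePair_apply A B x i

/-- A linear map preserves degrees and filtrations. -/
structure IsStrict {A B : FilteredDGModule.{u, w} k} (f : A →ₗ[k] B) : Prop where
  deg : ∀ i, ∀ x ∈ A.deg i, f x ∈ B.deg i
  fil : ∀ i, ∀ x ∈ A.fil i, f x ∈ B.fil i

/-- The first inclusion. -/
def inl : A →ₗ[k] A.prod B := LinearMap.inl k A B

/-- The second inclusion. -/
def inr : B →ₗ[k] A.prod B := LinearMap.inr k A B

/-- The first projection. -/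
def fst : A.prod B →ₗ[k] A := LinearMap.fst k A B

/-- The second projection. -/
def snd : A.prod B →ₗ[k] B := LinearMap.snd k A B

theorem isStrict_inl : IsStrict (inl A B) :=
  ⟨fun _ _ hx => ⟨hx, zero_mem _⟩, fun _ _ hx => ⟨hx, zero_mem _⟩⟩

theorem isStrict_inr : IsStrict (inr A B) :=
  ⟨fun _ _ hx => ⟨zero_mem _, hx⟩, fun _ _ hx => ⟨zero_mem _, hx⟩⟩

theorem isStrict_fst : IsStrict (fst A B) := ⟨fun _ _ hx => hx.1, fun _ _ hx => hx.1⟩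

theorem isStrict_snd : IsStrict (snd A B) := ⟨fun _ _ hx => hx.2, fun _ _ hx => hx.2⟩

variable {A B}

theorem IsStrict.comp {D : FilteredDGModule.{u, w} k} {f : A →ₗ[k] B} {g : B →ₗ[k] D}
    (hg : IsStrict g) (hf : IsStrict f) : IsStrict (g ∘ₗ f) :=
  ⟨fun i x hx => hg.1 i _ (hf.1 i x hx), fun i x hx => hg.2 i _ (hf.2 i x hx)⟩

theorem IsStrict.add {f g : A →ₗ[k] B} (hf : IsStrict f) (hg : IsStrict g) : IsStrict (f + g) :=
  ⟨fun i x hx => add_mem (hf.1 i x hx) (hg.1 i x hx),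
    fun i x hx => add_mem (hf.2 i x hx) (hg.2 i x hx)⟩

@[simp] theorem fst_inl (x : A) : fst A B (inl A B x) = x := rfl
@[simp] theorem snd_inl (x : A) : snd A B (inl A B x) = 0 := rfl
@[simp] theorem fst_inr (x : B) : fst A B (inr A B x) = 0 := rfl
@[simp] theorem snd_inr (x : B) : snd A B (inr A B x) = x := rfl

variable (A) in
/-- The map which forgets the colours. -/
def fold : A.prod A →ₗ[k] A := fst A A + snd A A

theorem isStrict_fold : IsStrict (fold A) := (isStrict_fst A A).add (isStrict_snd A A)

@[simp] theorem fold_inl (x : A) : fold A (inl A A x) = x := add_zero x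
@[simp] theorem fold_inr (x : A) : fold A (inr A A x) = x := zero_add x

variable (A) in
/-- A filtration by homogeneous submodules indexed by the integers, comparable to `fil` at double
speed. -/
structure Weighting where
  part : ℤ → Submodule k A
  antitone : Antitone part
  homogeneous : ∀ m, ∀ x ∈ part m, ∀ i, (DirectSum.decompose A.deg x i : A) ∈ part m
  bound : ℕ
  le_fil : ∀ m, part m ≤ A.fil ((m + 1) / 2).toNat
  fil_le : ∀ m : ℤ, A.fil ((m + bound + 1) / 2).toNat ≤ part m

variable (A) in
/-- The filtration for which everything has weight `w`. -/
def Weighting.point (w : ℕ) : A.Weighting where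
  part m := A.fil ((m + w + 1) / 2).toNat
  antitone _ _ h := A.fil_antitone (by omega)
  homogeneous _ := A.fil_homogeneous _
  bound := w
  le_fil _ := A.fil_antitone (by omega)
  fil_le _ := le_rfl

/-- The product of two weighted filtrations. -/
def Weighting.prod (W : A.Weighting) (W' : B.Weighting) : (A.prod B).Weighting where
  part m := (W.part m).prod (W'.part m)
  antitone _ _ h := Submodule.prod_mono (W.antitone h) (W'.antitone h)
  homogeneous m x hx i := by
    rw [decompose_prod]
    exact ⟨W.homogeneous m _ hx.1 i, W'.homogeneous m _ hx.2 i⟩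
  bound := max W.bound W'.bound
  le_fil m := Submodule.prod_mono (W.le_fil m) (W'.le_fil m)
  fil_le m := Submodule.prod_mono ((A.fil_antitone (by omega)).trans (W.fil_le m))
    ((B.fil_antitone (by omega)).trans (W'.fil_le m))

end FilteredDGModule

namespace Conv

open FilteredDGModule

variable {k : Type u} [CommRing k] {C : FilteredDGCooperad.{u, v} k} {A B : FilteredDGModule.{u, w} k}

theorem conj_isSym {α : A →ₗ[k] B} {β : B →ₗ[k] A} (hα : IsStrict α) (hβ : IsStrict β)
    {f : Family C A} (hf : IsSym f) : IsSym (conj α β f) where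
  equivariant n σ c := by
    rw [conj_apply, conj_apply, hf.1]
    exact EndOp.conj_rearrange α β hβ.1 σ _
  filtered n i c hc a d h := hα.2 _ _ (hf.2 n i c hc _ d fun s => hβ.2 _ _ (h s))

theorem conj_isHom {α : A →ₗ[k] B} {β : B →ₗ[k] A} (hα : IsStrict α) (hβ : IsStrict β) {j : ℤ}
    {f : Family C A} (hf : IsHom j f) : IsHom j (conj α β f) where
  equivariant := (conj_isSym hα hβ hf.isSym).1
  filtered := (conj_isSym hα hβ hf.isSym).2
  degree n i c hc _ d h := hα.1 _ _ (hf.2 n i c hc _ d fun s => hβ.1 _ _ (h s))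

/-- The filtration of the module of families which is induced by a weighted filtration. -/
def colFil (W : A.Weighting) (l : ℤ) : Submodule k (Family C A) where
  carrier := {v | ∀ (n i : ℕ) (c : C.obj n), c ∈ (C.obj n).fil i → ∀ (m : Fin n → ℤ) (a : Fin n → A),
    (∀ s, a s ∈ W.part (m s)) → v n c a ∈ W.part (2 * i + ∑ s, m s + l)}
  zero_mem' _ _ _ _ _ _ _ := zero_mem _
  add_mem' h h' n i c hc m a ha := add_mem (h n i c hc m a ha) (h' n i c hc m a ha)
  smul_mem' r _ h n i c hc m a ha := Submodule.smul_mem _ r (h n i c hc m a ha)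

theorem colFil_antitone (W : A.Weighting) : Antitone (colFil (C := C) W) :=
  fun _ _ hl _ h n i c hc m a ha => W.antitone (by omega) (h n i c hc m a ha)

theorem precompD_mem_colFil (W : A.Weighting) {l : ℤ} {v : Family C A} (hv : v ∈ colFil W l) :
    precompD v ∈ colFil W l := fun n i c hc => hv n i _ ((C.obj n).d_fil i c hc)

theorem conj_mem_colFil {α : A →ₗ[k] B} {β : B →ₗ[k] A} {W : A.Weighting} {W' : B.Weighting} (t : ℤ)
    (hα : ∀ m, ∀ x ∈ W.part m, α x ∈ W'.part (m - t)) (hβ : ∀ m, ∀ x ∈ W'.part m, β x ∈ W.part m)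
    {l : ℤ} {v : Family C A} (hv : v ∈ colFil W l) : conj α β v ∈ colFil W' (l - t) := by
  intro n i c hc m a ha
  have := hα _ _ (hv n i c hc m _ fun s => hβ _ _ (ha s))
  rwa [add_sub_assoc] at this

/-- A family increases the weighted filtration when its components lie deep enough in the
filtration. -/
theorem conj_mem_colFil_of_inFil {α : A →ₗ[k] B} {β : B →ₗ[k] A} {W' : B.Weighting} {w w' : ℕ}
    (hα : ∀ m : ℤ, ∀ x ∈ A.fil ((m + w' + 1) / 2).toNat, α x ∈ W'.part m)
    (hβ : ∀ m, ∀ x ∈ W'.part m, β x ∈ A.fil ((m + w + 1) / 2).toNat) {r : ℤ} {Y : Family C A}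
    (h : ∀ q, ∃ e, InFil e (Y q) ∧ w' + r ≤ 2 * e + q * w) : conj α β Y ∈ colFil W' r := by
  intro n i c hc m a ha
  obtain ⟨e, he, hr⟩ := h n
  refine hα _ _ (A.fil_mono ?_ (he i c hc _ (fun s => ((m s + w + 1) / 2).toNat)
    fun s => hβ _ _ (ha s)))
  have := Finset.sum_le_sum (s := Finset.univ) fun s (_ : s ∈ Finset.univ) =>
    (by omega : m s + w ≤ 2 * (((m s + w + 1) / 2).toNat : ℤ))
  rw [Finset.sum_add_distrib, ← Finset.mul_sum] at this
  simp only [Finset.sum_const, Finset.card_univ, Fintype.card_fin, nsmul_eq_mul] at this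
  have h2 : (((∑ s, ((m s + w + 1) / 2).toNat : ℕ)) : ℤ) =
    ∑ s, (((m s + w + 1) / 2).toNat : ℤ) := by push_cast; rfl
  omega

theorem mem_colFil_point {w : ℕ} {r : ℤ} {Y : Family C A}
    (h : ∀ q, ∃ e, InFil e (Y q) ∧ w + r ≤ 2 * e + q * w) : Y ∈ colFil (Weighting.point A w) r :=
  conj_mem_colFil_of_inFil (W' := Weighting.point A w) (α := LinearMap.id) (β := LinearMap.id)
    (fun _ _ h => h) (fun _ _ h => h) h

theorem mem_colFil_neg_bound (W : A.Weighting) {v : Family C A} (hv : IsSym v) :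
    v ∈ colFil W (-W.bound) :=
  conj_mem_colFil_of_inFil (α := LinearMap.id) (β := LinearMap.id) (w := 0) (w' := W.bound)
    (fun m _ h => W.fil_le m h) (fun m x h => by simpa using W.le_fil m h)
    fun q => ⟨0, hv.2 q, by simp⟩

theorem inFil_of_mem_colFil_point {w n N : ℕ} {l : ℤ} {v : Family C A}
    (hv : v ∈ colFil (Weighting.point A w) l) (h : 2 * N + n * w ≤ l + w + 1) : InFil N (v n) :=
  fun i c hc a d ha => by
  have key := hv n i c hc (fun s => 2 * d s - w) a fun s =>
    A.fil_mono (m := d s) (by omega) (ha s)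
  refine A.fil_mono ?_ key
  · rw [Finset.sum_sub_distrib, ← Finset.mul_sum, ← Nat.cast_sum]
    simp only [Finset.sum_const, Finset.card_univ, Fintype.card_fin, nsmul_eq_mul]
    omega

theorem inFil_of_mem_colFil (W : A.Weighting) {n N : ℕ} {l : ℤ} {v : Family C A}
    (hv : v ∈ colFil W l) (h : 2 * N + n * W.bound ≤ l) : InFil N (v n) :=
  fun i c hc a d ha => by
  have key := W.le_fil _ (hv n i c hc (fun s => 2 * d s - W.bound) a
    fun s => W.fil_le _ (A.fil_mono (m := d s) (by omega) (ha s)))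
  refine A.fil_mono ?_ key
  · rw [Finset.sum_sub_distrib, ← Finset.mul_sum, ← Nat.cast_sum]
    simp only [Finset.sum_const, Finset.card_univ, Fintype.card_fin, nsmul_eq_mul]
    omega

variable [Algebra ℚ k]

theorem star_mem_colFil (W : A.Weighting) (j : ℤ) {v Y : Family C A} {l r : ℤ}
    (hv : v ∈ colFil W l) (hY : Y ∈ colFil W r) : star j v Y ∈ colFil W (l + r) := by
  intro n i c hc m a ha
  let Q : Submodule k (EndOp.Mult A n) :=
    { carrier := {F | F a ∈ W.part (2 * i + ∑ s, m s + (l + r))}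
      zero_mem' := zero_mem (W.part _)
      add_mem' := fun h h' => add_mem (S := Submodule k A) h h'
      smul_mem' := fun r _ h => Submodule.smul_mem _ r h }
  refine star_mem j v Y (Q := Q) (fun {p q} e i₁ i₂ hi x hx y hy => ?_) hc
  refine EndOp.comp_mem e (P := fun s => W.part (m s)) (fun s x hx j => W.homogeneous _ x hx j)
    (fun a' b' ha hb => ?_) ha
  have h1 := hY q i₂ y hy (fun s => m (e (.inl s))) a' ha
  have h2 := hv (p + 1) i₁ x hx (Fin.cons _ fun s => m (e (.inr s))) (Fin.cons (Y q y a') b')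
    (fun s => Fin.cases h1 hb s)
  rw [Fin.sum_cons] at h2
  rw [← e.sum_comp m, Fintype.sum_sum_type]
  refine W.antitone (le_of_eq ?_) h2
  rw [← hi]
  push_cast
  ring

end Conv

namespace IsNilpotent

open Polynomial

section Ring

variable {R : Type*} [Ring R]

/-- Evaluation of polynomials at `1`. -/
def evalOne : R[X] →+* R := eval₂RingHom' (RingHom.id R) 1 fun a => Commute.one_right a

theorem evalOne_C (a : R) : evalOne (C a) = a := by simp [evalOne]

theorem evalOne_X : evalOne (X : R[X]) = 1 := by simp [evalOne]

variable [Algebra ℚ R]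

/-- The logarithm of `1 + a`, for nilpotent `a`. -/
def logOneAdd (a : R) : R :=
  ∑ i ∈ Finset.range (nilpotencyClass a), ((-1) ^ i / (i + 1) : ℚ) • a ^ (i + 1)

theorem logOneAdd_eq_sum {a : R} {n : ℕ} (h : a ^ n = 0) :
    logOneAdd a = ∑ i ∈ Finset.range n, ((-1) ^ i / (i + 1) : ℚ) • a ^ (i + 1) := by
  refine Finset.sum_subset (Finset.range_mono (csInf_le' h)) fun i _ hi => ?_
  rw [Finset.mem_range, not_lt] at hi
  rw [_root_.pow_succ, pow_eq_zero_of_le hi (pow_nilpotencyClass ⟨n, h⟩), zero_mul, smul_zero]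

theorem map_logOneAdd {S : Type*} [Ring S] [Algebra ℚ S] (f : R →+* S) {a : R} (ha : IsNilpotent a) :
    f (logOneAdd a) = logOneAdd (f a) := by
  obtain ⟨n, hn⟩ := ha
  have hn' : f a ^ n = 0 := by rw [← map_pow, hn, map_zero]
  simp [logOneAdd_eq_sum hn, logOneAdd_eq_sum hn', map_rat_smul]

theorem isNilpotent_logOneAdd {a : R} (ha : IsNilpotent a) : IsNilpotent (logOneAdd a) := by
  have : logOneAdd a = a * ∑ i ∈ Finset.range (nilpotencyClass a), ((-1) ^ i / (i + 1) : ℚ) • a ^ i := by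
    rw [logOneAdd, Finset.mul_sum]
    exact Finset.sum_congr rfl fun i _ => by rw [mul_smul_comm, pow_succ']
  rw [this]
  exact (Commute.sum_right _ _ _ fun i _ => ((Commute.refl a).pow_right i).smul_right _).isNilpotent_mul_right ha

section Leibniz

variable (D : R →ₗ[ℚ] R) (hD : ∀ x y, D (x * y) = D x * y + x * D y)
include hD

theorem leibniz_pow {a : R} (h : Commute a (D a)) (n : ℕ) :
    D (a ^ (n + 1)) = ((n + 1 : ℕ) : ℚ) • (a ^ n * D a) := by
  induction n with
  | zero => simp
  | succ n ih =>
    rw [_root_.pow_succ, hD, ih, smul_mul_assoc, mul_assoc, ← h.eq, ← mul_assoc, ← _root_.pow_succ]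
    push_cast
    module

theorem leibniz_exp {a : R} (h : Commute a (D a)) (ha : IsNilpotent a) :
    D (exp a) = exp a * D a := by
  obtain ⟨n, hn⟩ := ha
  have h1 : D 1 = 0 := by simpa using hD 1 1
  have h2 := congrArg D (exp_eq_sum (pow_eq_zero_of_le n.le_succ hn))
  rw [h2, Finset.sum_range_succ', map_add, map_sum,
    _root_.pow_zero, map_smul, h1, smul_zero, add_zero, exp_eq_sum hn, Finset.sum_mul]
  refine Finset.sum_congr rfl fun i _ => ?_
  rw [map_smul, leibniz_pow D hD h, smul_smul, smul_mul_assoc]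
  congr 1
  rw [Nat.factorial_succ]
  field_simp
  push_cast
  field_simp

theorem leibniz_logOneAdd {a : R} (h : Commute a (D a)) (ha : IsNilpotent a) :
    (1 + a) * D (logOneAdd a) = D a := by
  obtain ⟨n, hn⟩ := ha
  have : D (logOneAdd a) = (∑ i ∈ Finset.range n, (-a) ^ i) * D a := by
    rw [logOneAdd_eq_sum hn, map_sum, Finset.sum_mul]
    refine Finset.sum_congr rfl fun i _ => ?_
    rw [map_smul, leibniz_pow D hD h, smul_smul, neg_pow a]
    push_cast
    rw [div_mul_cancel₀ _ (by positivity), Algebra.smul_def]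
    simp [mul_assoc]
  rw [this, ← mul_assoc, ← sub_neg_eq_add 1 a, mul_neg_geom_sum, neg_pow, hn, mul_zero, sub_zero,
    one_mul]

end Leibniz

theorem eq_C_of_derivative_eq_zero {f : R[X]} (h : derivative f = 0) : f = C (f.coeff 0) := by
  ext n
  rcases n with _ | n
  · simp
  · have := congrArg (fun g => ((n + 1 : ℕ) : ℚ)⁻¹ • g.coeff n) h
    simp only [coeff_derivative, coeff_zero, smul_zero] at this
    rw [coeff_C_succ, ← this, ← Nat.cast_succ, ← nsmul_eq_mul', ← Nat.cast_smul_eq_nsmul ℚ, smul_smul,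
      inv_mul_cancel₀ (by positivity), one_smul]

end Ring

section CommRing

variable {R : Type*} [CommRing R] [Algebra ℚ R]

theorem logOneAdd_exp_of_comm {a : R} (ha : IsNilpotent a) : logOneAdd (exp a - 1) = a := by
  have hX : IsNilpotent (C a * X) := (Commute.all _ _).isNilpotent_mul_right (ha.map C)
  let D : R[X] →ₗ[ℚ] R[X] := derivative.restrictScalars ℚ
  have hD : ∀ x y : R[X], D (x * y) = D x * y + x * D y := fun x y => derivative_mul
  have hl := isNilpotent_exp_sub_one hX
  have h1 := leibniz_logOneAdd D hD (.all _ _) hl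
  have h2 := leibniz_exp D hD (.all _ _) hX
  have h3 : derivative (logOneAdd (exp (C a * X) - 1) - C a * X) = 0 := by
    have h4 : D (C a * X) = C a := by simp [D]
    have h5 : D (exp (C a * X) - 1) = exp (C a * X) * C a := by
      rw [map_sub, h2, h4]
      simp [D]
    rw [h5, add_sub_cancel] at h1
    rw [derivative_sub, sub_eq_zero]
    exact ((isUnit_exp hX).mul_left_cancel h1).trans h4.symm
  have h6 := eq_C_of_derivative_eq_zero h3
  have h7 : (logOneAdd (exp (C a * X) - 1) - C a * X).coeff 0 = 0 := by
    have := map_logOneAdd (constantCoeff (R := R)) hl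
    rw [map_sub, map_exp hX, map_one, map_mul,
      show constantCoeff (X : R[X]) = 0 by simp, mul_zero, exp_zero, sub_self] at this
    rw [coeff_sub, ← constantCoeff_apply, this]
    simp [logOneAdd_eq_sum (pow_one (0 : R))]
  rw [h7, map_zero, sub_eq_zero] at h6
  have := congrArg evalOne h6
  rwa [map_logOneAdd _ hl, map_sub, map_exp hX, map_mul, evalOne_C, evalOne_X, mul_one, map_one] at this

theorem exp_logOneAdd_of_comm {a : R} (ha : IsNilpotent a) : exp (logOneAdd a) = 1 + a := by
  have hX : IsNilpotent (C a * X) := (Commute.all _ _).isNilpotent_mul_right (ha.map C)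
  let D : R[X] →ₗ[ℚ] R[X] := derivative.restrictScalars ℚ
  have hD : ∀ x y : R[X], D (x * y) = D x * y + x * D y := fun x y => derivative_mul
  have hl := isNilpotent_logOneAdd hX
  have h1 := leibniz_logOneAdd D hD (.all _ _) hX
  have h2 := leibniz_exp D hD (.all _ _) hl.neg
  have h3 : derivative ((1 + C a * X) * exp (-logOneAdd (C a * X))) = 0 := by
    change D _ = 0
    have h4 : D (1 + C a * X) = D (C a * X) := by simp [D]
    rw [hD, h2, map_neg, h4, ← h1]
    ring
  have h6 := eq_C_of_derivative_eq_zero h3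
  have h7 : ((1 + C a * X) * exp (-logOneAdd (C a * X))).coeff 0 = 1 := by
    rw [← constantCoeff_apply, map_mul, map_exp hl.neg, map_neg, map_logOneAdd _ hX]
    simp [logOneAdd_eq_sum (pow_one (0 : R))]
  rw [h7, map_one] at h6
  have := congrArg evalOne h6
  rw [map_mul, map_exp hl.neg, map_neg, map_logOneAdd _ hX, map_add, map_mul, evalOne_C, evalOne_X, mul_one,
    map_one] at this
  have h8 := isNilpotent_logOneAdd ha
  calc exp (logOneAdd a) = (1 + a) * exp (-logOneAdd a) * exp (logOneAdd a) := by rw [this, one_mul]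
    _ = 1 + a := by rw [mul_assoc, exp_neg_mul_exp_self h8, mul_one]

end CommRing

section Ring

variable {R : Type*} [Ring R] [Algebra ℚ R]

/-- Nilpotent elements are images of nilpotent elements of commutative algebras. -/
theorem exists_comm {a : R} (ha : IsNilpotent a) :
    ∃ (B : Type) (_ : CommRing B) (_ : Algebra ℚ B) (f : B →+* R) (b : B), IsNilpotent b ∧ f b = a := by
  obtain ⟨n, hn⟩ := ha
  refine ⟨ℚ[X] ⧸ Ideal.span {(X : ℚ[X]) ^ n}, inferInstance, inferInstance,
    Ideal.Quotient.lift _ (aeval a).toRingHom fun x hx => ?_, Ideal.Quotient.mk _ X, ⟨n, ?_⟩, ?_⟩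
  · obtain ⟨y, rfl⟩ := Ideal.mem_span_singleton'.1 hx
    simp [hn]
  · rw [← map_pow, Ideal.Quotient.eq_zero_iff_mem]
    exact Ideal.mem_span_singleton_self _
  · simp

theorem logOneAdd_exp {a : R} (ha : IsNilpotent a) : logOneAdd (exp a - 1) = a := by
  obtain ⟨B, _, _, f, b, hb, rfl⟩ := exists_comm ha
  rw [← map_exp hb, ← map_one f, ← map_sub, ← map_logOneAdd f (isNilpotent_exp_sub_one hb),
    logOneAdd_exp_of_comm hb]

theorem exp_logOneAdd {a : R} (ha : IsNilpotent a) : exp (logOneAdd a) = 1 + a := by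
  obtain ⟨B, _, _, f, b, hb, rfl⟩ := exists_comm ha
  rw [← map_logOneAdd f hb, ← map_exp (isNilpotent_logOneAdd hb), exp_logOneAdd_of_comm hb, map_add, map_one]

end Ring

end IsNilpotent

namespace IsNilpotent

open Polynomial

variable {R : Type*} [Ring R]

/-- A truncated Cauchy product. -/
theorem sum_range_antidiagonal {a b : ℕ → R} {M N : ℕ} (ha : ∀ i ≥ M, a i = 0)
    (hb : ∀ i ≥ N, b i = 0) : ∑ n ∈ Finset.range (M + N), ∑ x ∈ Finset.HasAntidiagonal.antidiagonal n, a x.1 * b x.2 =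
      (∑ i ∈ Finset.range M, a i) * ∑ i ∈ Finset.range N, b i := by
  rw [Finset.sum_mul_sum, ← Finset.sum_product', Finset.sum_sigma']
  symm
  refine Finset.sum_of_injOn (fun x : ℕ × ℕ => (⟨x.1 + x.2, x⟩ : (_ : ℕ) × ℕ × ℕ)) ?_ ?_ ?_ ?_
  · rintro ⟨x, y⟩ - ⟨x', y'⟩ - h
    simp only [Sigma.mk.injEq] at h
    exact eq_of_heq h.2
  · rintro ⟨x, y⟩ h
    simp only [Finset.coe_product, Finset.coe_range, Set.mem_prod, Set.mem_Iio] at h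
    simp only [Finset.coe_sigma, Set.mem_sigma_iff, Finset.coe_range, Set.mem_Iio, Finset.mem_coe,
      Finset.HasAntidiagonal.mem_antidiagonal, and_true]
    omega
  · rintro ⟨n, x, y⟩ h1 h2
    simp only [Finset.mem_sigma, Finset.mem_range, Finset.HasAntidiagonal.mem_antidiagonal] at h1
    obtain ⟨-, rfl⟩ := h1
    by_cases hx : x < M
    · have hy : N ≤ y := by
        by_contra hy
        exact h2 ⟨(x, y), by simp; omega, rfl⟩
      rw [hb y hy, mul_zero]
    · rw [ha x (not_lt.1 hx), zero_mul]
  · intros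
    rfl

variable [Algebra ℚ R]

theorem invFactorial_smul_pow_succ (q : R) (n : ℕ) :
    ((n + 1).factorial : ℚ)⁻¹ • q ^ (n + 1) =
      ((n + 1 : ℕ) : ℚ)⁻¹ • (q * ((n.factorial : ℚ)⁻¹ • q ^ n)) := by
  rw [mul_smul_comm, smul_smul, ← _root_.pow_succ', Nat.factorial_succ]
  push_cast
  rw [mul_inv]

/-- Exchanging a divided power with an operator. -/
theorem pow_mul_eq_sum_antidiagonal {q : R} {p : ℕ → R}
    (h : ∀ i, q * p i = p i * q + ((i + 1 : ℕ) : ℚ) • p (i + 1)) (n : ℕ) :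
    ((n.factorial : ℚ)⁻¹ • q ^ n) * p 0 =
      ∑ x ∈ Finset.HasAntidiagonal.antidiagonal n, p x.1 * ((x.2.factorial : ℚ)⁻¹ • q ^ x.2) := by
  induction n with
  | zero => simp
  | succ n ih =>
    rw [invFactorial_smul_pow_succ, smul_mul_assoc, mul_assoc, ih, inv_smul_eq_iff₀ (by positivity)]
    have e1 : ∀ j : ℕ, q * ((j.factorial : ℚ)⁻¹ • q ^ j) =
        ((j + 1 : ℕ) : ℚ) • (((j + 1).factorial : ℚ)⁻¹ • q ^ (j + 1)) := fun j => by
      rw [invFactorial_smul_pow_succ, smul_inv_smul₀ (by positivity)]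
    have e2 : ∀ x : ℕ × ℕ, q * (p x.1 * ((x.2.factorial : ℚ)⁻¹ • q ^ x.2)) =
        ((x.2 + 1 : ℕ) : ℚ) • (p x.1 * (((x.2 + 1).factorial : ℚ)⁻¹ • q ^ (x.2 + 1))) +
        ((x.1 + 1 : ℕ) : ℚ) • (p (x.1 + 1) * ((x.2.factorial : ℚ)⁻¹ • q ^ x.2)) := fun x => by
      rw [← mul_assoc, h, add_mul, mul_assoc, e1, mul_smul_comm, smul_mul_assoc]
    rw [Finset.mul_sum, Finset.sum_congr rfl fun x _ => e2 x, Finset.sum_add_distrib]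
    have e3 : ∑ x ∈ Finset.HasAntidiagonal.antidiagonal (n + 1), ((x.2 : ℕ) : ℚ) •
        (p x.1 * ((x.2.factorial : ℚ)⁻¹ • q ^ x.2)) = ∑ x ∈ Finset.HasAntidiagonal.antidiagonal n,
        ((x.2 + 1 : ℕ) : ℚ) • (p x.1 * (((x.2 + 1).factorial : ℚ)⁻¹ • q ^ (x.2 + 1))) := by
      rw [Finset.Nat.sum_antidiagonal_succ']
      simp
    have e4 : ∑ x ∈ Finset.HasAntidiagonal.antidiagonal (n + 1), ((x.1 : ℕ) : ℚ) •
        (p x.1 * ((x.2.factorial : ℚ)⁻¹ • q ^ x.2)) = ∑ x ∈ Finset.HasAntidiagonal.antidiagonal n,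
        ((x.1 + 1 : ℕ) : ℚ) • (p (x.1 + 1) * ((x.2.factorial : ℚ)⁻¹ • q ^ x.2)) := by
      rw [Finset.Nat.sum_antidiagonal_succ]
      simp
    rw [← e3, ← e4, ← Finset.sum_add_distrib, Finset.smul_sum]
    refine Finset.sum_congr rfl fun x hx => ?_
    rw [← add_smul, ← Nat.cast_add, add_comm x.2, Finset.HasAntidiagonal.mem_antidiagonal.1 hx]

theorem mul_pow_eq_sum_antidiagonal {q : R} {p : ℕ → R}
    (h : ∀ i, p i * q = q * p i + ((i + 1 : ℕ) : ℚ) • p (i + 1)) (n : ℕ) :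
    p 0 * ((n.factorial : ℚ)⁻¹ • q ^ n) =
      ∑ x ∈ Finset.HasAntidiagonal.antidiagonal n, ((x.2.factorial : ℚ)⁻¹ • q ^ x.2) * p x.1 := by
  have := congrArg MulOpposite.unop (pow_mul_eq_sum_antidiagonal (q := MulOpposite.op q)
    (p := fun i => MulOpposite.op (p i)) (fun i => congrArg MulOpposite.op (h i)) n)
  rw [Finset.unop_sum] at this
  exact this

/-- Exchanging an exponential with an operator. -/
theorem exp_mul_eq {q : R} {p : ℕ → R} (hq : IsNilpotent q) {M : ℕ} (hp : ∀ i ≥ M, p i = 0)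
    (h : ∀ i, q * p i = p i * q + ((i + 1 : ℕ) : ℚ) • p (i + 1)) :
    exp q * p 0 = (∑ i ∈ Finset.range M, p i) * exp q := by
  obtain ⟨N, hN⟩ := hq
  have h2 := exp_eq_sum (pow_eq_zero_of_le (Nat.le_add_left N M) hN)
  rw [congrArg (· * p 0) h2, exp_eq_sum hN, Finset.sum_mul,
    ← sum_range_antidiagonal hp fun i hi => by rw [pow_eq_zero_of_le hi hN, smul_zero]]
  exact Finset.sum_congr rfl fun n _ => pow_mul_eq_sum_antidiagonal h n

theorem exp_mul_eq_exp_mul {q p y : R} (h : q * p = p * q + y) (hy : Commute p y)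
    (hp : IsNilpotent p) : q * exp p = exp p * q + exp p * y := by
  let D : R →ₗ[ℚ] R := LinearMap.mulLeft ℚ q - LinearMap.mulRight ℚ q
  have h1 : D p = y := by simp [D, h]
  have := leibniz_exp D (fun a b => by
    simp only [D, LinearMap.sub_apply, LinearMap.mulLeft_apply, LinearMap.mulRight_apply, sub_mul,
      mul_sub, mul_assoc, sub_add_sub_cancel]) (h1 ▸ hy) hp
  rw [h1] at this
  rw [← this]
  simp [D]

/-- The exponential of a family of commuting operators which are successive commutators with `S`. -/
theorem exp_smul_eq_exp_sum_smul {V : Type*} [AddCommGroup V] [Module R V] {S : R} {Q : ℕ → R} {M : ℕ} {v : V}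
    (hS : IsNilpotent S) (hQ : ∀ i, IsNilpotent (Q i)) (hM : ∀ i ≥ M, Q i = 0)
    (hc : ∀ i j, Commute (Q i) (Q j)) (h : ∀ i, S * Q i = Q i * S + ((i + 2 : ℕ) : ℚ) • Q (i + 1))
    (hv : S • v = Q 0 • v) : exp S • v = exp (∑ i ∈ Finset.range M, Q i) • v := by
  let P : R[X] := ∑ i ∈ Finset.range M, C (Q i) * X ^ (i + 1)
  have hX : ∀ (a : R) (i j : ℕ), Commute (C a * X ^ i) (X ^ j) := fun a i j =>
    (Commute.mul_left ((commute_X (C a)).symm.pow_right j) (.pow_pow_self X i j))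
  have hPc : ∀ (i j n m : ℕ), Commute (C (Q i) * X ^ n) (C (Q j) * X ^ m) := fun i j n m =>
    .mul_right (.mul_left ((hc i j).map C) ((commute_X (C (Q j))).pow_left n)) (hX _ _ _)
  have hP : IsNilpotent P := Commute.isNilpotent_sum (fun i _ =>
    Commute.isNilpotent_mul_right ((commute_X (C (Q i))).symm.pow_right _) ((hQ i).map C))
    fun i j _ _ => hPc i j _ _
  let D : R[X] →ₗ[ℚ] R[X] := derivative.restrictScalars ℚ
  have hDmul : ∀ x y : R[X], D (x * y) = D x * y + x * D y := fun x y => derivative_mul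
  have hD : D P = ∑ i ∈ Finset.range M, ((i + 1 : ℕ) : ℚ) • (C (Q i) * X ^ i) := by
    simp only [D, P, LinearMap.restrictScalars_apply, derivative_sum]
    refine Finset.sum_congr rfl fun i _ => ?_
    rw [derivative_C_mul, derivative_X_pow, Nat.add_sub_cancel, ← mul_smul_comm, Algebra.smul_def]
    simp
  have hSP : C S * P = P * C S + (D P - C (Q 0)) := by
    have : D P - C (Q 0) = ∑ i ∈ Finset.range M, ((i + 2 : ℕ) : ℚ) • (C (Q (i + 1)) * X ^ (i + 1)) := by
      have h1 : ∑ i ∈ Finset.range (M + 1), ((i + 1 : ℕ) : ℚ) • (C (Q i) * X ^ i) = D P := by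
        rw [Finset.sum_range_succ, hM M le_rfl, hD]
        simp
      rw [← h1, Finset.sum_range_succ']
      simp [add_assoc, one_add_one_eq_two]
    rw [this, Finset.mul_sum, Finset.sum_mul, ← Finset.sum_add_distrib]
    refine Finset.sum_congr rfl fun i _ => ?_
    rw [← mul_assoc, ← C_mul, h, C_add, add_mul, ← smul_C, smul_mul_assoc, C_mul, mul_assoc,
      mul_assoc, ((commute_X (C S)).pow_left _).eq]
  have hPD : Commute P (D P) := by
    rw [hD]
    exact .sum_left _ _ _ fun i _ => .sum_right _ _ _ fun j _ => (hPc i j _ _).smul_right _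
  have hP0 : Commute P (C (Q 0)) := .sum_left _ _ _ fun i _ => by
    simpa using hPc i 0 (i + 1) 0
  have h1 : D (exp P) = exp P * D P := leibniz_exp D hDmul hPD hP
  have h2 := exp_mul_eq_exp_mul hSP (hPD.sub_right hP0) hP
  have h3 : D (exp P) = C S * exp P + exp P * C (Q 0 - S) := by
    rw [h1, h2, C_sub, mul_sub, mul_sub]
    abel
  have h4 : ∀ n, (exp P).coeff n • v = ((n.factorial : ℚ)⁻¹ • S ^ n) • v := by
    intro n
    induction n with
    | zero =>
      have : (exp P).coeff 0 = 1 := by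
        rw [← constantCoeff_apply, map_exp hP]
        simp [P]
      simp [this]
    | succ n ih =>
      have := congrArg (fun f => ((n + 1 : ℕ) : ℚ)⁻¹ • f.coeff n) h3
      simp only [D, LinearMap.restrictScalars_apply, coeff_derivative, coeff_add, coeff_C_mul,
        coeff_mul_C] at this
      rw [← Nat.cast_succ, ← nsmul_eq_mul', ← Nat.cast_smul_eq_nsmul ℚ, smul_smul,
        inv_mul_cancel₀ (by positivity), one_smul] at this
      rw [this, invFactorial_smul_pow_succ, Algebra.smul_def, mul_smul, add_smul, mul_smul, mul_smul,
        ih, sub_smul, hv, sub_self, smul_zero, add_zero, ← mul_smul, ← mul_smul, ← Algebra.smul_def,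
        smul_mul_assoc]
  obtain ⟨N, hN⟩ := hS
  let K := max N ((exp P).natDegree + 1)
  have h5 : evalOne (exp P) = ∑ n ∈ Finset.range K, (exp P).coeff n := by
    change eval₂ _ _ _ = _
    rw [eval₂_eq_sum_range' _ (by omega : (exp P).natDegree < K)]
    simp
  have h6 : evalOne P = ∑ i ∈ Finset.range M, Q i := by
    simp [P, evalOne_C, evalOne_X]
  rw [← h6, ← map_exp hP, h5, exp_eq_sum (pow_eq_zero_of_le (le_max_left _ _ : N ≤ K) hN),
    Finset.sum_smul, Finset.sum_smul]
  exact Finset.sum_congr rfl fun n _ => (h4 n).symm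

end IsNilpotent

namespace Dynkin

/-- The word `x^{r_1} y^{s_1} ⋯ x^{r_n} y^{s_n}`. -/
def word {R : Type*} (x y : R) {n : ℕ} (rs : Fin n → ℕ × ℕ) : List R :=
  (List.ofFn fun i => List.replicate (rs i).1 x ++ List.replicate (rs i).2 y).flatten

theorem length_word {R : Type*} (x y : R) {n : ℕ} (rs : Fin n → ℕ × ℕ) :
    (word x y rs).length = ∑ i, ((rs i).1 + (rs i).2) := by
  simp [word, List.length_flatten, List.map_ofFn, Function.comp_def, List.sum_ofFn]

theorem mem_word {R : Type*} {x y : R} {n : ℕ} {rs : Fin n → ℕ × ℕ} {a : R} (h : a ∈ word x y rs) :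
    a = x ∨ a = y := by
  simp only [word, List.mem_flatten, List.mem_ofFn, exists_exists_eq_and, List.mem_append,
    List.mem_replicate] at h
  tauto

theorem map_word {R S : Type*} (f : R → S) (x y : R) {n : ℕ} (rs : Fin n → ℕ × ℕ) :
    (word x y rs).map f = word (f x) (f y) rs := by
  simp [word, List.map_flatten, List.map_ofFn, Function.comp_def]

/-- The sums over words of weight `N` which occur in Dynkin's form of the Baker-Campbell-Hausdorff
series. -/
def wordSum {V : Type*} [AddCommGroup V] (F : ∀ n, (Fin n → ℕ × ℕ) → V) (N : ℕ) : V :=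
  ∑ n ∈ Finset.Icc 1 N, ∑ rs : Fin n → Fin (N + 1) × Fin (N + 1),
    if (∀ i, 0 < (rs i).1.val + (rs i).2.val) ∧ ∑ i, ((rs i).1.val + (rs i).2.val) = N then
      F n fun i => ((rs i).1.val, (rs i).2.val)
    else 0

theorem map_wordSum {V W G : Type*} [AddCommGroup V] [AddCommGroup W] [FunLike G V W]
    [AddMonoidHomClass G V W] (g : G) (F : ∀ n, (Fin n → ℕ × ℕ) → V) (N : ℕ) :
    g (wordSum F N) = wordSum (fun n rs => g (F n rs)) N := by
  simp only [wordSum, map_sum]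
  refine Finset.sum_congr rfl fun n _ => Finset.sum_congr rfl fun rs _ => ?_
  split_ifs <;> simp

theorem wordSum_congr {V : Type*} [AddCommGroup V] {F G : ∀ n, (Fin n → ℕ × ℕ) → V} {N : ℕ}
    (h : ∀ n rs, (∑ i, ((rs i).1 + (rs i).2) = N) → 0 < N → F n rs = G n rs) :
    wordSum F N = wordSum G N := by
  refine Finset.sum_congr rfl fun n hn => Finset.sum_congr rfl fun rs _ => ?_
  split_ifs with h'
  · exact h _ _ h'.2 (by rw [Finset.mem_Icc] at hn; omega)
  · rfl

theorem wordSum_eq {V : Type*} [AddCommGroup V] (F : ∀ n, (Fin n → ℕ × ℕ) → V) {N M : ℕ} (h : N < M) :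
    wordSum F N = ∑ i ∈ Finset.range M, ∑ rs : Fin (i + 1) → Fin M × Fin M,
      if (∀ i, 0 < (rs i).1.val + (rs i).2.val) ∧ ∑ i, ((rs i).1.val + (rs i).2.val) = N then
        F (i + 1) fun i => ((rs i).1.val, (rs i).2.val)
      else 0 := by
  have h1 : ∀ i ∈ Finset.range M, i ∉ Finset.range N → (∑ rs : Fin (i + 1) → Fin M × Fin M,
      if (∀ i, 0 < (rs i).1.val + (rs i).2.val) ∧ ∑ i, ((rs i).1.val + (rs i).2.val) = N then
        F (i + 1) fun i => ((rs i).1.val, (rs i).2.val)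
      else 0) = 0 := fun i _ hi => by
    refine Finset.sum_eq_zero fun rs _ => if_neg fun h2 => ?_
    have := Finset.sum_le_sum (s := Finset.univ) fun j _ => Nat.succ_le_of_lt (h2.1 j)
    simp only [Nat.succ_eq_add_one, zero_add, Finset.sum_const, Finset.card_univ, Fintype.card_fin,
      smul_eq_mul] at this
    rw [Finset.mem_range] at hi
    simp at this
    omega
  rw [← Finset.sum_subset (Finset.range_mono h.le) h1, wordSum,
    show Finset.Icc 1 N = Finset.Ico (0 + 1) (N + 1) by ext; simp, ← Finset.sum_Ico_add',
    ← Finset.range_eq_Ico]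
  refine Finset.sum_congr rfl fun n _ => ?_
  refine Finset.sum_of_injOn (fun rs i => (Fin.castLE h (rs i).1, Fin.castLE h (rs i).2)) ?_ ?_ ?_ ?_
  · intro rs _ rs' _ hrs
    funext i
    have := congrFun hrs i
    simpa [Prod.ext_iff, Fin.ext_iff] using this
  · intro _ _
    simp
  · intro rs _ hrs
    refine if_neg fun h2 => hrs ?_
    have h3 : ∀ i, (rs i).1.val + (rs i).2.val ≤ N := fun i => by
      rw [← h2.2]
      exact Finset.single_le_sum (f := fun i => (rs i).1.val + (rs i).2.val) (fun _ _ => Nat.zero_le _)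
        (Finset.mem_univ i)
    refine ⟨fun i => (⟨(rs i).1.val, by have := h3 i; omega⟩, ⟨(rs i).2.val, by have := h3 i; omega⟩),
      by simp, ?_⟩
    funext i
    rfl
  · intro rs _
    rfl

theorem sum_wordSum {V : Type*} [AddCommGroup V] (F : ∀ n, (Fin n → ℕ × ℕ) → V) (M : ℕ) :
    ∑ N ∈ Finset.range M, wordSum F N = ∑ i ∈ Finset.range M, ∑ rs : Fin (i + 1) → Fin M × Fin M,
      if (∀ i, 0 < (rs i).1.val + (rs i).2.val) ∧ ∑ i, ((rs i).1.val + (rs i).2.val) < M then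
        F (i + 1) fun i => ((rs i).1.val, (rs i).2.val)
      else 0 := by
  rw [Finset.sum_congr rfl fun N hN => wordSum_eq F (Finset.mem_range.1 hN), Finset.sum_comm]
  refine Finset.sum_congr rfl fun i _ => ?_
  rw [Finset.sum_comm]
  refine Finset.sum_congr rfl fun rs _ => ?_
  by_cases h : ∀ i, 0 < (rs i).1.val + (rs i).2.val
  · simp [h]
  · simp only [h, false_and, if_false, Finset.sum_const_zero]

section Ring

variable {R : Type*} [Ring R]

theorem sum_pow {ι : Type*} [Fintype ι] (f : ι → R) (n : ℕ) :
    (∑ i, f i) ^ n = ∑ x : Fin n → ι, (List.ofFn fun i => f (x i)).prod := by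
  induction n with
  | zero => simp
  | succ n ih =>
    rw [pow_succ', ih, Finset.sum_mul_sum, ← Fintype.sum_prod_type',
      ← (Fin.consEquiv fun _ : Fin (n + 1) => ι).sum_comp]
    refine Finset.sum_congr rfl fun x _ => ?_
    simp [List.ofFn_succ, Fin.consEquiv]

theorem prod_word (x y : R) {n : ℕ} (rs : Fin n → ℕ × ℕ) :
    (word x y rs).prod = (List.ofFn fun i => x ^ (rs i).1 * y ^ (rs i).2).prod := by
  simp [word, List.prod_flatten, List.map_ofFn, Function.comp_def]

variable [Algebra ℚ R]

open IsNilpotent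

/-- All words of length at least `L` in `a` and `b` vanish. -/
def WordsVanish (a b : R) (L : ℕ) : Prop :=
  ∀ w : List R, (∀ x ∈ w, x = a ∨ x = b) → L ≤ w.length → w.prod = 0

omit [Algebra ℚ R] in
theorem WordsVanish.pow_left {a b : R} {L : ℕ} (h : WordsVanish a b L) : a ^ L = 0 := by
  have := h (List.replicate L a) (fun x hx => .inl (List.eq_of_mem_replicate hx)) (by simp)
  simpa using this

omit [Algebra ℚ R] in
theorem WordsVanish.pow_right {a b : R} {L : ℕ} (h : WordsVanish a b L) : b ^ L = 0 := by
  have := h (List.replicate L b) (fun x hx => .inr (List.eq_of_mem_replicate hx)) (by simp)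
  simpa using this

theorem ofFn_smul_prod {n : ℕ} (c : Fin n → ℚ) (f : Fin n → R) :
    (List.ofFn fun i => c i • f i).prod = (∏ i, c i) • (List.ofFn f).prod := by
  induction n with
  | zero => simp
  | succ n ih => rw [List.ofFn_succ, List.prod_cons, ih, List.ofFn_succ, List.prod_cons,
      Fin.prod_univ_succ, smul_mul_smul_comm]

theorem exp_mul_exp_sub_one_pow {a b : R} {L : ℕ} (hL : 0 < L) (h : WordsVanish a b L) (n : ℕ) :
    (exp a * exp b - 1) ^ n = ∑ rs : Fin n → Fin L × Fin L,
      if (∀ i, 0 < (rs i).1.val + (rs i).2.val) ∧ ∑ i, ((rs i).1.val + (rs i).2.val) < L then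
        (∏ i, ((rs i).1.val.factorial * (rs i).2.val.factorial : ℚ))⁻¹ •
          (word a b fun i => ((rs i).1.val, (rs i).2.val)).prod
      else 0 := by
  have h1 : exp a * exp b - 1 = ∑ x : Fin L × Fin L, (if 0 < x.1.val + x.2.val then
      (x.1.val.factorial * x.2.val.factorial : ℚ)⁻¹ else 0) • (a ^ x.1.val * b ^ x.2.val) := by
    have h2 : exp a * exp b = ∑ x : Fin L × Fin L,
        (x.1.val.factorial * x.2.val.factorial : ℚ)⁻¹ • (a ^ x.1.val * b ^ x.2.val) := by
      rw [exp_eq_sum h.pow_left, exp_eq_sum h.pow_right, Finset.sum_mul_sum, Fintype.sum_prod_type,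
        Finset.sum_range]
      refine Finset.sum_congr rfl fun i _ => ?_
      rw [Finset.sum_range]
      refine Finset.sum_congr rfl fun j _ => ?_
      rw [smul_mul_smul_comm, mul_inv]
    rw [h2, sub_eq_iff_eq_add, ← sub_eq_iff_eq_add', ← Finset.sum_sub_distrib]
    rw [Finset.sum_eq_single (⟨⟨0, hL⟩, ⟨0, hL⟩⟩ : Fin L × Fin L)]
    · simp
    · intro x _ hx
      have : 0 < x.1.val + x.2.val := by
        by_contra h3
        refine hx (Prod.ext (Fin.ext ?_) (Fin.ext ?_)) <;> simp <;> omega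
      simp [this]
    · simp
  rw [h1, sum_pow]
  refine Finset.sum_congr rfl fun rs _ => ?_
  rw [ofFn_smul_prod, ← prod_word a b fun i => ((rs i).1.val, (rs i).2.val)]
  split_ifs with h2
  · congr 1
    rw [← Finset.prod_inv_distrib]
    exact Finset.prod_congr rfl fun i _ => if_pos (h2.1 i)
  · by_cases h3 : ∀ i, 0 < (rs i).1.val + (rs i).2.val
    · rw [h _ (fun x hx => mem_word hx), smul_zero]
      rw [length_word]
      exact not_lt.1 fun h4 => h2 ⟨h3, h4⟩
    · push Not at h3
      obtain ⟨i, hi⟩ := h3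
      rw [Finset.prod_eq_zero (Finset.mem_univ i) (if_neg (by omega)), zero_smul]

theorem isNilpotent_exp_mul_exp_sub_one {a b : R} {L : ℕ} (hL : 0 < L) (h : WordsVanish a b L) :
    (exp a * exp b - 1) ^ L = 0 := by
  rw [exp_mul_exp_sub_one_pow hL h]
  refine Finset.sum_eq_zero fun rs _ => if_neg fun h2 => ?_
  have := Finset.sum_le_sum (s := Finset.univ) fun j _ => Nat.succ_le_of_lt (h2.1 j)
  simp only [Nat.succ_eq_add_one, zero_add, Finset.sum_const, Finset.card_univ, Fintype.card_fin,
      smul_eq_mul] at this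
  simp at this
  omega

/-- Dynkin's expansion of `log (e^a e^b)`. -/
theorem logOneAdd_exp_mul_exp {a b : R} {L : ℕ} (hL : 0 < L) (h : WordsVanish a b L) :
    logOneAdd (exp a * exp b - 1) = ∑ N ∈ Finset.range L, wordSum (fun n rs =>
      ((-1) ^ (n + 1) / n / ∏ i, ((rs i).1.factorial * (rs i).2.factorial : ℚ)) •
        (word a b rs).prod) N := by
  rw [logOneAdd_eq_sum (isNilpotent_exp_mul_exp_sub_one hL h), sum_wordSum]
  refine Finset.sum_congr rfl fun n _ => ?_
  rw [exp_mul_exp_sub_one_pow hL h, Finset.smul_sum]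
  refine Finset.sum_congr rfl fun rs _ => ?_
  split_ifs
  · rw [smul_smul]
    congr 1
    push_cast
    rw [_root_.pow_succ, _root_.pow_succ, mul_assoc, neg_one_mul, neg_neg, mul_one, ← div_eq_mul_inv]
  · rw [smul_zero]

end Ring

end Dynkin

namespace Dynkin

open IsNilpotent Polynomial

theorem exists_map_of_forall {R S : Type*} (f : R → S) {x y : R} {w : List S}
    (h : ∀ z ∈ w, z = f x ∨ z = f y) : ∃ w' : List R, (∀ z ∈ w', z = x ∨ z = y) ∧ w = w'.map f := by
  induction w with
  | nil => exact ⟨[], by simp, rfl⟩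
  | cons z t ih =>
    obtain ⟨w', h1, rfl⟩ := ih fun z hz => h z (by simp [hz])
    rcases h z (by simp) with rfl | rfl
    · exact ⟨x :: w', by simpa using h1, rfl⟩
    · exact ⟨y :: w', by simpa using h1, rfl⟩

variable {R : Type*} [Ring R]

/-- Right-nested commutators. -/
def commNested : List R → R
  | [] => 0
  | [a] => a
  | a :: b :: t => a * commNested (b :: t) - commNested (b :: t) * a

theorem commNested_cons (a : R) {w : List R} (h : w ≠ []) :
    commNested (a :: w) = a * commNested w - commNested w * a := by
  cases w with
  | nil => exact absurd rfl h
  | cons b t => rfl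

theorem prod_map_C_mul_X (w : List R) :
    (w.map fun x => C x * X).prod = C w.prod * X ^ w.length := by
  induction w with
  | nil => simp
  | cons x t ih =>
    rw [List.map_cons, List.prod_cons, ih, List.prod_cons, List.length_cons, C_mul, mul_assoc,
      ← mul_assoc X, X_mul_C, mul_assoc, ← _root_.pow_succ', mul_assoc]

theorem commNested_map_C_mul_X (w : List R) :
    commNested (w.map fun x => C x * X) = C (commNested w) * X ^ w.length := by
  induction w with
  | nil => simp [commNested]
  | cons x t ih =>
    by_cases ht : t = []
    · subst ht
      simp [commNested]
    · have e1 : ∀ (n : R) (m : ℕ), (C x * X) * (C n * X ^ m) = C (x * n) * X ^ (m + 1) := fun n m => by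
        rw [mul_assoc, ← mul_assoc X, X_mul_C, mul_assoc, ← _root_.pow_succ', ← mul_assoc, C_mul]
      have e2 : ∀ (n : R) (m : ℕ), (C n * X ^ m) * (C x * X) = C (n * x) * X ^ (m + 1) := fun n m => by
        rw [mul_assoc, ← mul_assoc (X ^ m), X_pow_mul_C, mul_assoc, ← _root_.pow_succ, ← mul_assoc, C_mul]
      rw [List.map_cons, commNested_cons _ (by simpa using ht), ih, commNested_cons _ ht, e1, e2,
        ← sub_mul, C_sub, List.length_cons]

theorem map_commNested {S : Type*} [Ring S] (f : R →+* S) (w : List R) :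
    commNested (w.map f) = f (commNested w) := by
  induction w with
  | nil => simp [commNested]
  | cons x t ih =>
    by_cases ht : t = []
    · subst ht
      simp [commNested]
    · rw [List.map_cons, commNested_cons _ (by simpa using ht), ih, commNested_cons _ ht, map_sub,
        map_mul, map_mul]

variable [Algebra ℚ R]

/-- The component of weight `N` of the Baker-Campbell-Hausdorff series. -/
def bchTerm (x y : R) (N : ℕ) : R :=
  wordSum (fun n rs => ((-1) ^ (n + 1) / n /
    (N * ∏ i, ((rs i).1.factorial * (rs i).2.factorial : ℚ))) • commNested (word x y rs)) N

/-- The inner derivation. -/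
def ad (x : R) : Module.End ℚ R := LinearMap.mulLeft ℚ x - LinearMap.mulRight ℚ x

theorem ad_apply (x y : R) : ad x y = x * y - y * x := rfl

theorem exp_mulLeft {x : R} (hx : IsNilpotent x) :
    exp (LinearMap.mulLeft ℚ x) = LinearMap.mulLeft ℚ (exp x) :=
  (map_exp hx (Algebra.lmul ℚ R)).symm

theorem isNilpotent_mulLeft {x : R} (hx : IsNilpotent x) : IsNilpotent (LinearMap.mulLeft ℚ x) :=
  hx.map (Algebra.lmul ℚ R)

theorem isNilpotent_mulRight {x : R} (hx : IsNilpotent x) : IsNilpotent (LinearMap.mulRight ℚ x) := by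
  obtain ⟨n, hn⟩ := hx
  exact ⟨n, by rw [LinearMap.pow_mulRight, hn, LinearMap.mulRight_zero_eq_zero]⟩

theorem exp_mulRight {x : R} (hx : IsNilpotent x) :
    exp (LinearMap.mulRight ℚ x) = LinearMap.mulRight ℚ (exp x) := by
  obtain ⟨n, hn⟩ := hx
  have h : LinearMap.mulRight ℚ x ^ n = 0 := by
    rw [LinearMap.pow_mulRight, hn, LinearMap.mulRight_zero_eq_zero]
  ext y
  simp [exp_eq_sum hn, exp_eq_sum h, LinearMap.pow_mulRight, LinearMap.sum_apply, Finset.mul_sum]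

theorem mulRight_neg (x : R) : LinearMap.mulRight ℚ (-x) = -LinearMap.mulRight ℚ x := by
  ext y
  simp

theorem commute_mulLeft_mulRight (x y : R) : Commute (LinearMap.mulLeft ℚ x) (LinearMap.mulRight ℚ y) :=
  LinearMap.ext fun z => by simp [mul_assoc]

theorem isNilpotent_ad {x : R} (hx : IsNilpotent x) : IsNilpotent (ad x) :=
  (commute_mulLeft_mulRight x x).isNilpotent_sub (isNilpotent_mulLeft hx) (isNilpotent_mulRight hx)

theorem exp_ad_apply {x : R} (hx : IsNilpotent x) (y : R) : exp (ad x) y = exp x * y * exp (-x) := by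
  have h : ad x = LinearMap.mulLeft ℚ x + LinearMap.mulRight ℚ (-x) := by
    rw [mulRight_neg, ad, sub_eq_add_neg]
  rw [h, exp_add_of_commute (commute_mulLeft_mulRight _ _) (isNilpotent_mulLeft hx)
    (isNilpotent_mulRight hx.neg), exp_mulLeft hx, exp_mulRight hx.neg, mul_assoc]
  rfl

theorem WordsVanish.ad {a b : R} {L : ℕ} (h : WordsVanish a b L) : WordsVanish (ad a) (ad b) (2 * L) := by
  have key : ∀ (m : ℕ) (T : R), (∀ u v : List R, (∀ x ∈ u, x = a ∨ x = b) → (∀ x ∈ v, x = a ∨ x = b) →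
      u.length + v.length = m → u.prod * T * v.prod = 0) → ∀ w : List (Module.End ℚ R),
      (∀ x ∈ w, x = Dynkin.ad a ∨ x = Dynkin.ad b) → w.length = m → w.prod T = 0 := by
    intro m
    induction m with
    | zero =>
      intro T hT w _ hw
      rw [List.length_eq_zero_iff.1 hw]
      simpa using hT [] [] (by simp) (by simp) rfl
    | succ m ih =>
      intro T hT w hwm hw
      obtain ⟨w', x, rfl⟩ : ∃ w' x, w = w' ++ [x] :=
        ⟨_, _, (List.dropLast_append_getLast (List.ne_nil_of_length_eq_add_one hw)).symm⟩
      obtain ⟨z, hz, rfl⟩ : ∃ z, (z = a ∨ z = b) ∧ x = Dynkin.ad z := by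
        rcases hwm x (by simp) with rfl | rfl
        · exact ⟨a, .inl rfl, rfl⟩
        · exact ⟨b, .inr rfl, rfl⟩
      rw [List.prod_append, List.prod_singleton, Module.End.mul_apply]
      refine ih _ (fun u v hu hv huv => ?_) w' (fun x hx => hwm x (by simp [hx])) (by simpa using hw)
      have h1 := hT (u ++ [z]) v (fun x hx => by
        rcases List.mem_append.1 hx with hx | hx
        · exact hu x hx
        · rw [List.mem_singleton.1 hx]; exact hz) hv (by simp; omega)
      have h2 := hT u (z :: v) hu (fun x hx => by
        rcases List.mem_cons.1 hx with rfl | hx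
        · exact hz
        · exact hv x hx) (by simp; omega)
      rw [List.prod_append, List.prod_singleton] at h1
      rw [List.prod_cons] at h2
      rw [ad_apply, mul_sub, sub_mul, ← mul_assoc, h1, ← mul_assoc, mul_assoc _ z, h2, sub_zero]
  intro w hw hL
  refine LinearMap.ext fun T => key _ T (fun u v hu hv huv => ?_) w hw rfl
  by_cases hu' : L ≤ u.length
  · rw [h u hu hu', zero_mul, zero_mul]
  · rw [h v hv (by omega), mul_zero]

/-- If `[E, x] = x` for all letters of a word, its nested commutator is obtained from `E` by
iterated commutators. -/
theorem prod_map_ad_apply {E : R} {w : List R} (hw : ∀ x ∈ w, E * x - x * E = x) (h : w ≠ []) :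
    (w.map ad).prod E = -commNested w := by
  induction w with
  | nil => exact absurd rfl h
  | cons x t ih =>
    rw [List.map_cons, List.prod_cons, Module.End.mul_apply]
    by_cases ht : t = []
    · subst ht
      rw [List.map_nil, List.prod_nil, Module.End.one_apply, ad_apply, commNested, ← neg_sub,
        hw x (by simp)]
    · rw [ih (fun y hy => hw y (by simp [hy])) ht, commNested_cons x ht, ad_apply]
      noncomm_ring

theorem commutator_logOneAdd {a b E : R} {L : ℕ} (hL : 0 < L) (h : WordsVanish a b L)
    (ha : E * a - a * E = a) (hb : E * b - b * E = b) :
    E * logOneAdd (exp a * exp b - 1) - logOneAdd (exp a * exp b - 1) * E =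
      ∑ N ∈ Finset.range (2 * L), (N : ℚ) • bchTerm a b N := by
  have hn : IsNilpotent (exp a * exp b - 1) := ⟨L, isNilpotent_exp_mul_exp_sub_one hL h⟩
  set Z := logOneAdd (exp a * exp b - 1) with hZ
  have hZn : IsNilpotent Z := isNilpotent_logOneAdd hn
  have hZe : exp Z = exp a * exp b := by rw [hZ, exp_logOneAdd hn, add_sub_cancel]
  have ha' : IsNilpotent a := ⟨L, h.pow_left⟩
  have hb' : IsNilpotent b := ⟨L, h.pow_right⟩
  have hZe' : exp (-Z) = exp (-b) * exp (-a) := by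
    have h1 : exp Z * (exp (-b) * exp (-a)) = 1 := by
      rw [hZe, mul_assoc, ← mul_assoc (exp b), exp_mul_exp_neg_self hb', one_mul,
        exp_mul_exp_neg_self ha']
    exact (left_inv_eq_right_inv (exp_neg_mul_exp_self hZn) h1)
  have h1 : exp (ad Z) = exp (ad a) * exp (ad b) := by
    ext y
    rw [exp_ad_apply hZn, Module.End.mul_apply, exp_ad_apply hb', exp_ad_apply ha', hZe, hZe']
    simp only [mul_assoc]
  have h2 := logOneAdd_exp_mul_exp (by omega) h.ad
  rw [← h1, logOneAdd_exp (isNilpotent_ad hZn)] at h2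
  have h3 := congrArg (fun T : Module.End ℚ R => -T E) h2
  simp only [ad_apply, neg_sub] at h3
  rw [h3, LinearMap.sum_apply, ← Finset.sum_neg_distrib]
  refine Finset.sum_congr rfl fun N _ => ?_
  have h4 := map_wordSum (LinearMap.applyₗ (R := ℚ) E : Module.End ℚ R →ₗ[ℚ] R) (fun n rs =>
      ((-1) ^ (n + 1) / n / ∏ i, ((rs i).1.factorial * (rs i).2.factorial : ℚ)) •
        (word (ad a) (ad b) rs).prod) N
  rw [LinearMap.applyₗ_apply_apply] at h4
  rw [h4, bchTerm]
  have h5 := map_wordSum (-LinearMap.id : R →ₗ[ℚ] R) (fun n rs => LinearMap.applyₗ (R := ℚ) E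
    (((-1) ^ (n + 1) / n / ∏ i, ((rs i).1.factorial * (rs i).2.factorial : ℚ)) •
        (word (ad a) (ad b) rs).prod)) N
  have h6 := map_wordSum ((N : ℚ) • LinearMap.id : R →ₗ[ℚ] R) (fun n rs => ((-1) ^ (n + 1) / n /
    (N * ∏ i, ((rs i).1.factorial * (rs i).2.factorial : ℚ))) • commNested (word a b rs)) N
  refine h5.trans (Eq.trans ?_ h6.symm)
  refine wordSum_congr fun n rs hrs hN => ?_
  have h7 : word a b rs ≠ [] := by
    rw [← List.length_pos_iff_ne_nil, length_word]
    omega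
  have h8 : ∀ x ∈ word a b rs, E * x - x * E = x := fun x hx => by
    rcases mem_word hx with rfl | rfl
    · exact ha
    · exact hb
  rw [LinearMap.applyₗ_apply_apply, LinearMap.smul_apply, ← map_word, prod_map_ad_apply h8 h7]
  have h9 : (N : ℚ) ≠ 0 := by positivity
  simp only [LinearMap.neg_apply, LinearMap.id_apply, smul_neg, neg_neg, LinearMap.smul_apply, smul_smul]
  congr 1
  field_simp

/-- The Baker-Campbell-Hausdorff formula, in Dynkin's form. -/
theorem logOneAdd_eq_sum_bchTerm {x y : R} {L : ℕ} (hL : 0 < L) (h : WordsVanish x y L) :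
    logOneAdd (exp x * exp y - 1) = ∑ N ∈ Finset.range (2 * L), bchTerm x y N := by
  let φ : R[X] →+* Module.End ℚ R[X] := (Algebra.lmul ℚ R[X]).toRingHom
  have hφ : ∀ f g : R[X], φ f g = f * g := fun f g => rfl
  let f : R → Module.End ℚ R[X] := fun r => φ (C r * X)
  let E : Module.End ℚ R[X] := LinearMap.mulLeft ℚ X * (derivative (R := R)).restrictScalars ℚ
  have hE : ∀ g : R[X], E g = X * derivative g := fun g => rfl
  have hEφ : ∀ g : R[X], E * φ g - φ g * E = φ (X * derivative g) := fun g => by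
    refine LinearMap.ext fun z => ?_
    change E (g * z) - g * E z = X * derivative g * z
    rw [hE, hE, derivative_mul, mul_add, ← mul_assoc, ← mul_assoc, ← mul_assoc, X_mul (p := g), add_sub_cancel_right]
  have hf : ∀ r, E * f r - f r * E = f r := fun r => by
    rw [hEφ, derivative_C_mul, derivative_X, mul_one, X_mul]
  have hw : WordsVanish (f x) (f y) L := fun w hw hL => by
    obtain ⟨w', h1, rfl⟩ := exists_map_of_forall f hw
    rw [show f = φ ∘ fun r => C r * X from rfl, ← List.map_map, ← map_list_prod, prod_map_C_mul_X,
      h w' h1 (by simpa using hL), C_0, zero_mul, map_zero]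
  have hx : IsNilpotent (C x * X) := (commute_X (C x)).symm.isNilpotent_mul_right
    (IsNilpotent.map ⟨L, h.pow_left⟩ C)
  have hy : IsNilpotent (C y * X) := (commute_X (C y)).symm.isNilpotent_mul_right
    (IsNilpotent.map ⟨L, h.pow_right⟩ C)
  have hn : IsNilpotent (exp (C x * X) * exp (C y * X) - 1) := by
    refine ⟨L, ?_⟩
    have := isNilpotent_exp_mul_exp_sub_one hL hw
    have h1 : φ ((exp (C x * X) * exp (C y * X) - 1) ^ L) = 0 := by
      rw [map_pow, map_sub, map_mul, map_exp hx, map_exp hy, map_one]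
      exact this
    have h3 := LinearMap.congr_fun h1 1
    rwa [hφ, mul_one] at h3
  have key := commutator_logOneAdd hL hw (hf x) (hf y)
  have h1 : logOneAdd (exp (f x) * exp (f y) - 1) = φ (logOneAdd (exp (C x * X) * exp (C y * X) - 1)) := by
    rw [map_logOneAdd _ hn, map_sub, map_mul, map_exp hx, map_exp hy, map_one]
  have h2 : ∀ N, bchTerm (f x) (f y) N = φ (C (bchTerm x y N) * X ^ N) := fun N => by
    have h1 := map_wordSum (φ.toAddMonoidHom.comp (monomial N).toAddMonoidHom) (fun n rs =>
      ((-1) ^ (n + 1) / n / (N * ∏ i, ((rs i).1.factorial * (rs i).2.factorial : ℚ))) •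
        commNested (word x y rs)) N
    rw [C_mul_X_pow_eq_monomial]
    refine Eq.trans (wordSum_congr fun n rs hrs _ => ?_) h1.symm
    change _ = φ (monomial N _)
    rw [← map_word, show f = φ ∘ fun r => C r * X from rfl, ← List.map_map, map_commNested,
      commNested_map_C_mul_X, length_word, hrs, C_mul_X_pow_eq_monomial, ← smul_monomial, map_rat_smul]
  set z := logOneAdd (exp (C x * X) * exp (C y * X) - 1) with hz
  let s := ∑ N ∈ Finset.range (2 * L), C (bchTerm x y N) * X ^ N
  have h3 : derivative (z - s) = 0 := by
    rw [h1, hEφ] at key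
    have h4 := LinearMap.congr_fun key 1
    rw [hφ, mul_one, LinearMap.sum_apply] at h4
    have h5 : X * derivative z = X * derivative s := by
      rw [h4, derivative_sum, Finset.mul_sum]
      refine Finset.sum_congr rfl fun N _ => ?_
      rw [h2, LinearMap.smul_apply, hφ, mul_one, derivative_C_mul, derivative_X_pow, ← mul_assoc X,
        X_mul_C, mul_assoc, Nat.cast_smul_eq_nsmul, nsmul_eq_mul]
      rcases N with _ | N
      · simp
      · rw [Nat.add_sub_cancel, ← mul_assoc X, X_mul_C, mul_assoc, ← _root_.pow_succ', C_eq_natCast,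
          ← mul_assoc, ← mul_assoc, (Nat.cast_commute _ _).eq]
    ext n
    have := congrArg (fun g => g.coeff (n + 1)) h5
    simpa [coeff_X_mul, sub_eq_zero] using this
  have h4 := eq_C_of_derivative_eq_zero h3
  have h5 : (z - s).coeff 0 = 0 := by
    have h6 : z.coeff 0 = 0 := by
      rw [← constantCoeff_apply, map_logOneAdd _ hn, map_sub, map_mul, map_exp hx, map_exp hy]
      simp [logOneAdd_eq_sum (pow_one (0 : R))]
    have h7 : s.coeff 0 = 0 := by
      rw [finsetSum_coeff]
      refine Finset.sum_eq_zero fun N _ => ?_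
      rcases N with _ | N
      · simp [bchTerm, wordSum]
      · simp
    rw [coeff_sub, h6, h7, sub_zero]
  rw [h5, C_0, sub_eq_zero] at h4
  have := congrArg evalOne h4
  rw [map_logOneAdd _ hn, map_sub, map_mul, map_exp hx, map_exp hy, map_one, map_mul, map_mul, evalOne_C,
    evalOne_C, evalOne_X, mul_one, mul_one] at this
  rw [this, map_sum]
  refine Finset.sum_congr rfl fun N _ => ?_
  rw [map_mul, map_pow, evalOne_C, evalOne_X, one_pow, mul_one]

end Dynkin

namespace FilteredDGModule

variable {k : Type u} [CommRing k] {A : FilteredDGModule.{u, w} k}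

/-- Convergence of a sequence for the filtration. -/
def HasLim (x : ℕ → A) (y : A) : Prop := ∀ l, ∃ N, ∀ m ≥ N, y - x m ∈ A.fil l

theorem HasLim.add {x x' : ℕ → A} {y y' : A} (h : HasLim x y) (h' : HasLim x' y') :
    HasLim (fun m => x m + x' m) (y + y') := fun l => by
  obtain ⟨N, hN⟩ := h l
  obtain ⟨N', hN'⟩ := h' l
  refine ⟨max N N', fun m hm => ?_⟩
  rw [add_sub_add_comm]
  exact add_mem (hN m (by omega)) (hN' m (by omega))

theorem HasLim.smul (r : k) {x : ℕ → A} {y : A} (h : HasLim x y) : HasLim (fun m => r • x m) (r • y) :=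
  fun l => by
  obtain ⟨N, hN⟩ := h l
  refine ⟨N, fun m hm => ?_⟩
  rw [← smul_sub]
  exact Submodule.smul_mem _ r (hN m hm)

theorem HasLim.sum {ι : Type*} (s : Finset ι) {x : ι → ℕ → A} {y : ι → A}
    (h : ∀ i ∈ s, HasLim (x i) (y i)) : HasLim (fun m => ∑ i ∈ s, x i m) (∑ i ∈ s, y i) := by
  classical
  induction s using Finset.induction_on with
  | empty => exact fun l => ⟨0, fun m _ => by simp⟩
  | insert i s hi ih =>
    simp only [Finset.sum_insert hi]
    exact (h i (by simp)).add (ih fun j hj => h j (by simp [hj]))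

variable (hA : A.IsComplete)
include hA

theorem IsComplete.eq_zero {x : A} (h : ∀ l, x ∈ A.fil l) : x = 0 := by
  rw [← A.sum_decompose x]
  refine Finset.sum_eq_zero fun i _ => ?_
  obtain ⟨y, -, hy⟩ := hA i (fun _ => 0) (fun _ => zero_mem _) fun l => by simp
  have h1 := hy (DirectSum.decompose A.deg x i) ⟨SetLike.coe_mem _, fun l => by
    rw [sub_zero]; exact A.fil_homogeneous l x (h l) i⟩
  have h2 := hy 0 ⟨zero_mem _, fun l => by simp⟩
  exact h1.trans h2.symm

theorem IsComplete.lim_unique {x : ℕ → A} {y y' : A} (h : HasLim x y) (h' : HasLim x y') : y = y' := by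
  rw [← sub_eq_zero]
  refine hA.eq_zero fun l => ?_
  obtain ⟨N, hN⟩ := h l
  obtain ⟨N', hN'⟩ := h' l
  have := sub_mem (hN (max N N') (by omega)) (hN' (max N N') (by omega))
  rwa [sub_sub_sub_cancel_right] at this

theorem IsComplete.exists_lim {i : ℤ} {x : ℕ → A} (hx : ∀ m, x m ∈ A.deg i)
    (h : ∀ l, ∃ N, ∀ m ≥ N, x m - x N ∈ A.fil l) : ∃ y ∈ A.deg i, HasLim x y := by
  choose φ hφ using h
  let ψ : ℕ → ℕ := fun l => ∑ l' ∈ Finset.range (l + 1), φ l'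
  have h1 : ∀ l, φ l ≤ ψ l := fun l =>
    Finset.single_le_sum (f := φ) (fun _ _ => Nat.zero_le _) (by simp)
  have h2 : ∀ l, ψ l ≤ ψ (l + 1) := fun l => by
    simp only [ψ]
    rw [Finset.sum_range_succ _ (l + 1)]
    omega
  obtain ⟨y, ⟨hy, hy'⟩, -⟩ := hA i (fun l => x (ψ l)) (fun l => hx _) fun l => by
    have := sub_mem (hφ l _ ((h1 l).trans (h2 l))) (hφ l _ (h1 l))
    rwa [sub_sub_sub_cancel_right] at this
  refine ⟨y, hy, fun l => ⟨φ l, fun m hm => ?_⟩⟩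
  have := sub_mem (add_mem (hy' l) (hφ l _ (h1 l))) (hφ l m hm)
  rwa [sub_add_sub_cancel, sub_sub_sub_cancel_right] at this

end FilteredDGModule

namespace Conv

open FilteredDGModule

variable {k : Type u} [CommRing k] {C : FilteredDGCooperad.{u, v} k} {A : FilteredDGModule.{u, w} k}

theorem eq_of_inFil (hA : A.IsComplete) {f g : Family C A} (h : ∀ n l, InFil l (f n - g n)) : f = g := by
  funext n
  refine LinearMap.ext fun c => MultilinearMap.ext fun a => ?_
  rw [← sub_eq_zero]
  refine hA.eq_zero fun l => ?_
  have := h n l 0 c ((C.obj n).mem_fil_zero c) a (fun _ => 0) fun s => A.mem_fil_zero _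
  simpa using this

theorem converges_unique (hA : A.IsComplete) {x : ℕ → Family C A} {L L' : Family C A} (h : Converges x L)
    (h' : Converges x L') : L = L' :=
  eq_of_inFil hA fun n l => by
  obtain ⟨N, hN⟩ := h n l
  obtain ⟨N', hN'⟩ := h' n l
  have := (hN (max N N') (by omega)).sub (hN' (max N N') (by omega))
  rwa [sub_sub_sub_cancel_right] at this

theorem seriesSum_eq (hA : A.IsComplete) {x : ℕ → Family C A} {L : Family C A} (h : Converges x L) :
    seriesSum x = L := by
  have h' : ∃ L, Converges x L := ⟨L, h⟩
  rw [seriesSum, dif_pos h']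
  exact converges_unique hA h'.choose_spec h

/-- A limit of elements of the convolution algebra is in the convolution algebra. -/
theorem exists_converges (hA : A.IsComplete) {j : ℤ} {x : ℕ → Family C A} (hx : ∀ i, IsHom j (x i))
    (hc : ∀ n l, ∃ N, ∀ i ≥ N, InFil l (x i n)) : ∃ L, IsHom j L ∧ Converges x L := by
  let S : ℕ → Family C A := fun m => ∑ i ∈ Finset.range m, x i
  have hS : ∀ m, IsHom j (S m) := fun m => (hom C A j).sum_mem fun i _ => hx i
  have hS' : ∀ m n, S m n = ∑ i ∈ Finset.range m, x i n := fun m n => Finset.sum_apply _ _ _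
  choose φ hφ using hc
  have hcauchy : ∀ n l, ∀ m ≥ φ n l, ∀ m' ≥ m, InFil l (S m' n - S m n) := fun n l m hm m' hm' => by
    rw [hS', hS', Finset.sum_range_sub_sum_range hm']
    refine Finset.sum_induction _ (InFil l) (fun _ _ => InFil.add) InFil.zero fun i hi => hφ n l i ?_
    rw [Finset.mem_filter] at hi
    omega
  have hlim : ∀ n (c : C.obj n) (a : Fin n → A), ∃ y, HasLim (fun m => S m n c a) y := by
    intro n c a
    have h1 : ∀ (i : ℤ) (c : C.obj n), c ∈ (C.obj n).deg i → ∀ (d : Fin n → ℤ) (a : Fin n → A),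
        (∀ s, a s ∈ A.deg (d s)) → ∃ y, HasLim (fun m => S m n c a) y := fun i c hc d a ha => by
      obtain ⟨y, -, hy⟩ := hA.exists_lim (fun m => (hS m).2 n i c hc a d ha) fun l =>
        ⟨φ n l, fun m hm => by
          have := hcauchy n l _ le_rfl m hm 0 c ((C.obj n).mem_fil_zero c) a (fun _ => 0)
            fun s => A.mem_fil_zero _
          simpa using this⟩
      exact ⟨y, hy⟩
    let I := Fintype.piFinset fun s => A.degrees (a s)
    have h2 : ∀ m, S m n c a = ∑ i ∈ (C.obj n).degrees c, ∑ r ∈ I,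
        S m n (DirectSum.decompose (C.obj n).deg c i) fun s => DirectSum.decompose A.deg (a s) (r s) := by
      intro m
      conv_lhs => rw [← (C.obj n).sum_decompose c, map_sum, sum_apply]
      refine Finset.sum_congr rfl fun i _ => ?_
      conv_lhs => rw [← funext fun s => A.sum_decompose (a s)]
      rw [MultilinearMap.map_sum_finset]
    choose y hy using fun (i : ℤ) (r : Fin n → ℤ) => h1 i (DirectSum.decompose (C.obj n).deg c i)
      (SetLike.coe_mem _) r (fun s => DirectSum.decompose A.deg (a s) (r s)) fun s => SetLike.coe_mem _
    rw [funext h2]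
    exact ⟨_, HasLim.sum _ fun i _ => HasLim.sum _ fun r _ => hy i r⟩
  choose L₀ hL₀ using hlim
  let L : Family C A := fun n =>
    { toFun := fun c =>
        { toFun := L₀ n c
          map_update_add' := fun a i x y => hA.lim_unique (hL₀ n c _) (by
            have := (hL₀ n c (Function.update a i x)).add (hL₀ n c (Function.update a i y))
            convert this using 2 with m
            convert (S m n c).map_update_add a i x y)
          map_update_smul' := fun a i r x => hA.lim_unique (hL₀ n c _) (by
            have := (hL₀ n c (Function.update a i x)).smul r
            convert this using 2 with m
            convert (S m n c).map_update_smul a i r x) }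
      map_add' := fun c c' => MultilinearMap.ext fun a => hA.lim_unique (hL₀ n (c + c') a) (by
        have := (hL₀ n c a).add (hL₀ n c' a)
        convert this using 2 with m
        · rw [map_add]
          rfl
        · rfl)
      map_smul' := fun r c => MultilinearMap.ext fun a => hA.lim_unique (hL₀ n (r • c) a) (by
        have := (hL₀ n c a).smul r
        convert this using 2 with m
        · rw [map_smul]
          rfl
        · rfl) }
  have hL : ∀ n c a, HasLim (fun m => S m n c a) (L n c a) := hL₀
  have hconv : ∀ n l, ∀ m ≥ φ n l, InFil l (L n - S m n) := fun n l m hm i c hc a d ha => by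
    obtain ⟨N, hN⟩ := hL n c a (∑ s, d s + (i + l))
    have h1 := hN (max N m) (by omega)
    have h2 := hcauchy n l m hm (max N m) (by omega) i c hc a d ha
    have := add_mem h1 h2
    rwa [LinearMap.sub_apply, sub_apply, sub_add_sub_cancel] at this
  refine ⟨L, ⟨fun n σ c => MultilinearMap.ext fun a => ?_, fun n i c hc a d ha => ?_, fun n => ?_⟩,
    fun n l => ⟨φ n l, fun m hm => ?_⟩⟩
  · rw [← sub_eq_zero]
    refine hA.eq_zero fun l => ?_
    have h1 := hconv n l _ le_rfl 0 (C.act n σ c) ((C.obj n).mem_fil_zero _)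
    have h2 := EndOp.act_mem_fil σ (hconv n l _ le_rfl 0 c ((C.obj n).mem_fil_zero _))
    have h3 := sub_mem h1 h2 a (fun _ => 0) fun s => A.mem_fil_zero _
    rw [← EndOp.actLinear_apply, LinearMap.sub_apply, LinearMap.sub_apply, (hS _).1, map_sub,
      EndOp.actLinear_apply, EndOp.actLinear_apply, sub_sub_sub_cancel_right] at h3
    simpa using h3
  · obtain ⟨y, hy, hy'⟩ := hA.exists_lim (fun m => (hS m).2 n i c hc a d ha) fun l =>
      ⟨φ n l, fun m hm => by
        have := hcauchy n l _ le_rfl m hm 0 c ((C.obj n).mem_fil_zero c) a (fun _ => 0)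
          fun s => A.mem_fil_zero _
        simpa using this⟩
    rwa [hA.lim_unique (hL n c a) hy']
  · have := (hconv n 0 _ le_rfl).add ((hS (φ n 0)).3 n)
    rwa [sub_add_cancel] at this
  · rw [← hS']
    exact hconv n l m hm

theorem inFil_of_converges {x : ℕ → Family C A} {L : Family C A} (h : Converges x L) {n l : ℕ}
    (hx : ∀ i, InFil l (x i n)) : InFil l (L n) := by
  obtain ⟨N, hN⟩ := h n l
  have := (hN N le_rfl).add
    (Finset.sum_induction (s := Finset.range N) (fun i => x i n) (InFil l) (fun _ _ => InFil.add) InFil.zero fun i _ => hx i)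
  rwa [sub_add_cancel] at this

/-- The remainder of a series whose terms lie deeper and deeper in a weighted filtration. -/
theorem sub_sum_mem_colFil {W : A.Weighting} {t : ℤ} {x : ℕ → Family C A} {L : Family C A} (h : Converges x L)
    (hx : ∀ i : ℕ, x i ∈ colFil W (i - t)) (m : ℕ) : L - ∑ i ∈ Finset.range m, x i ∈ colFil W (m - t) := by
  intro n i c hc d a ha
  obtain ⟨N, hN⟩ := h n ((2 * i + ∑ s, d s + (m - t) + W.bound + 1) / 2).toNat
  have h1 : (L n - ∑ i ∈ Finset.range (max N m), x i n) c a ∈ W.part (2 * i + ∑ s, d s + (m - t)) := by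
    have := hN (max N m) (by omega) i c hc a (fun _ => 0) fun s => A.mem_fil_zero _
    exact W.fil_le _ (A.fil_mono (by simp) this)
  have h2 : (∑ i ∈ Finset.range (max N m), x i - ∑ i ∈ Finset.range m, x i) ∈ colFil W (m - t) := by
    rw [Finset.sum_range_sub_sum_range (by omega)]
    refine sum_mem fun i hi => colFil_antitone W ?_ (hx i)
    rw [Finset.mem_filter] at hi
    omega
  have := add_mem h1 (h2 n i c hc d a ha)
  rw [← add_apply, ← LinearMap.add_apply, Pi.sub_apply, Finset.sum_apply, sub_add_sub_cancel] at this
  rwa [Pi.sub_apply]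

theorem exists_converges_of_mem_colFil (hA : A.IsComplete) (W : A.Weighting) (t : ℤ) {j : ℤ}
    {x : ℕ → Family C A} (hx : ∀ i, IsHom j (x i)) (hx' : ∀ i : ℕ, x i ∈ colFil W (i - t)) :
    ∃ L, IsHom j L ∧ Converges x L :=
  exists_converges hA hx fun n l => ⟨(2 * l + n * W.bound + t).toNat, fun i hi =>
    inFil_of_mem_colFil W (hx' i) (by omega)⟩

end Conv

namespace FilteredEnd

variable {k V : Type*} [CommRing k] [AddCommGroup V] [Module k V] (F : ℕ → Submodule k V)

/-- The algebra of endomorphisms which preserve a filtration. -/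
def filtEnd : Subalgebra k (Module.End k V) where
  carrier := {T | ∀ l, ∀ v ∈ F l, T v ∈ F l}
  mul_mem' hS hT l v hv := hS l _ (hT l v hv)
  add_mem' hS hT l v hv := add_mem (hS l v hv) (hT l v hv)
  algebraMap_mem' r l v hv := by
    rw [Module.algebraMap_end_apply]
    exact Submodule.smul_mem _ r hv

/-- The action on the quotient by a step of the filtration. -/
def toQuot (l : ℕ) : filtEnd F →ₐ[k] Module.End k (V ⧸ F l) where
  toFun T := (F l).mapQ (F l) T.1 (T.2 l)
  map_one' := Submodule.mapQ_id _
  map_mul' S T := Submodule.mapQ_comp _ _ _ _ _ _ _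
  map_zero' := Submodule.mapQ_zero _ _ _
  map_add' S T := by
    ext v
    rfl
  commutes' r := by
    ext v
    rfl

theorem toQuot_mk (l : ℕ) (T : filtEnd F) (v : V) :
    toQuot F l T (Submodule.Quotient.mk v) = Submodule.Quotient.mk (T.1 v) := rfl

/-- The operator `T` raises the filtration by `r`. -/
def Raises (r : ℕ) (T : Module.End k V) : Prop := ∀ l, ∀ v ∈ F l, T v ∈ F (l + r)

variable {F}

theorem Raises.pow {T : Module.End k V} (h : Raises F 1 T) (n : ℕ) : Raises F n (T ^ n) := by
  induction n with
  | zero => exact fun l v hv => hv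
  | succ n ih =>
    intro l v hv
    rw [pow_succ', Module.End.mul_apply]
    exact h _ _ (ih l v hv)

variable (hF : Antitone F) (hF0 : F 0 = ⊤)

include hF0 in
theorem Raises.mem {r : ℕ} {T : Module.End k V} (h : Raises F r T) (v : V) : T v ∈ F r := by
  have := h 0 v (by rw [hF0]; trivial)
  rwa [zero_add] at this

include hF hF0

theorem toQuot_eq_zero {r l : ℕ} (hl : l ≤ r) {T : filtEnd F} (h : Raises F r T.1) :
    toQuot F l T = 0 := by
  ext v
  change toQuot F l T (Submodule.Quotient.mk v) = 0
  rw [toQuot_mk, Submodule.Quotient.mk_eq_zero]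
  exact hF hl (h.mem hF0 v)

theorem toQuot_pow_eq_zero {l : ℕ} {T : filtEnd F} (h : Raises F 1 T.1) : toQuot F l T ^ l = 0 := by
  rw [← map_pow]
  exact toQuot_eq_zero hF hF0 le_rfl (h.pow l)

theorem isNilpotent_toQuot (l : ℕ) {T : filtEnd F} (h : Raises F 1 T.1) : IsNilpotent (toQuot F l T) :=
  ⟨l, toQuot_pow_eq_zero hF hF0 h⟩

end FilteredEnd

namespace FilteredEnd

variable {k V : Type*} [CommRing k] [Algebra ℚ k] [AddCommGroup V] [Module k V] {F : ℕ → Submodule k V}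

instance endAlgebraRat : Algebra ℚ (Module.End k V) := Algebra.compHom _ (algebraMap ℚ k)

theorem rat_smul_end (r : ℚ) (T : Module.End k V) : r • T = algebraMap ℚ k r • T := rfl

/-- The truncated exponential series. -/
def expSum (M : ℕ) (T : Module.End k V) : Module.End k V := ∑ n ∈ Finset.range M, invFact k n • T ^ n

theorem expSum_apply (M : ℕ) (T : Module.End k V) (v : V) :
    expSum M T v = ∑ n ∈ Finset.range M, invFact k n • (T ^ n) v := by
  simp [expSum, LinearMap.sum_apply]

theorem map_expSum {V' : Type*} [AddCommGroup V'] [Module k V'] (f : V →ₗ[k] V') {T : Module.End k V}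
    {T' : Module.End k V'} (h : ∀ v, f (T v) = T' (f v)) (M : ℕ) (v : V) :
    f (expSum M T v) = expSum M T' (f v) := by
  rw [expSum_apply, expSum_apply, map_sum]
  refine Finset.sum_congr rfl fun n hn => ?_
  rw [map_smul]
  congr 1
  clear hn
  induction n with
  | zero => rfl
  | succ n ih => rw [pow_succ', pow_succ', Module.End.mul_apply, Module.End.mul_apply, h, ih]

theorem mk_expSum (hF : Antitone F) (hF0 : F 0 = ⊤) {l M : ℕ} (hl : l ≤ M) {T : filtEnd F} (h : Raises F 1 T.1) (v : V) :
    (Submodule.Quotient.mk (expSum M T.1 v) : V ⧸ F l) =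
      IsNilpotent.exp (toQuot F l T) (Submodule.Quotient.mk v) := by
  rw [IsNilpotent.exp_eq_sum (pow_eq_zero_of_le hl (toQuot_pow_eq_zero hF hF0 h)), LinearMap.sum_apply,
    expSum_apply, ← Submodule.mkQ_apply, map_sum]
  refine Finset.sum_congr rfl fun n _ => ?_
  rw [map_smul, rat_smul_end, LinearMap.smul_apply, ← map_pow, toQuot_mk]
  rfl

end FilteredEnd

namespace Conv

open FilteredDGModule FilteredEnd

variable {k : Type u} [CommRing k] {C : FilteredDGCooperad.{u, v} k}
  {A B : FilteredDGModule.{u, w} k}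

/-! ### Conjugation and pre-Lie products -/

theorem comp_cons {X Y : Type*} (β : X → Y) {n : ℕ} (z : X) (b : Fin n → X) :
    (fun s => β ((Fin.cons z b : Fin (n + 1) → X) s)) = (Fin.cons (β z) fun s => β (b s) : Fin (n + 1) → Y) := by
  funext s
  refine Fin.cases ?_ (fun s => ?_) s <;> rfl

theorem conj_id (f : Family C A) : conj LinearMap.id LinearMap.id f = f := rfl

variable [Algebra ℚ k]

theorem conj_star_of_comp {α : A →ₗ[k] B} {β : B →ₗ[k] A} (hβ : IsStrict β) (j : ℤ) {f g : Family C A}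
    {g' : Family C B}
    (h : ∀ (q : ℕ) (y : C.obj q) a, g q y (fun s => β (a s)) = β (g' q y a)) :
    conj α β (star j f g) = star j (conj α β f) g' := by
  refine star_conj α β hβ.deg j fun p q x y a b => ?_
  rw [h, ← comp_cons]
  rfl

theorem star_congr_right (j : ℤ) {f g g' : Family C A}
    (h : ∀ (p q : ℕ) (x : C.obj (p + 1)) (y : C.obj q) a b,
      f _ x (Fin.cons (g _ y a) b) = f _ x (Fin.cons (g' _ y a) b)) : star j f g = star j f g' :=
  star_conj LinearMap.id LinearMap.id (fun _ _ h => h) j h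

theorem conj_star_conj {α α' : A →ₗ[k] B} {β : B →ₗ[k] A} (hβ : IsStrict β)
    (h : ∀ x, β (α' x) = x) (j : ℤ) (f g : Family C A) :
    star j (conj α β f) (conj α' β g) = conj α β (star j f g) := by
  refine (star_conj α β hβ.deg j fun p q x y a b => ?_).symm
  change _ = α (f _ x fun s => β ((Fin.cons (α' (g _ y fun s => β (a s))) b : Fin (p + 1) → B) s))
  rw [comp_cons, h]

theorem star_conj_congr {D : FilteredDGModule.{u, w} k} {α : A →ₗ[k] B} {β : B →ₗ[k] A}
    {α' α'' : D →ₗ[k] B} {β' : B →ₗ[k] D} (h : ∀ x, β (α' x) = β (α'' x)) (j : ℤ) (f : Family C A)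
    (g : Family C D) : star j (conj α β f) (conj α' β' g) = star j (conj α β f) (conj α'' β' g) := by
  refine star_congr_right j fun p q x y a b => ?_
  change α (f _ x fun s => β ((Fin.cons (α' (g _ y fun s => β' (a s))) b : Fin (p + 1) → B) s)) =
    α (f _ x fun s => β ((Fin.cons (α'' (g _ y fun s => β' (a s))) b : Fin (p + 1) → B) s))
  rw [comp_cons, comp_cons, h]

theorem star_zero_right (j : ℤ) (f : Family C A) : star j f 0 = 0 := (starₗ j f).map_zero

theorem star_conj_eq_zero {D : FilteredDGModule.{u, w} k} {α : A →ₗ[k] B} {β : B →ₗ[k] A}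
    {α' : D →ₗ[k] B} {β' : B →ₗ[k] D} (h : ∀ x, β (α' x) = 0) (j : ℤ) (f : Family C A)
    (g : Family C D) : star j (conj α β f) (conj α' β' g) = 0 := by
  have : conj (0 : D →ₗ[k] B) β' g = 0 := rfl
  rw [star_conj_congr (α'' := (0 : D →ₗ[k] B)) (fun x => by rw [h]; simp) j, this, star_zero_right]

end Conv

namespace Conv

open FilteredDGModule FilteredEnd

variable {k : Type u} [CommRing k] {C : FilteredDGCooperad.{u, v} k}
  {A B : FilteredDGModule.{u, w} k}

variable (C A) in
/-- The module of equivariant filtered families. -/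
def Sym : Type (max v w) := sym C A

instance : AddCommGroup (Sym C A) := inferInstanceAs (AddCommGroup (sym C A))

instance : Module k (Sym C A) := inferInstanceAs (Module k (sym C A))

/-- The family underlying an element of `Sym C A`. -/
def Sym.val : Sym C A →ₗ[k] Family C A := (sym C A).subtype

/-- An equivariant filtered family, as an element of `Sym C A`. -/
def Sym.mk (f : Family C A) (hf : IsSym f) : Sym C A := (⟨f, hf⟩ : sym C A)

theorem Sym.val_mk (f : Family C A) (hf : IsSym f) : (Sym.mk f hf).val = f := rfl

theorem Sym.isSym (x : Sym C A) : IsSym x.val := x.2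

theorem Sym.ext {x y : Sym C A} (h : x.val = y.val) : x = y := Subtype.ext h

/-- Conjugation, on equivariant families. -/
def conjSym {α : A →ₗ[k] B} {β : B →ₗ[k] A} (hα : IsStrict α) (hβ : IsStrict β) : Sym C A →ₗ[k] Sym C B where
  toFun f := Sym.mk (conj α β f.val) (conj_isSym hα hβ f.isSym)
  map_add' f g := Sym.ext ((conj α β).map_add f.val g.val)
  map_smul' r f := Sym.ext ((conj α β).map_smul r f.val)

variable (W : A.Weighting)

variable (C) in
/-- The weighted filtration of the module of equivariant families. -/
def symFil (l : ℕ) : Submodule k (Sym C A) := (colFil W (l - W.bound)).comap Sym.val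

theorem mem_symFil {l : ℕ} {x : Sym C A} : x ∈ symFil C W l ↔ x.val ∈ colFil W (l - W.bound) := Iff.rfl

theorem symFil_antitone : Antitone (symFil C W) :=
  fun _ _ h _ hx => colFil_antitone W (by omega) hx

theorem symFil_zero : symFil C W 0 = ⊤ :=
  eq_top_iff.2 fun x _ => by
    rw [mem_symFil]
    simpa using mem_colFil_neg_bound W x.isSym

variable (C) in
/-- The equivariant families which do not lower the weighted filtration. -/
def insertable : Submodule k (Sym C A) := (colFil W 0).comap Sym.val

variable [Algebra ℚ k]

/-- The operator `x ↦ x ⋆ Y`. -/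
def insLin (j : ℤ) : Sym C A →ₗ[k] Module.End k (Sym C A) where
  toFun Y :=
    { toFun := fun x => Sym.mk (star j x.val Y.val) (star_isSym j x.isSym Y.isSym)
      map_add' := fun x y => Sym.ext (LinearMap.map_add₂ (starₗ j) x.val y.val Y.val)
      map_smul' := fun r x => Sym.ext (LinearMap.map_smul₂ (starₗ j) r x.val Y.val) }
  map_add' Y Z := LinearMap.ext fun x => Sym.ext ((starₗ j x.val).map_add Y.val Z.val)
  map_smul' r Y := LinearMap.ext fun x => Sym.ext ((starₗ j x.val).map_smul r Y.val)

theorem val_insLin (j : ℤ) (Y x : Sym C A) : (insLin j Y x).val = star j x.val Y.val := rfl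

/-- The composition rule of insertion operators, one of them being of even degree. -/
theorem insLin_mul {i j : ℤ} {Y Z U : Sym C A} (hY : IsHom i Y.val) (hZ : IsHom j Z.val) (h : Even (i * j))
    (hU : U.val = star j Y.val Z.val - star i Z.val Y.val) :
    insLin j Z * insLin i Y = insLin i Y * insLin j Z + insLin (i + j) U := by
  refine LinearMap.ext fun x => Sym.ext ?_
  have := star_preLie x.isSym hY hZ
  rw [zsign, Int.negOnePow_even _ h, Units.val_one, Int.cast_one, one_smul] at this
  rw [LinearMap.add_apply, Module.End.mul_apply, Module.End.mul_apply, map_add]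
  simp only [val_insLin]
  rw [hU, ← starₗ_apply (i + j), map_sub, starₗ_apply, starₗ_apply, sub_eq_iff_eq_add.1 this]
  abel

variable {W} in
theorem raises_insLin (j : ℤ) {r : ℕ} {Y : Sym C A} (hY : Y.val ∈ colFil W r) :
    Raises (symFil C W) r (insLin j Y) := fun l x hx => by
  rw [mem_symFil] at hx ⊢
  have := star_mem_colFil W j hx hY
  rwa [show (l : ℤ) - W.bound + r = (l + r : ℕ) - W.bound by push_cast; ring] at this

variable (C) in
/-- The operator `x ↦ x ⋆ Y` as a filtered operator. -/
def ins (j : ℤ) : insertable C W →ₗ[k] filtEnd (symFil C W) where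
  toFun Y := ⟨insLin j Y.1, raises_insLin j (r := 0) Y.2⟩
  map_add' _ _ := Subtype.ext ((insLin j).map_add _ _)
  map_smul' _ _ := Subtype.ext ((insLin j).map_smul _ _)

theorem ins_mul {i j : ℤ} {Y Z U : insertable C W} (hY : IsHom i Y.1.val) (hZ : IsHom j Z.1.val)
    (h : Even (i * j)) (hU : U.1.val = star j Y.1.val Z.1.val - star i Z.1.val Y.1.val) :
    ins C W j Z * ins C W i Y = ins C W i Y * ins C W j Z + ins C W (i + j) U :=
  Subtype.ext (insLin_mul hY hZ h hU)

end Conv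

namespace Conv

open FilteredDGModule FilteredEnd

variable {k : Type u} [CommRing k] {C : FilteredDGCooperad.{u, v} k} {A : FilteredDGModule.{u, w} k}

/-! ### Two colours -/

/-- The elements with output of the first colour and inputs of the second one. -/
def up : Sym C A →ₗ[k] Sym C (A.prod A) := conjSym (isStrict_inl A A) (isStrict_snd A A)

/-- The elements with output and inputs of the second colour. -/
def side : Sym C A →ₗ[k] Sym C (A.prod A) := conjSym (isStrict_inr A A) (isStrict_snd A A)

/-- The elements with output of the first colour and inputs of all colours. -/
def iota : Sym C A →ₗ[k] Sym C (A.prod A) := conjSym (isStrict_inl A A) isStrict_fold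

/-- The restriction to inputs of the second colour. -/
def proj : Sym C (A.prod A) →ₗ[k] Sym C A := conjSym isStrict_fold (isStrict_inr A A)

theorem proj_iota (a : Sym C A) : proj (iota a) = a := by
  refine Sym.ext ?_
  change conj (fold A ∘ₗ inl A A) (fold A ∘ₗ inr A A) a.val = _
  rw [show (fold A).comp (inl A A) = LinearMap.id from LinearMap.ext fold_inl,
    show fold A ∘ₗ inr A A = LinearMap.id from LinearMap.ext fold_inr, conj_id]

/-- The weighted filtration with weights `w` and `w'`. -/
abbrev two (A : FilteredDGModule.{u, w} k) (w w' : ℕ) : (A.prod A).Weighting :=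
  (Weighting.point A w).prod (Weighting.point A w')

theorem up_mem_colFil {w w' : ℕ} {r : ℤ} {Y : Sym C A}
    (h : ∀ q, ∃ e, InFil e (Y.val q) ∧ w + r ≤ 2 * e + q * w') :
    (up Y).val ∈ colFil (two A w w') r :=
  conj_mem_colFil_of_inFil (W' := two A w w') (fun _ _ hx => ⟨hx, zero_mem _⟩) (fun _ _ hx => hx.2) h

theorem proj_mem_colFil {w w' : ℕ} (hw : w ≤ w') {l : ℤ} {x : Sym C (A.prod A)}
    (h : x.val ∈ colFil (two A w w') l) :
    (proj x).val ∈ colFil (Weighting.point A w') (l - (w' - w)) :=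
  conj_mem_colFil (W := two A w w') (W' := Weighting.point A w') _
    (fun m x hx => add_mem (A.fil_mono (m := ((m + w + 1) / 2).toNat) (by omega) hx.1)
      (A.fil_mono (m := ((m + w' + 1) / 2).toNat) (by omega) hx.2))
    (fun _ _ hx => ⟨zero_mem _, hx⟩) h

/-- The deformation `b` of an element `1 + b` without constant term. -/
def MorSet.dev (f : MorSet C A) : Sym C A := Sym.mk (f.1 - unit) ((sym C A).sub_mem f.2.1.isSym unit_isHom.isSym)

theorem MorSet.dev_isHom (f : MorSet C A) : IsHom 0 f.dev.val := (hom C A 0).sub_mem f.2.1 unit_isHom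

theorem MorSet.inFil_dev (f : MorSet C A) : InFil 1 (f.dev.val 0) := by
  have : f.dev.val 0 = f.1 0 := by
    change f.1 0 - unit 0 = _
    rw [unit, sub_zero]
  rw [this]
  exact f.2.2

variable [Algebra ℚ k]

theorem up_mul_up {i j : ℤ} {b c : Sym C A} (hb : IsHom i b.val) (hc : IsHom j c.val)
    (h : Even (i * j)) : Commute (insLin j (up c)) (insLin i (up b)) := by
  have h1 : ∀ (j : ℤ) (b c : Sym C A), star j (up b).val (up c).val = 0 := fun j b c =>
    star_conj_eq_zero (fun _ => rfl) j _ _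
  have := insLin_mul (U := 0) (conj_isHom (isStrict_inl A A) (isStrict_snd A A) hb)
    (conj_isHom (isStrict_inl A A) (isStrict_snd A A) hc) h (Y := up b) (Z := up c)
    (by rw [h1, h1, sub_zero, map_zero])
  rwa [map_zero, add_zero] at this

theorem side_mul_up {i j : ℤ} {b c : Sym C A} (hb : IsHom i b.val) (hc : IsHom j c.val)
    (h : Even (i * j)) : insLin j (side c) * insLin i (up b) =
      insLin i (up b) * insLin j (side c) + insLin (i + j) (up (insLin j c b)) := by
  refine insLin_mul (conj_isHom (isStrict_inl A A) (isStrict_snd A A) hb)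
    (conj_isHom (isStrict_inr A A) (isStrict_snd A A) hc) h ?_
  have h1 : star i (side c).val (up b).val = 0 := star_conj_eq_zero (fun _ => rfl) i _ _
  have h2 : star j (up b).val (side c).val = (up (insLin j c b)).val :=
    conj_star_conj (isStrict_snd A A) (fun _ => rfl) j _ _
  rw [h1, h2, sub_zero]

theorem insLin_side_iota (j : ℤ) (c a : Sym C A) : insLin j (side c) (iota a) = insLin j (up c) (iota a) :=
  Sym.ext (star_conj_congr (fun x => by rw [fold_inl, fold_inr]) j _ _)

theorem proj_insLin_side (j : ℤ) (c : Sym C A) (x : Sym C (A.prod A)) :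
    proj (insLin j (side c) x) = insLin j c (proj x) :=
  Sym.ext (conj_star_of_comp (isStrict_inr A A) j fun _ _ _ => rfl)

theorem proj_insLin_up_iota (j : ℤ) (c a : Sym C A) : proj (insLin j (up c) (iota a)) = insLin j c a := by
  rw [← insLin_side_iota, proj_insLin_side, proj_iota]

/-- The product of the insertion operators of a sequence. -/
def upProd : (n : ℕ) → (Fin n → Sym C A) → Module.End k (Sym C (A.prod A))
  | 0, _ => 1
  | n + 1, b => insLin 0 (up (b (Fin.last n))) * upProd n fun i => b i.castSucc

theorem upProd_succ (n : ℕ) (b : Fin (n + 1) → Sym C A) :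
    upProd (n + 1) b = insLin 0 (up (b (Fin.last n))) * upProd n fun i => b i.castSucc := rfl

theorem update_castSucc {X : Type*} {n : ℕ} (b : Fin (n + 1) → X) (i : Fin n) (x : X) :
    (fun s : Fin n => Function.update b i.castSucc x s.castSucc) =
      Function.update (fun s => b s.castSucc) i x := by
  funext s
  by_cases hs : s = i
  · subst hs; simp
  · rw [Function.update_of_ne hs, Function.update_of_ne fun h => hs (Fin.castSucc_injective _ h)]

theorem upProd_const (n : ℕ) (b : Sym C A) : upProd n (fun _ => b) = insLin 0 (up b) ^ n := by
  induction n with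
  | zero => rfl
  | succ n ih => rw [upProd, ih, pow_succ']

theorem commute_upProd {n : ℕ} {b : Fin n → Sym C A} (hb : ∀ i, IsHom 0 (b i).val) {c : Sym C A}
    (hc : IsHom 0 c.val) : Commute (insLin 0 (up c)) (upProd n b) := by
  induction n with
  | zero => exact Commute.one_right _
  | succ n ih => exact (up_mul_up (hb _) hc (by simp)).mul_right (ih fun i => hb _)

theorem side_mul_upProd {n : ℕ} {b : Fin n → Sym C A} (hb : ∀ i, IsHom 0 (b i).val) {c : Sym C A}
    (hc : IsHom 0 c.val) : insLin 0 (side c) * upProd n b = upProd n b * insLin 0 (side c) +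
      ∑ i, upProd n (Function.update b i (insLin 0 c (b i))) := by
  induction n with
  | zero => simp [upProd]
  | succ n ih =>
    have h1 : _ = _ := side_mul_up (hb (Fin.last n)) hc (by simp)
    have h2 := ih fun i => hb i.castSucc
    have h3 (i : Fin n) : upProd (n + 1) (Function.update b i.castSucc (insLin 0 c (b i.castSucc))) =
        insLin 0 (up (b (Fin.last n))) *
          upProd n (Function.update (fun i => b i.castSucc) i (insLin 0 c (b i.castSucc))) := by
      rw [upProd_succ, Function.update_of_ne (Fin.castSucc_lt_last i).ne', update_castSucc]
    have h4 : upProd (n + 1) (Function.update b (Fin.last n) (insLin 0 c (b (Fin.last n)))) =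
        insLin 0 (up (insLin 0 c (b (Fin.last n)))) * upProd n fun i => b i.castSucc := by
      rw [upProd_succ, Function.update_self]
      congr 2
      funext s
      rw [Function.update_of_ne (Fin.castSucc_lt_last s).ne]
    rw [upProd_succ, Fin.sum_univ_castSucc, h4, Finset.sum_congr rfl fun i _ => h3 i, ← Finset.mul_sum,
      ← mul_assoc, h1, add_mul, mul_assoc, h2, mul_add, mul_assoc, add_assoc, add_zero]

/-- Symmetric braces are products of commuting insertion operators. -/
theorem brace_eq (n : ℕ) (a : Sym C A) (b : Fin n → Sym C A) (hb : ∀ i, IsHom 0 (b i).val) :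
    brace n a.val (fun i => (b i).val) = (proj (upProd n b (iota a))).val := by
  induction n with
  | zero =>
    change _ = (proj (iota a)).val
    rw [proj_iota]
    rfl
  | succ n ih =>
    have h1 := LinearMap.congr_fun (side_mul_upProd (fun i : Fin n => hb i.castSucc) (hb (Fin.last n)))
      (iota a)
    have h3 := LinearMap.congr_fun
      (commute_upProd (fun i : Fin n => hb i.castSucc) (hb (Fin.last n))).eq (iota a)
    rw [Module.End.mul_apply, Module.End.mul_apply] at h3
    rw [LinearMap.add_apply, Module.End.mul_apply, Module.End.mul_apply, insLin_side_iota,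
      ← h3, LinearMap.sum_apply] at h1
    have h2 := congrArg (fun x => (proj x).val) h1
    simp only [map_add, map_sum, proj_insLin_side, val_insLin] at h2
    rw [brace, ih _ fun i => hb _, h2, add_sub_assoc, upProd]
    refine add_eq_left.2 (sub_eq_zero.2 ?_)
    refine Finset.sum_congr rfl fun i _ => ?_
    rw [← ih _ fun s => ?_]
    · congr 1
      funext s
      by_cases hs : s = i
      · subst hs; simp [val_insLin]
      · rw [Function.update_of_ne hs, Function.update_of_ne hs]
    · by_cases hs : s = i
      · subst hs
        rw [Function.update_self]
        exact star_isHom (hb _) (hb _)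
      · rw [Function.update_of_ne hs]
        exact hb _

theorem insLin_pow_isHom {B : FilteredDGModule.{u, w} k} {j : ℤ} {Y x : Sym C B} (hY : IsHom 0 Y.val)
    (hx : IsHom j x.val) (n : ℕ) : IsHom j ((insLin 0 Y ^ n) x).val := by
  induction n with
  | zero => exact hx
  | succ n ih =>
    rw [pow_succ', Module.End.mul_apply]
    have := star_isHom ih hY
    rwa [add_zero] at this

/-- Truncations of the circle product. -/
def circSum (M : ℕ) (a b : Sym C A) : Sym C A := proj (expSum M (insLin 0 (up b)) (iota a))

theorem circTerm_eq (a : Sym C A) (f : MorSet C A) (n : ℕ) :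
    circTerm a.val f.1 n = (invFact k n • proj ((insLin 0 (up f.dev) ^ n) (iota a))).val := by
  have := brace_eq n a (fun _ => f.dev) fun _ => f.dev_isHom
  rw [upProd_const] at this
  rw [map_smul, ← this]
  rfl

theorem sum_circTerm (a : Sym C A) (f : MorSet C A) (M : ℕ) :
    ∑ n ∈ Finset.range M, circTerm a.val f.1 n = (circSum M a f.dev).val := by
  rw [circSum, expSum_apply, map_sum, map_sum]
  refine Finset.sum_congr rfl fun n _ => ?_
  rw [circTerm_eq, map_smul proj]

theorem up_mem_of_inFil {w w' : ℕ} (hw : w ≤ 1) (hw' : w + 1 ≤ w') {b : Sym C A} (hb : InFil 1 (b.val 0)) :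
    (up b).val ∈ colFil (two A w w') (1 : ℕ) := by
  refine up_mem_colFil fun q => ?_
  rcases q with _ | q
  · exact ⟨1, hb, by push_cast; omega⟩
  · refine ⟨0, b.isSym.2 _, ?_⟩
    push_cast
    nlinarith

theorem circTerm_isHom {j : ℤ} {a : Family C A} (ha : IsHom j a) (f : MorSet C A) (n : ℕ) :
    IsHom j (circTerm a f.1 n) := by
  rw [show a = (Sym.mk a ha.isSym).val from rfl, circTerm_eq, map_smul]
  exact (hom C A j).smul_mem _ (conj_isHom isStrict_fold (isStrict_inr A A)
    (insLin_pow_isHom (conj_isHom (isStrict_inl A A) (isStrict_snd A A) f.dev_isHom)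
      (conj_isHom (isStrict_inl A A) isStrict_fold ha) n))

theorem circTerm_mem_colFil (a : Sym C A) (f : MorSet C A) (n : ℕ) :
    circTerm a.val f.1 n ∈ colFil (Weighting.point A 1) (n - 2) := by
  rw [circTerm_eq, map_smul]
  refine Submodule.smul_mem _ _ ?_
  have h1 := (raises_insLin 0 (up_mem_of_inFil (w := 0) (w' := 1) (by simp) le_rfl f.inFil_dev)).pow n
  have h2 := h1.mem (symFil_zero _) (iota a)
  convert proj_mem_colFil (by simp) (mem_symFil _ |>.1 h2) using 2
  simp [Weighting.prod, Weighting.point]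
  ring

theorem exists_circ (hA : A.IsComplete) {j : ℤ} {a : Family C A} (ha : IsHom j a) (f : MorSet C A) :
    IsHom j (circ a f.1) ∧ Converges (circTerm a f.1) (circ a f.1) := by
  obtain ⟨L, hL, hL'⟩ := exists_converges_of_mem_colFil hA (Weighting.point A 1) 2
    (circTerm_isHom ha f) (circTerm_mem_colFil (Sym.mk a ha.isSym) f)
  rw [circ, seriesSum_eq hA hL']
  exact ⟨hL, hL'⟩

theorem circ_sub_mem_colFil (hA : A.IsComplete) {j : ℤ} {a : Sym C A} (ha : IsHom j a.val) (f : MorSet C A)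
    (M : ℕ) : circ a.val f.1 - (circSum M a f.dev).val ∈ colFil (Weighting.point A 1) (M - 2) := by
  rw [← sum_circTerm]
  exact sub_sum_mem_colFil (exists_circ hA ha f).2 (circTerm_mem_colFil a f) M

end Conv

namespace Conv

open FilteredDGModule FilteredEnd

variable {k : Type u} [CommRing k] {C : FilteredDGCooperad.{u, v} k} {A B : FilteredDGModule.{u, w} k}

theorem up_mem_colFil_of_point {w w' : ℕ} {r : ℤ} {Y : Sym C A} (hY : Y.val ∈ colFil (Weighting.point A w') r) :
    (up Y).val ∈ colFil (two A w w') (r + (w' - w)) := by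
  have := conj_mem_colFil (W := Weighting.point A w') (W' := two A w w') (α := inl A A) (β := snd A A) (w - w')
    (fun m x hx => ⟨A.fil_mono (m := ((m + w' + 1) / 2).toNat) (by omega) hx, zero_mem _⟩) (fun _ _ hx => hx.2) hY
  rwa [show r - ((w : ℤ) - w') = r + (w' - w) by ring] at this

theorem side_mem_colFil_of_point {w w' : ℕ} {r : ℤ} {Y : Sym C A} (hY : Y.val ∈ colFil (Weighting.point A w') r) :
    (side Y).val ∈ colFil (two A w w') r := by
  have := conj_mem_colFil (W := Weighting.point A w') (W' := two A w w') (α := inr A A) (β := snd A A) 0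
    (fun m x hx => ⟨zero_mem _, by rw [sub_zero]; exact hx⟩) (fun _ _ hx => hx.2) hY
  rwa [sub_zero] at this

theorem bound_two {w w' : ℕ} (h : w ≤ w') : (two A w w').bound = w' := max_eq_right h

theorem colFil_one_le_zero {W : B.Weighting} {Y : Family C B} (h : Y ∈ colFil W 1) : Y ∈ colFil W 0 :=
  colFil_antitone W (by simp) h

variable [Algebra ℚ k]

/-- The operator `x ↦ x ⋆ Y` as a filtered operator. -/
def fins (W : B.Weighting) (j : ℤ) (Y : Sym C B) (h : Y.val ∈ colFil W 0) : filtEnd (symFil C W) :=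
  ⟨insLin j Y, raises_insLin j (r := 0) h⟩

theorem isNilpotent_fins (W : B.Weighting) (l : ℕ) (j : ℤ) {Y : Sym C B} (h : Y.val ∈ colFil W 1) :
    IsNilpotent (toQuot (symFil C W) l (fins W j Y (colFil_one_le_zero h))) :=
  isNilpotent_toQuot (symFil_antitone W) (symFil_zero W) l (raises_insLin j (r := 1) h)

theorem toQuot_fins_eq_zero (W : B.Weighting) {l r : ℕ} (hl : l ≤ r) (j : ℤ) {Y : Sym C B} (h : Y.val ∈ colFil W r)
    (h' : Y.val ∈ colFil W 0) : toQuot (symFil C W) l (fins W j Y h') = 0 :=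
  toQuot_eq_zero (symFil_antitone W) (symFil_zero W) hl (raises_insLin j (r := r) h)

theorem mk_expSum_insLin (W : B.Weighting) {l M : ℕ} (hl : l ≤ M) {Y : Sym C B} (h : Y.val ∈ colFil W 1) (x : Sym C B) :
    (Submodule.Quotient.mk (expSum M (insLin 0 Y) x) : Sym C B ⧸ symFil C W l) =
      IsNilpotent.exp (toQuot (symFil C W) l (fins W 0 Y (colFil_one_le_zero h))) (Submodule.Quotient.mk x) :=
  mk_expSum (F := symFil C W) (T := fins W 0 Y (colFil_one_le_zero h)) (symFil_antitone W) (symFil_zero W) hl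
    (raises_insLin 0 (r := 1) h) x

theorem toQuot_eq_of_eq {V : Type*} [AddCommGroup V] [Module k V] {F : ℕ → Submodule k V} (l : ℕ)
    {S T : filtEnd F} (h : S.1 = T.1) : toQuot F l S = toQuot F l T := congrArg _ (Subtype.ext h)

/-- An insertion operator modulo a step of the filtration. -/
theorem toQuot_fins_eq_sum (W : B.Weighting) {l : ℕ} (j : ℤ) {Y : Sym C B} (h : Y.val ∈ colFil W 0) {M : ℕ}
    {Z : ℕ → Sym C B} (hZ : ∀ i, (Z i).val ∈ colFil W 0)
    (hYZ : (Y - ∑ i ∈ Finset.range M, Z i).val ∈ colFil W l) :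
    toQuot (symFil C W) l (fins W j Y h) = ∑ i ∈ Finset.range M, toQuot (symFil C W) l (fins W j (Z i) (hZ i)) := by
  have h0 : (Y - ∑ i ∈ Finset.range M, Z i).val ∈ colFil W 0 := colFil_antitone W (by simp) hYZ
  rw [← sub_eq_zero, ← toQuot_fins_eq_zero W le_rfl j hYZ h0, ← map_sum, ← map_sub]
  refine toQuot_eq_of_eq l ?_
  change insLin j Y - (filtEnd (symFil C W)).val _ = insLin j _
  rw [map_sum, map_sub, map_sum]
  rfl

theorem power_isHom {y : Family C A} (hy : IsHom 0 y) : ∀ n, IsHom 0 (power y n)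
  | 0 => unit_isHom
  | 1 => hy
  | n + 2 => by
    have := star_isHom (power_isHom hy (n + 1)) hy
    rwa [add_zero] at this

theorem power_mem_colFil {y : Family C A} (h : y ∈ colFil (Weighting.point A 1) 1) :
    ∀ n : ℕ, power y (n + 1) ∈ colFil (Weighting.point A 1) (n + 1)
  | 0 => by simpa [power] using h
  | n + 1 => by
    have := star_mem_colFil (Weighting.point A 1) 0 (power_mem_colFil h n) h
    push_cast
    exact this

/-- The terms of the pre-Lie exponential of degree at least one. -/
def expPart (y : Sym C A) (hy : IsHom 0 y.val) (i : ℕ) : Sym C A :=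
  Sym.mk (expTerm y.val (i + 1)) ((sym C A).smul_mem _ (power_isHom hy _).isSym)

theorem expPart_isHom {y : Sym C A} (hy : IsHom 0 y.val) (i : ℕ) : IsHom 0 (expPart y hy i).val :=
  (hom C A 0).smul_mem _ (power_isHom hy _)

theorem expPart_zero {y : Sym C A} (hy : IsHom 0 y.val) : expPart y hy 0 = y :=
  Sym.ext (by
    change algebraMap ℚ k _ • power y.val 1 = y.val
    simp [power])

theorem insLin_expPart {y : Sym C A} (hy : IsHom 0 y.val) (i : ℕ) :
    insLin 0 y (expPart y hy i) = algebraMap ℚ k ((i + 2 : ℕ) : ℚ) • expPart y hy (i + 1) := by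
  refine Sym.ext ?_
  change star 0 (invFact k (i + 1) • power y.val (i + 1)) y.val =
    algebraMap ℚ k ((i + 2 : ℕ) : ℚ) • invFact k (i + 2) • power y.val (i + 2)
  rw [← starₗ_apply, LinearMap.map_smul₂, smul_smul, map_natCast, succ_mul_invFact]
  rfl

theorem circSum_sub_expSum_mem {y u : Sym C A} (hy : IsHom 0 y.val) (hy1 : y.val ∈ colFil (Weighting.point A 1) 1)
    (hu : u.val ∈ colFil (Weighting.point A 1) 1) {M : ℕ}
    (huy : (u - ∑ i ∈ Finset.range M, expPart y hy i).val ∈ colFil (Weighting.point A 1) M) (a : Sym C A) :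
    (circSum M a u - expSum M (insLin 0 y) a).val ∈ colFil (Weighting.point A 1) (M - 1) := by
  let W := two A 1 1
  have hup : ∀ {r : ℤ} {Y : Sym C A}, Y.val ∈ colFil (Weighting.point A 1) r → (up Y).val ∈ colFil W r :=
    fun h => by simpa using up_mem_colFil_of_point (w := 1) h
  have hpart (i : ℕ) : (expPart y hy i).val ∈ colFil (Weighting.point A 1) (i + 1 : ℕ) :=
    Submodule.smul_mem _ _ (by simpa using power_mem_colFil hy1 i)
  have hpart1 (i : ℕ) : (up (expPart y hy i)).val ∈ colFil W 1 :=
    colFil_antitone W (by push_cast; omega) (hup (hpart i))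
  have hS := side_mem_colFil_of_point (w := 1) hy1
  set F := symFil C W
  let S := toQuot F M (fins W 0 (side y) (colFil_one_le_zero hS))
  let Q (i : ℕ) := toQuot F M (fins W 0 (up (expPart y hy i)) (colFil_one_le_zero (hpart1 i)))
  have key := IsNilpotent.exp_smul_eq_exp_sum_smul (S := S) (Q := Q) (M := M) (v := (Submodule.Quotient.mk (iota a) : _ ⧸ F M))
    (isNilpotent_fins W M 0 hS) (fun i => isNilpotent_fins W M 0 (hpart1 i))
    (fun i hi => toQuot_fins_eq_zero W (by omega) 0 (hup (hpart i)) _)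
    (fun i j => by
      have := up_mul_up (expPart_isHom hy j) (expPart_isHom hy i) (by simp)
      change Q i * Q j = Q j * Q i
      rw [← map_mul, ← map_mul]
      exact toQuot_eq_of_eq M this.eq)
    (fun i => by
      have := side_mul_up (expPart_isHom hy i) hy (by simp)
      rw [insLin_expPart] at this
      change toQuot F M _ * toQuot F M _ = toQuot F M _ * toQuot F M _ +
        algebraMap ℚ k ((i + 2 : ℕ) : ℚ) • toQuot F M _
      rw [← map_mul, ← map_mul, ← map_smul, ← map_add]
      refine toQuot_eq_of_eq M (this.trans ?_)
      congr 1
      exact ((insLin 0).comp up).map_smul (algebraMap ℚ k ((i + 2 : ℕ) : ℚ)) (expPart y hy (i + 1)))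
    (congrArg Submodule.Quotient.mk ((insLin_side_iota 0 y a).trans (congrArg (fun z => insLin 0 (up z) (iota a)) (expPart_zero hy).symm)))
  have h1 := toQuot_fins_eq_sum W 0 (colFil_one_le_zero (hup hu)) (Z := fun i => up (expPart y hy i))
    (fun i => colFil_one_le_zero (hpart1 i)) (M := M) (l := M) (by
      rw [← map_sum, ← map_sub]
      exact hup huy)
  change _ = ∑ i ∈ Finset.range M, Q i at h1
  rw [← h1] at key
  have h2 := mk_expSum_insLin W le_rfl hS (M := M) (iota a)
  have h3 := mk_expSum_insLin W le_rfl (hup hu) (M := M) (iota a)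
  have h4 := (Submodule.Quotient.eq _).1 (h3.trans (key.symm.trans h2.symm))
  have h5 := proj_mem_colFil (A := A) (w := 1) le_rfl ((mem_symFil W).1 h4)
  rw [map_sub, map_expSum proj (proj_insLin_side 0 y), proj_iota, bound_two le_rfl] at h5
  simpa [circSum] using h5

end Conv

namespace Conv

open FilteredDGModule FilteredEnd

variable {k : Type u} [CommRing k] {C : FilteredDGCooperad.{u, v} k} {A : FilteredDGModule.{u, w} k}

theorem eq_of_mem_colFil (hA : A.IsComplete) (W : A.Weighting) {f g : Family C A} (h : ∀ l : ℕ, f - g ∈ colFil W l) :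
    f = g :=
  eq_of_inFil hA fun n l => inFil_of_mem_colFil W (h (2 * l + n * W.bound)) (by push_cast; rfl)

theorem Sym.eq_of_mk (hA : A.IsComplete) (W : A.Weighting) {x y : Sym C A}
    (h : ∀ l, (Submodule.Quotient.mk x : _ ⧸ symFil C W l) = Submodule.Quotient.mk y) : x = y :=
  Sym.ext (eq_of_mem_colFil hA W fun l => by
    have := (mem_symFil W).1 ((Submodule.Quotient.eq _).1 (h (l + W.bound)))
    rw [map_sub] at this
    simpa using this)

theorem mem_colFil_one_iff {f : Family C A} (hf : IsSym f) :
    f ∈ colFil (Weighting.point A 1) 1 ↔ InFil 1 (f 0) ∧ InFil 1 (f 1) := by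
  refine ⟨fun h => ⟨inFil_of_mem_colFil_point h (by simp), inFil_of_mem_colFil_point h (by simp)⟩,
    fun h => mem_colFil_point fun q => ?_⟩
  match q with
  | 0 => exact ⟨1, h.1, by simp⟩
  | 1 => exact ⟨1, h.2, by simp⟩
  | q + 2 => exact ⟨0, hf.2 _, by push_cast; omega⟩

theorem mem_colFil_zero_iff {f : Family C A} (hf : IsSym f) :
    f ∈ colFil (Weighting.point A 1) 0 ↔ InFil 1 (f 0) := by
  refine ⟨fun h => inFil_of_mem_colFil_point h (by simp), fun h => mem_colFil_point fun q => ?_⟩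
  match q with
  | 0 => exact ⟨1, h, by simp⟩
  | q + 1 => exact ⟨0, hf.2 _, by push_cast; omega⟩

theorem unit_mem_colFil : (unit : Family C A) ∈ colFil (Weighting.point A 1) 0 :=
  (mem_colFil_zero_iff unit_isHom.isSym).2 InFil.zero

variable (C A) in
/-- The left unit, as an equivariant family. -/
def unitSym : Sym C A := Sym.mk unit unit_isHom.isSym

theorem mem_colFil_neg_one {f : Family C A} (hf : IsSym f) : f ∈ colFil (Weighting.point A 1) (-1) :=
  mem_colFil_neg_bound (Weighting.point A 1) hf

theorem GaugeSet.mem_colFil (y : GaugeSet C A) : y.1 ∈ colFil (Weighting.point A 1) 1 :=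
  (mem_colFil_one_iff y.2.1.isSym).2 y.2.2

variable [Algebra ℚ k]

/-! ### The pre-Lie exponential -/

theorem expTerm_isHom {y : Family C A} (hy : IsHom 0 y) (n : ℕ) : IsHom 0 (expTerm y n) :=
  (hom C A 0).smul_mem _ (power_isHom hy n)

theorem expTerm_mem_colFil {y : Family C A} (h : y ∈ colFil (Weighting.point A 1) 1) (n : ℕ) :
    expTerm y n ∈ colFil (Weighting.point A 1) n := by
  refine Submodule.smul_mem _ _ ?_
  match n with
  | 0 => exact unit_mem_colFil
  | n + 1 => exact power_mem_colFil h n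

theorem exists_exp (hA : A.IsComplete) {y : Family C A} (hy : IsHom 0 y) (h : y ∈ colFil (Weighting.point A 1) 1) :
    IsHom 0 (exp y) ∧ Converges (expTerm y) (exp y) := by
  obtain ⟨L, hL, hL'⟩ := exists_converges_of_mem_colFil hA (Weighting.point A 1) 0
    (expTerm_isHom hy) (fun n => by simpa using expTerm_mem_colFil h n)
  rw [exp, seriesSum_eq hA hL']
  exact ⟨hL, hL'⟩

theorem exp_sub_mem_colFil (hA : A.IsComplete) {y : Family C A} (hy : IsHom 0 y) (h : y ∈ colFil (Weighting.point A 1) 1)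
    (M : ℕ) : exp y - ∑ i ∈ Finset.range M, expTerm y i ∈ colFil (Weighting.point A 1) M := by
  simpa using sub_sum_mem_colFil (exists_exp hA hy h).2 (W := Weighting.point A 1) (t := 0)
    (fun n => by simpa using expTerm_mem_colFil h n) M

theorem sum_range_succ_expTerm {y : Sym C A} (hy : IsHom 0 y.val) (M : ℕ) :
    ∑ i ∈ Finset.range (M + 1), expTerm y.val i = unit + (∑ i ∈ Finset.range M, expPart y hy i).val := by
  rw [Finset.sum_range_succ', add_comm, map_sum]
  congr 1
  change algebraMap ℚ k _ • unit = _
  simp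

theorem expSum_unitSym (y : Sym C A) (M : ℕ) :
    (expSum M (insLin 0 y) (unitSym C A)).val = ∑ i ∈ Finset.range M, expTerm y.val i := by
  rw [expSum_apply, map_sum]
  refine Finset.sum_congr rfl fun n hn => ?_
  clear hn
  rw [map_smul]
  refine congrArg (algebraMap ℚ k _ • ·) ?_
  match n with
  | 0 => rfl
  | n + 1 =>
    induction n with
    | zero => exact unit_star 0 y.isSym
    | succ n ih =>
      rw [pow_succ', Module.End.mul_apply, val_insLin, ih]
      rfl

/-- The pre-Lie exponential of a gauge element. -/
def expMor (hA : A.IsComplete) (y : GaugeSet C A) : MorSet C A :=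
  ⟨exp y.1, (exists_exp hA y.2.1 ((mem_colFil_one_iff y.2.1.isSym).2 y.2.2)).1, by
    have h := (mem_colFil_one_iff y.2.1.isSym).2 y.2.2
    rw [← mem_colFil_zero_iff (exists_exp hA y.2.1 h).1.isSym]
    simpa using exp_sub_mem_colFil hA y.2.1 h 0⟩

theorem expMor_dev_mem (hA : A.IsComplete) (y : GaugeSet C A) : (expMor hA y).dev.val ∈ colFil (Weighting.point A 1) 1 := by
  have := exp_sub_mem_colFil hA y.2.1 ((mem_colFil_one_iff y.2.1.isSym).2 y.2.2) 1
  have : exp y.1 - unit ∈ colFil (Weighting.point A 1) 1 := by simpa [expTerm, ratSmul, power] using this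
  exact this

/-- The circle product, as an equivariant family. -/
def circSym (hA : A.IsComplete) {j : ℤ} (a : Sym C A) (ha : IsHom j a.val) (f : MorSet C A) : Sym C A :=
  Sym.mk (circ a.val f.1) (exists_circ hA ha f).1.isSym

/-- An element of the deformation gauge group, as an equivariant family. -/
def GaugeSet.sym (y : GaugeSet C A) : Sym C A := Sym.mk y.1 y.2.1.isSym

/-- The insertion operator of a gauge element modulo a step of the filtration. -/
def GaugeSet.op (l : ℕ) (y : GaugeSet C A) : Module.End k (Sym C A ⧸ symFil C (Weighting.point A 1) l) :=
  toQuot (symFil C (Weighting.point A 1)) l (fins (Weighting.point A 1) 0 (GaugeSet.sym y) (colFil_one_le_zero (GaugeSet.mem_colFil y)))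

theorem mk_expSum_insLin_gauge {l M : ℕ} (hl : l ≤ M) (y : GaugeSet C A) (x : Sym C A) :
    (Submodule.Quotient.mk (expSum M (insLin 0 (GaugeSet.sym y)) x) : _ ⧸ symFil C (Weighting.point A 1) l) =
      IsNilpotent.exp (GaugeSet.op l y) (Submodule.Quotient.mk x) :=
  mk_expSum_insLin _ hl (GaugeSet.mem_colFil y) x

theorem mk_circSym_exp (hA : A.IsComplete) {j : ℤ} {a : Sym C A} (ha : IsHom j a.val) (y : GaugeSet C A) (l : ℕ) :
    (Submodule.Quotient.mk (circSym hA a ha (expMor hA y)) : _ ⧸ symFil C (Weighting.point A 1) l) =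
      IsNilpotent.exp (GaugeSet.op l y) (Submodule.Quotient.mk a) := by
  rw [← mk_expSum_insLin_gauge (show l ≤ l + 1 by omega), Submodule.Quotient.eq, mem_symFil]
  have h1 := circ_sub_mem_colFil hA ha (expMor hA y) (l + 1)
  have h2 := circSum_sub_expSum_mem (y := GaugeSet.sym y) y.2.1 (GaugeSet.mem_colFil y) (expMor_dev_mem hA y) (M := l + 1) (by
    have : exp y.1 - ∑ i ∈ Finset.range (l + 1 + 1), expTerm (GaugeSet.sym y).val i ∈ _ :=
      exp_sub_mem_colFil hA y.2.1 (GaugeSet.mem_colFil y) (l + 2)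
    rw [sum_range_succ_expTerm (y := GaugeSet.sym y) y.2.1 (l + 1), ← sub_sub] at this
    rw [map_sub]
    exact colFil_antitone _ (by push_cast; omega) this) a
  have := add_mem h1 (colFil_antitone _ (by push_cast; omega) h2)
  rw [map_sub, sub_add_sub_cancel] at this
  rw [map_sub]
  refine colFil_antitone _ ?_ this
  simp [Weighting.point]
  omega

theorem mk_expMor (hA : A.IsComplete) (y : GaugeSet C A) (l : ℕ) :
    (Submodule.Quotient.mk (Sym.mk (exp y.1) (expMor hA y).2.1.isSym) : _ ⧸ symFil C (Weighting.point A 1) l) =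
      IsNilpotent.exp (GaugeSet.op l y) (Submodule.Quotient.mk (unitSym C A)) := by
  rw [← mk_expSum_insLin_gauge le_rfl, Submodule.Quotient.eq, mem_symFil, map_sub, expSum_unitSym]
  exact colFil_antitone _ (by omega) (exp_sub_mem_colFil hA y.2.1 (GaugeSet.mem_colFil y) l)

/-! ### Units for the circle product -/

theorem brace_one (a : Family C A) (b : Fin 1 → Family C A) : brace 1 a b = star 0 a (b 0) := by
  simp [brace]

theorem brace_unit : ∀ (n : ℕ) (b : Fin (n + 2) → Family C A), (∀ i, IsSym (b i)) → brace (n + 2) unit b = 0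
  | 0, b, hb => by
    rw [brace, brace_one, unit_star 0 (hb _), Fin.sum_univ_one, brace_one, Function.update_self,
      unit_star 0 (star_isSym 0 (hb _) (hb _))]
    exact sub_self _
  | n + 1, b, hb => by
    rw [brace, brace_unit n _ fun i => hb _, ← starₗ_apply, map_zero, LinearMap.zero_apply, zero_sub, neg_eq_zero]
    refine Finset.sum_eq_zero fun i _ => brace_unit n _ fun s => ?_
    by_cases hs : s = i
    · subst hs
      rw [Function.update_self]
      exact star_isSym 0 (hb _) (hb _)
    · rw [Function.update_of_ne hs]
      exact hb _

theorem circ_eq_of_circTerm (hA : A.IsComplete) {a f L : Family C A} {N : ℕ} (h : ∀ n ≥ N, circTerm a f n = 0)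
    (h' : ∑ n ∈ Finset.range N, circTerm a f n = L) : circ a f = L :=
  seriesSum_eq hA fun n l => ⟨N, fun m hm => by
    have : ∑ i ∈ Finset.range m, circTerm a f i n = L n := by
      rw [← h', Finset.sum_apply]
      refine (Finset.sum_subset (by simpa using hm) fun i _ hi => ?_).symm
      rw [h i (by simpa using hi)]
      rfl
    rw [this, sub_self]
    exact InFil.zero⟩

theorem unit_circ (hA : A.IsComplete) {f : Family C A} (hf : IsSym f) : circ unit f = f := by
  have hb : IsSym (f - unit) := (sym C A).sub_mem hf unit_isHom.isSym
  refine circ_eq_of_circTerm hA (N := 2) (fun n hn => ?_) ?_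
  · obtain ⟨n, rfl⟩ := Nat.exists_eq_add_of_le' hn
    change algebraMap ℚ k _ • brace (n + 2) unit _ = 0
    rw [brace_unit n _ fun _ => hb, smul_zero]
  · rw [Finset.sum_range_succ, Finset.sum_range_one]
    change algebraMap ℚ k _ • unit + algebraMap ℚ k _ • brace 1 unit _ = f
    rw [brace_one, unit_star 0 hb]
    simp

theorem circ_unit (hA : A.IsComplete) (a : Family C A) (ha : IsSym a) : circ a unit = a := by
  refine circ_eq_of_circTerm hA (N := 1) (fun n hn => ?_) ?_
  · obtain ⟨n, rfl⟩ := Nat.exists_eq_add_of_le' hn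
    have := circTerm_eq (Sym.mk a ha) ⟨unit, unit_isHom, InFil.zero⟩ (n + 1)
    have h0 : MorSet.dev (⟨unit, unit_isHom, InFil.zero⟩ : MorSet C A) = 0 := Sym.ext (sub_self _)
    rw [h0, map_zero, map_zero, pow_succ', zero_mul, LinearMap.zero_apply, map_zero, smul_zero, map_zero] at this
    exact this
  · change ∑ n ∈ Finset.range 1, algebraMap ℚ k _ • brace n a _ = a
    simp [brace]

end Conv

namespace FilteredEnd

variable {k V : Type*} [CommRing k] [AddCommGroup V] [Module k V] {F : ℕ → Submodule k V}

theorem raises_prod {w : List (filtEnd F)} (h : ∀ T ∈ w, Raises F 1 T.1) : Raises F w.length w.prod.1 := by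
  induction w with
  | nil => exact fun l v hv => hv
  | cons T t ih =>
    intro l v hv
    rw [List.prod_cons, List.length_cons, ← add_assoc]
    exact h T (by simp) _ _ (ih (fun T hT => h T (by simp [hT])) l v hv)

end FilteredEnd

namespace Dynkin

theorem wordSum_mem {V : Type*} [AddCommGroup V] {S : Type*} [SetLike S V] [AddSubmonoidClass S V] (s : S)
    {F : ∀ n, (Fin n → ℕ × ℕ) → V} {N : ℕ} (h : ∀ n rs, (∑ i, ((rs i).1 + (rs i).2) = N) → F n rs ∈ s) :
    wordSum F N ∈ s :=
  sum_mem fun n _ => sum_mem fun rs _ => by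
    split_ifs with h'
    · exact h _ _ h'.2
    · exact zero_mem s

end Dynkin

namespace Conv

open FilteredDGModule FilteredEnd

variable {k : Type u} [CommRing k] {C : FilteredDGCooperad.{u, v} k} {A : FilteredDGModule.{u, w} k} [Algebra ℚ k]

variable (C) in
/-- Insertion operators modulo a step of the filtration. -/
def quotIns (W : A.Weighting) (l : ℕ) : insertable C W →ₗ[k] Module.End k (Sym C A ⧸ symFil C W l) :=
  (toQuot (symFil C W) l).toLinearMap ∘ₗ ins C W 0

theorem quotIns_mul (W : A.Weighting) (l : ℕ) {Y Z U : insertable C W} (hY : IsHom 0 Y.1.val) (hZ : IsHom 0 Z.1.val)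
    (hU : U.1.val = star 0 Y.1.val Z.1.val - star 0 Z.1.val Y.1.val) :
    quotIns C W l Z * quotIns C W l Y = quotIns C W l Y * quotIns C W l Z + quotIns C W l U := by
  have := ins_mul W hY hZ (by simp) hU
  change toQuot _ l (ins C W 0 Z) * toQuot _ l (ins C W 0 Y) =
    toQuot _ l (ins C W 0 Y) * toQuot _ l (ins C W 0 Z) + toQuot _ l (ins C W 0 U)
  rw [← map_mul, this, map_add, map_mul]
  rfl

theorem neg_commutator {R : Type*} [Ring R] {p q r : R} (h : p * q = q * p + r) : -p * -q - -q * -p = r := by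
  rw [neg_mul_neg, neg_mul_neg, h, add_sub_cancel_left]

theorem exists_nested (W : A.Weighting) (L : List (insertable C W)) (h : ∀ Z ∈ L, IsHom 0 Z.1.val ∧ Z.1.val ∈ colFil W 1) :
    ∃ Z : insertable C W, Z.1.val = nested (L.map fun Z => Z.1.val) ∧ IsHom 0 Z.1.val ∧ Z.1.val ∈ colFil W L.length ∧
      ∀ l, Dynkin.commNested (L.map fun Z => -quotIns C W l Z) = -quotIns C W l Z := by
  induction L with
  | nil => exact ⟨0, rfl, (hom C A 0).zero_mem, (colFil W _).zero_mem, fun l => by simp [Dynkin.commNested]⟩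
  | cons a t ih =>
    obtain ⟨Z, h1, h2, h3, h4⟩ := ih fun Z hZ => h Z (by simp [hZ])
    obtain ⟨ha, ha'⟩ := h a (by simp)
    cases t with
    | nil => exact ⟨a, rfl, ha, by simpa using ha', fun l => rfl⟩
    | cons b t =>
      have hstar (l m n : ℤ) {Y Z : Family C A} (hY : Y ∈ colFil W l) (hZ : Z ∈ colFil W m) (hn : n ≤ l + m) :
          star 0 Y Z ∈ colFil W n := colFil_antitone W hn (star_mem_colFil W 0 hY hZ)
      let U : Sym C A := insLin 0 Z.1 a.1 - insLin 0 a.1 Z.1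
      have hU : U.val = star 0 a.1.val Z.1.val - star 0 Z.1.val a.1.val := rfl
      have hU0 : U.val ∈ colFil W 0 := hU ▸ sub_mem (hstar 0 0 0 a.2 Z.2 (by simp)) (hstar 0 0 0 Z.2 a.2 (by simp))
      refine ⟨⟨U, hU0⟩, ?_, ?_, ?_, fun l => ?_⟩
      · change U.val = bracket 0 a.1.val (nested _)
        rw [hU, h1]
        rfl
      · rw [hU]
        have := (hom C A (0 + 0)).sub_mem (star_isHom ha h2) (star_isHom h2 ha)
        rwa [add_zero] at this
      · rw [hU]
        rw [List.length_cons]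
        exact sub_mem (hstar _ _ _ ha' h3 (by push_cast; omega)) (hstar _ _ _ h3 ha' (by push_cast; omega))
      · rw [List.map_cons, Dynkin.commNested_cons _ (by simp), h4]
        let U0 : insertable C W := ⟨U, hU0⟩
        exact (neg_commutator (quotIns_mul W l (U := -U0) h2 ha
          (by change -U.val = _; rw [hU, neg_sub]))).trans ((quotIns C W l).map_neg U0)

theorem exists_bchTerm (W : A.Weighting) {x y : insertable C W} (hx : IsHom 0 x.1.val ∧ x.1.val ∈ colFil W 1)
    (hy : IsHom 0 y.1.val ∧ y.1.val ∈ colFil W 1) : ∃ b : ℕ → insertable C W, ∀ N, (b N).1.val = bchTerm x.1.val y.1.val N ∧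
      IsHom 0 (b N).1.val ∧ (b N).1.val ∈ colFil W N ∧
      ∀ l, Dynkin.bchTerm (-quotIns C W l x) (-quotIns C W l y) N = -quotIns C W l (b N) := by
  have hw (n : ℕ) (rs : Fin n → ℕ × ℕ) : ∀ Z ∈ Dynkin.word x y rs, IsHom 0 Z.1.val ∧ Z.1.val ∈ colFil W 1 := by
    intro Z hZ
    rcases Dynkin.mem_word hZ with rfl | rfl <;> assumption
  choose Z h1 h2 h3 h4 using fun n rs => exists_nested W (Dynkin.word x y rs) (hw n rs)
  let c (N n : ℕ) (rs : Fin n → ℕ × ℕ) : ℚ := (-1) ^ (n + 1) / n /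
    (N * ∏ i, ((rs i).1.factorial * (rs i).2.factorial : ℚ))
  let G (N n : ℕ) (rs : Fin n → ℕ × ℕ) : insertable C W := algebraMap ℚ k (c N n rs) • Z n rs
  let v : insertable C W →ₗ[k] Family C A := Sym.val ∘ₗ (insertable C W).subtype
  refine ⟨fun N => Dynkin.wordSum (G N) N, fun N => ?_⟩
  have hv : v (Dynkin.wordSum (G N) N) = Dynkin.wordSum (fun n rs => v (G N n rs)) N := Dynkin.map_wordSum v _ N
  refine ⟨?_, ?_, ?_, fun l => ?_⟩
  · refine hv.trans (Finset.sum_congr rfl fun n _ => Finset.sum_congr rfl fun rs _ => ?_)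
    refine if_congr Iff.rfl ?_ rfl
    change algebraMap ℚ k _ • v (Z _ _) = algebraMap ℚ k _ • _
    refine congrArg (_ • ·) ((h1 _ _).trans ?_)
    rw [Dynkin.map_word]
    rfl
  · change v _ ∈ hom C A 0
    rw [hv]
    exact Dynkin.wordSum_mem _ fun n rs _ => (hom C A 0).smul_mem _ (h2 _ _)
  · change v _ ∈ colFil W N
    rw [hv]
    refine Dynkin.wordSum_mem _ fun n rs h => (colFil W N).smul_mem _ ?_
    have := h3 n rs
    rw [Dynkin.length_word, h] at this
    exact this
  · have := Dynkin.map_wordSum (-quotIns C W l) (G N) N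
    rw [LinearMap.neg_apply] at this
    rw [this, Dynkin.bchTerm]
    refine Dynkin.wordSum_congr fun n rs _ _ => ?_
    rw [map_smul, LinearMap.neg_apply, ← h4, Dynkin.map_word, rat_smul_end]

theorem wordsVanish_quotIns (W : A.Weighting) {x y : insertable C W} (hx : x.1.val ∈ colFil W 1)
    (hy : y.1.val ∈ colFil W 1) (l : ℕ) :
    Dynkin.WordsVanish (-quotIns C W l x) (-quotIns C W l y) (l + 1) := by
  intro w hw hl
  obtain ⟨w', hw', rfl⟩ := Dynkin.exists_map_of_forall (toQuot (symFil C W) l) (x := ins C W 0 (-x)) (y := ins C W 0 (-y)) (w := w)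
    fun z hz => by
      rcases hw z hz with rfl | rfl
      · exact .inl ((quotIns C W l).map_neg x).symm
      · exact .inr ((quotIns C W l).map_neg y).symm
  rw [← map_list_prod]
  refine toQuot_eq_zero (symFil_antitone W) (symFil_zero W) (r := w'.length) (by simp at hl; omega)
    (raises_prod fun T hT => ?_)
  rcases hw' T hT with rfl | rfl
  · exact raises_insLin 0 (r := 1) (neg_mem hx)
  · exact raises_insLin 0 (r := 1) (neg_mem hy)

theorem exp_eq_of_exp_neg {R : Type*} [Ring R] [Module ℚ R] {x y z : R} (hx : IsNilpotent x)
    (hy : IsNilpotent y) (hz : IsNilpotent z) (h : IsNilpotent.exp (-z) = IsNilpotent.exp (-x) * IsNilpotent.exp (-y)) :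
    IsNilpotent.exp z = IsNilpotent.exp y * IsNilpotent.exp x := by
  rw [← mul_one (IsNilpotent.exp y * _), ← IsNilpotent.exp_neg_mul_exp_self hz, h, mul_assoc,
    ← mul_assoc (IsNilpotent.exp x), ← mul_assoc (IsNilpotent.exp x), IsNilpotent.exp_mul_exp_neg_self hx, one_mul,
    ← mul_assoc, IsNilpotent.exp_mul_exp_neg_self hy, one_mul]

theorem bchTerm_isHom (x y : GaugeSet C A) (N : ℕ) :
    IsHom 0 (bchTerm x.1 y.1 N) ∧ bchTerm x.1 y.1 N ∈ colFil (Weighting.point A 1) N := by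
  obtain ⟨b, hb⟩ := exists_bchTerm (Weighting.point A 1) (x := ⟨GaugeSet.sym x, colFil_one_le_zero (GaugeSet.mem_colFil x)⟩)
    (y := ⟨GaugeSet.sym y, colFil_one_le_zero (GaugeSet.mem_colFil y)⟩) ⟨x.2.1, GaugeSet.mem_colFil x⟩ ⟨y.2.1, GaugeSet.mem_colFil y⟩
  obtain ⟨h1, h2, h3, -⟩ := hb N
  rw [h1] at h2 h3
  exact ⟨h2, h3⟩

theorem exists_bch (hA : A.IsComplete) (x y : GaugeSet C A) :
    IsHom 0 (bch x.1 y.1) ∧ Converges (bchTerm x.1 y.1) (bch x.1 y.1) := by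
  obtain ⟨L, hL, hL'⟩ := exists_converges_of_mem_colFil hA (Weighting.point A 1) 0
    (fun N => (bchTerm_isHom x y N).1) (fun N => by simpa using (bchTerm_isHom x y N).2)
  rw [bch, seriesSum_eq hA hL']
  exact ⟨hL, hL'⟩

theorem bch_sub_mem_colFil (hA : A.IsComplete) (x y : GaugeSet C A) (M : ℕ) :
    bch x.1 y.1 - ∑ N ∈ Finset.range M, bchTerm x.1 y.1 N ∈ colFil (Weighting.point A 1) M := by
  simpa using sub_sum_mem_colFil (exists_bch hA x y).2 (W := Weighting.point A 1) (t := 0)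
    (fun n => by simpa using (bchTerm_isHom x y n).2) M

/-- The Baker-Campbell-Hausdorff product of the deformation gauge group. -/
def bchGauge (hA : A.IsComplete) (x y : GaugeSet C A) : GaugeSet C A :=
  ⟨bch x.1 y.1, (exists_bch hA x y).1, by
    rw [← mem_colFil_one_iff (exists_bch hA x y).1.isSym]
    simpa [bchTerm] using bch_sub_mem_colFil hA x y 1⟩

/-- The Baker-Campbell-Hausdorff formula for insertion operators. -/
theorem exp_op_bchGauge (hA : A.IsComplete) (x y : GaugeSet C A) (l : ℕ) :
    IsNilpotent.exp (GaugeSet.op l (bchGauge hA x y)) =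
      IsNilpotent.exp (GaugeSet.op l y) * IsNilpotent.exp (GaugeSet.op l x) := by
  let W := Weighting.point A 1
  let i (x : GaugeSet C A) : insertable C W := ⟨GaugeSet.sym x, colFil_one_le_zero (GaugeSet.mem_colFil x)⟩
  have hop (x : GaugeSet C A) : GaugeSet.op l x = quotIns C W l (i x) := rfl
  have hn (x : GaugeSet C A) : IsNilpotent (quotIns C W l (i x)) := isNilpotent_fins W l 0 (GaugeSet.mem_colFil x)
  obtain ⟨b, hb⟩ := exists_bchTerm W (x := i x) (y := i y) ⟨x.2.1, GaugeSet.mem_colFil x⟩ ⟨y.2.1, GaugeSet.mem_colFil y⟩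
  rw [hop, hop, hop]
  refine exp_eq_of_exp_neg (hn x) (hn y) (hn _) ?_
  have hw := wordsVanish_quotIns W (x := i x) (y := i y) (GaugeSet.mem_colFil x) (GaugeSet.mem_colFil y) l
  have h1 := Dynkin.logOneAdd_eq_sum_bchTerm (by simp) hw
  have h2 : quotIns C W l (i (bchGauge hA x y)) = ∑ N ∈ Finset.range (2 * (l + 1)), quotIns C W l (b N) := by
    refine (toQuot_fins_eq_sum W 0 (Y := GaugeSet.sym (bchGauge hA x y)) (Z := fun N => (b N).1)
      (colFil_one_le_zero (GaugeSet.mem_colFil (bchGauge hA x y))) (M := 2 * (l + 1)) (fun N => (b N).2) ?_)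
    rw [map_sub, map_sum, Finset.sum_congr rfl fun N _ => (hb N).1]
    exact colFil_antitone _ (by push_cast; omega) (bch_sub_mem_colFil hA x y (2 * (l + 1)))
  rw [Finset.sum_congr rfl fun N _ => (hb N).2.2.2 l, Finset.sum_neg_distrib, ← h2] at h1
  rw [← h1, IsNilpotent.exp_logOneAdd ⟨_, Dynkin.isNilpotent_exp_mul_exp_sub_one (by simp) hw⟩, add_sub_cancel]

theorem exp_bch (hA : A.IsComplete) (x y : GaugeSet C A) : exp (bch x.1 y.1) = circ (exp x.1) (exp y.1) := by
  have hx := (expMor hA x).2.1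
  refine congrArg Sym.val (Sym.eq_of_mk hA (Weighting.point A 1)
    (x := Sym.mk _ (expMor hA (bchGauge hA x y)).2.1.isSym)
    (y := circSym hA (Sym.mk _ hx.isSym) hx (expMor hA y)) fun l => ?_)
  have h1 := mk_expMor hA (bchGauge hA x y) l
  have h2 := mk_circSym_exp hA (a := Sym.mk _ hx.isSym) hx y l
  have h3 := mk_expMor hA x l
  rw [exp_op_bchGauge, Module.End.mul_apply, ← h3] at h1
  exact h1.trans h2.symm

end Conv

namespace Conv

open FilteredDGModule FilteredEnd

variable {k : Type u} [CommRing k] {C : FilteredDGCooperad.{u, v} k} {A : FilteredDGModule.{u, w} k}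

/-! ### Three colours -/

variable (A) in
/-- Three copies of `A`. -/
abbrev three : FilteredDGModule.{u, w} k := A.prod (A.prod A)

variable (A) in
/-- The weighted filtration with weights `0`, `1` and `2`. -/
abbrev wThree : (three A).Weighting := (Weighting.point A 0).prod ((Weighting.point A 1).prod (Weighting.point A 2))

variable (A) in
/-- The map which forgets the colours. -/
abbrev foldThree : three A →ₗ[k] A := fst A (A.prod A) + fold A ∘ₗ snd A (A.prod A)

theorem isStrict_foldThree : IsStrict (foldThree A) :=
  (isStrict_fst _ _).add (isStrict_fold.comp (isStrict_snd _ _))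

/-- Output of the first colour, inputs of the two others. -/
def oneRest : Sym C A →ₗ[k] Sym C (three A) :=
  conjSym (isStrict_inl A (A.prod A)) (isStrict_fold.comp (isStrict_snd A (A.prod A)))

/-- Output of the second colour, inputs of the third one. -/
def twoThree : Sym C A →ₗ[k] Sym C (three A) :=
  conjSym ((isStrict_inr A (A.prod A)).comp (isStrict_inl A A)) ((isStrict_snd A A).comp (isStrict_snd A (A.prod A)))

/-- Output of the first colour, inputs of the third one. -/
def oneThree : Sym C A →ₗ[k] Sym C (three A) :=
  conjSym (isStrict_inl A (A.prod A)) ((isStrict_snd A A).comp (isStrict_snd A (A.prod A)))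

/-- Output of the first colour, inputs of all colours. -/
def iotaThree : Sym C A →ₗ[k] Sym C (three A) := conjSym (isStrict_inl A (A.prod A)) isStrict_foldThree

/-- The restriction to inputs of the third colour. -/
def projThree : Sym C (three A) →ₗ[k] Sym C A :=
  conjSym isStrict_foldThree ((isStrict_inr A (A.prod A)).comp (isStrict_inr A A))

theorem isStrict_split : IsStrict (inl A A ∘ₗ fst A (A.prod A) + inr A A ∘ₗ fold A ∘ₗ snd A (A.prod A)) :=
  ((isStrict_inl _ _).comp (isStrict_fst _ _)).add ((isStrict_inr _ _).comp (isStrict_fold.comp (isStrict_snd _ _)))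

/-- The second colour is split in two. -/
def splitColour : Sym C (A.prod A) →ₗ[k] Sym C (three A) :=
  conjSym ((isStrict_inl A (A.prod A)).comp isStrict_fold) isStrict_split

/-- The two first colours are merged, and inputs have the two last colours. -/
def dropColour : Sym C (three A) →ₗ[k] Sym C (A.prod A) :=
  conjSym ((isStrict_inl A A).comp isStrict_foldThree) (isStrict_inr A (A.prod A))

theorem isStrict_skip : IsStrict (inl A (A.prod A) ∘ₗ fst A A + inr A (A.prod A) ∘ₗ inr A A ∘ₗ snd A A) :=
  ((isStrict_inl _ _).comp (isStrict_fst _ _)).add ((isStrict_inr _ _).comp ((isStrict_inr _ _).comp (isStrict_snd _ _)))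

/-- Inputs have the first and the last colour. -/
def skipColour : Sym C (three A) →ₗ[k] Sym C (A.prod A) :=
  conjSym ((isStrict_inl A A).comp isStrict_foldThree) isStrict_skip

variable (C A) in
/-- The families with output of the first colour and inputs of the two others. -/
def colourOne : Submodule k (Sym C (three A)) :=
  LinearMap.eqLocus (conjSym ((isStrict_inl A (A.prod A)).comp (isStrict_fst A (A.prod A)))
    ((isStrict_inr A (A.prod A)).comp (isStrict_snd A (A.prod A)))) LinearMap.id

theorem oneRest_mem_colourOne (y : Sym C A) : oneRest y ∈ colourOne C A := rfl

theorem oneThree_mem_colourOne (y : Sym C A) : oneThree y ∈ colourOne C A := rfl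

theorem splitColour_iota (a : Sym C A) : splitColour (iota a) = iotaThree a := by
  refine Sym.ext ?_
  change conj (inl A (A.prod A) ∘ₗ fold A ∘ₗ inl A A)
    (fold A ∘ₗ (inl A A ∘ₗ fst A (A.prod A) + inr A A ∘ₗ fold A ∘ₗ snd A (A.prod A))) a.val = conj _ _ a.val
  congr 2
  · exact LinearMap.ext fun x => by simp
  · exact LinearMap.ext fun x => by simp

theorem dropColour_splitColour (x : Sym C (A.prod A)) : dropColour (splitColour x) = iota (proj x) := by
  refine Sym.ext ?_
  change conj ((inl A A ∘ₗ foldThree A) ∘ₗ (inl A (A.prod A) ∘ₗ fold A))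
    ((inl A A ∘ₗ fst A (A.prod A) + inr A A ∘ₗ fold A ∘ₗ snd A (A.prod A)) ∘ₗ inr A (A.prod A)) x.val =
    conj (inl A A ∘ₗ fold A) (inr A A ∘ₗ fold A) x.val
  congr 2
  · exact LinearMap.ext fun x => by simp
  · exact LinearMap.ext fun x => by simp

theorem proj_dropColour (x : Sym C (three A)) : proj (dropColour x) = projThree x := by
  refine Sym.ext ?_
  change conj (fold A ∘ₗ inl A A ∘ₗ foldThree A) (inr A (A.prod A) ∘ₗ inr A A) x.val = conj _ _ x.val
  congr 2
  exact LinearMap.ext fun x => by simp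

theorem dropColour_oneRest (b : Sym C A) : dropColour (oneRest b) = iota b := by
  refine Sym.ext ?_
  change conj (inl A A ∘ₗ foldThree A ∘ₗ inl A (A.prod A)) (fold A) b.val = conj (inl A A) (fold A) b.val
  congr 2
  exact LinearMap.ext fun x => by simp

theorem skipColour_iotaThree (a : Sym C A) : skipColour (iotaThree a) = iota a := by
  refine Sym.ext ?_
  change conj (inl A A ∘ₗ foldThree A ∘ₗ inl A (A.prod A))
    (foldThree A ∘ₗ (inl A (A.prod A) ∘ₗ fst A A + inr A (A.prod A) ∘ₗ inr A A ∘ₗ snd A A)) a.val =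
    conj (inl A A) (fold A) a.val
  congr 2
  · exact LinearMap.ext fun x => by simp
  · exact LinearMap.ext fun x => by simp [fold]

theorem proj_skipColour (x : Sym C (three A)) : proj (skipColour x) = projThree x := by
  refine Sym.ext ?_
  change conj (fold A ∘ₗ inl A A ∘ₗ foldThree A)
    ((inl A (A.prod A) ∘ₗ fst A A + inr A (A.prod A) ∘ₗ inr A A ∘ₗ snd A A) ∘ₗ inr A A) x.val = conj _ _ x.val
  congr 2
  · exact LinearMap.ext fun x => by simp
  · exact LinearMap.ext fun x => by simp

theorem projThree_oneThree (c : Sym C A) : projThree (oneThree c) = c := by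
  refine Sym.ext ?_
  change conj (foldThree A ∘ₗ inl A (A.prod A)) LinearMap.id c.val = conj LinearMap.id LinearMap.id c.val
  congr 2
  exact LinearMap.ext fun x => by simp

theorem oneRest_mem_colFil {r : ℤ} {Y : Sym C A} (hY : Y.val ∈ colFil (Weighting.point A 1) r) :
    (oneRest Y).val ∈ colFil (wThree A) (r + 1) := by
  have := conj_mem_colFil (W := Weighting.point A 1) (W' := wThree A) (α := inl A (A.prod A))
    (β := fold A ∘ₗ snd A (A.prod A)) (-1)
    (fun m x hx => ⟨A.fil_mono (m := ((m + 1 + 1) / 2).toNat) (by omega) hx, zero_mem _⟩)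
    (fun m x hx => add_mem hx.2.1 (A.fil_mono (m := ((m + 2 + 1) / 2).toNat) (by omega) hx.2.2)) hY
  rwa [sub_neg_eq_add] at this

theorem twoThree_mem_colFil {Y : Sym C A} (hY : Y.val ∈ colFil (Weighting.point A 1) 0) :
    (twoThree Y).val ∈ colFil (wThree A) 1 := by
  refine conj_mem_colFil_of_inFil (W' := wThree A) (w := 2) (w' := 1) (fun m x hx => ⟨zero_mem _, hx, zero_mem _⟩) (fun m x hx => hx.2.2)
    fun q => ?_
  rcases q with _ | q
  · exact ⟨1, (mem_colFil_zero_iff Y.isSym).1 hY, by simp⟩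
  · exact ⟨0, Y.isSym.2 _, by push_cast; omega⟩

theorem oneThree_mem_colFil {Y : Sym C A} (hY : Y.val ∈ colFil (Weighting.point A 1) 0) :
    (oneThree Y).val ∈ colFil (wThree A) 1 := by
  refine conj_mem_colFil_of_inFil (W' := wThree A) (w := 2) (w' := 0) (fun m x hx => ⟨hx, zero_mem _⟩) (fun m x hx => hx.2.2)
    fun q => ?_
  rcases q with _ | q
  · exact ⟨1, (mem_colFil_zero_iff Y.isSym).1 hY, by simp⟩
  · exact ⟨0, Y.isSym.2 _, by push_cast; omega⟩

theorem projThree_mem_colFil {l : ℤ} {x : Sym C (three A)} (h : x.val ∈ colFil (wThree A) l) :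
    (projThree x).val ∈ colFil (Weighting.point A 2) (l - 2) :=
  conj_mem_colFil (W := wThree A) (W' := Weighting.point A 2) 2
    (fun m _ hx => add_mem (A.fil_mono (m := ((m + 0 + 1) / 2).toNat) (by push_cast; omega) hx.1)
      (add_mem (A.fil_mono (m := ((m + 1 + 1) / 2).toNat) (by push_cast; omega) hx.2.1)
      (A.fil_mono (m := ((m + 2 + 1) / 2).toNat) (by push_cast; omega) hx.2.2)))
    (fun _ _ hx => ⟨zero_mem _, zero_mem _, hx⟩) h

variable [Algebra ℚ k]

theorem splitColour_insLin (j : ℤ) (y : Sym C A) (x : Sym C (A.prod A)) :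
    splitColour (insLin j (up y) x) = insLin j (oneRest y) (splitColour x) :=
  Sym.ext (conj_star_of_comp isStrict_split j fun q z a => by
    change inl A A _ = inl A A _ + inr A A (fold A (snd A (A.prod A) (inl A (A.prod A) _)))
    rw [snd_inl, map_zero, map_zero, add_zero]
    refine congrArg (fun b => inl A A (y.val q z b)) (funext fun s => ?_)
    change snd A A (inl A A (fst A (A.prod A) (a s)) + inr A A (fold A (snd A (A.prod A) (a s)))) =
      fold A (snd A (A.prod A) (a s))
    rw [map_add, snd_inl, snd_inr, zero_add])

theorem dropColour_insLin (j : ℤ) (c : Sym C A) (x : Sym C (three A)) :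
    dropColour (insLin j (twoThree c) x) = insLin j (up c) (dropColour x) :=
  Sym.ext (conj_star_of_comp (isStrict_inr _ _) j fun _ _ _ => rfl)

theorem skipColour_insLin (j : ℤ) {z : Sym C (three A)} (hz : z ∈ colourOne C A) (x : Sym C (three A)) :
    skipColour (insLin j z x) = insLin j (up (projThree z)) (skipColour x) := by
  refine Sym.ext (conj_star_of_comp isStrict_skip j fun q y a => ?_)
  have h := congrArg Sym.val (LinearMap.mem_eqLocus.1 hz)
  have h' (b : Fin q → three A) : z.val q y b =
      inl A (A.prod A) (fst A (A.prod A) (z.val q y fun s => inr A (A.prod A) (snd A (A.prod A) (b s)))) :=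
    congrFun (congrArg DFunLike.coe (LinearMap.congr_fun (congrFun h q) y)) b |>.symm
  change _ = inl A (A.prod A) (foldThree A (z.val q y fun s => inr A (A.prod A) (inr A A (snd A A (a s))))) + 0
  rw [h', h' fun s => inr A (A.prod A) (inr A A (snd A A (a s))), add_zero]
  simp

theorem insLin_twoThree_mem_colourOne (j : ℤ) (c : Sym C A) {z : Sym C (three A)} (hz : z ∈ colourOne C A) :
    insLin j (twoThree c) z ∈ colourOne C A := by
  refine LinearMap.mem_eqLocus.2 (Sym.ext ?_)
  have h := congrArg Sym.val (LinearMap.mem_eqLocus.1 hz)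
  refine (conj_star_of_comp ((isStrict_inr A (A.prod A)).comp (isStrict_snd A (A.prod A))) j
    (g' := (twoThree c).val) fun _ _ _ => rfl).trans ?_
  exact congrArg (fun x => star j x (twoThree c).val) h

theorem star_colourOne (j : ℤ) {y z : Sym C (three A)} (hy : y ∈ colourOne C A) (hz : z ∈ colourOne C A) :
    star j y.val z.val = 0 := by
  have h := congrArg Sym.val (LinearMap.mem_eqLocus.1 hy)
  have h' := congrArg Sym.val (LinearMap.mem_eqLocus.1 hz)
  rw [← show _ = y.val from h, ← show _ = z.val from h']
  exact star_conj_eq_zero (fun _ => rfl) j _ _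

theorem star_twoThree_colourOne (j : ℤ) (c : Sym C A) {z : Sym C (three A)} (hz : z ∈ colourOne C A) :
    star j (twoThree c).val z.val = 0 := by
  have h' := congrArg Sym.val (LinearMap.mem_eqLocus.1 hz)
  rw [← show _ = z.val from h']
  exact star_conj_eq_zero (fun _ => rfl) j _ _

theorem commute_insLin_colourOne {i j : ℤ} {y z : Sym C (three A)} (hy : y ∈ colourOne C A) (hz : z ∈ colourOne C A)
    (hy' : IsHom i y.val) (hz' : IsHom j z.val) (h : Even (i * j)) : Commute (insLin j z) (insLin i y) := by
  have := insLin_mul (U := 0) hy' hz' h (by rw [star_colourOne j hy hz, star_colourOne i hz hy, sub_zero, map_zero])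
  rwa [map_zero, add_zero] at this

theorem insLin_twoThree_mul {i : ℤ} {z : Sym C (three A)} (hz : z ∈ colourOne C A) (hz' : IsHom i z.val)
    {c : Sym C A} (hc : IsHom 0 c.val) : insLin 0 (twoThree c) * insLin i z =
      insLin i z * insLin 0 (twoThree c) + insLin i (insLin 0 (twoThree c) z) := by
  have := insLin_mul (U := insLin 0 (twoThree c) z) hz'
    (conj_isHom ((isStrict_inr A (A.prod A)).comp (isStrict_inl A A)) ((isStrict_snd A A).comp (isStrict_snd A (A.prod A))) hc)
    (Z := twoThree c) (by simp) (by rw [star_twoThree_colourOne i c hz, sub_zero]; rfl)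
  rwa [add_zero] at this

theorem insLin_twoThree_iotaThree (c a : Sym C A) :
    insLin 0 (twoThree c) (iotaThree a) = insLin 0 (oneThree c) (iotaThree a) :=
  Sym.ext (star_conj_congr (fun x => by simp) 0 _ _)

theorem commute_twoThree_oneThree {c : Sym C A} (hc : IsHom 0 c.val) :
    Commute (insLin 0 (twoThree c)) (insLin 0 (oneThree c)) := by
  have := insLin_twoThree_mul (oneThree_mem_colourOne c)
    (conj_isHom (isStrict_inl A (A.prod A)) ((isStrict_snd A A).comp (isStrict_snd A (A.prod A))) hc) hc
  have h0 : insLin 0 (twoThree c) (oneThree c) = 0 := Sym.ext (star_conj_eq_zero (fun _ => rfl) 0 _ _)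
  rwa [h0, map_zero, add_zero] at this

end Conv

namespace IsNilpotent

theorem exp_mul_exp_eq {R : Type*} [Ring R] [Algebra ℚ R] {q p p' : R} (hp : IsNilpotent p) (hp' : IsNilpotent p')
    (h : exp q * p = p' * exp q) : exp q * exp p = exp p' * exp q := by
  obtain ⟨n, hn⟩ := hp
  obtain ⟨m, hm⟩ := hp'
  rw [exp_eq_sum (pow_eq_zero_of_le (le_max_left n m) hn), exp_eq_sum (pow_eq_zero_of_le (le_max_right n m) hm),
    Finset.mul_sum, Finset.sum_mul]
  refine Finset.sum_congr rfl fun i _ => ?_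
  rw [mul_smul_comm, smul_mul_assoc, (SemiconjBy.pow_right (show SemiconjBy (exp q) p p' from h) i).eq]

theorem exp_smul_congr {R V : Type*} [Ring R] [Algebra ℚ R] [AddCommGroup V] [Module R V] {q p : R} {x : V}
    (hq : IsNilpotent q) (hp : IsNilpotent p) (h : Commute q p) (hx : q • x = p • x) : exp q • x = exp p • x := by
  have hpow (i : ℕ) : q ^ i • x = p ^ i • x := by
    induction i with
    | zero => simp
    | succ i ih => rw [_root_.pow_succ', mul_smul, ih, ← mul_smul, (h.pow_right i).eq, mul_smul, hx, ← mul_smul,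
        ← _root_.pow_succ]
  obtain ⟨n, hn⟩ := hq
  obtain ⟨m, hm⟩ := hp
  rw [exp_eq_sum (pow_eq_zero_of_le (le_max_left n m) hn), exp_eq_sum (pow_eq_zero_of_le (le_max_right n m) hm),
    Finset.sum_smul, Finset.sum_smul]
  refine Finset.sum_congr rfl fun i _ => ?_
  rw [Algebra.smul_def, Algebra.smul_def, mul_smul, mul_smul, hpow]

end IsNilpotent

namespace Conv

open FilteredDGModule FilteredEnd

variable {k : Type u} [CommRing k] {C : FilteredDGCooperad.{u, v} k} {A : FilteredDGModule.{u, w} k}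

theorem twoThree_isHom {j : ℤ} {c : Sym C A} (hc : IsHom j c.val) : IsHom j (twoThree c).val :=
  conj_isHom ((isStrict_inr A (A.prod A)).comp (isStrict_inl A A)) ((isStrict_snd A A).comp (isStrict_snd A (A.prod A))) hc

theorem oneRest_isHom {j : ℤ} {c : Sym C A} (hc : IsHom j c.val) : IsHom j (oneRest c).val :=
  conj_isHom (isStrict_inl A (A.prod A)) (isStrict_fold.comp (isStrict_snd A (A.prod A))) hc

theorem oneThree_isHom {j : ℤ} {c : Sym C A} (hc : IsHom j c.val) : IsHom j (oneThree c).val :=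
  conj_isHom (isStrict_inl A (A.prod A)) ((isStrict_snd A A).comp (isStrict_snd A (A.prod A))) hc

theorem projThree_sub_mem {l : ℕ} {x y : Sym C (three A)}
    (h : (Submodule.Quotient.mk x : _ ⧸ symFil C (wThree A) l) = Submodule.Quotient.mk y) :
    (projThree x - projThree y).val ∈ colFil (Weighting.point A 2) (l - 4) := by
  have := projThree_mem_colFil ((mem_symFil _).1 ((Submodule.Quotient.eq _).1 h))
  rw [map_sub projThree] at this
  exact colFil_antitone _ (by simp [Weighting.prod, Weighting.point]; omega) this

variable [Algebra ℚ k]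

/-- The terms of the insertion of the second colour in the inputs of a family. -/
def substTerm (c y : Sym C A) (i : ℕ) : Sym C (three A) :=
  invFact k i • (insLin 0 (twoThree c) ^ i) (oneRest y)

theorem substTerm_zero (c y : Sym C A) : substTerm c y 0 = oneRest y := by
  simp [substTerm, invFact]

theorem insLin_substTerm (c y : Sym C A) (i : ℕ) :
    insLin 0 (twoThree c) (substTerm c y i) = algebraMap ℚ k ((i + 1 : ℕ) : ℚ) • substTerm c y (i + 1) := by
  rw [substTerm, substTerm, map_smul, smul_smul, map_natCast, succ_mul_invFact, pow_succ', Module.End.mul_apply]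

theorem substTerm_mem_colourOne (c y : Sym C A) (i : ℕ) : substTerm c y i ∈ colourOne C A := by
  refine (colourOne C A).smul_mem _ ?_
  induction i with
  | zero => exact oneRest_mem_colourOne y
  | succ i ih =>
    rw [pow_succ', Module.End.mul_apply]
    exact insLin_twoThree_mem_colourOne 0 c ih

theorem substTerm_isHom {j : ℤ} {c y : Sym C A} (hc : IsHom 0 c.val) (hy : IsHom j y.val) (i : ℕ) :
    IsHom j (substTerm c y i).val :=
  (hom C (three A) j).smul_mem _ (insLin_pow_isHom (twoThree_isHom hc) (oneRest_isHom hy) i)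

theorem substTerm_mem_colFil {c y : Sym C A} (hc : c.val ∈ colFil (Weighting.point A 1) 0) {r : ℤ}
    (hy : y.val ∈ colFil (Weighting.point A 1) r) (i : ℕ) : (substTerm c y i).val ∈ colFil (wThree A) (r + 1 + i) := by
  refine Submodule.smul_mem _ _ ?_
  induction i with
  | zero => exact colFil_antitone _ (by simp) (oneRest_mem_colFil hy)
  | succ i ih =>
    rw [pow_succ', Module.End.mul_apply]
    have := star_mem_colFil (wThree A) 0 ih (twoThree_mem_colFil hc)
    push_cast
    rwa [← add_assoc]

theorem expSum_twoThree (c y : Sym C A) (M : ℕ) :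
    expSum M (insLin 0 (twoThree c)) (oneRest y) = ∑ i ∈ Finset.range M, substTerm c y i := expSum_apply _ _ _

theorem expSum_twoThree_mem_colourOne (c y : Sym C A) (M : ℕ) :
    expSum M (insLin 0 (twoThree c)) (oneRest y) ∈ colourOne C A := by
  rw [expSum_twoThree]
  exact sum_mem fun i _ => substTerm_mem_colourOne c y i

theorem expSum_twoThree_isHom {j : ℤ} {c y : Sym C A} (hc : IsHom 0 c.val) (hy : IsHom j y.val) (M : ℕ) :
    IsHom j (expSum M (insLin 0 (twoThree c)) (oneRest y)).val := by
  rw [expSum_twoThree, map_sum]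
  exact (hom C (three A) j).sum_mem fun i _ => substTerm_isHom hc hy i

theorem expSum_twoThree_mem_colFil {c y : Sym C A} (hc : c.val ∈ colFil (Weighting.point A 1) 0) {r : ℤ}
    (hy : y.val ∈ colFil (Weighting.point A 1) r) (M : ℕ) :
    (expSum M (insLin 0 (twoThree c)) (oneRest y)).val ∈ colFil (wThree A) (r + 1) := by
  rw [expSum_twoThree, map_sum]
  exact sum_mem fun i _ => colFil_antitone _ (by omega) (substTerm_mem_colFil hc hy i)

theorem exp_twoThree_mul (l : ℕ) {j : ℤ} {c y : Sym C A} (hc : IsHom 0 c.val) (hy : IsHom j y.val)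
    (hc1 : c.val ∈ colFil (Weighting.point A 1) 0) (h1 : (oneRest y).val ∈ colFil (wThree A) 0)
    (h2 : (expSum l (insLin 0 (twoThree c)) (oneRest y)).val ∈ colFil (wThree A) 0) :
    IsNilpotent.exp (toQuot (symFil C (wThree A)) l (fins (wThree A) 0 (twoThree c) (colFil_one_le_zero (twoThree_mem_colFil hc1)))) *
      toQuot (symFil C (wThree A)) l (fins (wThree A) j (oneRest y) h1) =
    toQuot (symFil C (wThree A)) l (fins (wThree A) j (expSum l (insLin 0 (twoThree c)) (oneRest y)) h2) *
      IsNilpotent.exp (toQuot (symFil C (wThree A)) l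
        (fins (wThree A) 0 (twoThree c) (colFil_one_le_zero (twoThree_mem_colFil hc1)))) := by
  have hmem (i : ℕ) : (substTerm c y i).val ∈ colFil (wThree A) i :=
    colFil_antitone _ (by omega) (substTerm_mem_colFil hc1 (mem_colFil_neg_one y.isSym) i)
  have hmem0 (i : ℕ) : (substTerm c y i).val ∈ colFil (wThree A) 0 := colFil_antitone _ (by omega) (hmem i)
  have key := IsNilpotent.exp_mul_eq (p := fun i => toQuot (symFil C (wThree A)) l (fins (wThree A) j (substTerm c y i) (hmem0 i)))
    (isNilpotent_fins (wThree A) l 0 (twoThree_mem_colFil hc1)) (M := l)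
    (fun i hi => toQuot_fins_eq_zero (wThree A) hi j (hmem i) _) (fun i => by
      have := insLin_twoThree_mul (substTerm_mem_colourOne c y i) (substTerm_isHom hc hy i) hc
      rw [insLin_substTerm, map_smul] at this
      rw [rat_smul_end, ← map_mul, ← map_mul, ← map_smul, ← map_add]
      exact toQuot_eq_of_eq l this)
  rw [← toQuot_fins_eq_sum (wThree A) j h2 hmem0 (by
    rw [expSum_twoThree, sub_self]
    exact zero_mem _)] at key
  refine Eq.trans ?_ key
  congr 1
  exact toQuot_eq_of_eq l (congrArg (insLin j) (substTerm_zero c y).symm)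

theorem exp_twoThree_iotaThree (l : ℕ) {c : Sym C A} (hc : IsHom 0 c.val)
    (hc1 : c.val ∈ colFil (Weighting.point A 1) 0) (a : Sym C A) :
    IsNilpotent.exp (toQuot (symFil C (wThree A)) l (fins (wThree A) 0 (twoThree c) (colFil_one_le_zero (twoThree_mem_colFil hc1))))
      (Submodule.Quotient.mk (iotaThree a)) =
    IsNilpotent.exp (toQuot (symFil C (wThree A)) l (fins (wThree A) 0 (oneThree c) (colFil_one_le_zero (oneThree_mem_colFil hc1))))
      (Submodule.Quotient.mk (iotaThree a)) :=
  IsNilpotent.exp_smul_congr (isNilpotent_fins (wThree A) l 0 (twoThree_mem_colFil hc1))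
    (isNilpotent_fins (wThree A) l 0 (oneThree_mem_colFil hc1))
    (by
      rw [commute_iff_eq, ← map_mul, ← map_mul]
      exact toQuot_eq_of_eq l (commute_twoThree_oneThree hc).eq)
    (congrArg Submodule.Quotient.mk (insLin_twoThree_iotaThree c a))

theorem projThree_expSum_twoThree (M : ℕ) (c : Sym C A) (x : Sym C (A.prod A)) :
    projThree (expSum M (insLin 0 (twoThree c)) (splitColour x)) = circSum M (proj x) c := by
  rw [← proj_dropColour, map_expSum dropColour (dropColour_insLin 0 c), dropColour_splitColour, circSum]

theorem projThree_expSum_oneRest (M : ℕ) (c y : Sym C A) :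
    projThree (expSum M (insLin 0 (twoThree c)) (oneRest y)) = circSum M y c := by
  rw [← proj_dropColour, map_expSum dropColour (dropColour_insLin 0 c), dropColour_oneRest, circSum]

/-- Compatibility of pre-Lie products and circle products, up to a step of the filtration. -/
theorem circSum_insLin_sub_mem (l : ℕ) {j : ℤ} {c y : Sym C A} (hc : IsHom 0 c.val) (hy : IsHom j y.val)
    (hc1 : c.val ∈ colFil (Weighting.point A 1) 0) (a : Sym C A) :
    (circSum l (insLin j y a) c - proj (insLin j (up (circSum l y c)) (expSum l (insLin 0 (up c)) (iota a)))).val ∈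
      colFil (Weighting.point A 2) (l - 4) := by
  have h1 : (oneRest y).val ∈ colFil (wThree A) 0 :=
    colFil_antitone _ (by simp) (oneRest_mem_colFil (mem_colFil_neg_one y.isSym))
  have h2 : (expSum l (insLin 0 (twoThree c)) (oneRest y)).val ∈ colFil (wThree A) 0 :=
    colFil_antitone _ (by simp) (expSum_twoThree_mem_colFil hc1 (mem_colFil_neg_one y.isSym) l)
  have key := LinearMap.congr_fun (exp_twoThree_mul l hc hy hc1 h1 h2) (Submodule.Quotient.mk (iotaThree a))
  rw [Module.End.mul_apply, Module.End.mul_apply, exp_twoThree_iotaThree l hc hc1, toQuot_mk,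
    ← mk_expSum_insLin (wThree A) le_rfl (oneThree_mem_colFil hc1), toQuot_mk,
    ← mk_expSum_insLin (wThree A) le_rfl (twoThree_mem_colFil hc1)] at key
  have := projThree_sub_mem key
  have e1 : (fins (wThree A) j (oneRest y) h1).1 (iotaThree a) = splitColour (insLin j (up y) (iota a)) := by
    rw [splitColour_insLin, splitColour_iota]
    rfl
  have e2 : projThree ((fins (wThree A) j (expSum l (insLin 0 (twoThree c)) (oneRest y)) h2).1
      (expSum l (insLin 0 (oneThree c)) (iotaThree a))) =
      proj (insLin j (up (circSum l y c)) (expSum l (insLin 0 (up c)) (iota a))) := by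
    change projThree (insLin j _ _) = _
    rw [← proj_skipColour, skipColour_insLin j (expSum_twoThree_mem_colourOne c y l), projThree_expSum_oneRest,
      map_expSum skipColour (skipColour_insLin 0 (oneThree_mem_colourOne c)), projThree_oneThree, skipColour_iotaThree]
  rwa [e1, e2, projThree_expSum_twoThree, proj_insLin_up_iota] at this

/-- Associativity of the circle product, up to a step of the filtration. -/
theorem circSum_circSum_sub_mem (l : ℕ) {b c : Sym C A} (hb : IsHom 0 b.val) (hc : IsHom 0 c.val)
    (hb1 : b.val ∈ colFil (Weighting.point A 1) 0) (hc1 : c.val ∈ colFil (Weighting.point A 1) 0) (a : Sym C A) :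
    (circSum l (circSum l a b) c - circSum l a (circSum l b c + c)).val ∈ colFil (Weighting.point A 2) (l - 4) := by
  set Y := expSum l (insLin 0 (twoThree c)) (oneRest b) with hY
  have h1 : (oneRest b).val ∈ colFil (wThree A) 1 := colFil_antitone _ (by simp) (oneRest_mem_colFil hb1)
  have h2 : Y.val ∈ colFil (wThree A) 1 :=
    colFil_antitone _ (by simp) (expSum_twoThree_mem_colFil hc1 hb1 l)
  have h3 : (Y + oneThree c).val ∈ colFil (wThree A) 1 := add_mem h2 (oneThree_mem_colFil hc1)
  have hY1 := expSum_twoThree_mem_colourOne c b l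
  have hcomm := commute_insLin_colourOne (oneThree_mem_colourOne c) hY1 (oneThree_isHom hc) (expSum_twoThree_isHom hc hb l)
    (by simp)
  set F := symFil C (wThree A)
  have hn1 := isNilpotent_fins (wThree A) l 0 h1
  have hn2 := isNilpotent_fins (wThree A) l 0 h2
  have hn3 := isNilpotent_fins (wThree A) l 0 (oneThree_mem_colFil hc1)
  have key := LinearMap.congr_fun (IsNilpotent.exp_mul_exp_eq hn1 hn2
    (exp_twoThree_mul l hc hb hc1 (colFil_one_le_zero h1) (colFil_one_le_zero h2))) (Submodule.Quotient.mk (iotaThree a))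
  have hadd : toQuot F l (fins (wThree A) 0 (Y + oneThree c) (colFil_one_le_zero h3)) =
      toQuot F l (fins (wThree A) 0 Y (colFil_one_le_zero h2)) +
        toQuot F l (fins (wThree A) 0 (oneThree c) (colFil_one_le_zero (oneThree_mem_colFil hc1))) := by
    rw [← map_add]
    exact toQuot_eq_of_eq l ((insLin 0).map_add _ _)
  have hexp := IsNilpotent.exp_add_of_commute (by
    rw [commute_iff_eq, ← map_mul, ← map_mul]
    exact toQuot_eq_of_eq l hcomm.eq) hn2 hn3
  rw [Module.End.mul_apply, Module.End.mul_apply, exp_twoThree_iotaThree l hc hc1] at key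
  rw [← hadd] at hexp
  replace key := key.trans (LinearMap.congr_fun hexp _).symm
  rw [← mk_expSum_insLin (wThree A) le_rfl h1, ← mk_expSum_insLin (wThree A) le_rfl (twoThree_mem_colFil hc1),
    ← mk_expSum_insLin (wThree A) le_rfl h3] at key
  have := projThree_sub_mem key
  have e1 : expSum l (insLin 0 (oneRest b)) (iotaThree a) = splitColour (expSum l (insLin 0 (up b)) (iota a)) := by
    rw [map_expSum splitColour (splitColour_insLin 0 b), splitColour_iota]
  have e2 : projThree (expSum l (insLin 0 (Y + oneThree c)) (iotaThree a)) = circSum l a (circSum l b c + c) := by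
    rw [← proj_skipColour, map_expSum skipColour (skipColour_insLin 0 (add_mem hY1 (oneThree_mem_colourOne c))),
      map_add, projThree_oneThree, projThree_expSum_oneRest, skipColour_iotaThree]
    rfl
  rwa [e1, e2, projThree_expSum_twoThree] at this

end Conv

namespace FilteredEnd

variable {k V : Type*} [CommRing k] [Algebra ℚ k] [AddCommGroup V] [Module k V]

theorem mul_expSum {S p y : Module.End k V} (h : S * p = p * S + y) (hy : Commute p y) (M : ℕ) :
    S * expSum (M + 1) p = expSum (M + 1) p * S + expSum M p * y := by
  have hpow (n : ℕ) : S * p ^ (n + 1) = p ^ (n + 1) * S + ((n + 1 : ℕ) : k) • (p ^ n * y) := by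
    induction n with
    | zero => simpa using h
    | succ n ih =>
      rw [pow_succ, ← mul_assoc, ih, add_mul, mul_assoc, h, mul_add, smul_mul_assoc, mul_assoc, ← hy.eq, ← mul_assoc,
        ← mul_assoc, ← pow_succ p n, add_assoc]
      push_cast
      module
  rw [expSum, expSum, Finset.mul_sum, Finset.sum_mul, Finset.sum_mul, Finset.sum_range_succ', Finset.sum_range_succ' (n := M)]
  have (n : ℕ) : S * invFact k (n + 1) • p ^ (n + 1) =
      invFact k (n + 1) • p ^ (n + 1) * S + invFact k n • p ^ n * y := by
    rw [mul_smul_comm, hpow, smul_add, smul_smul, mul_comm (invFact k (n + 1)), succ_mul_invFact, smul_mul_assoc, smul_mul_assoc]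
  simp only [this, Finset.sum_add_distrib, pow_zero, mul_smul_comm, smul_mul_assoc, mul_one, one_mul]
  abel

theorem expSum_mem {F : Submodule k V} {T : Module.End k V} (h : ∀ v ∈ F, T v ∈ F) (M : ℕ) {v : V} (hv : v ∈ F) :
    expSum M T v ∈ F := by
  rw [expSum_apply]
  refine sum_mem fun n hn => F.smul_mem _ ?_
  clear hn
  induction n with
  | zero => exact hv
  | succ n ih =>
    rw [pow_succ', Module.End.mul_apply]
    exact h _ ih

end FilteredEnd

namespace Conv

open FilteredDGModule FilteredEnd

variable {k : Type u} [CommRing k] {C : FilteredDGCooperad.{u, v} k} {A : FilteredDGModule.{u, w} k}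

/-- Convergence of a sequence of families to zero, arity by arity. -/
def TendsZero (x : ℕ → Family C A) : Prop := ∀ n l, ∃ N, ∀ m ≥ N, InFil l (x m n)

theorem TendsZero.of_mem_colFil {x : ℕ → Family C A} (W : A.Weighting) (t : ℤ) (h : ∀ m : ℕ, x m ∈ colFil W (m - t)) :
    TendsZero x := fun n l => ⟨(2 * l + n * W.bound + t).toNat, fun m hm => inFil_of_mem_colFil W (h m) (by omega)⟩

theorem TendsZero.add {x y : ℕ → Family C A} (hx : TendsZero x) (hy : TendsZero y) : TendsZero fun m => x m + y m :=
  fun n l => by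
  obtain ⟨N, hN⟩ := hx n l
  obtain ⟨N', hN'⟩ := hy n l
  exact ⟨max N N', fun m hm => (hN m (by omega)).add (hN' m (by omega))⟩

theorem TendsZero.sub {x y : ℕ → Family C A} (hx : TendsZero x) (hy : TendsZero y) : TendsZero fun m => x m - y m :=
  fun n l => by
  obtain ⟨N, hN⟩ := hx n l
  obtain ⟨N', hN'⟩ := hy n l
  exact ⟨max N N', fun m hm => (hN m (by omega)).sub (hN' m (by omega))⟩

theorem TendsZero.eq (hA : A.IsComplete) {f g : Family C A} (h : TendsZero fun _ => f - g) : f = g :=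
  eq_of_inFil hA fun n l => by
    obtain ⟨N, hN⟩ := h n l
    exact hN N le_rfl

theorem iota_mem_colFil {l : ℤ} {x : Sym C A} (h : x.val ∈ colFil (Weighting.point A 1) l) :
    (iota x).val ∈ colFil (two A 1 1) l := by
  have := conj_mem_colFil (W := Weighting.point A 1) (W' := two A 1 1) (α := inl A A) (β := fold A) 0
    (fun m x hx => ⟨by rw [sub_zero]; exact hx, zero_mem _⟩) (fun _ _ hx => add_mem hx.1 hx.2) h
  rwa [sub_zero] at this

theorem MorSet.dev_mem_colFil (f : MorSet C A) : f.dev.val ∈ colFil (Weighting.point A 1) 0 :=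
  sub_mem ((mem_colFil_zero_iff f.2.1.isSym).2 f.2.2) unit_mem_colFil

/-- The precomposition with the differential of `C`, on equivariant families. -/
def precompDSym : Sym C A →ₗ[k] Sym C A where
  toFun x := Sym.mk (precompD x.val) (precompD_isSym x.isSym)
  map_add' x y := Sym.ext (precompD.map_add x.val y.val)
  map_smul' r x := Sym.ext (precompD.map_smul r x.val)

theorem precompDSym_iota (b : Sym C A) : precompDSym (iota b) = iota (precompDSym b) := rfl

theorem proj_precompDSym (x : Sym C (A.prod A)) : proj (precompDSym x) = precompDSym (proj x) := rfl

theorem up_mem_colFil_one {u : Sym C A} (hu : u.val ∈ colFil (Weighting.point A 1) 0) :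
    (up u).val ∈ colFil (two A 0 1) 1 := colFil_antitone _ (by simp) (up_mem_colFil_of_point (w := 0) hu)

variable [Algebra ℚ k]

theorem circSum_add (M : ℕ) (a a' b : Sym C A) : circSum M (a + a') b = circSum M a b + circSum M a' b := by
  simp only [circSum, map_add]

theorem circSum_sub (M : ℕ) (a a' b : Sym C A) : circSum M (a - a') b = circSum M a b - circSum M a' b := by
  simp only [circSum, map_sub]

theorem circSum_mem_colFil (M : ℕ) {m : ℤ} {x c : Sym C A} (hx : x.val ∈ colFil (Weighting.point A 1) m)
    (hc : c.val ∈ colFil (Weighting.point A 1) 0) : (circSum M x c).val ∈ colFil (Weighting.point A 1) m := by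
  have h1 : (up c).val ∈ colFil (two A 1 1) 0 := colFil_antitone _ (by simp) (up_mem_colFil_of_point (w := 1) hc)
  have h2 := expSum_mem (F := (colFil (two A 1 1) m).comap Sym.val) (T := insLin 0 (up c)) (fun x hx =>
    colFil_antitone _ (by simp) (star_mem_colFil (two A 1 1) 0 hx h1)) M (iota_mem_colFil hx)
  exact colFil_antitone _ (by simp) (proj_mem_colFil le_rfl h2)

theorem circSum_sub_circSum_mem {l M : ℕ} (hl : l ≤ M) {u u' : Sym C A} (hu : u.val ∈ colFil (Weighting.point A 1) 0)
    (hu' : u'.val ∈ colFil (Weighting.point A 1) 0) (h : (u - u').val ∈ colFil (Weighting.point A 1) l) (a : Sym C A) :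
    (circSum M a u - circSum M a u').val ∈ colFil (Weighting.point A 1) (l - 2) := by
  have h1 := toQuot_fins_eq_sum (two A 0 1) (l := l) 0 (colFil_one_le_zero (up_mem_colFil_one hu)) (Z := fun _ => up u') (M := 1)
    (fun _ => colFil_one_le_zero (up_mem_colFil_one hu')) (by
      rw [Finset.sum_range_one, ← map_sub up]
      exact colFil_antitone _ (by simp) (up_mem_colFil_of_point (w := 0) h))
  rw [Finset.sum_range_one] at h1
  have h2 := mk_expSum_insLin (two A 0 1) hl (up_mem_colFil_one hu) (iota a)
  rw [h1, ← mk_expSum_insLin (two A 0 1) hl (up_mem_colFil_one hu'), Submodule.Quotient.eq, mem_symFil] at h2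
  rw [circSum, circSum, ← map_sub]
  refine colFil_antitone _ ?_ (proj_mem_colFil (by simp) h2)
  rw [bound_two (by simp)]
  push_cast
  omega

theorem circ_sub_circSum_mem (hA : A.IsComplete) {j : ℤ} {a : Sym C A} (ha : IsHom j a.val) (f : MorSet C A) (m : ℕ) :
    circ a.val f.1 - (circSum (m + 2) a f.dev).val ∈ colFil (Weighting.point A 1) m := by
  simpa using circ_sub_mem_colFil hA ha f (m + 2)

theorem circ_add (hA : A.IsComplete) {j : ℤ} {a a' : Family C A} (ha : IsHom j a) (ha' : IsHom j a') (f : MorSet C A) :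
    circ (a + a') f.1 = circ a f.1 + circ a' f.1 :=
  TendsZero.eq hA (TendsZero.of_mem_colFil (Weighting.point A 1) 2 fun m => by
    have h1 := circ_sub_mem_colFil hA (a := Sym.mk a ha.isSym) ha f m
    have h2 := circ_sub_mem_colFil hA (a := Sym.mk a' ha'.isSym) ha' f m
    have h3 := circ_sub_mem_colFil hA (a := Sym.mk a ha.isSym + Sym.mk a' ha'.isSym) ((hom C A j).add_mem ha ha') f m
    have := sub_mem (sub_mem h3 h1) h2
    rw [circSum_add, map_add, map_add] at this
    convert this using 1
    simp only [Sym.val_mk]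
    abel)

/-- The circle product of elements whose constant term lies in the first step of the filtration. -/
def circMor (hA : A.IsComplete) (f g : MorSet C A) : MorSet C A :=
  ⟨circ f.1 g.1, (exists_circ hA f.2.1 g).1, by
    rw [← mem_colFil_zero_iff (exists_circ hA f.2.1 g).1.isSym]
    have h1 := circ_sub_mem_colFil hA (a := Sym.mk f.1 f.2.1.isSym) f.2.1 g 2
    have h2 := circSum_mem_colFil 2 (x := Sym.mk f.1 f.2.1.isSym) ((mem_colFil_zero_iff f.2.1.isSym).2 f.2.2) g.dev_mem_colFil
    have := add_mem h1 (colFil_antitone _ (by simp) h2)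
    rwa [sub_add_cancel] at this⟩

theorem circ_eq_add (hA : A.IsComplete) (f g : MorSet C A) : circ f.1 g.1 = g.1 + circ f.dev.val g.1 := by
  have := circ_add hA unit_isHom f.dev_isHom g
  rwa [unit_circ hA g.2.1.isSym, show unit + f.dev.val = f.1 from add_sub_cancel _ _] at this

theorem dev_circMor_sub_mem (hA : A.IsComplete) (f g : MorSet C A) (M : ℕ) :
    ((circMor hA f g).dev - (circSum M f.dev g.dev + g.dev)).val ∈ colFil (Weighting.point A 1) (M - 2) := by
  have := circ_sub_mem_colFil hA f.dev_isHom g M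
  convert this using 1
  change circ f.1 g.1 - unit - ((circSum M f.dev g.dev).val + (g.1 - unit)) = _
  rw [circ_eq_add hA]
  abel

theorem circ_assoc (hA : A.IsComplete) {j : ℤ} {a : Family C A} (ha : IsHom j a) (f g : MorSet C A) :
    circ (circ a f.1) g.1 = circ a (circ f.1 g.1) := by
  let a' : Sym C A := Sym.mk a ha.isSym
  let af := circSym hA a' ha f
  have haf : IsHom j af.val := (exists_circ hA ha f).1
  have h1 : TendsZero fun m : ℕ => circ af.val g.1 - (circSum (m + 2) af g.dev).val :=
    .of_mem_colFil (Weighting.point A 1) 0 fun m => by simpa using circ_sub_circSum_mem hA haf g m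
  have h2 : TendsZero fun m : ℕ => (circSum (m + 2) (af - circSum (m + 2) a' f.dev) g.dev).val :=
    .of_mem_colFil (Weighting.point A 1) 0 fun m => circSum_mem_colFil _
      (by rw [sub_zero]; exact circ_sub_circSum_mem hA (a := a') ha f m) g.dev_mem_colFil
  have h3 : TendsZero fun m : ℕ => (circSum (m + 2) (circSum (m + 2) a' f.dev) g.dev -
      circSum (m + 2) a' (circSum (m + 2) f.dev g.dev + g.dev)).val :=
    .of_mem_colFil (Weighting.point A 2) 2 fun m => by
      have := circSum_circSum_sub_mem (m + 2) f.dev_isHom g.dev_isHom f.dev_mem_colFil g.dev_mem_colFil a'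
      exact colFil_antitone _ (by push_cast; omega) this
  have h4 : TendsZero fun m : ℕ => (circSum (m + 2) a' (circMor hA f g).dev -
      circSum (m + 2) a' (circSum (m + 2) f.dev g.dev + g.dev)).val :=
    .of_mem_colFil (Weighting.point A 1) 2 fun m => circSum_sub_circSum_mem (by simp) (circMor hA f g).dev_mem_colFil
      (add_mem (circSum_mem_colFil _ f.dev_mem_colFil g.dev_mem_colFil) g.dev_mem_colFil)
      (by simpa using dev_circMor_sub_mem hA f g (m + 2)) a'
  have h5 : TendsZero fun m : ℕ => circ a (circMor hA f g).1 - (circSum (m + 2) a' (circMor hA f g).dev).val :=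
    .of_mem_colFil (Weighting.point A 1) 0 fun m => by
      rw [sub_zero]
      exact circ_sub_circSum_mem hA (a := a') ha (circMor hA f g) m
  refine TendsZero.eq hA ?_
  convert (((h1.add h2).add h3).sub h4).sub h5 using 2
  change circ (circ a f.1) g.1 - circ a (circ f.1 g.1) = circ (circ a f.1) g.1 - _ + _ + _ - _ - (circ a (circ f.1 g.1) - _)
  simp only [map_sub, circSum_sub]
  abel

end Conv

namespace Conv

open FilteredDGModule FilteredEnd

variable {k : Type u} [CommRing k] {C : FilteredDGCooperad.{u, v} k} {A : FilteredDGModule.{u, w} k}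

/-! ### Composition of infinity-morphisms -/

/-- The element `δ + α`, as an equivariant family. -/
def deltaAdd {α : Family C A} (hα : IsHom (-1) α) : Sym C A :=
  Sym.mk (delta + α) ((hom C A (-1)).add_mem delta_isHom hα).isSym

theorem deltaAdd_isHom {α : Family C A} (hα : IsHom (-1) α) : IsHom (-1) (deltaAdd hα).val :=
  (hom C A (-1)).add_mem delta_isHom hα

variable [Algebra ℚ k]

/-- The operator `x ↦ x ⋆ M + x ∘ d_C`. -/
def twistOp (M : Sym C A) : Module.End k (Sym C A) := insLin (-1) M + precompDSym

theorem twistOp_mem_colFil {M : Sym C A} {l : ℤ} {x : Sym C A}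
    (h : x.val ∈ colFil (Weighting.point A 1) l) : (twistOp M x).val ∈ colFil (Weighting.point A 1) (l - 1) := by
  have h1 := star_mem_colFil (Weighting.point A 1) (-1) h (mem_colFil_neg_one M.isSym)
  exact add_mem h1 (colFil_antitone _ (by simp) (precompD_mem_colFil _ h))

theorem twistOp_isHom {M x : Sym C A} {j : ℤ} (hM : IsHom (-1) M.val) (hx : IsHom j x.val) :
    IsHom (j - 1) (twistOp M x).val := by
  have h1 := star_isHom hx hM
  rw [← sub_eq_add_neg] at h1
  exact (hom C A _).add_mem h1 (precompD_isHom hx)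

theorem proj_twistOp (M : Sym C A) (x : Sym C (A.prod A)) : proj (twistOp (side M) x) = twistOp M (proj x) := by
  rw [twistOp, LinearMap.add_apply, map_add, proj_insLin_side, proj_precompDSym]
  rfl

theorem twistOp_iota (M a : Sym C A) : twistOp (side M) (iota a) = insLin (-1) (up M) (iota a) + iota (precompDSym a) := by
  rw [twistOp, LinearMap.add_apply, insLin_side_iota, precompDSym_iota]

theorem twistOp_mul_up {M b : Sym C A} (hM : IsHom (-1) M.val) (hb : IsHom 0 b.val) :
    twistOp (side M) * insLin 0 (up b) = insLin 0 (up b) * twistOp (side M) + insLin (-1) (up (twistOp M b)) := by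
  have h1 : precompDSym * insLin 0 (up b) = insLin 0 (up b) * precompDSym + insLin (-1) (up (precompDSym b)) := by
    refine LinearMap.ext fun x => Sym.ext ?_
    have := precompD_star 0 x.val (up b).val
    rw [zsign_zero, one_smul] at this
    exact this
  have h2 := side_mul_up hb hM (by simp)
  rw [zero_add] at h2
  rw [twistOp, add_mul, h1, h2, mul_add, twistOp, LinearMap.add_apply, map_add, map_add]
  abel

theorem twistOp_circSum {M b : Sym C A} (hM : IsHom (-1) M.val) (hb : IsHom 0 b.val) (g : Sym C A) (m : ℕ) :
    twistOp M (circSum (m + 1) g b) = circSum (m + 1) (precompDSym g) b +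
      proj (insLin (-1) (up (M + twistOp M b)) (expSum m (insLin 0 (up b)) (iota g))) +
      invFact k m • proj ((insLin 0 (up b) ^ m) (insLin (-1) (up M) (iota g))) := by
  have hMb : IsHom (-1) (twistOp M b).val := by simpa using twistOp_isHom hM hb
  have hc (y : Sym C A) (hy : IsHom (-1) y.val) : Commute (insLin 0 (up b)) (insLin (-1) (up y)) := up_mul_up hy hb (by simp)
  have key := LinearMap.congr_fun (mul_expSum (twistOp_mul_up hM hb) (hc _ hMb) m) (iota g)
  rw [Module.End.mul_apply, LinearMap.add_apply, Module.End.mul_apply, Module.End.mul_apply, twistOp_iota, map_add] at key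
  have h1 : expSum (m + 1) (insLin 0 (up b)) (insLin (-1) (up M) (iota g)) =
      expSum m (insLin 0 (up b)) (insLin (-1) (up M) (iota g)) +
        invFact k m • (insLin 0 (up b) ^ m) (insLin (-1) (up M) (iota g)) := by
    rw [expSum_apply, expSum_apply, Finset.sum_range_succ]
  have h2 : insLin (-1) (up (M + twistOp M b)) (expSum m (insLin 0 (up b)) (iota g)) =
      expSum m (insLin 0 (up b)) (insLin (-1) (up M) (iota g)) +
      expSum m (insLin 0 (up b)) (insLin (-1) (up (twistOp M b)) (iota g)) := by
    rw [← map_add, ← LinearMap.add_apply, ← map_add, ← map_add]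
    exact map_expSum _ (fun v => (LinearMap.congr_fun (hc (M + twistOp M b) ((hom C A _).add_mem hM hMb)).eq v).symm) m _
  rw [circSum, ← proj_twistOp, key, h1, h2]
  simp only [map_add, map_smul, circSum]
  abel

theorem circ_insLin (hA : A.IsComplete) {i j : ℤ} {a y : Sym C A} (ha : IsHom i a.val) (hy : IsHom j y.val)
    (f : MorSet C A) {e : Sym C A} (he : e.val = circ y.val f.1) : TendsZero fun m => circ (star j a.val y.val) f.1 -
      (proj (insLin j (up e) (expSum (m + 2) (insLin 0 (up f.dev)) (iota a)))).val := by
  have h1 : TendsZero fun m : ℕ => circ (insLin j y a).val f.1 - (circSum (m + 2) (insLin j y a) f.dev).val :=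
    .of_mem_colFil (Weighting.point A 1) 0 fun m => by
      rw [sub_zero]
      exact circ_sub_circSum_mem hA (star_isHom ha hy) f m
  have h2 : TendsZero fun m : ℕ => (circSum (m + 2) (insLin j y a) f.dev - proj (insLin j (up (circSum (m + 2) y f.dev))
      (expSum (m + 2) (insLin 0 (up f.dev)) (iota a)))).val :=
    .of_mem_colFil (Weighting.point A 2) 2 fun m => by
      have := circSum_insLin_sub_mem (m + 2) f.dev_isHom hy f.dev_mem_colFil a
      exact colFil_antitone _ (by push_cast; omega) this
  have h3 : TendsZero fun m : ℕ => (proj (insLin j (up (e - circSum (m + 2) y f.dev))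
      (expSum (m + 2) (insLin 0 (up f.dev)) (iota a)))).val :=
    .of_mem_colFil (Weighting.point A 1) 1 fun m => by
      have h4 : (e - circSum (m + 2) y f.dev).val ∈ colFil (Weighting.point A 1) m := by
        rw [map_sub, he]
        exact circ_sub_circSum_mem hA hy f m
      have h5 := mem_colFil_neg_bound (two A 0 1) (expSum (m + 2) (insLin 0 (up f.dev)) (iota a)).isSym
      have h6 := proj_mem_colFil (x := insLin j (up (e - circSum (m + 2) y f.dev)) (expSum (m + 2) (insLin 0 (up f.dev)) (iota a)))
        (by simp) (star_mem_colFil (two A 0 1) j h5 (up_mem_colFil_of_point (w := 0) h4))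
      refine colFil_antitone _ ?_ h6
      rw [bound_two (by simp)]
      push_cast
      omega
  convert (h1.add h2).sub h3 using 2
  simp only [map_sub, LinearMap.sub_apply]
  change _ = circ (star j a.val y.val) f.1 - _ + _ - _
  abel

theorem twistOp_circ (hA : A.IsComplete) {j : ℤ} {g μ ν : Sym C A} (hg : IsHom j g.val) (hμ : IsHom (-1) μ.val)
    (hν : IsHom (-1) ν.val) (f : MorSet C A) (h : (μ + twistOp μ f.dev).val = circ ν.val f.1) :
    (twistOp μ (circSym hA g hg f)).val = circ (twistOp ν g).val f.1 := by
  have hR : IsHom (j - 1) (precompDSym g).val := precompD_isHom hg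
  have hs : IsHom (j - 1) (insLin (-1) ν g).val := star_isHom hg hν
  have h1 : TendsZero fun m : ℕ => (twistOp μ (circSym hA g hg f - circSum (m + 3) g f.dev)).val :=
    .of_mem_colFil (Weighting.point A 1) 0 fun m => by
      have := circ_sub_circSum_mem hA hg f (m + 1)
      exact colFil_antitone _ (by push_cast; omega) (twistOp_mem_colFil (l := (m + 1 : ℕ))
        (x := circSym hA g hg f - circSum (m + 3) g f.dev) (by rw [map_sub]; exact this))
  have h2 : TendsZero fun m : ℕ => circ (precompDSym g).val f.1 - (circSum (m + 3) (precompDSym g) f.dev).val :=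
    .of_mem_colFil (Weighting.point A 1) 0 fun m =>
      colFil_antitone _ (by push_cast; omega) (circ_sub_circSum_mem hA hR f (m + 1))
  have h3 := circ_insLin hA hg hν f h
  have h4 : TendsZero fun m : ℕ => (invFact k (m + 2) • proj ((insLin 0 (up f.dev) ^ (m + 2)) (insLin (-1) (up μ) (iota g)))).val :=
    .of_mem_colFil (Weighting.point A 1) 0 fun m => by
      have h1 := (raises_insLin 0 (r := 1) (up_mem_colFil_one f.dev_mem_colFil)).pow (m + 2)
      have h2 := h1.mem (symFil_zero _) (insLin (-1) (up μ) (iota g))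
      refine Submodule.smul_mem _ _ (colFil_antitone _ ?_ (proj_mem_colFil (by simp) ((mem_symFil _).1 h2)))
      rw [bound_two (by simp)]
      push_cast
      omega
  refine TendsZero.eq hA ?_
  convert ((h1.sub h2).sub h3).add h4 using 2 with m
  have e1 := circ_add hA hs hR f
  have e2 : (twistOp ν g).val = (insLin (-1) ν g).val + (precompDSym g).val := rfl
  rw [e2, e1, map_sub (twistOp μ), twistOp_circSum hμ f.dev_isHom g (m + 2), val_insLin]
  simp only [map_sub, map_add, LinearMap.add_apply]
  abel

theorem deltaAdd_add_twistOp {α : Family C A} (hα : IsHom (-1) α) (f : MorSet C A) :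
    (deltaAdd hα + twistOp (deltaAdd hα) f.dev).val = star (-1) f.1 (delta + α) + precompD f.1 := by
  have h1 : star (-1) f.1 (delta + α) = delta + α + star (-1) f.dev.val (delta + α) := by
    have h := LinearMap.map_add₂ (starₗ (-1)) unit f.dev.val (delta + α)
    rw [show unit + f.dev.val = f.1 from add_sub_cancel _ _] at h
    exact h.trans (congrArg (· + _) (unit_star (-1) (deltaAdd hα).isSym))
  have h2 : precompD f.1 = precompD f.dev.val := by
    have h := precompD.map_add unit f.dev.val
    rw [show unit + f.dev.val = f.1 from add_sub_cancel _ _, precompD_unit, zero_add] at h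
    exact h
  rw [h1, h2, add_assoc]
  rfl

theorem IsInftyMor.circ (hA : A.IsComplete) {f g α β γ : Family C A} (hα : IsHom (-1) α) (hβ : IsHom (-1) β)
    (hγ : IsHom (-1) γ) (hf : IsInftyMor f α β) (hg : IsInftyMor g β γ) : IsInftyMor (circ g f) α γ := by
  let F : MorSet C A := ⟨f, hf.1, hf.2⟩
  let G : MorSet C A := ⟨g, hg.1, hg.2⟩
  have h2 := twistOp_circ hA (g := Sym.mk g hg.1.isSym) hg.1 (deltaAdd_isHom hα) (deltaAdd_isHom hβ) F
    ((deltaAdd_add_twistOp hα F).trans hf.eq)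
  have h3 : (twistOp (deltaAdd hβ) (Sym.mk g hg.1.isSym)).val = Conv.circ (delta + γ) g := hg.eq
  rw [h3] at h2
  have h4 : Conv.circ (Conv.circ (delta + γ) g) f = Conv.circ (delta + γ) (Conv.circ g f) :=
    circ_assoc hA (deltaAdd_isHom hγ) G F
  exact ⟨(circMor hA G F).2.1, (circMor hA G F).2.2, h2.trans h4⟩

end Conv

namespace Conv

open FilteredDGModule FilteredEnd

variable {k : Type u} [CommRing k] {C : FilteredDGCooperad.{u, v} k} {A : FilteredDGModule.{u, w} k}

/-! ### Maurer--Cartan elements -/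

theorem zsign_neg_one_smul (x : Family C A) : zsign k (-1) • x = -x := by
  rw [show zsign k (-1) = -1 by simp [zsign]]
  exact neg_one_smul k x

variable [Algebra ℚ k]

theorem twistOp_twistOp {μ : Sym C A} (hμ : IsHom (-1) μ.val) (x : Sym C A) :
    twistOp μ (twistOp μ x) = insLin (-2) (twistOp μ μ) x := by
  have h1 : star (-1) (star (-1) x.val μ.val) μ.val = star (-2) x.val (star (-1) μ.val μ.val) := by
    have h := star_preLie x.isSym hμ hμ
    rw [show zsign k (-1 * -1) = zsign k (-1) by simp [zsign], zsign_neg_one_smul, eq_neg_iff_add_eq_zero, ← two_smul k] at h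
    have h2 := congrArg (algebraMap ℚ k (2⁻¹) • ·) h
    simp only [smul_smul, smul_zero] at h2
    rw [← map_ofNat (algebraMap ℚ k) 2, ← map_mul, inv_mul_cancel₀ two_ne_zero, map_one, one_smul, sub_eq_zero] at h2
    exact h2
  have h2 := precompD_star (-1) x.val μ.val
  rw [zsign_neg_one_smul] at h2
  refine Sym.ext ?_
  change star (-1) (star (-1) x.val μ.val + precompD x.val) μ.val + precompD (star (-1) x.val μ.val + precompD x.val) =
    star (-2) x.val (star (-1) μ.val μ.val + precompD μ.val)
  rw [map_add precompD, precompD_precompD, add_zero, h2, ← starₗ_apply (-1) (_ + _), map_add, LinearMap.add_apply,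
    starₗ_apply, starₗ_apply, h1, ← starₗ_apply (-2) x.val (_ + _), map_add, starₗ_apply, starₗ_apply]
  exact (add_add_add_comm _ _ _ _).trans (by abel_nf; rfl)

theorem twistOp_deltaAdd {α : Family C A} (hα : IsHom (-1) α) :
    (twistOp (deltaAdd hα) (deltaAdd hα)).val = diff (-1) α + star (-1) α α := by
  rw [diff_eq hα, zsign_neg_one_smul, zsign_neg_one_smul]
  change star (-1) (delta + α) (delta + α) + precompD (delta + α) = _
  rw [← starₗ_apply, map_add, map_add, LinearMap.add_apply, LinearMap.add_apply, map_add precompD, precompD_delta]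
  simp only [starₗ_apply, delta_star_delta]
  abel

theorem circSym_injective (hA : A.IsComplete) {i : ℤ} {x y : Family C A} (hx : IsHom i x) (hy : IsHom i y) {f g : MorSet C A}
    (hfg : circMor hA f g = ⟨unit, unit_isHom, InFil.zero⟩) (h : circ x f.1 = circ y f.1) : x = y := by
  have h1 : circ (circ x f.1) g.1 = circ (circ y f.1) g.1 := congrArg (circ · g.1) h
  have h2 : circ f.1 g.1 = unit := congrArg Subtype.val hfg
  rwa [circ_assoc hA hx, circ_assoc hA hy, h2, circ_unit hA x hx.isSym, circ_unit hA y hy.isSym] at h1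

theorem zero_circ (hA : A.IsComplete) (f : MorSet C A) : circ (0 : Family C A) f.1 = 0 := by
  have h := circ_add hA (hom C A 0).zero_mem (hom C A 0).zero_mem f
  rwa [add_zero, left_eq_add] at h

/-- Maurer--Cartan elements are transported along invertible morphisms. -/
theorem maurerCartan_of_star_eq (hA : A.IsComplete) {α β : Family C A} (hα : IsHom (-1) α) (hβ : IsHom (-1) β) {f g : MorSet C A}
    (hfg : circMor hA f g = ⟨unit, unit_isHom, InFil.zero⟩) (hf : star (-1) f.1 (delta + α) + precompD f.1 = circ (delta + β) f.1)
    (h : diff (-1) α + star (-1) α α = 0) : diff (-1) β + star (-1) β β = 0 := by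
  have h1 := twistOp_circ hA (deltaAdd_isHom hβ) (deltaAdd_isHom hα) (deltaAdd_isHom hβ) f ((deltaAdd_add_twistOp hα f).trans hf)
  have h2 : circSym hA (deltaAdd hβ) (deltaAdd_isHom hβ) f = twistOp (deltaAdd hα) (Sym.mk f.1 f.2.1.isSym) := Sym.ext hf.symm
  have h3 : twistOp (deltaAdd hα) (deltaAdd hα) = 0 := Sym.ext ((twistOp_deltaAdd hα).trans h)
  rw [h2, twistOp_twistOp (deltaAdd_isHom hα), h3, map_zero, LinearMap.zero_apply, map_zero] at h1
  rw [← twistOp_deltaAdd hβ]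
  exact circSym_injective hA (twistOp_isHom (deltaAdd_isHom hβ) (deltaAdd_isHom hβ)) (hom C A _).zero_mem hfg
    (h1.symm.trans (zero_circ hA f).symm)

/-! ### The gauge action -/

theorem gaugeIter_one {y α : Family C A} (hy : IsHom 0 y) :
    gaugeIter y α 1 = star (-1) y (delta + α) - star 0 (delta + α) y + precompD y := by
  change star (-1) y α - star 0 α y - diff 0 y = _
  rw [diff_eq hy, zsign_zero, one_smul, one_smul, ← starₗ_apply (-1) y (delta + α), ← starₗ_apply 0 (delta + α), map_add,
    map_add, LinearMap.add_apply]
  simp only [starₗ_apply]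
  abel

theorem gaugeIter_isHom {y α : Family C A} (hy : IsHom 0 y) (hα : IsHom (-1) α) : ∀ n, IsHom (-1) (gaugeIter y α n)
  | 0 => hα
  | 1 => by
    rw [gaugeIter_one hy]
    have hd : IsHom (-1) (delta + α) := deltaAdd_isHom hα
    exact (hom C A (-1)).add_mem ((hom C A (-1)).sub_mem (star_isHom hy hd) (star_isHom hd hy)) (precompD_isHom hy)
  | n + 2 =>
    have h := gaugeIter_isHom hy hα (n + 1)
    (hom C A (-1)).sub_mem (star_isHom hy h) (star_isHom h hy)

theorem gaugeIter_mem_colFil {y α : Family C A} (hy : IsHom 0 y) (hy1 : y ∈ colFil (Weighting.point A 1) 1)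
    (hα : IsHom (-1) α) : ∀ n : ℕ, gaugeIter y α n ∈ colFil (Weighting.point A 1) (n - 1)
  | 0 => colFil_antitone _ (by simp) (mem_colFil_neg_one hα.isSym)
  | 1 => by
    rw [gaugeIter_one hy]
    have hd := mem_colFil_neg_one (deltaAdd hα).isSym
    exact add_mem (sub_mem (colFil_antitone _ (by simp) (star_mem_colFil _ (-1) hy1 hd))
      (colFil_antitone _ (by simp) (star_mem_colFil _ 0 hd hy1)))
      (colFil_antitone _ (by simp) (precompD_mem_colFil _ hy1))
  | n + 2 => by
    have h := gaugeIter_mem_colFil hy hy1 hα (n + 1)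
    exact sub_mem (colFil_antitone _ (by push_cast; omega) (star_mem_colFil _ (-1) hy1 h))
      (colFil_antitone _ (by push_cast; omega) (star_mem_colFil _ 0 h hy1))

theorem exists_gauge (hA : A.IsComplete) (y : GaugeSet C A) {α : Family C A} (hα : IsHom (-1) α) :
    IsHom (-1) (gauge y.1 α) ∧ Converges (gaugeTerm y.1 α) (gauge y.1 α) := by
  obtain ⟨L, hL, hL'⟩ := exists_converges_of_mem_colFil hA (Weighting.point A 1) 1
    (fun n => (hom C A (-1)).smul_mem _ (gaugeIter_isHom y.2.1 hα n))
    (fun n => Submodule.smul_mem _ _ (gaugeIter_mem_colFil y.2.1 (GaugeSet.mem_colFil y) hα n)) (x := gaugeTerm y.1 α)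
  rw [gauge, seriesSum_eq hA hL']
  exact ⟨hL, hL'⟩

theorem gauge_sub_mem_colFil (hA : A.IsComplete) (y : GaugeSet C A) {α : Family C A} (hα : IsHom (-1) α) (M : ℕ) :
    gauge y.1 α - ∑ i ∈ Finset.range M, gaugeTerm y.1 α i ∈ colFil (Weighting.point A 1) (M - 1) :=
  sub_sum_mem_colFil (exists_gauge hA y hα).2
    (fun n => Submodule.smul_mem _ _ (gaugeIter_mem_colFil y.2.1 (GaugeSet.mem_colFil y) hα n)) M

/-- The iterated commutators of `twistOp (δ + α)` with an insertion operator. -/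
def gaugeOp (y : GaugeSet C A) {α : Family C A} (hα : IsHom (-1) α) : ℕ → Module.End k (Sym C A)
  | 0 => twistOp (deltaAdd hα)
  | n + 1 => insLin (-1) (Sym.mk (gaugeIter y.1 α (n + 1)) (gaugeIter_isHom y.2.1 hα (n + 1)).isSym)

theorem gaugeOp_mul (y : GaugeSet C A) {α : Family C A} (hα : IsHom (-1) α) (n : ℕ) :
    gaugeOp y hα n * insLin 0 (GaugeSet.sym y) = insLin 0 (GaugeSet.sym y) * gaugeOp y hα n + gaugeOp y hα (n + 1) := by
  match n with
  | 0 =>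
    have hd := deltaAdd_isHom hα
    let D : Sym C A := insLin (-1) (deltaAdd hα) (GaugeSet.sym y) - insLin 0 (GaugeSet.sym y) (deltaAdd hα)
    have h1 := insLin_mul (Y := GaugeSet.sym y) (Z := deltaAdd hα) (U := D) y.2.1 hd (by simp) rfl
    have h2 : precompDSym * insLin 0 (GaugeSet.sym y) = insLin 0 (GaugeSet.sym y) * precompDSym +
        insLin (-1) (precompDSym (GaugeSet.sym y)) := by
      refine LinearMap.ext fun x => Sym.ext ?_
      have := precompD_star 0 x.val y.1
      rw [zsign_zero, one_smul] at this
      exact this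
    have h3 : gaugeOp y hα 1 = insLin (-1) (D + precompDSym (GaugeSet.sym y)) :=
      congrArg (insLin (-1)) (Sym.ext (gaugeIter_one y.2.1))
    rw [zero_add] at h1
    change twistOp _ * _ = _ * twistOp _ + _
    rw [h3, twistOp, add_mul, h1, h2, mul_add, map_add]
    abel
  | n + 1 => exact insLin_mul (i := 0) (j := -1) (Y := GaugeSet.sym y) y.2.1 (gaugeIter_isHom y.2.1 hα (n + 1)) (by simp) rfl

theorem gaugeOp_unit (y : GaugeSet C A) {α : Family C A} (hα : IsHom (-1) α) (n : ℕ) :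
    (gaugeOp y hα n (unitSym C A)).val = gaugeIter y.1 α n + if n = 0 then delta else 0 := by
  match n with
  | 0 =>
    change star (-1) unit (delta + α) + precompD unit = α + delta
    rw [precompD_unit, add_zero]
    exact (unit_star (-1) (deltaAdd hα).isSym).trans (add_comm _ _)
  | n + 1 =>
    change star (-1) unit (gaugeIter y.1 α (n + 1)) = _
    rw [unit_star _ (gaugeIter_isHom y.2.1 hα (n + 1)).isSym]
    simp

theorem twistOp_expSum_unit (y : GaugeSet C A) {α : Family C A} (hα : IsHom (-1) α) (M : ℕ) :
    twistOp (deltaAdd hα) (expSum M (insLin 0 (GaugeSet.sym y)) (unitSym C A)) = ∑ s ∈ Finset.range M,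
      invFact k s • (insLin 0 (GaugeSet.sym y) ^ s) (∑ i ∈ Finset.range (M - s), invFact k i • gaugeOp y hα i (unitSym C A)) := by
  have key (n : ℕ) := LinearMap.congr_fun (IsNilpotent.mul_pow_eq_sum_antidiagonal (q := insLin 0 (GaugeSet.sym y))
    (p := fun i => invFact k i • gaugeOp y hα i) (fun i => by
      rw [smul_mul_assoc, gaugeOp_mul, smul_add, rat_smul_end, smul_smul, map_natCast, succ_mul_invFact, mul_smul_comm]) n)
    (unitSym C A)
  rw [expSum_apply, map_sum]
  have h (n : ℕ) : twistOp (deltaAdd hα) (invFact k n • (insLin 0 (GaugeSet.sym y) ^ n) (unitSym C A)) =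
      ∑ s ∈ Finset.range (n + 1), invFact k s • (insLin 0 (GaugeSet.sym y) ^ s)
        (invFact k (n - s) • gaugeOp y hα (n - s) (unitSym C A)) := by
    have := key n
    rw [LinearMap.sum_apply, ← Finset.Nat.sum_antidiagonal_swap, Finset.Nat.sum_antidiagonal_eq_sum_range_succ_mk] at this
    refine Eq.trans ?_ this
    change _ = (invFact k 0 • twistOp (deltaAdd hα)) _
    rw [show invFact k 0 = 1 by simp [invFact], one_smul]
    rfl
  rw [Finset.sum_congr rfl fun n _ => h n, Finset.sum_range_diag_flip M fun s i => invFact k s •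
    (insLin 0 (GaugeSet.sym y) ^ s) (invFact k i • gaugeOp y hα i (unitSym C A))]
  refine Finset.sum_congr rfl fun s _ => ?_
  rw [map_sum, Finset.smul_sum]

/-- The defining relation of the gauge action. -/
theorem star_exp_eq_circ_gauge (hA : A.IsComplete) (y : GaugeSet C A) {α : Family C A} (hα : IsHom (-1) α) :
    star (-1) (exp y.1) (delta + α) + precompD (exp y.1) = circ (delta + gauge y.1 α) (exp y.1) := by
  let W := Weighting.point A 1
  have hg := (exists_gauge hA y hα).1
  let E : Sym C A := Sym.mk (exp y.1) (expMor hA y).2.1.isSym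
  refine congrArg Sym.val (Sym.eq_of_mk hA W (x := twistOp (deltaAdd hα) E)
    (y := circSym hA (deltaAdd hg) (deltaAdd_isHom hg) (expMor hA y)) fun l => ?_)
  have h1 := mk_circSym_exp hA (deltaAdd_isHom hg) y l
  rw [← mk_expSum_insLin_gauge le_rfl] at h1
  refine Eq.trans ?_ h1.symm
  have h2 : (E - expSum l (insLin 0 (GaugeSet.sym y)) (unitSym C A)).val ∈ colFil W l := by
    rw [map_sub, expSum_unitSym]
    exact exp_sub_mem_colFil hA y.2.1 (GaugeSet.mem_colFil y) l
  have h3 : twistOp (deltaAdd hα) (expSum l (insLin 0 (GaugeSet.sym y)) (unitSym C A)) -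
      expSum l (insLin 0 (GaugeSet.sym y)) (deltaAdd hg) ∈ symFil C W l := by
    rw [twistOp_expSum_unit, expSum_apply, ← Finset.sum_sub_distrib]
    refine sum_mem fun s hs => ?_
    rw [Finset.mem_range] at hs
    rw [← smul_sub, ← map_sub]
    refine Submodule.smul_mem _ _ ?_
    have h4 : (∑ i ∈ Finset.range (l - s), invFact k i • gaugeOp y hα i (unitSym C A)) - deltaAdd hg ∈ symFil C W (l - s) := by
      rw [← neg_sub]
      refine neg_mem ((mem_symFil W).2 ?_)
      have h5 : (∑ i ∈ Finset.range (l - s), invFact k i • gaugeOp y hα i (unitSym C A)).val =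
          ∑ i ∈ Finset.range (l - s), gaugeTerm y.1 α i + delta := by
        rw [map_sum, Finset.sum_congr rfl fun i _ => by rw [map_smul, gaugeOp_unit, smul_add], Finset.sum_add_distrib]
        congr 1
        rw [Finset.sum_eq_single_of_mem 0 (by simp; omega) fun i _ hi => by rw [if_neg hi, smul_zero]]
        simp [invFact]
      rw [map_sub, h5, show (deltaAdd hg).val = delta + gauge y.1 α from rfl, add_comm _ (delta : Family C A),
        add_sub_add_left_eq_sub]
      exact gauge_sub_mem_colFil hA y hα (l - s)
    have := ((raises_insLin 0 (r := 1) (Y := GaugeSet.sym y) (GaugeSet.mem_colFil y)).pow s) _ _ h4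
    rwa [Nat.sub_add_cancel hs.le] at this
  refine (Submodule.Quotient.eq _).2 ?_
  have := add_mem ((mem_symFil W (l := l)).2 (colFil_antitone W (le_refl ((l : ℤ) - 1))
    (twistOp_mem_colFil (M := deltaAdd hα) h2))) h3
  rw [map_sub (twistOp _)] at this
  exact (sub_add_sub_cancel _ _ (expSum l (insLin 0 (GaugeSet.sym y)) (deltaAdd hg))) ▸ this

end Conv

namespace Conv

open FilteredDGModule FilteredEnd

variable {k : Type u} [CommRing k] {C : FilteredDGCooperad.{u, v} k} {A : FilteredDGModule.{u, w} k} [Algebra ℚ k]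

/-! ### Bijectivity of the pre-Lie exponential -/

theorem power_inFil {l : ℕ} {y : Family C A} (hy : ∀ n, InFil l (y n)) (hy0 : ∀ n, InFil 0 (y n)) :
    ∀ m n, InFil l (power y (m + 1) n)
  | 0, n => hy n
  | m + 1, _ => star_inFil 0 fun q p _ => ⟨l, 0, le_rfl, power_inFil hy hy0 m (p + 1), hy0 q⟩

theorem power_sub_mem_colFil {x y : Family C A} (hx : x ∈ colFil (Weighting.point A 1) 1)
    (hy : y ∈ colFil (Weighting.point A 1) 1) {m : ℕ} (h : x - y ∈ colFil (Weighting.point A 1) m) :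
    ∀ n : ℕ, power x (n + 1) - power y (n + 1) ∈ colFil (Weighting.point A 1) (m + n)
  | 0 => by simpa [power] using h
  | n + 1 => by
    have h1 := star_mem_colFil (Weighting.point A 1) 0 (power_sub_mem_colFil hx hy h n) hx
    have h2 := star_mem_colFil (Weighting.point A 1) 0 (power_mem_colFil hy n) h
    have h3 : power x (n + 1 + 1) - power y (n + 1 + 1) =
        star 0 (power x (n + 1) - power y (n + 1)) x + star 0 (power y (n + 1)) (x - y) := by
      change star 0 _ _ - star 0 _ _ = _
      rw [← starₗ_apply 0 (_ - _), ← starₗ_apply 0 _ (x - y), map_sub, map_sub, LinearMap.sub_apply]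
      exact (sub_add_sub_cancel _ _ _).symm
    rw [h3]
    exact add_mem (colFil_antitone _ (by push_cast; omega) h1) (colFil_antitone _ (by push_cast; omega) h2)

/-- The non-linear part of the pre-Lie exponential. -/
def expRem (y : Family C A) : Family C A := exp y - unit - y

theorem sum_expTerm_succ_succ (y : Family C A) (M : ℕ) :
    ∑ i ∈ Finset.range (M + 2), expTerm y i = ∑ i ∈ Finset.range M, expTerm y (i + 2) + y + unit := by
  rw [Finset.sum_range_succ', Finset.sum_range_succ']
  have h0 : expTerm y 0 = unit := by
    change algebraMap ℚ k _ • unit = _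
    simp
  have h1 : expTerm y (0 + 1) = y := by
    change algebraMap ℚ k _ • y = _
    simp
  rw [h0, h1]

theorem expRem_isHom (hA : A.IsComplete) {y : Family C A} (hy : IsHom 0 y) (hy1 : y ∈ colFil (Weighting.point A 1) 1) :
    IsHom 0 (expRem y) :=
  (hom C A 0).sub_mem ((hom C A 0).sub_mem (exists_exp hA hy hy1).1 unit_isHom) hy

theorem exp_sub_unit_inFil (hA : A.IsComplete) {y : Family C A} (hy : IsHom 0 y) (hy1 : y ∈ colFil (Weighting.point A 1) 1)
    {l : ℕ} (h : ∀ n, InFil l (y n)) (n : ℕ) : InFil l ((exp y - unit : Family C A) n) := by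
  obtain ⟨N, hN⟩ := (exists_exp hA hy hy1).2 n l
  have h1 := hN (N + 1) (by omega)
  have h2 : ∀ i, InFil l (expTerm y (i + 1) n) := fun i => (power_inFil h hy.filtered i n).smul _
  have h3 := h1.add (Finset.sum_induction (s := Finset.range N) (fun i => expTerm y (i + 1) n) (InFil l)
    (fun _ _ => InFil.add) InFil.zero fun i _ => h2 i)
  have h0 : expTerm y 0 = unit := by
    change algebraMap ℚ k _ • unit = _
    simp
  rw [Finset.sum_range_succ', h0, sub_add_eq_sub_sub, sub_right_comm, sub_add_cancel] at h3
  exact h3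

theorem expRem_sub_mem_colFil (hA : A.IsComplete) {x y : Family C A} (hx : IsHom 0 x) (hy : IsHom 0 y)
    (hx1 : x ∈ colFil (Weighting.point A 1) 1) (hy1 : y ∈ colFil (Weighting.point A 1) 1) {m : ℕ}
    (h : x - y ∈ colFil (Weighting.point A 1) m) :
    expRem x - expRem y ∈ colFil (Weighting.point A 1) (m + 1) := by
  have h1 := sub_mem (exp_sub_mem_colFil hA hx hx1 (m + 2)) (exp_sub_mem_colFil hA hy hy1 (m + 2))
  have h2 : ∑ i ∈ Finset.range m, expTerm x (i + 2) - ∑ i ∈ Finset.range m, expTerm y (i + 2) ∈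
      colFil (Weighting.point A 1) (m + 1) := by
    rw [← Finset.sum_sub_distrib]
    refine sum_mem fun i _ => ?_
    have h3 : expTerm x (i + 2) - expTerm y (i + 2) = algebraMap ℚ k _ • (power x (i + 2) - power y (i + 2)) :=
      (smul_sub _ _ _).symm
    rw [h3]
    exact Submodule.smul_mem _ _ (colFil_antitone _ (by push_cast; omega) (power_sub_mem_colFil hx1 hy1 h (i + 1)))
  rw [sum_expTerm_succ_succ, sum_expTerm_succ_succ] at h1
  have h4 := add_mem (colFil_antitone _ (by push_cast; omega) h1) h2
  have h5 : expRem x - expRem y = exp x - (∑ i ∈ Finset.range m, expTerm x (i + 2) + x + unit) -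
      (exp y - (∑ i ∈ Finset.range m, expTerm y (i + 2) + y + unit)) +
      (∑ i ∈ Finset.range m, expTerm x (i + 2) - ∑ i ∈ Finset.range m, expTerm y (i + 2)) := by
    rw [expRem, expRem]
    abel
  rw [h5]
  exact h4

theorem exp_injective (hA : A.IsComplete) {x y : Family C A} (hx : IsHom 0 x) (hy : IsHom 0 y)
    (hx1 : x ∈ colFil (Weighting.point A 1) 1) (hy1 : y ∈ colFil (Weighting.point A 1) 1) (h : exp x = exp y) : x = y := by
  have h1 : x - y = -(expRem x - expRem y) := by
    rw [expRem, expRem, h]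
    abel
  refine eq_of_mem_colFil hA (Weighting.point A 1) fun l => ?_
  induction l with
  | zero => exact colFil_antitone _ (by simp) (sub_mem hx1 hy1)
  | succ l ih =>
    rw [h1]
    exact neg_mem (colFil_antitone _ (by push_cast; omega) (expRem_sub_mem_colFil hA hx hy hx1 hy1 ih))

theorem expTerm_zero (n : ℕ) : expTerm (0 : Family C A) (n + 1) = 0 := by
  have : power (0 : Family C A) (n + 1) = 0 := by
    match n with
    | 0 => rfl
    | n + 1 =>
      change star 0 _ 0 = 0
      rw [← starₗ_apply, map_zero]
  rw [expTerm, this]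
  exact smul_zero _

theorem exp_zero (hA : A.IsComplete) : exp (0 : Family C A) = unit :=
  seriesSum_eq hA fun n l => ⟨1, fun m hm => by
    obtain ⟨m, rfl⟩ := Nat.exists_eq_add_of_le' hm
    have h0 : expTerm (0 : Family C A) 0 = unit := by
      change algebraMap ℚ k _ • unit = _
      simp
    rw [Finset.sum_range_succ', h0, Finset.sum_eq_zero fun i _ => by rw [expTerm_zero]; rfl, zero_add, sub_self]
    exact InFil.zero⟩

/-- The iterates converging to the preimage of `1 + d` under the pre-Lie exponential. -/
def logIter (d : Family C A) : ℕ → Family C A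
  | 0 => 0
  | s + 1 => d - expRem (logIter d s)

theorem logIter_isHom (hA : A.IsComplete) {d : Family C A} (hd : IsHom 0 d) (hd1 : d ∈ colFil (Weighting.point A 1) 1) :
    ∀ s, IsHom 0 (logIter d s) ∧ logIter d s ∈ colFil (Weighting.point A 1) 1 ∧
      logIter d (s + 1) - logIter d s ∈ colFil (Weighting.point A 1) (s + 1)
  | 0 => by
    refine ⟨(hom C A 0).zero_mem, zero_mem _, ?_⟩
    have : logIter d 1 - logIter d 0 = d := by
      change d - (exp 0 - unit - 0) - 0 = d
      rw [exp_zero hA]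
      simp
    rw [zero_add, this]
    simpa using hd1
  | s + 1 => by
    obtain ⟨h1, h2, h3⟩ := logIter_isHom hA hd hd1 s
    have h4 : IsHom 0 (logIter d (s + 1)) := (hom C A 0).sub_mem hd (expRem_isHom hA h1 h2)
    have h5 : logIter d (s + 1) ∈ colFil (Weighting.point A 1) 1 := by
      have := add_mem (colFil_antitone _ (by omega) h3) h2
      rwa [sub_add_cancel] at this
    refine ⟨h4, h5, ?_⟩
    have h6 : logIter d (s + 1 + 1) - logIter d (s + 1) = -(expRem (logIter d (s + 1)) - expRem (logIter d s)) := by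
      change d - _ - (d - _) = _
      abel
    rw [h6]
    exact neg_mem (colFil_antitone _ (by push_cast; omega) (expRem_sub_mem_colFil hA h4 h1 h5 h2 (m := s + 1)
      (colFil_antitone _ (by push_cast; omega) h3)))

theorem logIter_inFil (hA : A.IsComplete) {d : Family C A} (hd : IsHom 0 d) (hd1 : d ∈ colFil (Weighting.point A 1) 1)
    {l : ℕ} (h : ∀ n, InFil l (d n)) : ∀ s n, InFil l (logIter d s n)
  | 0, _ => InFil.zero
  | s + 1, n => by
    have hs := logIter_isHom hA hd hd1 s
    exact (h n).sub ((exp_sub_unit_inFil hA hs.1 hs.2.1 (logIter_inFil hA hd hd1 h s) n).sub (logIter_inFil hA hd hd1 h s n))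

/-- The pre-Lie exponential is onto, compatibly with the filtrations. -/
theorem exists_exp_eq (hA : A.IsComplete) {d : Family C A} (hd : IsHom 0 d) (hd1 : d ∈ colFil (Weighting.point A 1) 1) :
    ∃ y, IsHom 0 y ∧ y ∈ colFil (Weighting.point A 1) 1 ∧ exp y = unit + d ∧
      ∀ l, (∀ n, InFil l (d n)) → ∀ n, InFil l (y n) := by
  have hs := logIter_isHom hA hd hd1
  obtain ⟨y, hy, hy'⟩ := exists_converges_of_mem_colFil hA (Weighting.point A 1) 0
    (x := fun s => logIter d (s + 1) - logIter d s) (fun s => (hom C A 0).sub_mem (hs (s + 1)).1 (hs s).1)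
    (fun s => colFil_antitone _ (by omega) (hs s).2.2)
  have hlim (s : ℕ) : y - logIter d s ∈ colFil (Weighting.point A 1) s := by
    have := sub_sum_mem_colFil (W := Weighting.point A 1) (t := 0) hy' (fun s => colFil_antitone _ (by omega) (hs s).2.2) s
    rw [Finset.sum_range_sub] at this
    simpa [logIter] using this
  have hy1 : y ∈ colFil (Weighting.point A 1) 1 := by
    have := add_mem (hlim 1) (hs 1).2.1
    rwa [sub_add_cancel] at this
  refine ⟨y, hy, hy1, eq_of_mem_colFil hA (Weighting.point A 1) fun s => ?_, fun l hl n => ?_⟩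
  · have h1 := expRem_sub_mem_colFil hA hy (hs s).1 hy1 (hs s).2.1 (hlim s)
    have h2 := hlim (s + 1)
    have h3 : exp y - (unit + d) = (y - logIter d (s + 1)) + (expRem y - expRem (logIter d s)) := by
      change _ = (y - (d - expRem (logIter d s))) + (exp y - unit - y - expRem (logIter d s))
      abel
    rw [h3]
    exact add_mem (colFil_antitone _ (by push_cast; omega) h2) (colFil_antitone _ (by omega) h1)
  · exact inFil_of_converges hy' fun s => (logIter_inFil hA hd hd1 hl _ n).sub (logIter_inFil hA hd hd1 hl _ n)

theorem inFil_iff_exp (hA : A.IsComplete) (y : GaugeSet C A) (l : ℕ) :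
    (∀ n, InFil l (y.1 n)) ↔ ∀ n, InFil l ((exp y.1 - unit : Family C A) n) := by
  refine ⟨exp_sub_unit_inFil hA y.2.1 (GaugeSet.mem_colFil y), fun h => ?_⟩
  obtain ⟨x, hx, hx1, hxy, hxl⟩ := exists_exp_eq hA ((hom C A 0).sub_mem (expMor hA y).2.1 unit_isHom) (expMor_dev_mem hA y)
  rw [add_sub_cancel] at hxy
  rw [← exp_injective hA hx y.2.1 hx1 (GaugeSet.mem_colFil y) hxy]
  exact hxl l h

/-! ### The deformation gauge group -/

theorem expMor_injective (hA : A.IsComplete) : Function.Injective (expMor (C := C) hA) := fun x y h =>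
  Subtype.ext (exp_injective hA x.2.1 y.2.1 (GaugeSet.mem_colFil x) (GaugeSet.mem_colFil y) (congrArg Subtype.val h))

theorem expMor_bchGauge (hA : A.IsComplete) (x y : GaugeSet C A) :
    expMor hA (bchGauge hA x y) = circMor hA (expMor hA x) (expMor hA y) := Subtype.ext (exp_bch hA x y)

variable (C A) in
/-- The unit of the circle product. -/
def unitMor : MorSet C A := ⟨unit, unit_isHom, InFil.zero⟩

/-- The neutral element of the deformation gauge group. -/
def GaugeSet.zero : GaugeSet C A := ⟨0, (hom C A 0).zero_mem, InFil.zero, InFil.zero⟩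

/-- The opposite of an element of the deformation gauge group. -/
def GaugeSet.neg (y : GaugeSet C A) : GaugeSet C A :=
  ⟨-y.1, (hom C A 0).neg_mem y.2.1, by simpa using InFil.zero.sub y.2.2.1, by simpa using InFil.zero.sub y.2.2.2⟩

theorem expMor_zero (hA : A.IsComplete) : expMor (C := C) hA GaugeSet.zero = unitMor C A := Subtype.ext (exp_zero hA)

theorem GaugeSet.op_neg (y : GaugeSet C A) (l : ℕ) : GaugeSet.op l (GaugeSet.neg y) = -GaugeSet.op l y := by
  rw [GaugeSet.op, GaugeSet.op, ← map_neg (toQuot (symFil C (Weighting.point A 1)) l)]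
  exact toQuot_eq_of_eq l (map_neg (insLin 0) (GaugeSet.sym y))

theorem circMor_exp_neg (hA : A.IsComplete) (y : GaugeSet C A) :
    circMor hA (expMor hA (GaugeSet.neg y)) (expMor hA y) = unitMor C A := by
  rw [← expMor_bchGauge]
  refine Subtype.ext (congrArg Sym.val (Sym.eq_of_mk hA (Weighting.point A 1)
    (x := Sym.mk _ (expMor hA (bchGauge hA (GaugeSet.neg y) y)).2.1.isSym) (y := unitSym C A) fun l => ?_))
  have h := mk_expMor hA (bchGauge hA (GaugeSet.neg y) y) l
  have hn : IsNilpotent (GaugeSet.op l y) := isNilpotent_fins (Weighting.point A 1) l 0 (GaugeSet.mem_colFil y)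
  rw [exp_op_bchGauge, GaugeSet.op_neg, IsNilpotent.exp_mul_exp_neg_self hn, Module.End.one_apply] at h
  exact h

theorem circMor_exp_neg' (hA : A.IsComplete) (y : GaugeSet C A) :
    circMor hA (expMor hA y) (expMor hA (GaugeSet.neg y)) = unitMor C A := by
  have h := circMor_exp_neg hA (GaugeSet.neg y)
  rwa [show GaugeSet.neg (GaugeSet.neg y) = y from Subtype.ext (neg_neg _)] at h

/-- The monoid of morphisms. -/
abbrev morMonoid (hA : A.IsComplete) : Monoid (MorSet C A) where
  mul := circMor hA
  one := unitMor C A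
  mul_assoc f g h := Subtype.ext (circ_assoc hA f.2.1 g h)
  one_mul f := Subtype.ext (unit_circ hA f.2.1.isSym)
  mul_one f := Subtype.ext (circ_unit hA f.1 f.2.1.isSym)

/-- The deformation gauge group. -/
abbrev gaugeGroup (hA : A.IsComplete) : Group (GaugeSet C A) :=
  letI := morMonoid (C := C) hA
  letI : Mul (GaugeSet C A) := ⟨bchGauge hA⟩
  letI : One (GaugeSet C A) := ⟨GaugeSet.zero⟩
  letI : Inv (GaugeSet C A) := ⟨GaugeSet.neg⟩
  have hmul (x y : GaugeSet C A) : expMor hA (x * y) = expMor hA x * expMor hA y := expMor_bchGauge hA x y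
  have hone : expMor (C := C) hA 1 = 1 := expMor_zero hA
  Group.ofLeftAxioms
    (fun x y z => expMor_injective hA (by rw [hmul, hmul, hmul, hmul, mul_assoc]))
    (fun x => expMor_injective hA (by rw [hmul, hone, one_mul]))
    (fun x => expMor_injective hA (by rw [hmul, hone]; exact circMor_exp_neg hA x))

/-! ### The gauge action -/

theorem isInftyMor_exp (hA : A.IsComplete) (y : GaugeSet C A) {α : Family C A} (hα : IsHom (-1) α) :
    IsInftyMor (exp y.1) α (gauge y.1 α) where
  isHom := (expMor hA y).2.1
  zero_mem := (expMor hA y).2.2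
  eq := star_exp_eq_circ_gauge hA y hα

theorem IsInftyMor.target_unique (hA : A.IsComplete) {f g : MorSet C A} (hfg : circMor hA f g = unitMor C A)
    {α β β' : Family C A} (hβ : IsHom (-1) β) (hβ' : IsHom (-1) β') (h : IsInftyMor f.1 α β) (h' : IsInftyMor f.1 α β') :
    β = β' :=
  add_left_cancel (circSym_injective hA (deltaAdd_isHom hβ) (deltaAdd_isHom hβ') hfg (h.eq.symm.trans h'.eq))

theorem gauge_unique (hA : A.IsComplete) (y : GaugeSet C A) {α β : Family C A} (hα : IsHom (-1) α) (hβ : IsHom (-1) β)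
    (h : IsInftyMor (exp y.1) α β) : gauge y.1 α = β :=
  IsInftyMor.target_unique hA (f := expMor hA y) (circMor_exp_neg' hA y) (exists_gauge hA y hα).1 hβ (isInftyMor_exp hA y hα) h

theorem isInftyMor_unit (hA : A.IsComplete) {α : Family C A} (hα : IsHom (-1) α) : IsInftyMor unit α α where
  isHom := unit_isHom
  zero_mem := InFil.zero
  eq := by
    have h : IsHom (-1) (delta + α) := deltaAdd_isHom hα
    rw [circ_unit hA _ h.isSym, unit_star _ h.isSym]
    exact (congrArg (_ + ·) precompD_unit).trans (add_zero _)

/-- The Maurer--Cartan elements are stable under the gauge action. -/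
def gaugeMC (hA : A.IsComplete) (y : GaugeSet C A) (α : MC C A) : MC C A :=
  ⟨gauge y.1 α.1, (exists_gauge hA y α.2.1).1, maurerCartan_of_star_eq hA α.2.1 (exists_gauge hA y α.2.1).1
    (f := expMor hA y) (circMor_exp_neg' hA y) (star_exp_eq_circ_gauge hA y α.2.1) α.2.2⟩

theorem gaugeMC_zero (hA : A.IsComplete) (α : MC C A) : gaugeMC hA GaugeSet.zero α = α :=
  Subtype.ext (gauge_unique hA GaugeSet.zero α.2.1 α.2.1 ((exp_zero (C := C) hA).symm ▸ isInftyMor_unit hA α.2.1))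

theorem gaugeMC_bchGauge (hA : A.IsComplete) (x y : GaugeSet C A) (α : MC C A) :
    gaugeMC hA (bchGauge hA x y) α = gaugeMC hA x (gaugeMC hA y α) := by
  refine Subtype.ext (gauge_unique hA _ α.2.1 (gaugeMC hA x (gaugeMC hA y α)).2.1 ?_)
  have h := IsInftyMor.circ hA α.2.1 (gaugeMC hA y α).2.1 (gaugeMC hA x (gaugeMC hA y α)).2.1 (isInftyMor_exp hA y α.2.1)
    (isInftyMor_exp hA x (gaugeMC hA y α).2.1)
  rw [← exp_bch hA] at h
  exact h

end Conv

namespace Conv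

open FilteredDGModule FilteredDGCooperad

variable {k : Type u} [CommRing k] {C : FilteredDGCooperad.{u, v} k} {A : FilteredDGModule.{u, w} k}

/-! ### Algebras over the cobar construction -/

/-- The operadic extension of a family of multilinear maps to monomials. -/
def evalMon (α : Family C A) : ∀ {n : ℕ}, C.Mon n → EndOp.Mult A n
  | n, .gen _ c => α n c
  | _, .one => EndOp.one
  | _, .comp e t u => EndOp.comp e (evalMon α t) (evalMon α u)
  | _, .act σ t => EndOp.act σ (evalMon α t)

/-- The partial composition of the endomorphism operad, as a bilinear map. -/
def compₗ {p q n : ℕ} (e : Fin q ⊕ Fin p ≃ Fin n) : EndOp.Mult A (p + 1) →ₗ[k] EndOp.Mult A q →ₗ[k] EndOp.Mult A n :=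
  TensorProduct.curry (EndOp.compTensor e)

theorem compₗ_apply {p q n : ℕ} (e : Fin q ⊕ Fin p ≃ Fin n) (f : EndOp.Mult A (p + 1)) (g : EndOp.Mult A q) :
    compₗ e f g = EndOp.comp e f g := rfl

/-- The action of the symmetric group on the endomorphism operad, as a linear map. -/
def actₗ {n : ℕ} (σ : Equiv.Perm (Fin n)) : EndOp.Mult A n →ₗ[k] EndOp.Mult A n where
  toFun := EndOp.act σ
  map_add' := EndOp.rearrange_add σ
  map_smul' := EndOp.rearrange_smul σ

theorem actₗ_apply {n : ℕ} (σ : Equiv.Perm (Fin n)) (f : EndOp.Mult A n) : actₗ σ f = EndOp.act σ f := rfl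

/-- The operadic extension of a family of multilinear maps to linear combinations of monomials. -/
def evalLin (α : Family C A) (n : ℕ) : C.Lin n →ₗ[k] EndOp.Mult A n := Finsupp.lift _ k _ (evalMon α)

theorem evalLin_mono (α : Family C A) {n : ℕ} (t : C.Mon n) : evalLin α n (mono t) = evalMon α t := by
  simp [evalLin, mono]

theorem evalLin_linComp (α : Family C A) {p q n : ℕ} (e : Fin q ⊕ Fin p ≃ Fin n) (x : C.Lin (p + 1)) (y : C.Lin q) :
    evalLin α n (linComp e x y) = EndOp.comp e (evalLin α _ x) (evalLin α _ y) := by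
  have : (linComp e).compr₂ (evalLin α n) = (compₗ e).compl₁₂ (evalLin α _) (evalLin α _) :=
    Cobar.lin_ext fun t => Cobar.lin_ext fun u => by
      simp only [LinearMap.compr₂_apply, LinearMap.compl₁₂_apply, Cobar.linComp_mono, evalLin_mono, compₗ_apply]
      rfl
  exact LinearMap.congr_fun (LinearMap.congr_fun this x) y

theorem evalLin_linAct (α : Family C A) {n : ℕ} (σ : Equiv.Perm (Fin n)) (x : C.Lin n) :
    evalLin α n (linAct σ x) = EndOp.act σ (evalLin α n x) := by
  have : evalLin α n ∘ₗ linAct σ = actₗ σ ∘ₗ evalLin α n := Cobar.lin_ext fun t => by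
    simp only [LinearMap.comp_apply, Cobar.linAct_mono, evalLin_mono, actₗ_apply]
    rfl
  exact LinearMap.congr_fun this x

section

variable {α : Family C A} {i : ℤ}

theorem evalMon_mem_deg (hα : IsHom (-1) α) : ∀ {n : ℕ} (t : C.Mon n), evalMon α t ∈ EndOp.deg A n t.degree
  | n, .gen j c => hα.degree n j c c.2
  | _, .one => EndOp.one_mem_deg
  | _, .comp e t u => EndOp.comp_mem_deg e (evalMon_mem_deg hα t) (evalMon_mem_deg hα u)
  | _, .act σ t => EndOp.act_mem_deg σ (evalMon_mem_deg hα t)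

theorem evalMon_mem_fil (hα : IsHom (-1) α) : ∀ {n : ℕ} (t : C.Mon n) {l : ℕ}, t.InFil l → evalMon α t ∈ EndOp.fil A n l
  | n, .gen j c, l, h => hα.filtered n l c h
  | _, .one, l, h => by
    rw [show l = 0 from h]
    exact EndOp.one_mem_fil
  | _, .comp e t u, l, h => by
    obtain ⟨a, b, rfl, ha, hb⟩ := h
    exact EndOp.comp_mem_fil e (evalMon_mem_fil hα t ha) (evalMon_mem_fil hα u hb)
  | _, .act σ t, l, h => EndOp.act_mem_fil σ (evalMon_mem_fil hα t (l := l) h)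

theorem evalLin_base (hα : IsHom (-1) α) {n : ℕ} {x : C.Lin n} (h : BaseRel x) : evalLin α n x = 0 := by
  cases h with
  | gen_add j c c' => simp [evalLin_mono, evalMon]
  | gen_smul j a c => simp [evalLin_mono, evalMon]
  | gen_act σ j c => simp [evalLin_mono, evalMon, hα.equivariant]
  | act_one t => simp [evalLin_mono, evalMon, EndOp.act_one_apply]
  | act_mul σ τ t => simp [evalLin_mono, evalMon, EndOp.act_mul_apply]
  | comp_relabel e σ t u => simp [evalLin_mono, evalMon, EndOp.comp_relabel]
  | comp_act e ρ τ t u => simp [evalLin_mono, evalMon, EndOp.comp_act]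
  | one_comp t => simp [evalLin_mono, evalMon, EndOp.one_comp]
  | comp_one t => simp [evalLin_mono, evalMon, EndOp.comp_one]
  | sequential e g h t u v => simp [evalLin_mono, evalMon, EndOp.sequential e g h]
  | parallel e h g t u v =>
    rw [map_sub, map_smul, evalLin_mono, evalLin_mono, sub_eq_zero]
    exact EndOp.parallel e h g _ (evalMon_mem_deg hα u) (evalMon_mem_deg hα v)

theorem evalLin_rel (hα : IsHom (-1) α) {n : ℕ} {x : C.Lin n} (h : IsRel x) : evalLin α n x = 0 := by
  induction h with
  | base h => exact evalLin_base hα h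
  | zero => simp
  | add _ _ h1 h2 => simp [h1, h2]
  | smul a _ h1 => simp [h1]
  | comp_left e y h h1 => rw [evalLin_linComp, h1, ← compₗ_apply, map_zero, LinearMap.zero_apply]
  | comp_right e x h h1 => rw [evalLin_linComp, h1, ← compₗ_apply, map_zero]
  | act σ _ h1 => rw [evalLin_linAct, h1, ← actₗ_apply, map_zero]

/-- The operadic extension of a family of multilinear maps to the cobar construction. -/
def evalCobar (hα : IsHom (-1) α) (n : ℕ) : C.Cobar n →ₗ[k] EndOp.Mult A n :=
  (C.relIdeal n).liftQ (evalLin α n) fun _ h => evalLin_rel hα h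

theorem evalCobar_cls (hα : IsHom (-1) α) {n : ℕ} (t : C.Mon n) : evalCobar hα n (Cobar.cls t) = evalMon α t :=
  evalLin_mono α t

theorem evalCobar_gen (hα : IsHom (-1) α) (n : ℕ) : evalCobar hα n ∘ₗ Cobar.gen n = α n :=
  linearMap_ext (C.obj n) fun j c hc => by
    rw [LinearMap.comp_apply, Cobar.gen_of_mem ⟨c, hc⟩, evalCobar_cls]
    rfl

theorem evalCobar_comp (hα : IsHom (-1) α) {p q n : ℕ} (e : Fin q ⊕ Fin p ≃ Fin n) (x : C.Cobar (p + 1)) (y : C.Cobar q) :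
    evalCobar hα n (Cobar.comp e x y) = EndOp.comp e (evalCobar hα _ x) (evalCobar hα _ y) := by
  have : (Cobar.comp e).compr₂ (evalCobar hα n) = (compₗ e).compl₁₂ (evalCobar hα _) (evalCobar hα _) :=
    Cobar.hom_ext fun t => Cobar.hom_ext fun u => by
      simp only [LinearMap.compr₂_apply, LinearMap.compl₁₂_apply, Cobar.comp_cls, evalCobar_cls, compₗ_apply]
      rfl
  exact LinearMap.congr_fun (LinearMap.congr_fun this x) y

theorem evalCobar_act (hα : IsHom (-1) α) {n : ℕ} (σ : Equiv.Perm (Fin n)) (x : C.Cobar n) :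
    evalCobar hα n (Cobar.act σ x) = EndOp.act σ (evalCobar hα n x) := by
  have : evalCobar hα n ∘ₗ Cobar.act σ = actₗ σ ∘ₗ evalCobar hα n := Cobar.hom_ext fun t => by
    simp only [LinearMap.comp_apply, Cobar.act_cls, evalCobar_cls, actₗ_apply]
    rfl
  exact LinearMap.congr_fun this x

end

theorem gen_mem_fil {n l : ℕ} {c : C.obj n} (hc : c ∈ (C.obj n).fil l) : Cobar.gen n c ∈ Cobar.fil C n l := by
  classical
  rw [← (C.obj n).sum_decompose c, map_sum]
  refine sum_mem fun j _ => ?_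
  rw [Cobar.gen_of_mem]
  exact Submodule.subset_span ⟨.gen j (DirectSum.decompose (C.obj n).deg c j), (C.obj n).fil_homogeneous l c hc j, rfl⟩

variable [Algebra ℚ k]

/-- The image of the differential of a generator under an operadic map. -/
theorem map_dGen {m : ∀ n, C.Cobar n →ₗ[k] EndOp.Mult A n}
    (hm : ∀ {p q n : ℕ} (e : Fin q ⊕ Fin p ≃ Fin n) (x : C.Cobar (p + 1)) (y : C.Cobar q),
      m n (Cobar.comp e x y) = EndOp.comp e (m (p + 1) x) (m q y)) {α : Family C A} (hα : ∀ n, m n ∘ₗ Cobar.gen n = α n)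
    (n : ℕ) : m n ∘ₗ Cobar.dGen n = EndOp.dLinear ∘ₗ α n - (diff (-1) α + star (-1) α α) n := by
  have h1 : m n ∘ₗ (C.treeSum n fun {p q} e => TensorProduct.lift (Cobar.comp e) ∘ₗ
      TensorProduct.map (Cobar.gen (p + 1) ∘ₗ (C.obj (p + 1)).sgn 1) (Cobar.gen q)) = star (-1) α α n := by
    refine LinearMap.ext fun c => ?_
    simp only [star, treeSum, LinearMap.comp_apply, LinearMap.sum_apply, LinearMap.smul_apply, map_sum, map_smul]
    refine Finset.sum_congr rfl fun qp _ => congrArg _ (Finset.sum_congr rfl fun e _ => ?_)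
    refine LinearMap.congr_fun (f := m n ∘ₗ TensorProduct.lift (Cobar.comp e) ∘ₗ
      TensorProduct.map (Cobar.gen (qp.2 + 1) ∘ₗ (C.obj (qp.2 + 1)).sgn 1) (Cobar.gen qp.1))
      (g := EndOp.compTensor e ∘ₗ TensorProduct.map (α (qp.2 + 1) ∘ₗ (C.obj (qp.2 + 1)).sgn (-1)) (α qp.1))
      (TensorProduct.ext' fun x y => ?_) _
    simp only [← hα, LinearMap.comp_apply, TensorProduct.map_tmul, TensorProduct.lift.tmul, hm,
      sgn_congr (A := C.obj (qp.2 + 1)) (show Even ((1 : ℤ) - -1) by decide)]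
    rfl
  have h2 : (diff (-1) α + star (-1) α α) n = EndOp.dLinear ∘ₗ α n + α n ∘ₗ (C.obj n).d + star (-1) α α n := by
    change (EndOp.dLinear ∘ₗ α n : C.obj n →ₗ[k] EndOp.Mult A n) - zsign k (-1) • (α n ∘ₗ (C.obj n).d) + _ = _
    rw [show zsign k (-1) • (α n ∘ₗ (C.obj n).d) = -(α n ∘ₗ (C.obj n).d) from
      congrFun (zsign_neg_one_smul (precompD α)) n, sub_neg_eq_add]
  rw [h2, Cobar.dGen, LinearMap.comp_sub, h1, LinearMap.comp_neg, ← LinearMap.comp_assoc, hα]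
  abel

/-- The algebra over the cobar construction given by a Maurer--Cartan element. -/
def CobarAlg.ofMC (α : MC C A) : CobarAlg C A where
  map := evalCobar α.2.1
  map_deg n i x hx := by
    induction hx using Submodule.span_induction with
    | zero => simp
    | add x y _ _ h1 h2 => simpa using add_mem h1 h2
    | smul a x _ h1 => simpa using Submodule.smul_mem _ a h1
    | mem x hx =>
      obtain ⟨t, rfl, rfl⟩ := hx
      rw [evalCobar_cls]
      exact evalMon_mem_deg α.2.1 t
  map_fil n l x hx := by
    induction hx using Submodule.span_induction with
    | zero => simp
    | add x y _ _ h1 h2 => simpa using add_mem h1 h2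
    | smul a x _ h1 => simpa using Submodule.smul_mem _ a h1
    | mem x hx =>
      obtain ⟨t, ht, rfl⟩ := hx
      rw [evalCobar_cls]
      exact evalMon_mem_fil α.2.1 t ht
  map_act n := evalCobar_act α.2.1
  map_one := evalCobar_cls α.2.1 _
  map_comp := evalCobar_comp α.2.1
  map_d n x := by
    have hmon : ∀ {n : ℕ} (t : C.Mon n), evalCobar α.2.1 n (Cobar.dMon t) = EndOp.d (evalMon α.1 t) := by
      intro n t
      induction t with
      | @gen n j c =>
        have h := LinearMap.congr_fun (map_dGen (evalCobar_comp α.2.1) (evalCobar_gen α.2.1) n) c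
        refine h.trans ?_
        rw [LinearMap.sub_apply, congrFun α.2.2 n]
        exact sub_zero _
      | one => exact (map_zero _).trans EndOp.d_one.symm
      | comp e t u ht hu =>
        rw [Cobar.dMon, map_add, map_smul, evalCobar_comp, evalCobar_comp, ht, hu, evalCobar_cls, evalCobar_cls]
        exact (EndOp.d_comp e (evalMon_mem_deg α.2.1 t) (evalMon_mem_deg α.2.1 u)).symm
      | act σ t ht =>
        rw [Cobar.dMon, evalCobar_act, ht]
        exact (EndOp.d_act σ (evalMon_mem_deg α.2.1 t)).symm
    have : evalCobar α.2.1 n ∘ₗ Cobar.d n = EndOp.dLinear ∘ₗ evalCobar α.2.1 n := Cobar.hom_ext fun t => by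
      rw [LinearMap.comp_apply, LinearMap.comp_apply, evalCobar_cls]
      exact (congrArg (evalCobar α.2.1 n) (Cobar.dLin_mono t)).trans (hmon t)
    exact LinearMap.congr_fun this x

theorem CobarAlg.twist_ofMC (α : MC C A) : (CobarAlg.ofMC α).twist = α.1 := funext (evalCobar_gen α.2.1)

theorem CobarAlg.twist_injective {ρ σ : CobarAlg C A} (h : ρ.twist = σ.twist) : ρ = σ := by
  have hmon : ∀ {n : ℕ} (t : C.Mon n), ρ.map n (Cobar.cls t) = σ.map n (Cobar.cls t) := by
    intro n t
    induction t with
    | @gen n j c =>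
      rw [← Cobar.gen_of_mem c]
      exact LinearMap.congr_fun (congrFun h n) c
    | one => exact ρ.map_one.trans σ.map_one.symm
    | comp e t u ht hu => rw [← Cobar.comp_cls, ρ.map_comp, σ.map_comp, ht, hu]
    | act s t ht => rw [← Cobar.act_cls, ρ.map_act, σ.map_act, ht]
  have hmap : ρ.map = σ.map := funext fun n => Cobar.hom_ext hmon
  cases ρ
  cases σ
  cases hmap
  rfl

/-- The Maurer--Cartan element of an algebra over the cobar construction. -/
def CobarAlg.toMC (ρ : CobarAlg C A) : MC C A :=
  ⟨ρ.twist, {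
    equivariant := fun n σ c => by
      change ρ.map n (Cobar.gen n _) = EndOp.act σ (ρ.map n (Cobar.gen n c))
      rw [← Cobar.act_gen, ρ.map_act]
    degree := fun n i c hc => ρ.map_deg n _ _ (Cobar.gen_mem_deg hc)
    filtered := fun n i c hc => ρ.map_fil n _ _ (gen_mem_fil hc) }, by
    funext n
    have h := map_dGen (fun e => ρ.map_comp e) (α := ρ.twist) (fun _ => rfl) n
    have h' : ρ.map n ∘ₗ Cobar.dGen n = EndOp.dLinear ∘ₗ ρ.twist n := linearMap_ext (C.obj n) fun j c hc => by
      have := ρ.map_d n (Cobar.gen n c)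
      rw [Cobar.gen_of_mem ⟨c, hc⟩] at this
      refine Eq.trans ?_ (this.trans ?_)
      · exact (congrArg (ρ.map n) (Cobar.dLin_mono (.gen j ⟨c, hc⟩))).symm
      · rw [← Cobar.gen_of_mem]
        rfl
    rw [h', eq_comm, sub_eq_self] at h
    exact h⟩

theorem CobarAlg.ofMC_toMC (ρ : CobarAlg C A) : CobarAlg.ofMC ρ.toMC = ρ :=
  CobarAlg.twist_injective (CobarAlg.twist_ofMC _)

theorem CobarAlg.toMC_ofMC (α : MC C A) : (CobarAlg.ofMC α).toMC = α := Subtype.ext (CobarAlg.twist_ofMC α)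

end Conv

namespace Conv

open FilteredDGModule FilteredDGCooperad CategoryTheory

variable {k : Type u} [CommRing k] {C : FilteredDGCooperad.{u, v} k} {A : FilteredDGModule.{u, w} k} [Algebra ℚ k]

/-! ### Isotopies -/

theorem inFil_exp_sub_unit (hA : A.IsComplete) (y : GaugeSet C A) : InFil 1 (exp y.1 1 - unit 1) :=
  ((mem_colFil_one_iff (expMor hA y).dev_isHom.isSym).1 (expMor_dev_mem hA y)).2

theorem exists_expMor_eq (hA : A.IsComplete) {f : MorSet C A} (h : InFil 1 (f.1 1 - unit 1)) : ∃ y, expMor hA y = f := by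
  obtain ⟨y, hy, hy1, hyf, -⟩ := exists_exp_eq hA f.dev_isHom
    ((mem_colFil_one_iff f.dev_isHom.isSym).2 ⟨f.inFil_dev, h⟩)
  exact ⟨⟨y, hy, (mem_colFil_one_iff hy.isSym).1 hy1⟩, Subtype.ext (hyf.trans (add_sub_cancel _ _))⟩

theorem isInftyIsotopy_exp (hA : A.IsComplete) (y : GaugeSet C A) {α : Family C A} (hα : IsHom (-1) α) :
    IsInftyIsotopy (exp y.1) α (gauge y.1 α) where
  toIsInftyMor := isInftyMor_exp hA y hα
  one_mem := inFil_exp_sub_unit hA y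

theorem IsInftyIsotopy.exists_exp (hA : A.IsComplete) {f : Family C A} {α β : MC C A} (h : IsInftyIsotopy f α.1 β.1) :
    ∃ y : GaugeSet C A, exp y.1 = f ∧ gaugeMC hA y α = β := by
  obtain ⟨y, hy⟩ := exists_expMor_eq hA (f := ⟨f, h.isHom, h.zero_mem⟩) h.one_mem
  have hy' : exp y.1 = f := congrArg Subtype.val hy
  refine ⟨y, hy', Subtype.ext (gauge_unique hA y α.2.1 β.2.1 ?_)⟩
  rw [hy']
  exact h.toIsInftyMor

theorem isLabelledGroupoid (hA : A.IsComplete) : IsLabelledGroupoid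
    (fun ρ σ : CobarAlg C A => {f : Family C A | IsInftyIsotopy f ρ.twist σ.twist}) circ unit where
  one_mem ρ := { toIsInftyMor := isInftyMor_unit hA ρ.toMC.2.1, one_mem := by rw [sub_self]; exact InFil.zero }
  mul_mem {ρ σ τ f g} hf hg := by
    obtain ⟨x, rfl, hx⟩ := IsInftyIsotopy.exists_exp hA (α := ρ.toMC) (β := σ.toMC) hf
    obtain ⟨y, rfl, hy⟩ := IsInftyIsotopy.exists_exp hA (α := σ.toMC) (β := τ.toMC) hg
    have h := isInftyIsotopy_exp hA (bchGauge hA y x) ρ.toMC.2.1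
    have h2 : gaugeMC hA (bchGauge hA y x) ρ.toMC = τ.toMC := (gaugeMC_bchGauge hA y x ρ.toMC).trans (by rw [hx, hy])
    have h' : gauge (bchGauge hA y x).1 ρ.toMC.1 = τ.twist := congrArg Subtype.val h2
    rw [h'] at h
    exact (exp_bch hA y x) ▸ h
  one_mul hf := unit_circ hA hf.isHom.isSym
  mul_one hf := circ_unit hA _ hf.isHom.isSym
  assoc {_ _ _ _ f g h} hf hg hh := circ_assoc hA hh.isHom ⟨g, hg.isHom, hg.zero_mem⟩ ⟨f, hf.isHom, hf.zero_mem⟩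
  exists_inv {ρ σ f} hf := by
    obtain ⟨y, rfl, hy⟩ := IsInftyIsotopy.exists_exp hA (α := ρ.toMC) (β := σ.toMC) hf
    let := gaugeGroup (C := C) (A := A) hA
    have h1 : gaugeMC hA (GaugeSet.neg y) σ.toMC = ρ.toMC := by
      rw [← hy, ← gaugeMC_bchGauge]
      exact (congrArg (gaugeMC hA · ρ.toMC) (inv_mul_cancel y)).trans (gaugeMC_zero hA _)
    have h := isInftyIsotopy_exp hA (GaugeSet.neg y) σ.toMC.2.1
    rw [show gauge (GaugeSet.neg y).1 σ.toMC.1 = ρ.twist from congrArg Subtype.val h1] at h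
    exact ⟨_, h, congrArg Subtype.val (circMor_exp_neg hA y), congrArg Subtype.val (circMor_exp_neg' hA y)⟩

/-- The zero Maurer--Cartan element. -/
def zeroMC : MC C A := ⟨0, (hom C A _).zero_mem, by
  have h1 : diff (-1) (0 : Family C A) = 0 := by
    rw [diff_eq (hom C A (-1)).zero_mem, ← starₗ_apply, ← starₗ_apply, map_zero, map_zero, map_zero, LinearMap.zero_apply,
      zsign_neg_one_smul, neg_zero, sub_zero, sub_zero]
  rw [h1, ← starₗ_apply, map_zero, add_zero]⟩

/-- Every invertible morphism is an `∞`-morphism for suitable Maurer--Cartan elements. -/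
theorem exists_isInftyMor (hA : A.IsComplete) {f g : MorSet C A} (hfg : circMor hA f g = unitMor C A)
    (hgf : circMor hA g f = unitMor C A) : ∃ β : MC C A, IsInftyMor f.1 (zeroMC (C := C) (A := A)).1 β.1 := by
  have ha : IsHom (-1) (star (-1) f.1 (delta + 0) + precompD f.1) := by
    have := star_isHom f.2.1 (deltaAdd_isHom (hom C A (-1)).zero_mem)
    exact (hom C A (-1)).add_mem this (precompD_isHom f.2.1)
  have hb := (exists_circ hA ha g).1
  have hβ := (hom C A (-1)).sub_mem hb delta_isHom
  have h : star (-1) f.1 (delta + 0) + precompD f.1 =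
      circ (delta + (circ (star (-1) f.1 (delta + 0) + precompD f.1) g.1 - delta)) f.1 := by
    rw [add_sub_cancel, circ_assoc hA ha, show circ g.1 f.1 = unit from congrArg Subtype.val hgf, circ_unit hA _ ha.isSym]
  exact ⟨⟨_, hβ, maurerCartan_of_star_eq hA zeroMC.2.1 hβ hfg h zeroMC.2.2⟩, f.2.1, f.2.2, h⟩

/-! ### The Deligne groupoid -/

/-- The gauge action. -/
abbrev gaugeAction (hA : A.IsComplete) :
    letI := gaugeGroup (C := C) hA
    MulAction (GaugeSet C A) (MC C A) :=
  letI := gaugeGroup (C := C) hA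
  { smul := gaugeMC hA
    one_smul := gaugeMC_zero hA
    mul_smul := gaugeMC_bchGauge hA }

/-- The pre-Lie exponential with values in the group of invertible morphisms. -/
def expHom (hA : A.IsComplete) :
    letI := gaugeGroup (C := C) hA
    letI := morMonoid (C := C) hA
    GaugeSet C A →* (MorSet C A)ˣ :=
  letI := gaugeGroup (C := C) hA
  letI := morMonoid (C := C) hA
  { toFun := fun y => ⟨expMor hA y, expMor hA (GaugeSet.neg y), circMor_exp_neg' hA y, circMor_exp_neg hA y⟩
    map_one' := Units.ext (expMor_zero hA)
    map_mul' := fun x y => Units.ext (expMor_bchGauge hA x y) }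

/-- A functor which preserves objects and separating labels of arrows is the identity. -/
theorem functor_eq_id {D : Type*} [Category D] {X : Type*} (v : ∀ {a b : D}, (a ⟶ b) → X)
    (hv : ∀ {a b : D} {f g : a ⟶ b}, v f = v g → f = g) {F : D ⥤ D} (h : ∀ a, F.obj a = a)
    (hF : ∀ {a b : D} (f : a ⟶ b), v (F.map f) = v f) : F = 𝟭 D := by
  have hval {a b c d : D} (h : a = b) (f : b ⟶ c) (h' : c = d) : v (eqToHom h ≫ f ≫ eqToHom h') = v f := by
    subst h h'
    rw [eqToHom_refl, eqToHom_refl, Category.id_comp, Category.comp_id]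
  exact CategoryTheory.Functor.ext h fun a b f => hv ((hF f).trans (hval _ f _).symm)

/-- The functor from the Deligne groupoid to the groupoid of algebras over the cobar construction. -/
def deligneFunctor (hA : A.IsComplete) :
    letI := gaugeGroup (C := C) hA
    letI := gaugeAction (C := C) hA
    letI := (isLabelledGroupoid (C := C) hA).groupoid
    ActionCategory (GaugeSet C A) (MC C A) ⥤ CobarAlg C A :=
  letI := gaugeGroup (C := C) hA
  letI := gaugeAction (C := C) hA
  letI := (isLabelledGroupoid (C := C) hA).groupoid
  { obj := fun α => CobarAlg.ofMC α.back
    map := fun {α β} f => ⟨exp f.1.1, by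
      have h := isInftyIsotopy_exp hA f.1 α.back.2.1
      rw [show gauge f.1.1 α.back.1 = β.back.1 from congrArg Subtype.val f.2] at h
      change IsInftyIsotopy _ _ _
      rw [CobarAlg.twist_ofMC, CobarAlg.twist_ofMC]
      exact h⟩
    map_id := fun α => Subtype.ext (exp_zero hA)
    map_comp := fun f g => Subtype.ext (exp_bch hA g.1 f.1) }

/-- The functor from the groupoid of algebras over the cobar construction to the Deligne groupoid. -/
def deligneInverse (hA : A.IsComplete) :
    letI := gaugeGroup (C := C) hA
    letI := gaugeAction (C := C) hA
    letI := (isLabelledGroupoid (C := C) hA).groupoid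
    CobarAlg C A ⥤ ActionCategory (GaugeSet C A) (MC C A) :=
  letI := gaugeGroup (C := C) hA
  letI := gaugeAction (C := C) hA
  letI := (isLabelledGroupoid (C := C) hA).groupoid
  have hex {ρ σ : CobarAlg C A} (f : ρ ⟶ σ) := IsInftyIsotopy.exists_exp hA (α := ρ.toMC) (β := σ.toMC) f.2
  have hinj {x y : GaugeSet C A} (h : exp x.1 = exp y.1) : x = y := expMor_injective hA (Subtype.ext h)
  { obj := fun ρ => (ρ.toMC : ActionCategory (GaugeSet C A) (MC C A))
    map := fun f => ⟨(hex f).choose, (hex f).choose_spec.2⟩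
    map_id := fun ρ => Subtype.ext (hinj ((hex (𝟙 ρ)).choose_spec.1.trans (exp_zero hA).symm))
    map_comp := fun f g => Subtype.ext (hinj ((hex (f ≫ g)).choose_spec.1.trans
      ((congrArg₂ circ (hex g).choose_spec.1 (hex f).choose_spec.1).symm.trans (exp_bch hA _ _).symm))) }

theorem exp_deligneInverse_map (hA : A.IsComplete) :
    letI := gaugeGroup (C := C) hA
    letI := gaugeAction (C := C) hA
    letI := (isLabelledGroupoid (C := C) hA).groupoid
    ∀ {ρ σ : CobarAlg C A} (f : ρ ⟶ σ), exp ((deligneInverse hA).map f).1.1 = f.1 := by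
  let := gaugeGroup (C := C) (A := A) hA
  let := gaugeAction (C := C) (A := A) hA
  let := (isLabelledGroupoid (C := C) (A := A) hA).groupoid
  intro ρ σ f
  exact (IsInftyIsotopy.exists_exp hA (α := ρ.toMC) (β := σ.toMC) f.2).choose_spec.1

theorem deligneFunctor_comp_deligneInverse (hA : A.IsComplete) :
    letI := gaugeGroup (C := C) hA
    letI := gaugeAction (C := C) hA
    letI := (isLabelledGroupoid (C := C) hA).groupoid
    (deligneFunctor (C := C) hA).comp (deligneInverse hA) = Functor.id _ := by
  let := gaugeGroup (C := C) (A := A) hA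
  let := gaugeAction (C := C) (A := A) hA
  let := (isLabelledGroupoid (C := C) (A := A) hA).groupoid
  refine functor_eq_id (D := ActionCategory (GaugeSet C A) (MC C A)) (fun {a b} (f : a ⟶ b) => exp f.1.1)
    (fun h => Subtype.ext (expMor_injective hA (Subtype.ext h))) (fun α => ?_)
    fun f => exp_deligneInverse_map hA _
  exact (congrArg (fun β : MC C A => (β : ActionCategory (GaugeSet C A) (MC C A))) (CobarAlg.toMC_ofMC α.back)).trans
    (ActionCategory.back_coe α)

theorem deligneInverse_comp_deligneFunctor (hA : A.IsComplete) :
    letI := gaugeGroup (C := C) hA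
    letI := gaugeAction (C := C) hA
    letI := (isLabelledGroupoid (C := C) hA).groupoid
    (deligneInverse (C := C) hA).comp (deligneFunctor hA) = Functor.id _ := by
  let := gaugeGroup (C := C) (A := A) hA
  let := gaugeAction (C := C) (A := A) hA
  let := (isLabelledGroupoid (C := C) (A := A) hA).groupoid
  exact functor_eq_id (D := CobarAlg C A) (fun {a b} (f : a ⟶ b) => f.1) (fun h => Subtype.ext h) CobarAlg.ofMC_toMC fun f => exp_deligneInverse_map hA f

/-- The groups of invertible morphisms and of isotopies, and the pre-Lie exponential. -/
theorem exists_subgroups (hA : A.IsComplete) :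
    letI := gaugeGroup (C := C) hA
    letI := morMonoid (C := C) hA
    ∃ K H : Subgroup (MorSet C A)ˣ,
      (∀ f : (MorSet C A)ˣ, f ∈ K ↔ ∃ ρ σ : CobarAlg C A, IsInftyMor f.1.1 ρ.twist σ.twist) ∧
      (∀ f : MorSet C A, (∃ ρ σ : CobarAlg C A, IsInftyIsotopy f.1 ρ.twist σ.twist) ↔ ∃ h ∈ H, (h : MorSet C A) = f) ∧
      H ≤ K ∧
      (∀ f : (MorSet C A)ˣ, f ∈ H ↔ InFil 1 (f.1.1 1 - unit 1)) ∧
      ∃ E : GaugeSet C A ≃* H,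
        (∀ f : GaugeSet C A, (E f).1.1.1 = exp f.1) ∧
        (∀ l ≥ 2, ∀ f : GaugeSet C A, (∀ n, InFil l (f.1 n)) ↔ ∀ n, InFil l ((exp f.1 - unit : Family C A) n)) := by
  let := gaugeGroup (C := C) (A := A) hA
  let := morMonoid (C := C) (A := A) hA
  have hinj : Function.Injective (expHom (C := C) hA) := fun x y h => expMor_injective hA (congrArg Units.val h)
  refine ⟨⊤, (expHom hA).range, fun f => ⟨fun _ => ?_, fun _ => Subgroup.mem_top f⟩, fun f => ⟨?_, ?_⟩, le_top, fun f => ⟨?_, fun h => ?_⟩,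
    MonoidHom.ofInjective hinj, fun _ => rfl, fun l _ f => inFil_iff_exp hA f l⟩
  · obtain ⟨β, hβ⟩ := exists_isInftyMor hA f.mul_inv f.inv_mul
    refine ⟨CobarAlg.ofMC zeroMC, CobarAlg.ofMC β, ?_⟩
    rw [CobarAlg.twist_ofMC, CobarAlg.twist_ofMC]
    exact hβ
  · rintro ⟨ρ, σ, h⟩
    obtain ⟨y, hy⟩ := exists_expMor_eq hA (f := f) h.one_mem
    exact ⟨expHom hA y, ⟨y, rfl⟩, hy⟩
  · rintro ⟨_, ⟨y, rfl⟩, rfl⟩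
    refine ⟨CobarAlg.ofMC zeroMC, CobarAlg.ofMC (gaugeMC hA y zeroMC), ?_⟩
    rw [CobarAlg.twist_ofMC, CobarAlg.twist_ofMC]
    exact isInftyIsotopy_exp hA y zeroMC.2.1
  · rintro ⟨y, rfl⟩
    exact inFil_exp_sub_unit hA y
  · obtain ⟨y, hy⟩ := exists_expMor_eq hA h
    exact ⟨y, Units.ext hy⟩

end Conv

end

theorem mainTheorem4 {k : Type u} [CommRing k] [Algebra ℚ k]
    (C : FilteredDGCooperad.{u, v} k) (A : FilteredDGModule.{u, w} k) (hA : A.IsComplete) :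
    -- all the series in question converge
    (∀ f g : Conv.GaugeSet C A, ∃ L, Conv.Converges (Conv.bchTerm f.1 g.1) L) ∧
    (∀ f : Conv.GaugeSet C A, ∃ L, Conv.Converges (Conv.expTerm f.1) L) ∧
    (∀ (f : Conv.GaugeSet C A) (α : Conv.MC C A),
      ∃ L, Conv.Converges (Conv.gaugeTerm f.1 α.1) L) ∧
    (∀ (j : ℤ) (a : Conv.Family C A) (f : Conv.MorSet C A), Conv.IsHom j a →
      ∃ L, Conv.Converges (Conv.circTerm a f.1) L) ∧
    -- composites of infinity-morphisms are infinity-morphisms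
    (∀ (f g : Conv.Family C A) (α β γ : Conv.MC C A),
      Conv.IsInftyMor f α.1 β.1 → Conv.IsInftyMor g β.1 γ.1 →
        Conv.IsInftyMor (Conv.circ g f) α.1 γ.1) ∧
    -- the deformation gauge group, its action on Maurer-Cartan elements, the circle product
    ∃ (_ : Group (Conv.GaugeSet C A)) (_ : MulAction (Conv.GaugeSet C A) (Conv.MC C A))
      (_ : Monoid (Conv.MorSet C A)),
      (∀ f g : Conv.GaugeSet C A, (f * g).1 = Conv.bch f.1 g.1) ∧
      (1 : Conv.GaugeSet C A).1 = 0 ∧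
      (∀ (f : Conv.GaugeSet C A) (α : Conv.MC C A), (f • α).1 = Conv.gauge f.1 α.1) ∧
      (∀ f g : Conv.MorSet C A, (f * g).1 = Conv.circ f.1 g.1) ∧
      (1 : Conv.MorSet C A).1 = Conv.unit ∧
      -- `K` is the group of invertible infinity-morphisms, `H` the group of infinity-isotopies
      (∃ K H : Subgroup (Conv.MorSet C A)ˣ,
        (∀ f : (Conv.MorSet C A)ˣ,
          f ∈ K ↔ ∃ ρ σ : Conv.CobarAlg C A, Conv.IsInftyMor f.1.1 ρ.twist σ.twist) ∧
        (∀ f : Conv.MorSet C A,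
          (∃ ρ σ : Conv.CobarAlg C A, Conv.IsInftyIsotopy f.1 ρ.twist σ.twist) ↔
            ∃ h ∈ H, (h : Conv.MorSet C A) = f) ∧
        H ≤ K ∧
        (∀ f : (Conv.MorSet C A)ˣ, f ∈ H ↔ Conv.InFil 1 (f.1.1 1 - Conv.unit 1)) ∧
        -- the pre-Lie exponential is an isomorphism of groups, compatible with the filtrations
        ∃ E : Conv.GaugeSet C A ≃* H,
          (∀ f : Conv.GaugeSet C A, (E f).1.1.1 = Conv.exp f.1) ∧
          (∀ l ≥ 2, ∀ f : Conv.GaugeSet C A, (∀ n, Conv.InFil l (f.1 n)) ↔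
            ∀ n, Conv.InFil l ((Conv.exp f.1 - Conv.unit : Conv.Family C A) n))) ∧
      -- the groupoid of algebras over the cobar construction and infinity-isotopies
      ∃ h : IsLabelledGroupoid
          (fun ρ σ : Conv.CobarAlg C A =>
            {f : Conv.Family C A | Conv.IsInftyIsotopy f ρ.twist σ.twist}) Conv.circ Conv.unit,
        letI := h.groupoid
        -- it is isomorphic to the Deligne groupoid, the action groupoid of the gauge action
        ∃ (F : CategoryTheory.Functor
            (CategoryTheory.ActionCategory (Conv.GaugeSet C A) (Conv.MC C A)) (Conv.CobarAlg C A))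
          (G : CategoryTheory.Functor (Conv.CobarAlg C A)
            (CategoryTheory.ActionCategory (Conv.GaugeSet C A) (Conv.MC C A))),
          F.comp G = CategoryTheory.Functor.id _ ∧ G.comp F = CategoryTheory.Functor.id _ ∧
          (∀ α : CategoryTheory.ActionCategory (Conv.GaugeSet C A) (Conv.MC C A),
            (F.obj α).twist = α.back.1) ∧
          (∀ (α β : CategoryTheory.ActionCategory (Conv.GaugeSet C A) (Conv.MC C A)) (f : α ⟶ β),
            (F.map f).1 = Conv.exp f.1.1) := by
  exact ⟨fun f g => ⟨_, (Conv.exists_bch hA f g).2⟩,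
    fun f => ⟨_, (Conv.exists_exp hA f.2.1 (Conv.GaugeSet.mem_colFil f)).2⟩,
    fun f α => ⟨_, (Conv.exists_gauge hA f α.2.1).2⟩,
    fun j a f ha => ⟨_, (Conv.exists_circ hA ha f).2⟩,
    fun f g α β γ hf hg => hf.circ hA α.2.1 β.2.1 γ.2.1 hg,
    Conv.gaugeGroup hA, Conv.gaugeAction hA, Conv.morMonoid hA,
    fun _ _ => rfl, rfl, fun _ _ => rfl, fun _ _ => rfl, rfl,
    Conv.exists_subgroups hA,
    Conv.isLabelledGroupoid hA, Conv.deligneFunctor hA, Conv.deligneInverse hA,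
    Conv.deligneFunctor_comp_deligneInverse hA, Conv.deligneInverse_comp_deligneFunctor hA,
    fun _ => Conv.CobarAlg.twist_ofMC _, fun _ _ _ => rfl⟩
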